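/- **Setting.** Let $G=(V,E)$ be a connected undirected graph with $n$ nodes and $m\ge 1$ edges. Every edge $e=[k,l]$ has a length $\ell_e>0$ that equals the shortest-path distance $d(k,l)$ of its endnodes. Let $R>0$, and let $0\le lb_e\le ub_e$ be real numbers for $e\in E$. $G$ also denotes the set of all points $x=(e_x,t_x)$, $e_x=[k,l]\in E$, $t_x\in[0,1]$, at distance $t_x\ell_{e_x}$ from $k$ and $(1-t_x)\ell_{e_x}$ from $l$ along $e_x$, and $d$ is the shortest-path distance on the points of $G$; in particular $d(x,i)=\min\{t_x\ell_{e_x}+d(k,i),(1-t_x)\ell_{e_x}+d(l,i)\}$ for a node $i$. Put $$C_e(x)=\{t\in[0,1]: d(x,(e,t))\le R\},\qquad g(x,w)=\sum_{e\in E}\int_{C_e(x)}w_e\,dt ,$$ for a vector $w=(w_e)_{e\in E}$ of constant demands. The maximal regret of $x$ and the regret of $x$ with respect to $y\in G$ are $$r(x)=\max_{lb\le w\le ub}\Big(\max_{y\in G}g(y,w)-g(x,w)\Big),\qquad r(x,y)=\max_{lb\le w\le ub}\big(g(y,w)-g(x,w)\big).$$ The single-facility minmax regret maximal covering location problem with unknown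 constant demand on each edge (MMR-EMCLP) asks for a point $x^*\in G$ with $r(x^*)=\min_{x\in G}r(x)$. **Partition points.** For $e=[i,j]\ne e_x$ let $s_e^+(x)=\min\{1,\max\{0,(R-d(x,i))/\ell_e\}\}$ and $s_e^-(x)=\max\{0,\min\{1,1-(R-d(x,j))/\ell_e\}\}$; for $e_x=[k,l]$ let $s_{e_x}^+(x)=\max\{0,(d(x,k)-R)/\ell_{e_x}\}$ and $s_{e_x}^-(x)=\min\{1,1-(d(x,l)-R)/\ell_{e_x}\}$. The set $PP\subseteq G$ of partition points consists of: the nodes; the points $x$ with $d(x,i)=R$ for some node $i$; the points $x=(e_x,t_x)$, $e_x=[k,l]$, $0<t_x<1$, with $t_x\ell_{e_x}+d(k,i)=(1-t_x)\ell_{e_x}+d(l,i)$ for some node $i$; and the points $x$ such that for some $e\in E$ one has $0<s_e^+(x)=s_e^-(x)<1$ and, on at least one side of $x$ on $e_x$, no point sufficiently close to $x$ (and different from $x$) covers $e$ completely. **Theorem.** Let $\lambda_s(N)$ be the maximum length of a Davenport–Schinzel sequence of order $s$ on $N$ symbols (no two adjacent symbols equal, no alternating subsequence $a\,b\,a\,b\cdots$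 of length $s+2$ with $a\neq b$). There are a real-RAM program (exact arithmetic $+,-,\times,\div$ and comparison on reals; addition, subtraction and comparison on integers; indirect addressing; unit cost per operation) and a constant $C$ such that on every input as above the program halts after at most $C\,m\,\lambda_3(m^3)$ steps, having carried out the following procedure: it determines the set $PP$; for every edge $e$ it determines a minimum point $x'_e$ over $e$, and the minimum value, of the upper envelope $x\mapsto\max_{y\in PP}r(x,y)$; and it returns a point $x^*$ among the $x'_e$ with the smallest value. The returned point is an exact optimal solution of the MMR-EMCLP, $r(x^*)=\min_{x\in G}r(x)$, and the returned value is $r(x^*)$. -/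

import Mathlib

/-! ### Davenport–Schinzel sequences -/

namespace DavenportSchinzel

/-- The alternating list `a, b, a, b, …` of length `k`. -/
def alternating {α : Type} (a b : α) : ℕ → List α
  | 0 => []
  | k + 1 => a :: alternating b a k

/-- `u` is a Davenport–Schinzel sequence of order `s`: no two adjacent symbols are equal and there
is no alternating subsequence `a … b … a … b …` of length `s + 2` with `a ≠ b`. -/
def IsSeq {α : Type} (s : ℕ) (u : List α) : Prop :=
  u.IsChain (· ≠ ·) ∧ ∀ a b : α, a ≠ b → ¬ (alternating a b (s + 2)).Sublist u

/-- The lengths of the Davenport–Schinzel sequences of order `s` on `n` symbols. -/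
def lengths (s n : ℕ) : Set ℕ := {L | ∃ u : List (Fin n), IsSeq s u ∧ u.length = L}

/-- `λ_s(n)`: the maximum length of a Davenport–Schinzel sequence of order `s` on `n` symbols
(a genuine maximum, by `lengths_bddAbove` below). -/
noncomputable def lam (s n : ℕ) : ℕ := sSup (lengths s n)

/-- The list cut into consecutive disjoint pairs. -/
def pairs {α : Type} : List α → List (α × α)
  | a :: b :: u => (a, b) :: pairs u
  | _ => []

theorem length_le_pairs {α : Type} : ∀ u : List α, u.length ≤ 2 * (pairs u).length + 1
  | [] => by simp
  | [_] => by simp [pairs]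
  | _ :: _ :: u => by
    have := length_le_pairs u
    simp only [pairs, List.length_cons]
    omega

theorem alternating_sublist {α : Type} [DecidableEq α] (a b : α) :
    ∀ u : List α, (alternating a b (2 * (pairs u).count (a, b))).Sublist u
  | [] => by simp [pairs, alternating]
  | [_] => by simp [pairs, alternating]
  | c :: d :: u => by
    have ih := alternating_sublist a b u
    by_cases h : (c, d) = (a, b)
    · obtain ⟨rfl, rfl⟩ := Prod.mk.inj h
      have : 2 * (pairs (c :: d :: u)).count (c, d) = 2 * (pairs u).count (c, d) + 1 + 1 := by
        simp [pairs]; ring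
      rw [this]
      exact (ih.cons_cons d).cons_cons c
    · have : (pairs (c :: d :: u)).count (a, b) = (pairs u).count (a, b) := by
        simp [pairs, List.count_cons_of_ne h]
      rw [this]
      exact (ih.cons d).cons c

theorem alternating_mono {α : Type} : ∀ (k l : ℕ) (a b : α), k ≤ l →
    (alternating a b k).Sublist (alternating a b l)
  | 0, _, _, _, _ => by simp [alternating]
  | k + 1, l + 1, a, b, h => by
    simpa [alternating] using alternating_mono k l b a (by omega)

theorem pairs_ne {α : Type} : ∀ u : List α, u.IsChain (· ≠ ·) → ∀ p ∈ pairs u, p.1 ≠ p.2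
  | [], _ => by simp [pairs]
  | [_], _ => by simp [pairs]
  | a :: b :: u, h => by
    intro p hp
    simp only [pairs, List.mem_cons] at hp
    rcases hp with rfl | hp
    · exact (List.isChain_cons_cons.1 h).1
    · exact pairs_ne u (List.isChain_cons_cons.1 h).2.tail p hp

theorem lengths_bddAbove (s n : ℕ) : BddAbove (lengths s n) := by
  refine ⟨2 * (n * n * (s + 2)) + 1, ?_⟩
  rintro L ⟨u, ⟨hc, hu⟩, rfl⟩
  have hcount : ∀ p : Fin n × Fin n, (pairs u).count p ≤ s + 2 := by
    intro p
    by_contra hlt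
    have hmem : p ∈ pairs u := List.count_pos_iff.1 (by omega)
    exact hu p.1 p.2 (pairs_ne u hc p hmem)
      ((alternating_mono _ _ _ _ (show s + 2 ≤ 2 * (pairs u).count p by omega)).trans
        (alternating_sublist p.1 p.2 u))
  have hsum : ∑ p : Fin n × Fin n, (pairs u).count p = (pairs u).length := by
    have := Multiset.sum_count_eq_card (s := Finset.univ) (m := (pairs u : Multiset (Fin n × Fin n)))
      (by simp)
    simp only [Multiset.coe_count, Multiset.coe_card] at this
    convert this
  have h1 : (pairs u).length ≤ n * n * (s + 2) := by
    rw [← hsum]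
    calc ∑ p : Fin n × Fin n, (pairs u).count p ≤ ∑ _p : Fin n × Fin n, (s + 2) :=
          Finset.sum_le_sum fun p _ => hcount p
      _ = n * n * (s + 2) := by simp
  have := length_le_pairs u
  omega

end DavenportSchinzel

/-! ### A real RAM

A real RAM with finitely many integer and real registers and finitely many integer and real arrays
in use by a program (registers and arrays are addressed by literal numbers, array cells by the
content of an integer register).  Integers can be added, subtracted (truncated at `0`) and compared;
reals can be added, subtracted, multiplied, divided and compared exactly.  Every instruction and
every evaluation of a test costs one time unit. -/

namespace RealRAM

structure State where
  ireg : ℕ → ℕ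
  rreg : ℕ → ℝ
  iarr : ℕ → ℕ → ℕ
  rarr : ℕ → ℕ → ℝ

inductive Instr where
  | iconst (d c : ℕ)
  | iadd (d a b : ℕ)
  | isub (d a b : ℕ)
  | iload (d A i : ℕ)
  | istore (A i a : ℕ)
  | rconst (d : ℕ) (c : ℤ)
  | radd (d a b : ℕ)
  | rsub (d a b : ℕ)
  | rmul (d a b : ℕ)
  | rdiv (d a b : ℕ)
  | rload (d A i : ℕ)
  | rstore (A i a : ℕ)

namespace State

def setI (σ : State) (d v : ℕ) : State := { σ with ireg := Function.update σ.ireg d v }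

def setR (σ : State) (d : ℕ) (v : ℝ) : State := { σ with rreg := Function.update σ.rreg d v }

def setIA (σ : State) (A i v : ℕ) : State :=
  { σ with iarr := Function.update σ.iarr A (Function.update (σ.iarr A) i v) }

def setRA (σ : State) (A i : ℕ) (v : ℝ) : State :=
  { σ with rarr := Function.update σ.rarr A (Function.update (σ.rarr A) i v) }

end State

/-- The effect of one instruction; `d` is the destination register. -/
noncomputable def Instr.run : Instr → State → State
  | iconst d c, σ => σ.setI d c
  | iadd d a b, σ => σ.setI d (σ.ireg a + σ.ireg b)
  | isub d a b, σ => σ.setI d (σ.ireg a - σ.ireg b)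
  | iload d A i, σ => σ.setI d (σ.iarr A (σ.ireg i))
  | istore A i a, σ => σ.setIA A (σ.ireg i) (σ.ireg a)
  | rconst d c, σ => σ.setR d (c : ℝ)
  | radd d a b, σ => σ.setR d (σ.rreg a + σ.rreg b)
  | rsub d a b, σ => σ.setR d (σ.rreg a - σ.rreg b)
  | rmul d a b, σ => σ.setR d (σ.rreg a * σ.rreg b)
  | rdiv d a b, σ => σ.setR d (σ.rreg a / σ.rreg b)
  | rload d A i, σ => σ.setR d (σ.rarr A (σ.ireg i))
  | rstore A i a, σ => σ.setRA A (σ.ireg i) (σ.rreg a)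

/-- Comparisons of two registers. -/
inductive Test where
  | ile (a b : ℕ)
  | ilt (a b : ℕ)
  | rle (a b : ℕ)
  | rlt (a b : ℕ)

def Test.Holds : Test → State → Prop
  | ile a b, σ => σ.ireg a ≤ σ.ireg b
  | ilt a b, σ => σ.ireg a < σ.ireg b
  | rle a b, σ => σ.rreg a ≤ σ.rreg b
  | rlt a b, σ => σ.rreg a < σ.rreg b

/-- Programs: finite, structured, independent of the input. -/
inductive Prog where
  | skip
  | instr (i : Instr)
  | seq (p q : Prog)
  | branch (t : Test) (p q : Prog)
  | loop (t : Test) (p : Prog)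

/-- `Exec p σ T τ`: the (deterministic) run of `p` from state `σ` halts in state `τ` after exactly
`T` time units.  `loop t p` repeats `p` while `t` holds. -/
inductive Exec : Prog → State → ℕ → State → Prop
  | skip (σ : State) : Exec Prog.skip σ 0 σ
  | instr (i : Instr) (σ : State) : Exec (Prog.instr i) σ 1 (i.run σ)
  | seq {p q : Prog} {σ τ υ : State} {S T : ℕ} :
      Exec p σ S τ → Exec q τ T υ → Exec (Prog.seq p q) σ (S + T) υ
  | branch_true {t : Test} {p q : Prog} {σ τ : State} {T : ℕ} :
      t.Holds σ → Exec p σ T τ → Exec (Prog.branch t p q) σ (T + 1) τ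
  | branch_false {t : Test} {p q : Prog} {σ τ : State} {T : ℕ} :
      ¬ t.Holds σ → Exec q σ T τ → Exec (Prog.branch t p q) σ (T + 1) τ
  | loop_true {t : Test} {p : Prog} {σ τ υ : State} {S T : ℕ} :
      t.Holds σ → Exec p σ S τ → Exec (Prog.loop t p) τ T υ →
        Exec (Prog.loop t p) σ (S + T + 1) υ
  | loop_false {t : Test} {p : Prog} {σ : State} :
      ¬ t.Holds σ → Exec (Prog.loop t p) σ 1 σ

end RealRAM

/-! ### The location problem -/

/-- The data of an instance: an undirected graph with nodes `Fin n` and edges `Fin m`, the edge `e`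
being `[src e, dst e]` (the order only fixes the parametrisation of `e` by `[0,1]`), edge lengths,
constant lower and upper demand bounds on each edge, and the coverage radius `R`. -/
structure Network where
  n : ℕ
  m : ℕ
  src : Fin m → Fin n
  dst : Fin m → Fin n
  len : Fin m → ℝ
  lb : Fin m → ℝ
  ub : Fin m → ℝ
  R : ℝ

namespace Network

/-- `N.Walk i j L`: there is a walk of total length `L` from node `i` to node `j`. -/
inductive Walk (N : Network) : Fin N.n → Fin N.n → ℝ → Prop
  | nil (i : Fin N.n) : Walk N i i 0
  | fwd (e : Fin N.m) {j : Fin N.n} {L : ℝ} :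
      Walk N (N.dst e) j L → Walk N (N.src e) j (N.len e + L)
  | bwd (e : Fin N.m) {j : Fin N.n} {L : ℝ} :
      Walk N (N.src e) j L → Walk N (N.dst e) j (N.len e + L)

/-- The shortest-path distance between two nodes. -/
noncomputable def nodeDist (N : Network) (i j : Fin N.n) : ℝ := sInf {L | N.Walk i j L}

/-- The standing assumptions.  `geodesic` says that the distance between the endnodes of an edge
is the length of the edge. -/
structure Valid (N : Network) : Prop where
  m_pos : 0 < N.m
  len_pos : ∀ e, 0 < N.len e
  R_pos : 0 < N.R
  lb_nonneg : ∀ e, 0 ≤ N.lb e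
  lb_le_ub : ∀ e, N.lb e ≤ N.ub e
  connected : ∀ i j, ∃ L, N.Walk i j L
  geodesic : ∀ e, N.nodeDist (N.src e) (N.dst e) = N.len e

/-- A point `x = (e, t)` of the network: on the edge `e`, at relative distance `t` from `src e`. -/
structure Point (N : Network) where
  e : Fin N.m
  t : ℝ
  ht : t ∈ Set.Icc (0 : ℝ) 1

variable {N : Network}

/-- The distance from a point to a node. -/
noncomputable def distNode (x : N.Point) (i : Fin N.n) : ℝ :=
  min (x.t * N.len x.e + N.nodeDist (N.src x.e) i)
    ((1 - x.t) * N.len x.e + N.nodeDist (N.dst x.e) i)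

/-- The distance between two points of the network; two points of one edge are also joined by the
subedge between them. -/
noncomputable def dist (x y : N.Point) : ℝ :=
  let viaNodes := min (y.t * N.len y.e + distNode x (N.src y.e))
    ((1 - y.t) * N.len y.e + distNode x (N.dst y.e))
  if x.e = y.e then min (|x.t - y.t| * N.len x.e) viaNodes else viaNodes

/-- `C_e(x)`, as a set of parameters in `[0,1]`: the points of `e` within distance `R` of `x`. -/
def coverSet (x : N.Point) (e : Fin N.m) : Set ℝ :=
  {t | ∃ ht : t ∈ Set.Icc (0 : ℝ) 1, dist x ⟨e, t, ht⟩ ≤ N.R}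

/-- The covered demand `g_e(x, w_e)` on an edge, for a demand function on `[0,1]`. -/
noncomputable def coverEdge (x : N.Point) (e : Fin N.m) (w : ℝ → ℝ) : ℝ :=
  ∫ t in coverSet x e, w t

/-- The total covered demand `g(x, w)` for the constant demand `w e` on each edge `e`. -/
noncomputable def cover (x : N.Point) (w : Fin N.m → ℝ) : ℝ :=
  ∑ e, coverEdge x e (fun _ => w e)

/-- The constant demand realisations `lb ≤ w ≤ ub`. -/
def scenarios (N : Network) : Set (Fin N.m → ℝ) := Set.Icc N.lb N.ub

/-- The maximal regret `r(x) = max_w (max_y g(y, w) - g(x, w))`. -/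
noncomputable def maxRegret (x : N.Point) : ℝ :=
  ⨆ w : N.scenarios, ((⨆ y : N.Point, cover y w) - cover x w)

/-- `r(x, y) = max_w (g(y, w) - g(x, w))`. -/
noncomputable def regret (x y : N.Point) : ℝ :=
  ⨆ w : N.scenarios, (cover y w - cover x w)

/-! #### Partition points -/

/-- The edge coverage function `s_e^+`. -/
noncomputable def sPlus (e : Fin N.m) (x : N.Point) : ℝ :=
  if e = x.e then max 0 ((distNode x (N.src e) - N.R) / N.len e)
  else min 1 (max 0 ((N.R - distNode x (N.src e)) / N.len e))

/-- The edge coverage function `s_e^-`. -/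
noncomputable def sMinus (e : Fin N.m) (x : N.Point) : ℝ :=
  if e = x.e then min 1 (1 - (distNode x (N.dst e) - N.R) / N.len e)
  else max 0 (min 1 (1 - (N.R - distNode x (N.dst e)) / N.len e))

/-- Bottleneck points (of some node). -/
def IsBottleneck (x : N.Point) : Prop :=
  0 < x.t ∧ x.t < 1 ∧ ∃ i : Fin N.n,
    x.t * N.len x.e + N.nodeDist (N.src x.e) i = (1 - x.t) * N.len x.e + N.nodeDist (N.dst x.e) i

/-- Network intersect points. -/
def IsNetworkIntersect (x : N.Point) : Prop := ∃ i : Fin N.n, distNode x i = N.R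

/-- Exact coverage points: `0 < s_e^+(x) = s_e^-(x) < 1` for some edge `e` that is no longer
completely covered by the points next to `x` on at least one side of `x` on its edge. -/
def IsExactCoverage (x : N.Point) : Prop :=
  ∃ e : Fin N.m, 0 < sPlus e x ∧ sPlus e x = sMinus e x ∧ sMinus e x < 1 ∧
    ∃ ε₁ ε₂ : ℝ, 0 ≤ ε₁ ∧ 0 ≤ ε₂ ∧ 0 < ε₁ + ε₂ ∧
      ∀ x' : N.Point, x'.e = x.e →
        x'.t ∈ Set.Ioo (x.t - ε₁) x.t ∪ Set.Ioo x.t (x.t + ε₂) →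
          coverSet x' e ≠ Set.Icc 0 1

/-- The set `PP` of partition points. -/
def partitionPoints (N : Network) : Set N.Point :=
  {x | x.t = 0 ∨ x.t = 1 ∨ IsNetworkIntersect x ∨ IsBottleneck x ∨ IsExactCoverage x}

/-- The upper envelope `x ↦ max_{y ∈ PP} r(x, y)`. -/
noncomputable def envelope (x : N.Point) : ℝ := ⨆ y : N.partitionPoints, regret x y

/-! #### Input and output -/

/-- The initial state: `n`, `m`, `R` in registers; endnodes, lengths and demand bounds in arrays;
everything else is `0`. -/
noncomputable def input (N : Network) : RealRAM.State where
  ireg := fun k => if k = 0 then N.n else if k = 1 then N.m else 0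
  rreg := fun k => if k = 0 then N.R else 0
  iarr := fun A i => if h : i < N.m then
      (if A = 0 then (N.src ⟨i, h⟩ : ℕ) else if A = 1 then (N.dst ⟨i, h⟩ : ℕ) else 0) else 0
  rarr := fun A i => if h : i < N.m then
      (if A = 0 then N.len ⟨i, h⟩ else if A = 1 then N.lb ⟨i, h⟩
        else if A = 2 then N.ub ⟨i, h⟩ else 0) else 0

/-- The final state holds
* the set `PP`: the partition points on the edge `e` are the points `(e, t)` with `t` in real
  array `0` at the positions from `iarr 0 e` up to, but excluding, `iarr 0 (e + 1)`;
* for each edge `e`, a minimum point `x'_e = (e, rarr 1 e)` over `e` of the upper envelope of the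
  functions `r(·, y)`, `y ∈ PP`, together with its value `rarr 2 e`;
* the returned point `x* = (ireg 0, rreg 0)` and its value `rreg 1`: it is one of the points
  `x'_e`, with the smallest of their values, and it solves the problem, that is, its maximal regret
  is the least maximal regret over all points of the network, and equals the returned value. -/
structure IsSolution (N : Network) (τ : RealRAM.State) : Prop where
  partition : ∀ x : N.Point, x ∈ N.partitionPoints ↔
    ∃ j, τ.iarr 0 x.e ≤ j ∧ j < τ.iarr 0 ((x.e : ℕ) + 1) ∧ τ.rarr 0 j = x.t
  partition_mem : ∀ e : Fin N.m, ∀ j, τ.iarr 0 e ≤ j → j < τ.iarr 0 ((e : ℕ) + 1) →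
    τ.rarr 0 j ∈ Set.Icc (0 : ℝ) 1
  edge_min : ∀ e : Fin N.m, ∃ x : N.Point, x.e = e ∧ x.t = τ.rarr 1 e ∧
    envelope x = τ.rarr 2 e ∧ ∀ x' : N.Point, x'.e = e → envelope x ≤ envelope x'
  best : ∃ e : Fin N.m, (e : ℕ) = τ.ireg 0 ∧ τ.rreg 0 = τ.rarr 1 e ∧ τ.rreg 1 = τ.rarr 2 e ∧
    ∀ e' : Fin N.m, τ.rarr 2 e ≤ τ.rarr 2 e'
  optimal : ∃ x : N.Point, (x.e : ℕ) = τ.ireg 0 ∧ x.t = τ.rreg 0 ∧ maxRegret x = τ.rreg 1 ∧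
    ∀ x' : N.Point, maxRegret x ≤ maxRegret x'

end Network

/-! ### Lower bound for Davenport–Schinzel lengths -/

namespace DavenportSchinzel

theorem le_lam_three (N : ℕ) : N ≤ lam 3 N := by
  refine le_csSup (lengths_bddAbove 3 N) ⟨List.finRange N, ⟨?_, ?_⟩, by simp⟩
  · exact (List.nodup_finRange N).isChain
  · intro a b _ h
    have := h.nodup (List.nodup_finRange N)
    simp [alternating] at this

end DavenportSchinzel

/-! ### A structured language over the real RAM

Expressions and commands with unit-cost assignments, compiled to `RealRAM.Prog` with a constant
factor; registers from `100` on serve as scratch space of the compiler. -/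

namespace RAMLang

open RealRAM

inductive IE where
  | reg (k : ℕ)
  | lit (c : ℕ)
  | add (a b : IE)
  | sub (a b : IE)
  | ld (A : ℕ) (i : IE)

inductive RE where
  | reg (k : ℕ)
  | lit (c : ℤ)
  | add (a b : RE)
  | sub (a b : RE)
  | mul (a b : RE)
  | div (a b : RE)
  | mn (a b : RE)
  | mx (a b : RE)
  | ld (A : ℕ) (i : IE)

inductive BE where
  | ile (a b : IE)
  | ilt (a b : IE)
  | rle (a b : RE)
  | rlt (a b : RE)
  | and (a b : BE)
  | or (a b : BE)
  | not (a : BE)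

inductive Cmd where
  | skip
  | iset (d : ℕ) (e : IE)
  | rset (d : ℕ) (e : RE)
  | ist (A : ℕ) (i e : IE)
  | rst (A : ℕ) (i : IE) (e : RE)
  | seq (c d : Cmd)
  | ite (b : BE) (c d : Cmd)
  | wh (b : BE) (c : Cmd)

notation:60 a:61 ";;" b:60 => Cmd.seq a b

def IE.eval : IE → State → ℕ
  | reg k, σ => σ.ireg k
  | lit c, _ => c
  | add a b, σ => a.eval σ + b.eval σ
  | sub a b, σ => a.eval σ - b.eval σ
  | ld A i, σ => σ.iarr A (i.eval σ)

noncomputable def RE.eval : RE → State → ℝ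
  | reg k, σ => σ.rreg k
  | lit c, _ => c
  | add a b, σ => a.eval σ + b.eval σ
  | sub a b, σ => a.eval σ - b.eval σ
  | mul a b, σ => a.eval σ * b.eval σ
  | div a b, σ => a.eval σ / b.eval σ
  | mn a b, σ => min (a.eval σ) (b.eval σ)
  | mx a b, σ => max (a.eval σ) (b.eval σ)
  | ld A i, σ => σ.rarr A (i.eval σ)

def BE.eval : BE → State → Prop
  | ile a b, σ => a.eval σ ≤ b.eval σ
  | ilt a b, σ => a.eval σ < b.eval σ
  | rle a b, σ => a.eval σ ≤ b.eval σ
  | rlt a b, σ => a.eval σ < b.eval σ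
  | and a b, σ => a.eval σ ∧ b.eval σ
  | or a b, σ => a.eval σ ∨ b.eval σ
  | not a, σ => ¬ a.eval σ

inductive HExec : Cmd → State → ℕ → State → Prop
  | skip (σ : State) : HExec .skip σ 0 σ
  | iset (d : ℕ) (e : IE) (σ : State) : HExec (.iset d e) σ 1 (σ.setI d (e.eval σ))
  | rset (d : ℕ) (e : RE) (σ : State) : HExec (.rset d e) σ 1 (σ.setR d (e.eval σ))
  | ist (A : ℕ) (i e : IE) (σ : State) :
      HExec (.ist A i e) σ 1 (σ.setIA A (i.eval σ) (e.eval σ))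
  | rst (A : ℕ) (i : IE) (e : RE) (σ : State) :
      HExec (.rst A i e) σ 1 (σ.setRA A (i.eval σ) (e.eval σ))
  | seq {c d : Cmd} {σ τ υ : State} {S T : ℕ} :
      HExec c σ S τ → HExec d τ T υ → HExec (.seq c d) σ (S + T) υ
  | ite_true {b : BE} {c d : Cmd} {σ τ : State} {T : ℕ} :
      b.eval σ → HExec c σ T τ → HExec (.ite b c d) σ (T + 1) τ
  | ite_false {b : BE} {c d : Cmd} {σ τ : State} {T : ℕ} :
      ¬ b.eval σ → HExec d σ T τ → HExec (.ite b c d) σ (T + 1) τ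
  | wh_true {b : BE} {c : Cmd} {σ τ υ : State} {S T : ℕ} :
      b.eval σ → HExec c σ S τ → HExec (.wh b c) τ T υ → HExec (.wh b c) σ (S + T + 1) υ
  | wh_false {b : BE} {c : Cmd} {σ : State} : ¬ b.eval σ → HExec (.wh b c) σ 1 σ

/-! #### Compilation -/

def IE.comp : IE → ℕ → Prog
  | reg k, s => .seq (.instr (.iconst (100 + s) 0)) (.instr (.iadd (100 + s) k (100 + s)))
  | lit c, s => .instr (.iconst (100 + s) c)
  | add a b, s => .seq (a.comp s) (.seq (b.comp (s + 1))
      (.instr (.iadd (100 + s) (100 + s) (100 + (s + 1)))))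
  | sub a b, s => .seq (a.comp s) (.seq (b.comp (s + 1))
      (.instr (.isub (100 + s) (100 + s) (100 + (s + 1)))))
  | ld A i, s => .seq (i.comp s) (.instr (.iload (100 + s) A (100 + s)))

def RE.comp : RE → ℕ → Prog
  | reg k, s => .seq (.instr (.rconst (100 + s) 0)) (.instr (.radd (100 + s) k (100 + s)))
  | lit c, s => .instr (.rconst (100 + s) c)
  | add a b, s => .seq (a.comp s) (.seq (b.comp (s + 1))
      (.instr (.radd (100 + s) (100 + s) (100 + (s + 1)))))
  | sub a b, s => .seq (a.comp s) (.seq (b.comp (s + 1))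
      (.instr (.rsub (100 + s) (100 + s) (100 + (s + 1)))))
  | mul a b, s => .seq (a.comp s) (.seq (b.comp (s + 1))
      (.instr (.rmul (100 + s) (100 + s) (100 + (s + 1)))))
  | div a b, s => .seq (a.comp s) (.seq (b.comp (s + 1))
      (.instr (.rdiv (100 + s) (100 + s) (100 + (s + 1)))))
  | mn a b, s => .seq (a.comp s) (.seq (b.comp (s + 1))
      (.branch (.rle (100 + s) (100 + (s + 1))) .skip (.seq (.instr (.rconst (100 + s) 0))
        (.instr (.radd (100 + s) (100 + s) (100 + (s + 1)))))))
  | mx a b, s => .seq (a.comp s) (.seq (b.comp (s + 1))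
      (.branch (.rle (100 + (s + 1)) (100 + s)) .skip (.seq (.instr (.rconst (100 + s) 0))
        (.instr (.radd (100 + s) (100 + s) (100 + (s + 1)))))))
  | ld A i, s => .seq (i.comp s) (.instr (.rload (100 + s) A (100 + s)))

/-- Sets register `100 + s` to `1` or `0` according to the test. -/
def flag (t : Test) (s : ℕ) : Prog :=
  .branch t (.instr (.iconst (100 + s) 1)) (.instr (.iconst (100 + s) 0))

def BE.comp : BE → ℕ → Prog
  | ile a b, s => .seq (a.comp s) (.seq (b.comp (s + 1)) (flag (.ile (100 + s) (100 + (s + 1))) s))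
  | ilt a b, s => .seq (a.comp s) (.seq (b.comp (s + 1)) (flag (.ilt (100 + s) (100 + (s + 1))) s))
  | rle a b, s => .seq (a.comp s) (.seq (b.comp (s + 1)) (flag (.rle (100 + s) (100 + (s + 1))) s))
  | rlt a b, s => .seq (a.comp s) (.seq (b.comp (s + 1)) (flag (.rlt (100 + s) (100 + (s + 1))) s))
  | and a b, s => .seq (a.comp s) (.seq (b.comp (s + 1))
      (.seq (.instr (.iadd (100 + s) (100 + s) (100 + (s + 1))))
        (.seq (.instr (.iconst (100 + (s + 1)) 2)) (flag (.ile (100 + (s + 1)) (100 + s)) s))))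
  | or a b, s => .seq (a.comp s) (.seq (b.comp (s + 1))
      (.seq (.instr (.iadd (100 + s) (100 + s) (100 + (s + 1))))
        (.seq (.instr (.iconst (100 + (s + 1)) 1)) (flag (.ile (100 + (s + 1)) (100 + s)) s))))
  | not a, s => .seq (a.comp s) (.seq (.instr (.iconst (100 + (s + 1)) 1))
      (.instr (.isub (100 + s) (100 + (s + 1)) (100 + s))))

/-- Evaluates a test; afterwards it holds iff register `101` is at most register `100`. -/
def BE.guard (b : BE) : Prog := .seq (b.comp 0) (.instr (.iconst 101 1))

def Cmd.comp : Cmd → Prog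
  | skip => .skip
  | iset d e => .seq (e.comp 0) (.seq (.instr (.iconst 101 0)) (.instr (.iadd d 100 101)))
  | rset d e => .seq (e.comp 0) (.seq (.instr (.rconst 101 0)) (.instr (.radd d 100 101)))
  | ist A i e => .seq (i.comp 0) (.seq (e.comp 1) (.instr (.istore A 100 101)))
  | rst A i e => .seq (i.comp 0) (.seq (e.comp 1) (.instr (.rstore A 100 101)))
  | seq c d => .seq c.comp d.comp
  | ite b c d => .seq b.guard (.branch (.ile 101 100) c.comp d.comp)
  | wh b c => .seq b.guard (.loop (.ile 101 100) (.seq c.comp b.guard))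

def IE.cost : IE → ℕ
  | reg _ => 2
  | lit _ => 1
  | add a b => a.cost + b.cost + 1
  | sub a b => a.cost + b.cost + 1
  | ld _ i => i.cost + 1

def RE.cost : RE → ℕ
  | reg _ => 2
  | lit _ => 1
  | add a b => a.cost + b.cost + 1
  | sub a b => a.cost + b.cost + 1
  | mul a b => a.cost + b.cost + 1
  | div a b => a.cost + b.cost + 1
  | mn a b => a.cost + b.cost + 3
  | mx a b => a.cost + b.cost + 3
  | ld _ i => i.cost + 1

def BE.cost : BE → ℕ
  | ile a b => a.cost + b.cost + 2
  | ilt a b => a.cost + b.cost + 2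
  | rle a b => a.cost + b.cost + 2
  | rlt a b => a.cost + b.cost + 2
  | and a b => a.cost + b.cost + 4
  | or a b => a.cost + b.cost + 4
  | not a => a.cost + 2

/-- The constant factor lost by compilation. -/
def Cmd.factor : Cmd → ℕ
  | skip => 0
  | iset _ e => e.cost + 2
  | rset _ e => e.cost + 2
  | ist _ i e => i.cost + e.cost + 1
  | rst _ i e => i.cost + e.cost + 1
  | seq c d => c.factor + d.factor
  | ite b c d => b.cost + 2 + c.factor + d.factor
  | wh b c => b.cost + 2 + c.factor

def IE.wf : IE → Bool
  | reg k => decide (k < 100)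
  | lit _ => true
  | add a b => a.wf && b.wf
  | sub a b => a.wf && b.wf
  | ld _ i => i.wf

def RE.wf : RE → Bool
  | reg k => decide (k < 100)
  | lit _ => true
  | add a b => a.wf && b.wf
  | sub a b => a.wf && b.wf
  | mul a b => a.wf && b.wf
  | div a b => a.wf && b.wf
  | mn a b => a.wf && b.wf
  | mx a b => a.wf && b.wf
  | ld _ i => i.wf

def BE.wf : BE → Bool
  | ile a b => a.wf && b.wf
  | ilt a b => a.wf && b.wf
  | rle a b => a.wf && b.wf
  | rlt a b => a.wf && b.wf
  | and a b => a.wf && b.wf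
  | or a b => a.wf && b.wf
  | not a => a.wf

def Cmd.wf : Cmd → Bool
  | skip => true
  | iset d e => decide (d < 100) && e.wf
  | rset d e => decide (d < 100) && e.wf
  | ist _ i e => i.wf && e.wf
  | rst _ i e => i.wf && e.wf
  | seq c d => c.wf && d.wf
  | ite b c d => b.wf && c.wf && d.wf
  | wh b c => b.wf && c.wf

/-- The states agree on the arrays and on the registers below `100 + s`. -/
structure Agree (s : ℕ) (σ τ : State) : Prop where
  ireg : ∀ k < 100 + s, τ.ireg k = σ.ireg k
  rreg : ∀ k < 100 + s, τ.rreg k = σ.rreg k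
  iarr : τ.iarr = σ.iarr
  rarr : τ.rarr = σ.rarr

theorem Agree.refl (s : ℕ) (σ : State) : Agree s σ σ := ⟨by simp, by simp, rfl, rfl⟩

theorem Agree.trans {s : ℕ} {σ τ υ : State} (h : Agree s σ τ) (h' : Agree s τ υ) : Agree s σ υ :=
  ⟨fun k hk => (h'.ireg k hk).trans (h.ireg k hk), fun k hk => (h'.rreg k hk).trans (h.rreg k hk),
    h'.iarr.trans h.iarr, h'.rarr.trans h.rarr⟩

theorem Agree.mono {s s' : ℕ} {σ τ : State} (h : Agree s' σ τ) (hs : s ≤ s') : Agree s σ τ :=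
  ⟨fun k hk => h.ireg k (by omega), fun k hk => h.rreg k (by omega), h.iarr, h.rarr⟩

theorem Agree.setI {s d v : ℕ} {σ τ : State} (h : Agree s σ τ) (hd : 100 + s ≤ d) :
    Agree s σ (τ.setI d v) := by
  refine ⟨fun k hk => ?_, h.rreg, h.iarr, h.rarr⟩
  have : k ≠ d := by omega
  simpa [State.setI, Function.update_of_ne this] using h.ireg k hk

theorem Agree.setR {s d : ℕ} {v : ℝ} {σ τ : State} (h : Agree s σ τ) (hd : 100 + s ≤ d) :
    Agree s σ (τ.setR d v) := by
  refine ⟨h.ireg, fun k hk => ?_, h.iarr, h.rarr⟩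
  have : k ≠ d := by omega
  simpa [State.setR, Function.update_of_ne this] using h.rreg k hk

@[simp] theorem ireg_setI (σ : State) (d v k : ℕ) :
    (σ.setI d v).ireg k = if k = d then v else σ.ireg k := by
  simp [State.setI, Function.update_apply]
@[simp] theorem rreg_setI (σ : State) (d v : ℕ) : (σ.setI d v).rreg = σ.rreg := rfl
@[simp] theorem iarr_setI (σ : State) (d v : ℕ) : (σ.setI d v).iarr = σ.iarr := rfl
@[simp] theorem rarr_setI (σ : State) (d v : ℕ) : (σ.setI d v).rarr = σ.rarr := rfl
@[simp] theorem rreg_setR (σ : State) (d : ℕ) (v : ℝ) (k : ℕ) :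
    (σ.setR d v).rreg k = if k = d then v else σ.rreg k := by
  simp [State.setR, Function.update_apply]
@[simp] theorem ireg_setR (σ : State) (d : ℕ) (v : ℝ) : (σ.setR d v).ireg = σ.ireg := rfl
@[simp] theorem iarr_setR (σ : State) (d : ℕ) (v : ℝ) : (σ.setR d v).iarr = σ.iarr := rfl
@[simp] theorem rarr_setR (σ : State) (d : ℕ) (v : ℝ) : (σ.setR d v).rarr = σ.rarr := rfl
@[simp] theorem iarr_setIA (σ : State) (A i v B : ℕ) :
    (σ.setIA A i v).iarr B = if B = A then Function.update (σ.iarr A) i v else σ.iarr B := by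
  simp [State.setIA, Function.update_apply]
@[simp] theorem ireg_setIA (σ : State) (A i v : ℕ) : (σ.setIA A i v).ireg = σ.ireg := rfl
@[simp] theorem rreg_setIA (σ : State) (A i v : ℕ) : (σ.setIA A i v).rreg = σ.rreg := rfl
@[simp] theorem rarr_setIA (σ : State) (A i v : ℕ) : (σ.setIA A i v).rarr = σ.rarr := rfl
@[simp] theorem rarr_setRA (σ : State) (A i : ℕ) (v : ℝ) (B : ℕ) :
    (σ.setRA A i v).rarr B = if B = A then Function.update (σ.rarr A) i v else σ.rarr B := by
  simp [State.setRA, Function.update_apply]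
@[simp] theorem ireg_setRA (σ : State) (A i : ℕ) (v : ℝ) : (σ.setRA A i v).ireg = σ.ireg := rfl
@[simp] theorem rreg_setRA (σ : State) (A i : ℕ) (v : ℝ) : (σ.setRA A i v).rreg = σ.rreg := rfl
@[simp] theorem iarr_setRA (σ : State) (A i : ℕ) (v : ℝ) : (σ.setRA A i v).iarr = σ.iarr := rfl

theorem IE.eval_agree {e : IE} (he : e.wf) {s : ℕ} {σ τ : State} (h : Agree s σ τ) :
    e.eval τ = e.eval σ := by
  induction e with
  | reg k => exact h.ireg k (by simp [IE.wf] at he; omega)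
  | lit c => rfl
  | add a b iha ihb => simp [IE.wf] at he; simp [IE.eval, iha he.1, ihb he.2]
  | sub a b iha ihb => simp [IE.wf] at he; simp [IE.eval, iha he.1, ihb he.2]
  | ld A i ih => simp [IE.wf] at he; simp [IE.eval, ih he, h.iarr]

theorem RE.eval_agree {e : RE} (he : e.wf) {s : ℕ} {σ τ : State} (h : Agree s σ τ) :
    e.eval τ = e.eval σ := by
  induction e with
  | reg k => exact h.rreg k (by simp [RE.wf] at he; omega)
  | lit c => rfl
  | add a b iha ihb => simp [RE.wf] at he; simp [RE.eval, iha he.1, ihb he.2]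
  | sub a b iha ihb => simp [RE.wf] at he; simp [RE.eval, iha he.1, ihb he.2]
  | mul a b iha ihb => simp [RE.wf] at he; simp [RE.eval, iha he.1, ihb he.2]
  | div a b iha ihb => simp [RE.wf] at he; simp [RE.eval, iha he.1, ihb he.2]
  | mn a b iha ihb => simp [RE.wf] at he; simp [RE.eval, iha he.1, ihb he.2]
  | mx a b iha ihb => simp [RE.wf] at he; simp [RE.eval, iha he.1, ihb he.2]
  | ld A i => simp [RE.wf] at he; simp [RE.eval, IE.eval_agree he h, h.rarr]

theorem BE.eval_agree {e : BE} (he : e.wf) {s : ℕ} {σ τ : State} (h : Agree s σ τ) :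
    e.eval τ ↔ e.eval σ := by
  induction e with
  | ile a b => simp [BE.wf] at he; simp [BE.eval, IE.eval_agree he.1 h, IE.eval_agree he.2 h]
  | ilt a b => simp [BE.wf] at he; simp [BE.eval, IE.eval_agree he.1 h, IE.eval_agree he.2 h]
  | rle a b => simp [BE.wf] at he; simp [BE.eval, RE.eval_agree he.1 h, RE.eval_agree he.2 h]
  | rlt a b => simp [BE.wf] at he; simp [BE.eval, RE.eval_agree he.1 h, RE.eval_agree he.2 h]
  | and a b iha ihb => simp [BE.wf] at he; simp [BE.eval, iha he.1, ihb he.2]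
  | or a b iha ihb => simp [BE.wf] at he; simp [BE.eval, iha he.1, ihb he.2]
  | not a iha => simp [BE.wf] at he; simp [BE.eval, iha he]

theorem IE.comp_spec (e : IE) (he : e.wf) (s : ℕ) (σ : State) :
    ∃ T τ, Exec (e.comp s) σ T τ ∧ T ≤ e.cost ∧ Agree s σ τ ∧ τ.ireg (100 + s) = e.eval σ := by
  induction e generalizing s σ with
  | reg k =>
    refine ⟨_, _, .seq (.instr _ _) (.instr _ _), by simp [IE.cost],
      ((Agree.refl s σ).setI le_rfl).setI le_rfl, ?_⟩
    have : k ≠ 100 + s := by simp [IE.wf] at he; omega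
    simp [Instr.run, IE.eval, this]
  | lit c => exact ⟨_, _, .instr _ _, by simp [IE.cost], (Agree.refl s σ).setI le_rfl,
      by simp [Instr.run, IE.eval]⟩
  | add a b iha ihb =>
    simp only [IE.wf, Bool.and_eq_true] at he
    obtain ⟨T, τ, h1, h2, h3, h4⟩ := iha he.1 s σ
    obtain ⟨T', τ', h1', h2', h3', h4'⟩ := ihb he.2 (s + 1) τ
    refine ⟨_, _, .seq h1 (.seq h1' (.instr _ _)), by simp [IE.cost]; omega,
      (h3.trans (h3'.mono (by omega))).setI le_rfl, ?_⟩
    simp [Instr.run, IE.eval, h4', h3'.ireg (100 + s) (by omega), h4, IE.eval_agree he.2 h3]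
  | sub a b iha ihb =>
    simp only [IE.wf, Bool.and_eq_true] at he
    obtain ⟨T, τ, h1, h2, h3, h4⟩ := iha he.1 s σ
    obtain ⟨T', τ', h1', h2', h3', h4'⟩ := ihb he.2 (s + 1) τ
    refine ⟨_, _, .seq h1 (.seq h1' (.instr _ _)), by simp [IE.cost]; omega,
      (h3.trans (h3'.mono (by omega))).setI le_rfl, ?_⟩
    simp [Instr.run, IE.eval, h4', h3'.ireg (100 + s) (by omega), h4, IE.eval_agree he.2 h3]
  | ld A i ih =>
    obtain ⟨T, τ, h1, h2, h3, h4⟩ := ih he s σ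
    exact ⟨_, _, .seq h1 (.instr _ _), by simp [IE.cost]; omega, h3.setI le_rfl,
      by simp [Instr.run, IE.eval, h4, h3.iarr]⟩

theorem RE.comp_spec_binary {a b : RE} (hb : b.wf) (s : ℕ) (σ : State) {Ta Tb : ℕ}
    (iha : ∃ T τ, Exec (a.comp s) σ T τ ∧ T ≤ Ta ∧ Agree s σ τ ∧ τ.rreg (100 + s) = a.eval σ)
    (ihb : ∀ σ, ∃ T τ, Exec (b.comp (s + 1)) σ T τ ∧ T ≤ Tb ∧ Agree (s + 1) σ τ ∧
      τ.rreg (100 + (s + 1)) = b.eval σ) (q : Prog) :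
    ∃ T τ, T ≤ Ta + Tb ∧ Agree s σ τ ∧ τ.rreg (100 + s) = a.eval σ ∧
      τ.rreg (100 + (s + 1)) = b.eval σ ∧ ∀ U υ, Exec q τ U υ →
        ∃ V ≤ T + U, Exec (.seq (a.comp s) (.seq (b.comp (s + 1)) q)) σ V υ := by
  obtain ⟨T, τ, h1, h2, h3, h4⟩ := iha
  obtain ⟨T', τ', h1', h2', h3', h4'⟩ := ihb τ
  exact ⟨T + T', τ', by omega, h3.trans (h3'.mono (by omega)),
    (h3'.rreg _ (by omega)).trans h4, h4'.trans (RE.eval_agree hb h3),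
    fun U υ h => ⟨_, by omega, .seq h1 (.seq h1' h)⟩⟩

theorem RE.comp_spec (e : RE) (he : e.wf) (s : ℕ) (σ : State) :
    ∃ T τ, Exec (e.comp s) σ T τ ∧ T ≤ e.cost ∧ Agree s σ τ ∧ τ.rreg (100 + s) = e.eval σ := by
  induction e generalizing s σ with
  | reg k =>
    refine ⟨_, _, .seq (.instr _ _) (.instr _ _), by simp [RE.cost],
      ((Agree.refl s σ).setR le_rfl).setR le_rfl, ?_⟩
    have : k ≠ 100 + s := by simp [RE.wf] at he; omega
    simp [Instr.run, RE.eval, this]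
  | lit c => exact ⟨_, _, .instr _ _, by simp [RE.cost], (Agree.refl s σ).setR le_rfl,
      by simp [Instr.run, RE.eval]⟩
  | add a b iha ihb | sub a b iha ihb | mul a b iha ihb | div a b iha ihb =>
    simp only [RE.wf, Bool.and_eq_true] at he
    obtain ⟨T, τ, h2, h3, h4, h5, h6⟩ := RE.comp_spec_binary he.2 s σ (iha he.1 s σ)
      (ihb he.2 (s + 1)) _
    obtain ⟨V, hV, h⟩ := h6 _ _ (.instr _ _)
    exact ⟨_, _, h, by simp only [RE.cost]; omega, h3.setR le_rfl,
      by simp [Instr.run, RE.eval, h4, h5]⟩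
  | mn a b iha ihb =>
    simp only [RE.wf, Bool.and_eq_true] at he
    obtain ⟨T, τ, h2, h3, h4, h5, h6⟩ := RE.comp_spec_binary he.2 s σ (iha he.1 s σ)
      (ihb he.2 (s + 1)) (.branch (.rle (100 + s) (100 + (s + 1))) .skip (.seq (.instr (.rconst (100 + s) 0))
        (.instr (.radd (100 + s) (100 + s) (100 + (s + 1))))))
    by_cases hle : a.eval σ ≤ b.eval σ
    · obtain ⟨V, hV, h⟩ := h6 _ _ (.branch_true (by simpa [Test.Holds, h4, h5] using hle) (.skip _))
      exact ⟨_, _, h, by simp only [RE.cost]; omega, h3, by simp [RE.eval, h4, hle]⟩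
    · obtain ⟨V, hV, h⟩ := h6 _ _ (.branch_false (by simpa [Test.Holds, h4, h5] using hle)
        (.seq (.instr _ _) (.instr _ _)))
      exact ⟨_, _, h, by simp only [RE.cost]; omega, (h3.setR le_rfl).setR le_rfl,
        by simp [Instr.run, RE.eval, h5, (not_le.1 hle).le]⟩
  | mx a b iha ihb =>
    simp only [RE.wf, Bool.and_eq_true] at he
    obtain ⟨T, τ, h2, h3, h4, h5, h6⟩ := RE.comp_spec_binary he.2 s σ (iha he.1 s σ)
      (ihb he.2 (s + 1)) (.branch (.rle (100 + (s + 1)) (100 + s)) .skip (.seq (.instr (.rconst (100 + s) 0))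
        (.instr (.radd (100 + s) (100 + s) (100 + (s + 1))))))
    by_cases hle : b.eval σ ≤ a.eval σ
    · obtain ⟨V, hV, h⟩ := h6 _ _ (.branch_true (by simpa [Test.Holds, h4, h5] using hle) (.skip _))
      exact ⟨_, _, h, by simp only [RE.cost]; omega, h3, by simp [RE.eval, h4, hle]⟩
    · obtain ⟨V, hV, h⟩ := h6 _ _ (.branch_false (by simpa [Test.Holds, h4, h5] using hle)
        (.seq (.instr _ _) (.instr _ _)))
      exact ⟨_, _, h, by simp only [RE.cost]; omega, (h3.setR le_rfl).setR le_rfl,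
        by simp [Instr.run, RE.eval, h5, (not_le.1 hle).le]⟩
  | ld A i =>
    obtain ⟨T, τ, h1, h2, h3, h4⟩ := i.comp_spec he s σ
    exact ⟨_, _, .seq h1 (.instr _ _), by simp [RE.cost]; omega, h3.setR le_rfl,
      by simp [Instr.run, RE.eval, h4, h3.rarr]⟩

open Classical in
theorem flag_spec (t : Test) (s : ℕ) (σ : State) :
    ∃ τ, Exec (flag t s) σ 2 τ ∧ Agree s σ τ ∧
      τ.ireg (100 + s) = if t.Holds σ then 1 else 0 := by
  by_cases h : t.Holds σ
  · exact ⟨_, .branch_true h (.instr _ _), (Agree.refl s σ).setI le_rfl, by simp [Instr.run, h]⟩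
  · exact ⟨_, .branch_false h (.instr _ _), (Agree.refl s σ).setI le_rfl, by simp [Instr.run, h]⟩

open Classical in
theorem BE.comp_spec (e : BE) (he : e.wf) (s : ℕ) (σ : State) :
    ∃ T τ, Exec (e.comp s) σ T τ ∧ T ≤ e.cost ∧ Agree s σ τ ∧
      τ.ireg (100 + s) = if e.eval σ then 1 else 0 := by
  induction e generalizing s σ with
  | ile a b | ilt a b =>
    simp only [BE.wf, Bool.and_eq_true] at he
    obtain ⟨T, τ, h1, h2, h3, h4⟩ := a.comp_spec he.1 s σ
    obtain ⟨T', τ', h1', h2', h3', h4'⟩ := b.comp_spec he.2 (s + 1) τ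
    obtain ⟨υ, h5, h6, h7⟩ := flag_spec _ s τ'
    refine ⟨_, _, .seq h1 (.seq h1' h5), by simp only [BE.cost]; omega,
      (h3.trans (h3'.mono (by omega))).trans h6, ?_⟩
    simp [h7, Test.Holds, BE.eval, h4', h3'.ireg (100 + s) (by omega), h4, IE.eval_agree he.2 h3]
    congr
  | rle a b | rlt a b =>
    simp only [BE.wf, Bool.and_eq_true] at he
    obtain ⟨T, τ, h1, h2, h3, h4⟩ := a.comp_spec he.1 s σ
    obtain ⟨T', τ', h1', h2', h3', h4'⟩ := b.comp_spec he.2 (s + 1) τ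
    obtain ⟨υ, h5, h6, h7⟩ := flag_spec _ s τ'
    refine ⟨_, _, .seq h1 (.seq h1' h5), by simp only [BE.cost]; omega,
      (h3.trans (h3'.mono (by omega))).trans h6, ?_⟩
    simp [h7, Test.Holds, BE.eval, h4', h3'.rreg (100 + s) (by omega), h4, RE.eval_agree he.2 h3]
    congr
  | and a b iha ihb | or a b iha ihb =>
    simp only [BE.wf, Bool.and_eq_true] at he
    obtain ⟨T, τ, h1, h2, h3, h4⟩ := iha he.1 s σ
    obtain ⟨T', τ', h1', h2', h3', h4'⟩ := ihb he.2 (s + 1) τ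
    obtain ⟨υ, h5, h6, h7⟩ := flag_spec _ s _
    refine ⟨_, _, .seq h1 (.seq h1' (.seq (.instr _ _) (.seq (.instr _ _) h5))),
      by simp only [BE.cost]; omega,
      (((h3.trans (h3'.mono (by omega))).setI le_rfl).setI (by omega)).trans h6, ?_⟩
    simp only [h7, Test.Holds, BE.eval, Instr.run, ireg_setI, h4', h3'.ireg (100 + s) (by omega),
      h4, BE.eval_agree he.2 h3]
    by_cases ha : a.eval σ <;> by_cases hb : b.eval σ <;> simp [ha, hb]
  | not a iha =>
    obtain ⟨T, τ, h1, h2, h3, h4⟩ := iha he s σ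
    refine ⟨_, _, .seq h1 (.seq (.instr _ _) (.instr _ _)), by simp only [BE.cost]; omega,
      (h3.setI (by omega)).setI le_rfl, ?_⟩
    by_cases ha : a.eval σ <;> simp [BE.eval, Instr.run, h4, ha]

theorem BE.guard_spec (e : BE) (he : e.wf) (σ : State) :
    ∃ T τ, Exec e.guard σ T τ ∧ T ≤ e.cost + 1 ∧ Agree 0 σ τ ∧
      ((Test.ile 101 100).Holds τ ↔ e.eval σ) := by
  obtain ⟨T, τ, h1, h2, h3, h4⟩ := e.comp_spec he 0 σ
  refine ⟨_, _, .seq h1 (.instr _ _), by omega, h3.setI (by omega), ?_⟩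
  by_cases h : e.eval σ <;> simp_all [Test.Holds, Instr.run]

theorem Agree.congr_setI {s d v v' : ℕ} {σ τ : State} (h : Agree s σ τ) (hv : v' = v) :
    Agree s (σ.setI d v) (τ.setI d v') := by
  subst hv
  refine ⟨fun k hk => ?_, h.rreg, h.iarr, h.rarr⟩
  simp [h.ireg k hk]

theorem Agree.congr_setR {s d : ℕ} {v v' : ℝ} {σ τ : State} (h : Agree s σ τ) (hv : v' = v) :
    Agree s (σ.setR d v) (τ.setR d v') := by
  subst hv
  refine ⟨h.ireg, fun k hk => ?_, h.iarr, h.rarr⟩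
  simp [h.rreg k hk]

theorem Agree.congr_setIA {s A i i' v v' : ℕ} {σ τ : State} (h : Agree s σ τ) (hi : i' = i)
    (hv : v' = v) : Agree s (σ.setIA A i v) (τ.setIA A i' v') := by
  subst hv hi
  exact ⟨h.ireg, h.rreg, by simp [State.setIA, h.iarr], h.rarr⟩

theorem Agree.congr_setRA {s A i i' : ℕ} {v v' : ℝ} {σ τ : State} (h : Agree s σ τ) (hi : i' = i)
    (hv : v' = v) : Agree s (σ.setRA A i v) (τ.setRA A i' v') := by
  subst hv hi
  exact ⟨h.ireg, h.rreg, h.iarr, by simp [State.setRA, h.rarr]⟩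

/-- Compilation is correct and loses a constant factor of time. -/
theorem HExec.compile {c : Cmd} {σ τ : State} {T : ℕ} (h : HExec c σ T τ) (hc : c.wf) :
    ∀ σ', Agree 0 σ σ' → ∃ T' τ', Exec c.comp σ' T' τ' ∧ T' ≤ c.factor * T ∧ Agree 0 τ τ' := by
  induction h with
  | skip σ => exact fun σ' h => ⟨0, σ', .skip _, by simp, h⟩
  | iset d e σ =>
    intro σ' h
    simp only [Cmd.wf, Bool.and_eq_true, decide_eq_true_eq] at hc
    obtain ⟨T, τ, h1, h2, h3, h4⟩ := e.comp_spec hc.2 0 σ'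
    refine ⟨_, _, .seq h1 (.seq (.instr _ _) (.instr _ _)), by simp only [Cmd.factor]; omega, ?_⟩
    refine ((h.trans h3).setI (d := 101) (v := 0) (by omega)).congr_setI (v' := τ.ireg 100 + 0) ?_
    simp at h4
    simp [h4, IE.eval_agree hc.2 h]
  | rset d e σ =>
    intro σ' h
    simp only [Cmd.wf, Bool.and_eq_true, decide_eq_true_eq] at hc
    obtain ⟨T, τ, h1, h2, h3, h4⟩ := e.comp_spec hc.2 0 σ'
    refine ⟨_, _, .seq h1 (.seq (.instr _ _) (.instr _ _)), by simp only [Cmd.factor]; omega, ?_⟩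
    refine ((h.trans h3).setR (d := 101) (v := ((0 : ℤ) : ℝ)) (by omega)).congr_setR
      (v' := τ.rreg 100 + ((0 : ℤ) : ℝ)) ?_
    simp at h4
    simp [h4, RE.eval_agree hc.2 h]
  | ist A i e σ =>
    intro σ' h
    simp only [Cmd.wf, Bool.and_eq_true] at hc
    obtain ⟨T, τ, h1, h2, h3, h4⟩ := i.comp_spec hc.1 0 σ'
    obtain ⟨T', τ', h1', h2', h3', h4'⟩ := e.comp_spec hc.2 1 τ
    refine ⟨_, _, .seq h1 (.seq h1' (.instr _ _)), by simp only [Cmd.factor]; omega, ?_⟩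
    have h5 := h3'.ireg 100 (by omega)
    refine ((h.trans h3).trans (h3'.mono (by omega))).congr_setIA ?_ ?_
    · simp at h4
      rw [h5, h4, IE.eval_agree hc.1 h]
    · simp at h4'
      rw [h4', IE.eval_agree hc.2 (h.trans h3)]
  | rst A i e σ =>
    intro σ' h
    simp only [Cmd.wf, Bool.and_eq_true] at hc
    obtain ⟨T, τ, h1, h2, h3, h4⟩ := i.comp_spec hc.1 0 σ'
    obtain ⟨T', τ', h1', h2', h3', h4'⟩ := e.comp_spec hc.2 1 τ
    refine ⟨_, _, .seq h1 (.seq h1' (.instr _ _)), by simp only [Cmd.factor]; omega, ?_⟩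
    have h5 := h3'.ireg 100 (by omega)
    refine ((h.trans h3).trans (h3'.mono (by omega))).congr_setRA ?_ ?_
    · simp at h4
      rw [h5, h4, IE.eval_agree hc.1 h]
    · simp at h4'
      rw [h4', RE.eval_agree hc.2 (h.trans h3)]
  | seq _ _ ih1 ih2 =>
    intro σ' h
    simp only [Cmd.wf, Bool.and_eq_true] at hc
    obtain ⟨T, τ, h1, h2, h3⟩ := ih1 hc.1 σ' h
    obtain ⟨T', τ', h1', h2', h3'⟩ := ih2 hc.2 τ h3
    refine ⟨_, _, .seq h1 h1', ?_, h3'⟩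
    simp only [Cmd.factor]
    nlinarith
  | ite_true hb _ ih =>
    intro σ' h
    simp only [Cmd.wf, Bool.and_eq_true] at hc
    obtain ⟨T, τ, h1, h2, h3, h4⟩ := BE.guard_spec _ hc.1.1 σ'
    obtain ⟨T', τ', h1', h2', h3'⟩ := ih hc.1.2 τ (h.trans h3)
    refine ⟨_, _, .seq h1 (.branch_true (h4.2 ((BE.eval_agree hc.1.1 h).2 hb)) h1'), ?_, h3'⟩
    simp only [Cmd.factor]
    nlinarith
  | ite_false hb _ ih =>
    intro σ' h
    simp only [Cmd.wf, Bool.and_eq_true] at hc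
    obtain ⟨T, τ, h1, h2, h3, h4⟩ := BE.guard_spec _ hc.1.1 σ'
    obtain ⟨T', τ', h1', h2', h3'⟩ := ih hc.2 τ (h.trans h3)
    refine ⟨_, _, .seq h1 (.branch_false (fun hh => hb ((BE.eval_agree hc.1.1 h).1 (h4.1 hh))) h1'),
      ?_, h3'⟩
    simp only [Cmd.factor]
    nlinarith
  | wh_true hb _ _ ih1 ih2 =>
    intro σ' h
    have hc' := hc
    simp only [Cmd.wf, Bool.and_eq_true] at hc
    obtain ⟨T, τ, h1, h2, h3, h4⟩ := BE.guard_spec _ hc.1 σ'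
    obtain ⟨T', τ', h1', h2', h3'⟩ := ih1 hc.2 τ (h.trans h3)
    obtain ⟨T'', τ'', h1'', h2'', h3''⟩ := ih2 hc' τ' h3'
    cases h1'' with
    | seq hg hl =>
      refine ⟨_, _, .seq h1 (.loop_true (h4.2 ((BE.eval_agree hc.1 h).2 hb)) (.seq h1' hg) hl),
        ?_, h3''⟩
      simp only [Cmd.factor] at h2'' ⊢
      nlinarith
  | wh_false hb =>
    intro σ' h
    simp only [Cmd.wf, Bool.and_eq_true] at hc
    obtain ⟨T, τ, h1, h2, h3, h4⟩ := BE.guard_spec _ hc.1 σ'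
    refine ⟨_, _, .seq h1 (.loop_false fun hh => hb ((BE.eval_agree hc.1 h).1 (h4.1 hh))), ?_,
      h.trans h3⟩
    simp only [Cmd.factor]
    omega

/-! #### Frames -/

def Cmd.wI : Cmd → ℕ → Bool
  | iset d _, k => d == k
  | seq c d, k => c.wI k || d.wI k
  | ite _ c d, k => c.wI k || d.wI k
  | wh _ c, k => c.wI k
  | _, _ => false

def Cmd.wR : Cmd → ℕ → Bool
  | rset d _, k => d == k
  | seq c d, k => c.wR k || d.wR k
  | ite _ c d, k => c.wR k || d.wR k
  | wh _ c, k => c.wR k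
  | _, _ => false

def Cmd.wIA : Cmd → ℕ → Bool
  | ist A _ _, k => A == k
  | seq c d, k => c.wIA k || d.wIA k
  | ite _ c d, k => c.wIA k || d.wIA k
  | wh _ c, k => c.wIA k
  | _, _ => false

def Cmd.wRA : Cmd → ℕ → Bool
  | rst A _ _, k => A == k
  | seq c d, k => c.wRA k || d.wRA k
  | ite _ c d, k => c.wRA k || d.wRA k
  | wh _ c, k => c.wRA k
  | _, _ => false

/-- `τ` differs from `σ` at most in the registers and arrays that `c` writes to. -/
structure Frame (c : Cmd) (σ τ : State) : Prop where
  ir : ∀ k, c.wI k = false → τ.ireg k = σ.ireg k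
  rr : ∀ k, c.wR k = false → τ.rreg k = σ.rreg k
  ia : ∀ A, c.wIA A = false → τ.iarr A = σ.iarr A
  ra : ∀ A, c.wRA A = false → τ.rarr A = σ.rarr A

theorem Frame.refl (c : Cmd) (σ : State) : Frame c σ σ :=
  ⟨fun _ _ => rfl, fun _ _ => rfl, fun _ _ => rfl, fun _ _ => rfl⟩

theorem Frame.trans {c : Cmd} {σ τ υ : State} (h : Frame c σ τ) (h' : Frame c τ υ) :
    Frame c σ υ :=
  ⟨fun k hk => (h'.ir k hk).trans (h.ir k hk), fun k hk => (h'.rr k hk).trans (h.rr k hk),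
    fun k hk => (h'.ia k hk).trans (h.ia k hk), fun k hk => (h'.ra k hk).trans (h.ra k hk)⟩

theorem Frame.of_imp {c d : Cmd} {σ τ : State} (h : Frame c σ τ)
    (h1 : ∀ k, d.wI k = false → c.wI k = false) (h2 : ∀ k, d.wR k = false → c.wR k = false)
    (h3 : ∀ k, d.wIA k = false → c.wIA k = false) (h4 : ∀ k, d.wRA k = false → c.wRA k = false) :
    Frame d σ τ :=
  ⟨fun k hk => h.ir k (h1 k hk), fun k hk => h.rr k (h2 k hk), fun k hk => h.ia k (h3 k hk),
    fun k hk => h.ra k (h4 k hk)⟩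

theorem Frame.wh {b : BE} {c : Cmd} {σ τ : State} (h : Frame c σ τ) : Frame (.wh b c) σ τ :=
  ⟨h.ir, h.rr, h.ia, h.ra⟩

theorem HExec.frame {c : Cmd} {σ τ : State} {T : ℕ} (h : HExec c σ T τ) : Frame c σ τ := by
  induction h with
  | skip σ => exact Frame.refl _ _
  | iset d e σ =>
    refine ⟨fun k hk => ?_, fun _ _ => rfl, fun _ _ => rfl, fun _ _ => rfl⟩
    have : k ≠ d := by simp [Cmd.wI] at hk; omega
    simp [this]
  | rset d e σ =>
    refine ⟨fun _ _ => rfl, fun k hk => ?_, fun _ _ => rfl, fun _ _ => rfl⟩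
    have : k ≠ d := by simp [Cmd.wR] at hk; omega
    simp [this]
  | ist A i e σ =>
    refine ⟨fun _ _ => rfl, fun _ _ => rfl, fun k hk => ?_, fun _ _ => rfl⟩
    have : k ≠ A := by simp [Cmd.wIA] at hk; omega
    simp [this]
  | rst A i e σ =>
    refine ⟨fun _ _ => rfl, fun _ _ => rfl, fun _ _ => rfl, fun k hk => ?_⟩
    have : k ≠ A := by simp [Cmd.wRA] at hk; omega
    simp [this]
  | seq _ _ ih1 ih2 =>
    refine (ih1.of_imp ?_ ?_ ?_ ?_).trans (ih2.of_imp ?_ ?_ ?_ ?_) <;>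
      simp +contextual [Cmd.wI, Cmd.wR, Cmd.wIA, Cmd.wRA]
  | ite_true _ _ ih =>
    refine ih.of_imp ?_ ?_ ?_ ?_ <;> simp +contextual [Cmd.wI, Cmd.wR, Cmd.wIA, Cmd.wRA]
  | ite_false _ _ ih =>
    refine ih.of_imp ?_ ?_ ?_ ?_ <;> simp +contextual [Cmd.wI, Cmd.wR, Cmd.wIA, Cmd.wRA]
  | wh_true _ _ _ ih1 ih2 =>
    exact ih1.wh.trans ih2
  | wh_false _ => exact Frame.refl _ _

/-! #### Program logic -/

/-- From `σ`, the command halts in a state `τ` after time `t` with `Q t τ`. -/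
def Run (c : Cmd) (σ : State) (Q : ℕ → State → Prop) : Prop := ∃ T τ, HExec c σ T τ ∧ Q T τ

theorem Run.mono {c : Cmd} {σ : State} {Q Q' : ℕ → State → Prop} (h : Run c σ Q)
    (hQ : ∀ t τ, Frame c σ τ → Q t τ → Q' t τ) : Run c σ Q' := by
  obtain ⟨T, τ, h1, h2⟩ := h
  exact ⟨T, τ, h1, hQ T τ h1.frame h2⟩

theorem run_skip {σ : State} {Q : ℕ → State → Prop} : Run .skip σ Q ↔ Q 0 σ :=
  ⟨fun ⟨_, _, h, hQ⟩ => by cases h; exact hQ, fun h => ⟨_, _, .skip _, h⟩⟩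

theorem run_iset {d : ℕ} {e : IE} {σ : State} {Q : ℕ → State → Prop} :
    Run (.iset d e) σ Q ↔ Q 1 (σ.setI d (e.eval σ)) :=
  ⟨fun ⟨_, _, h, hQ⟩ => by cases h; exact hQ, fun h => ⟨_, _, .iset _ _ _, h⟩⟩

theorem run_rset {d : ℕ} {e : RE} {σ : State} {Q : ℕ → State → Prop} :
    Run (.rset d e) σ Q ↔ Q 1 (σ.setR d (e.eval σ)) :=
  ⟨fun ⟨_, _, h, hQ⟩ => by cases h; exact hQ, fun h => ⟨_, _, .rset _ _ _, h⟩⟩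

theorem run_ist {A : ℕ} {i e : IE} {σ : State} {Q : ℕ → State → Prop} :
    Run (.ist A i e) σ Q ↔ Q 1 (σ.setIA A (i.eval σ) (e.eval σ)) :=
  ⟨fun ⟨_, _, h, hQ⟩ => by cases h; exact hQ, fun h => ⟨_, _, .ist _ _ _ _, h⟩⟩

theorem run_rst {A : ℕ} {i : IE} {e : RE} {σ : State} {Q : ℕ → State → Prop} :
    Run (.rst A i e) σ Q ↔ Q 1 (σ.setRA A (i.eval σ) (e.eval σ)) :=
  ⟨fun ⟨_, _, h, hQ⟩ => by cases h; exact hQ, fun h => ⟨_, _, .rst _ _ _ _, h⟩⟩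

theorem run_seq {c d : Cmd} {σ : State} {Q : ℕ → State → Prop} :
    Run (c ;; d) σ Q ↔ Run c σ fun t τ => Run d τ fun t' υ => Q (t + t') υ := by
  constructor
  · rintro ⟨_, _, h, hQ⟩
    cases h with
    | seq h1 h2 => exact ⟨_, _, h1, _, _, h2, hQ⟩
  · rintro ⟨_, _, h1, _, _, h2, hQ⟩
    exact ⟨_, _, .seq h1 h2, hQ⟩

theorem run_ite {b : BE} {c d : Cmd} {σ : State} {Q : ℕ → State → Prop} :
    Run (.ite b c d) σ Q ↔ (b.eval σ → Run c σ fun t τ => Q (t + 1) τ) ∧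
      (¬ b.eval σ → Run d σ fun t τ => Q (t + 1) τ) := by
  constructor
  · rintro ⟨_, _, h, hQ⟩
    cases h with
    | ite_true hb h => exact ⟨fun _ => ⟨_, _, h, hQ⟩, fun hb' => absurd hb hb'⟩
    | ite_false hb h => exact ⟨fun hb' => absurd hb' hb, fun _ => ⟨_, _, h, hQ⟩⟩
  · rintro ⟨h1, h2⟩
    by_cases hb : b.eval σ
    · obtain ⟨_, _, h, hQ⟩ := h1 hb
      exact ⟨_, _, .ite_true hb h, hQ⟩
    · obtain ⟨_, _, h, hQ⟩ := h2 hb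
      exact ⟨_, _, .ite_false hb h, hQ⟩

/-- Sequencing with a specification of the first command. -/
theorem Run.seq {c d : Cmd} {σ : State} {Q Q' : ℕ → State → Prop} (h : Run c σ Q)
    (hd : ∀ t τ, Frame c σ τ → Q t τ → Run d τ fun t' υ => Q' (t + t') υ) : Run (c ;; d) σ Q' :=
  run_seq.2 (h.mono hd)

/-- While loops with an invariant and a potential that pays for the time. -/
theorem Run.while {b : BE} {c : Cmd} {σ : State} (I : State → Prop) (Φ : State → ℕ) (h0 : I σ)
    (hstep : ∀ τ, Frame c σ τ → I τ → b.eval τ →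
      Run c τ fun t υ => I υ ∧ t + 1 + Φ υ ≤ Φ τ) :
    Run (.wh b c) σ fun t τ => I τ ∧ ¬ b.eval τ ∧ t + Φ τ ≤ Φ σ + 1 := by
  suffices H : ∀ n τ, Φ τ ≤ n → Frame c σ τ → I τ →
      Run (.wh b c) τ fun t υ => I υ ∧ ¬ b.eval υ ∧ t + Φ υ ≤ Φ τ + 1 from
    H _ σ le_rfl (Frame.refl _ _) h0
  intro n
  induction n with
  | zero =>
    intro τ hn hf hI
    by_cases hb : b.eval τ
    · obtain ⟨T, υ, h1, h2, h3⟩ := hstep τ hf hI hb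
      omega
    · exact ⟨_, _, .wh_false hb, hI, hb, by omega⟩
  | succ n ih =>
    intro τ hn hf hI
    by_cases hb : b.eval τ
    · obtain ⟨T, υ, h1, h2, h3⟩ := hstep τ hf hI hb
      obtain ⟨T', υ', h1', h2', h3', h4'⟩ := ih υ (by omega) (hf.trans h1.frame) h2
      exact ⟨_, _, .wh_true hb h1 h1', h2', h3', by omega⟩
    · exact ⟨_, _, .wh_false hb, hI, hb, by omega⟩

/-- `for i from its current value below hi`. -/
def forTo (i : ℕ) (hi : IE) (c : Cmd) : Cmd :=
  .wh (.ilt (.reg i) hi) (c ;; .iset i (.add (.reg i) (.lit 1)))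

theorem Run.forTo {i : ℕ} {hi : IE} {c : Cmd} {σ : State} {a n : ℕ} (I : ℕ → State → Prop)
    (f : ℕ → ℕ) (ha : σ.ireg i = a) (han : a ≤ n)
    (hhi : ∀ τ, Frame (RAMLang.forTo i hi c) σ τ → hi.eval τ = n) (hi' : c.wI i = false)
    (h0 : I a σ)
    (hstep : ∀ k τ, a ≤ k → k < n → Frame (RAMLang.forTo i hi c) σ τ → τ.ireg i = k → I k τ →
      Run c τ fun t υ => t ≤ f k ∧ I (k + 1) (υ.setI i (k + 1))) :
    Run (RAMLang.forTo i hi c) σ fun t τ => I n τ ∧ τ.ireg i = n ∧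
      t ≤ 1 + ∑ k ∈ Finset.Ico a n, (f k + 2) := by
  have H := Run.while (b := .ilt (.reg i) hi) (c := c ;; .iset i (.add (.reg i) (.lit 1))) (σ := σ)
    (fun τ => a ≤ τ.ireg i ∧ τ.ireg i ≤ n ∧ I (τ.ireg i) τ)
    (fun τ => ∑ k ∈ Finset.Ico (τ.ireg i) n, (f k + 2)) (by rw [ha]; exact ⟨le_rfl, han, h0⟩) ?_
  · refine H.mono fun t τ hf ⟨⟨h1, h2, h3⟩, h4, h5⟩ => ?_
    have : τ.ireg i = n := by
      simp only [BE.eval, IE.eval, hhi τ hf] at h4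
      omega
    rw [this] at h3 h5
    rw [ha] at h5
    refine ⟨h3, this, by simp at h5; omega⟩
  · rintro τ hf ⟨h1, h2, h3⟩ hb
    have hf' : Frame (RAMLang.forTo i hi c) σ τ := hf.wh
    simp only [BE.eval, IE.eval, hhi τ hf'] at hb
    rw [run_seq]
    refine (hstep _ τ h1 hb hf' rfl h3).mono fun t υ hfr ⟨ht, hI⟩ => ?_
    rw [run_iset]
    have hυ : υ.ireg i = τ.ireg i := hfr.ir i hi'
    simp only [IE.eval, hυ, ireg_setI, if_true]
    refine ⟨⟨by omega, by omega, hI⟩, ?_⟩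
    rw [Finset.sum_eq_sum_Ico_succ_bot hb]
    omega

/-- `for` with a constant bound for the time of an iteration. -/
theorem Run.forTo' {i : ℕ} {hi : IE} {c : Cmd} {σ : State} {a n : ℕ} (I : ℕ → State → Prop)
    (C : ℕ) (ha : σ.ireg i = a) (han : a ≤ n)
    (hhi : ∀ τ, Frame (RAMLang.forTo i hi c) σ τ → hi.eval τ = n) (hi' : c.wI i = false)
    (h0 : I a σ)
    (hstep : ∀ k τ, a ≤ k → k < n → Frame (RAMLang.forTo i hi c) σ τ → τ.ireg i = k → I k τ →
      Run c τ fun t υ => t ≤ C ∧ I (k + 1) (υ.setI i (k + 1))) :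
    Run (RAMLang.forTo i hi c) σ fun t τ => I n τ ∧ τ.ireg i = n ∧
      t ≤ 1 + (n - a) * (C + 2) := by
  refine (Run.forTo I (fun _ => C) ha han hhi hi' h0 hstep).mono fun t τ _ h => ?_
  simpa using h

attribute [simp] run_skip run_iset run_rset run_ist run_rst run_seq run_ite IE.eval RE.eval BE.eval

end RAMLang

namespace RAMLang

open RealRAM

/-! ### Insertion sort -/

/-- `f` is nondecreasing on the positions `[s, t)`. -/
def SortedOn (f : ℕ → ℝ) (s t : ℕ) : Prop := ∀ p q, s ≤ p → p ≤ q → q < t → f p ≤ f q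

/-- Moves the entry at position `ireg 23` of the arrays `X`, `Y` down to its place in the sorted
part above position `ireg 20`. -/
def sink (X Y : ℕ) : Cmd :=
  .wh (.and (.ilt (.reg 20) (.reg 23)) (.rlt (.ld X (.reg 23)) (.ld X (.sub (.reg 23) (.lit 1)))))
    (.rset 20 (.ld X (.reg 23)) ;; .rst X (.reg 23) (.ld X (.sub (.reg 23) (.lit 1))) ;;
      .rst X (.sub (.reg 23) (.lit 1)) (.reg 20) ;;
      .iset 24 (.ld Y (.reg 23)) ;; .ist Y (.reg 23) (.ld Y (.sub (.reg 23) (.lit 1))) ;;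
      .ist Y (.sub (.reg 23) (.lit 1)) (.reg 24) ;; .iset 23 (.sub (.reg 23) (.lit 1)))

theorem update_swap {α : Type} (f : ℕ → α) (i j : ℕ) :
    Function.update (Function.update f i (f j)) j (f i) = f ∘ Equiv.swap i j := by
  funext k
  simp only [Function.update_apply, Function.comp, Equiv.swap_apply_def]
  split_ifs <;> simp_all

theorem run_sink {X Y : ℕ} {σ : State} {s i : ℕ} (hs : σ.ireg 20 = s) (hi : σ.ireg 23 = i)
    (hsi : s ≤ i) (hX : SortedOn (σ.rarr X) s i) :
    Run (sink X Y) σ fun t τ => t ≤ 8 * (i - s) + 1 ∧ SortedOn (τ.rarr X) s (i + 1) ∧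
      ∃ π : Equiv.Perm ℕ, (∀ k, ¬ (s ≤ k ∧ k ≤ i) → π k = k) ∧ τ.rarr X = σ.rarr X ∘ π ∧
        τ.iarr Y = σ.iarr Y ∘ π := by
  have H := Run.while (σ := σ)
    (b := .and (.ilt (.reg 20) (.reg 23)) (.rlt (.ld X (.reg 23)) (.ld X (.sub (.reg 23) (.lit 1)))))
    (c := .rset 20 (.ld X (.reg 23)) ;; .rst X (.reg 23) (.ld X (.sub (.reg 23) (.lit 1))) ;;
      .rst X (.sub (.reg 23) (.lit 1)) (.reg 20) ;;
      .iset 24 (.ld Y (.reg 23)) ;; .ist Y (.reg 23) (.ld Y (.sub (.reg 23) (.lit 1))) ;;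
      .ist Y (.sub (.reg 23) (.lit 1)) (.reg 24) ;; .iset 23 (.sub (.reg 23) (.lit 1)))
    (fun τ => s ≤ τ.ireg 23 ∧ τ.ireg 23 ≤ i ∧
      (∀ p q, s ≤ p → p ≤ q → q ≤ i → p ≠ τ.ireg 23 → q ≠ τ.ireg 23 →
        τ.rarr X p ≤ τ.rarr X q) ∧
      (∀ q, τ.ireg 23 < q → q ≤ i → τ.rarr X (τ.ireg 23) ≤ τ.rarr X q) ∧
      ∃ π : Equiv.Perm ℕ, (∀ k, ¬ (s ≤ k ∧ k ≤ i) → π k = k) ∧ τ.rarr X = σ.rarr X ∘ π ∧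
        τ.iarr Y = σ.iarr Y ∘ π)
    (fun τ => 8 * (τ.ireg 23 - s)) ?_ ?_
  · refine H.mono fun t τ hf ⟨⟨h1, h2, h3, h4, h5⟩, h6, h7⟩ => ⟨by omega, ?_, h5⟩
    have h20 : τ.ireg 20 = s := (hf.ir 20 rfl).trans hs
    simp only [BE.eval, IE.eval, RE.eval, h20, not_and, not_lt] at h6
    intro p q hp hpq hq
    rcases eq_or_lt_of_le hpq with rfl | hpq
    · exact le_rfl
    by_cases hpj : p = τ.ireg 23
    · subst hpj
      exact h4 q hpq (by omega)
    by_cases hqj : q = τ.ireg 23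
    · subst hqj
      refine le_trans ?_ (h6 (by omega))
      exact h3 p _ hp (by omega) (by omega) hpj (by omega)
    · exact h3 p q hp hpq.le (by omega) hpj hqj
  · refine ⟨by omega, by omega, ?_, fun q hq hqi => by omega, 1, by simp, rfl, rfl⟩
    intro p q hp hpq hq hpi hqi
    exact hX p q hp hpq (by omega)
  · rintro τ hf ⟨h1, h2, h3, h4, π, h5, h6, h7⟩ hb
    have h20 : τ.ireg 20 = s := (hf.ir 20 rfl).trans hs
    simp only [BE.eval, IE.eval, RE.eval, h20] at hb
    obtain ⟨hb1, hb2⟩ := hb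
    obtain ⟨j, hj⟩ : ∃ j, τ.ireg 23 = j := ⟨_, rfl⟩
    rw [hj] at h1 h2 h3 h4 hb1 hb2
    have hne : ¬ (j - 1 = j) := by omega
    simp only [run_seq, run_rset, run_rst, run_iset, run_ist, RE.eval, IE.eval, rreg_setR,
      ireg_setR, ireg_setRA, rarr_setR, rarr_setRA, iarr_setR, iarr_setRA, ireg_setI, iarr_setI,
      iarr_setIA, rreg_setRA, rarr_setI, rarr_setIA, ireg_setIA, hj, if_true,
      update_swap, Nat.reduceEqDiff, if_false]
    refine ⟨⟨by omega, by omega, ?_, ?_, π * Equiv.swap j (j - 1), ?_, ?_, ?_⟩, by omega⟩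
    · intro p q hp hpq hq hpj hqj
      simp only [Function.comp, Equiv.swap_apply_def, if_neg hpj, if_neg hqj]
      rcases eq_or_lt_of_le hpq with rfl | hpq
      · exact le_rfl
      by_cases ha : p = j
      · rw [if_pos ha, if_neg (by omega)]
        exact h3 _ _ (by omega) (by omega) hq (by omega) (by omega)
      · by_cases hb : q = j
        · rw [if_neg ha, if_pos hb]
          exact h3 _ _ (by omega) (by omega) (by omega) (by omega) (by omega)
        · rw [if_neg ha, if_neg hb]
          exact h3 _ _ hp hpq.le hq ha hb
    · intro q hq hqi
      simp only [Function.comp, Equiv.swap_apply_def, if_true, hne, if_false]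
      split_ifs with ha hb
      · exact hb2.le
      · omega
      · exact h4 q (by omega) hqi
    · intro k hk
      have : Equiv.swap j (j - 1) k = k := Equiv.swap_apply_of_ne_of_ne (by omega) (by omega)
      simp [this, h5 k hk]
    · rw [h6]; rfl
    · rw [h7]; rfl

/-- Sorts positions `[ireg 20, ireg 21)` of the real array `X` and permutes `Y` accordingly. -/
def isort (X Y : ℕ) : Cmd :=
  .iset 22 (.reg 20) ;; forTo 22 (.reg 21) (.iset 23 (.reg 22) ;; sink X Y)

theorem run_isort {X Y : ℕ} {σ : State} {s f : ℕ} (hs : σ.ireg 20 = s) (hf : σ.ireg 21 = f)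
    (hsf : s ≤ f) :
    Run (isort X Y) σ fun t τ => t ≤ 8 * (f - s) * (f - s) + 4 * (f - s) + 2 ∧
      SortedOn (τ.rarr X) s f ∧
      ∃ π : Equiv.Perm ℕ, (∀ k, ¬ (s ≤ k ∧ k < f) → π k = k) ∧ τ.rarr X = σ.rarr X ∘ π ∧
        τ.iarr Y = σ.iarr Y ∘ π := by
  rw [isort, run_seq, run_iset]
  refine (Run.forTo' (a := s) (n := f) (fun k τ => SortedOn (τ.rarr X) s k ∧
    ∃ π : Equiv.Perm ℕ, (∀ k, ¬ (s ≤ k ∧ k < f) → π k = k) ∧ τ.rarr X = σ.rarr X ∘ π ∧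
        τ.iarr Y = σ.iarr Y ∘ π) (8 * (f - s) + 2) (by simp [hs]) hsf ?_ rfl ?_ ?_).mono ?_
  · intro τ hτ
    simpa [hf] using hτ.ir 21 rfl
  · refine ⟨fun p q _ _ _ => by omega, 1, by simp, rfl, rfl⟩
  · rintro k τ hk hkf hτ hτk ⟨h1, π, h2, h3, h4⟩
    rw [run_seq, run_iset]
    have h20 : τ.ireg 20 = s := by simpa [hs] using hτ.ir 20 rfl
    refine (run_sink (X := X) (Y := Y) (s := s) (i := k) (by simp [h20]) (by simp [hτk]) hk
      (by simpa using h1)).mono ?_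
    rintro t υ - ⟨ht, h5, π', h6, h7, h8⟩
    refine ⟨by omega, by simpa using h5, π * π', fun k' hk' => ?_, ?_, ?_⟩
    · rw [Equiv.Perm.mul_apply, h6 k' (by omega), h2 k' hk']
    · simp [h7, h3, Function.comp_assoc]
    · simp [h8, h4, Function.comp_assoc]
  · rintro t τ - ⟨⟨h1, h2⟩, h3, h4⟩
    refine ⟨?_, h1, h2⟩
    nlinarith

/-! ### Linear-time selection -/

open Classical in
/-- The number of positions in `[s, f)` whose entry satisfies `P`. -/
noncomputable def cnt (P : ℝ → Prop) (B : ℕ → ℝ) (s f : ℕ) : ℕ :=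
  ((Finset.Ico s f).filter fun i => P (B i)).card

/-- `r` is the entry of rank `k` among the positions `[s, f)`. -/
def IsKth (B : ℕ → ℝ) (s f k : ℕ) (r : ℝ) : Prop :=
  cnt (· < r) B s f ≤ k ∧ k < cnt (· ≤ r) B s f

theorem cnt_self (P : ℝ → Prop) (B : ℕ → ℝ) (s : ℕ) : cnt P B s s = 0 := by simp [cnt]

open Classical in
theorem cnt_succ (P : ℝ → Prop) (B : ℕ → ℝ) {s f : ℕ} (h : s ≤ f) :
    cnt P B s (f + 1) = cnt P B s f + if P (B f) then 1 else 0 := by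
  unfold cnt
  rw [← Finset.insert_Ico_right_eq_Ico_add_one h, Finset.filter_insert]
  split_ifs with hp
  · rw [Finset.card_insert_of_notMem (by simp)]
  · rfl

open Classical in
theorem cnt_congr {P : ℝ → Prop} {B B' : ℕ → ℝ} {s f : ℕ} (h : ∀ i, s ≤ i → i < f → B' i = B i) :
    cnt P B' s f = cnt P B s f := by
  unfold cnt
  congr 1
  refine Finset.filter_congr fun i hi => ?_
  rw [Finset.mem_Ico] at hi
  rw [h i hi.1 hi.2]

theorem cnt_le_of_imp {P Q : ℝ → Prop} {B : ℕ → ℝ} {s f : ℕ} (h : ∀ x, P x → Q x) :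
    cnt P B s f ≤ cnt Q B s f :=
  Finset.card_le_card fun i hi => by
    simp only [Finset.mem_filter] at hi ⊢
    exact ⟨hi.1, h _ hi.2⟩

theorem cnt_congr_prop {P Q : ℝ → Prop} {B : ℕ → ℝ} {s f : ℕ} (h : ∀ x, P x ↔ Q x) :
    cnt P B s f = cnt Q B s f := by
  have : P = Q := funext fun x => propext (h x)
  rw [this]

open Classical in
theorem cnt_append (P : ℝ → Prop) (B : ℕ → ℝ) {s q f : ℕ} (h : s ≤ q) (h' : q ≤ f) :
    cnt P B s f = cnt P B s q + cnt P B q f := by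
  unfold cnt
  rw [← Finset.Ico_union_Ico_eq_Ico h h', Finset.filter_union, Finset.card_union_of_disjoint]
  exact Finset.disjoint_filter_filter (Finset.Ico_disjoint_Ico_consecutive s q f)

theorem cnt_add_not (P : ℝ → Prop) (B : ℕ → ℝ) (s f : ℕ) :
    cnt P B s f + cnt (fun x => ¬ P x) B s f = f - s := by
  unfold cnt
  rw [Finset.card_filter_add_card_filter_not]
  simp

theorem cnt_perm {P : ℝ → Prop} {B : ℕ → ℝ} {s f : ℕ} {π : Equiv.Perm ℕ}
    (h : ∀ k, ¬ (s ≤ k ∧ k < f) → π k = k) : cnt P (B ∘ π) s f = cnt P B s f := by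
  have hmem : ∀ k, (s ≤ k ∧ k < f) → (s ≤ π k ∧ π k < f) := by
    intro k hk
    by_contra hcon
    have := h _ hcon
    rw [π.injective this] at hcon
    exact hcon hk
  unfold cnt
  refine Finset.card_bij (fun i _ => π i) ?_ (fun _ _ _ _ h => π.injective h) ?_
  · intro i hi
    simp only [Finset.mem_filter, Finset.mem_Ico, Function.comp] at hi ⊢
    exact ⟨hmem i hi.1, hi.2⟩
  · intro i hi
    simp only [Finset.mem_filter, Finset.mem_Ico] at hi
    refine ⟨π.symm i, ?_, by simp⟩
    simp only [Finset.mem_filter, Finset.mem_Ico, Function.comp, Equiv.apply_symm_apply]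
    refine ⟨?_, hi.2⟩
    by_contra hcon
    have := h _ hcon
    simp only [Equiv.apply_symm_apply] at this
    rw [← this] at hcon
    exact hcon hi.1

theorem isKth_of_sorted {B : ℕ → ℝ} {s f k : ℕ} (h : SortedOn B s f) (hk : s + k < f) :
    IsKth B s f k (B (s + k)) := by
  constructor
  · refine (Finset.card_le_card (t := Finset.Ico s (s + k)) fun i hi => ?_).trans (by simp)
    simp only [Finset.mem_filter, Finset.mem_Ico] at hi ⊢
    refine ⟨hi.1.1, ?_⟩
    by_contra hcon
    exact absurd (h (s + k) i (by omega) (by omega) hi.1.2) (not_le.2 hi.2)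
  · refine lt_of_lt_of_le ?_ (Finset.card_le_card (s := Finset.Ico s (s + k + 1)) fun i hi => ?_)
    · simp; omega
    · simp only [Finset.mem_filter, Finset.mem_Ico] at hi ⊢
      exact ⟨⟨hi.1, by omega⟩, h i (s + k) hi.1 (by omega) hk⟩

/-- Sorts the groups of five of the segment `[ireg 32, ireg 33)` and appends their medians. -/
def groupMedians : Cmd :=
  .iset 35 (.reg 32) ;; .iset 36 (.reg 33) ;;
  .wh (.ile (.add (.reg 35) (.lit 5)) (.reg 33))
    (.iset 20 (.reg 35) ;; .iset 21 (.add (.reg 35) (.lit 5)) ;; isort 18 15 ;;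
      .rst 18 (.reg 36) (.ld 18 (.add (.reg 35) (.lit 2))) ;;
      .iset 36 (.add (.reg 36) (.lit 1)) ;; .iset 35 (.add (.reg 35) (.lit 5)))

theorem three_le_cnt {P : ℝ → Prop} {B : ℕ → ℝ} {q i j l : ℕ} (hij : i < j) (hjl : j < l)
    (hi : q ≤ i) (hl : l < q + 5) (h1 : P (B i)) (h2 : P (B j)) (h3 : P (B l)) :
    3 ≤ cnt P B q (q + 5) := by
  have : ({i, j, l} : Finset ℕ).card = 3 := by
    rw [Finset.card_insert_of_notMem (by simp; omega), Finset.card_pair (by omega)]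
  rw [← this]
  refine Finset.card_le_card fun x hx => ?_
  simp only [Finset.mem_insert, Finset.mem_singleton] at hx
  simp only [Finset.mem_filter, Finset.mem_Ico]
  rcases hx with rfl | rfl | rfl
  · exact ⟨by omega, h1⟩
  · exact ⟨by omega, h2⟩
  · exact ⟨by omega, h3⟩

theorem run_groupMedians {σ : State} {s f : ℕ} (hs : σ.ireg 32 = s) (hf : σ.ireg 33 = f)
    (hsf : s ≤ f) :
    Run groupMedians σ fun t τ => t ≤ 46 * (f - s) + 3 ∧ τ.ireg 36 = f + (f - s) / 5 ∧
      (∀ P, cnt P (τ.rarr 18) s f = cnt P (σ.rarr 18) s f) ∧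
      (∀ i < s, τ.rarr 18 i = σ.rarr 18 i) ∧
      (∀ r, 3 * cnt (· ≤ r) (τ.rarr 18) f (τ.ireg 36) ≤ cnt (· ≤ r) (τ.rarr 18) s f) ∧
      (∀ r, 3 * cnt (r ≤ ·) (τ.rarr 18) f (τ.ireg 36) ≤ cnt (r ≤ ·) (τ.rarr 18) s f) := by
  rw [groupMedians, run_seq, run_iset, run_seq, run_iset]
  have H := Run.while (σ := (σ.setI 35 s).setI 36 f)
    (b := .ile (.add (.reg 35) (.lit 5)) (.reg 33))
    (c := .iset 20 (.reg 35) ;; .iset 21 (.add (.reg 35) (.lit 5)) ;; isort 18 15 ;;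
      .rst 18 (.reg 36) (.ld 18 (.add (.reg 35) (.lit 2))) ;;
      .iset 36 (.add (.reg 36) (.lit 1)) ;; .iset 35 (.add (.reg 35) (.lit 5)))
    (fun τ => ∃ j, τ.ireg 35 = s + 5 * j ∧ τ.ireg 36 = f + j ∧ s + 5 * j ≤ f ∧
      (∀ P, cnt P (τ.rarr 18) s f = cnt P (σ.rarr 18) s f) ∧
      (∀ i < s, τ.rarr 18 i = σ.rarr 18 i) ∧
      (∀ r, 3 * cnt (· ≤ r) (τ.rarr 18) f (f + j) ≤ cnt (· ≤ r) (τ.rarr 18) s (s + 5 * j)) ∧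
      (∀ r, 3 * cnt (r ≤ ·) (τ.rarr 18) f (f + j) ≤ cnt (r ≤ ·) (τ.rarr 18) s (s + 5 * j)))
    (fun τ => 46 * (f - τ.ireg 35)) ⟨0, by simp, by simp, by simpa using hsf, by simp, by simp,
      by simp [cnt_self], by simp [cnt_self]⟩ ?_
  · simp only [IE.eval, hs, ireg_setI, hf]
    refine H.mono fun t τ hfr ⟨⟨j, h1, h2, h3, h4, h5, h6, h7⟩, h8, h9⟩ => ?_
    have h33 : τ.ireg 33 = f := by simpa [hf] using hfr.ir 33 rfl
    simp only [BE.eval, IE.eval, h1, h33] at h8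
    have hj : j = (f - s) / 5 := by omega
    have e := fun P => cnt_append P (τ.rarr 18) (s := s) (q := s + 5 * j) (f := f) (by omega) h3
    refine ⟨?_, by omega, h4, h5, fun r => ?_, fun r => ?_⟩
    · simp at h9; omega
    · rw [h2, e]
      exact (h6 r).trans le_self_add
    · rw [h2, e]
      exact (h7 r).trans le_self_add
  · rintro τ hfr ⟨j, h1, h2, h3, h4, h5, h6, h7⟩ hb
    have h33 : τ.ireg 33 = f := by simpa [hf] using hfr.ir 33 rfl
    simp only [BE.eval, IE.eval, h1, h33] at hb
    rw [run_seq, run_iset, run_seq, run_iset, run_seq]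
    refine (run_isort (X := 18) (Y := 15) (s := s + 5 * j) (f := s + 5 * j + 5) (by simp [h1])
      (by simp [h1]) (by omega)).mono ?_
    rintro t υ hfu ⟨ht, hsort, π, hπ, hB, -⟩
    have e35 : υ.ireg 35 = s + 5 * j := by simpa [h1] using hfu.ir 35 rfl
    have e36 : υ.ireg 36 = f + j := by simpa [h2] using hfu.ir 36 rfl
    simp only [rarr_setI] at hB
    have hout : ∀ i, ¬ (s + 5 * j ≤ i ∧ i < s + 5 * j + 5) → υ.rarr 18 i = τ.rarr 18 i := by
      intro i hi
      rw [hB]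
      simp [hπ i hi]
    set B' := υ.rarr 18 with hB'
    set B'' := Function.update B' (f + j) (B' (s + 5 * j + 2)) with hB''
    have hne : ∀ i, i ≠ f + j → B'' i = B' i := fun i hi => by simp [hB'', hi]
    have htot : ∀ P, cnt P B'' s f = cnt P (σ.rarr 18) s f := by
      intro P
      rw [cnt_congr (B := B') fun i _ _ => hne i (by omega), hB, cnt_perm, h4]
      intro k hk
      exact hπ k (by omega)
    have hstep : ∀ P : ℝ → Prop, (P (B' (s + 5 * j + 2)) → 3 ≤ cnt P B' (s + 5 * j) (s + 5 * j + 5)) →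
        3 * cnt P (τ.rarr 18) f (f + j) ≤ cnt P (τ.rarr 18) s (s + 5 * j) →
        3 * cnt P B'' f (f + (j + 1)) ≤ cnt P B'' s (s + 5 * (j + 1)) := by
      intro P hP h
      rw [← add_assoc, cnt_succ P B'' (by omega),
        cnt_append P B'' (s := s) (q := s + 5 * j) (f := s + 5 * (j + 1)) (by omega) (by omega),
        cnt_congr (B := τ.rarr 18) (B' := B'') (s := f) (f := f + j)
          fun i _ _ => (hne i (by omega)).trans (hout i (by omega)),
        cnt_congr (B := τ.rarr 18) (B' := B'') (s := s) (f := s + 5 * j)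
          fun i _ _ => (hne i (by omega)).trans (hout i (by omega)),
        cnt_congr (B := B') (B' := B'') (s := s + 5 * j) (f := s + 5 * (j + 1))
          fun i _ _ => (hne i (by omega))]
      have : B'' (f + j) = B' (s + 5 * j + 2) := by simp [hB'']
      rw [this]
      split_ifs with hp
      · have := hP hp
        rw [show s + 5 * (j + 1) = s + 5 * j + 5 by ring]
        omega
      · omega
    simp only [run_seq, run_rst, run_iset, IE.eval, RE.eval, ireg_setRA, ireg_setI, rarr_setRA,
      rarr_setI, e35, e36, if_true, Nat.reduceEqDiff, if_false, ← hB', ← hB'']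
    have e' : s + 5 * j + 5 - (s + 5 * j) = 5 := by omega
    rw [e'] at ht
    refine ⟨⟨j + 1, by ring, by ring, by omega, htot, fun i hi => ?_, fun r => ?_, fun r => ?_⟩, ?_⟩
    · rw [hne i (by omega), hout i (by omega), h5 i hi]
    · refine hstep _ (fun hp => ?_) (h6 r)
      exact three_le_cnt (i := s + 5 * j) (j := s + 5 * j + 1) (l := s + 5 * j + 2) (by omega)
        (by omega) (by omega) (by omega)
        ((hsort _ (s + 5 * j + 2) (by omega) (by omega) (by omega)).trans hp)
        ((hsort _ (s + 5 * j + 2) (by omega) (by omega) (by omega)).trans hp) hp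
    · refine hstep _ (fun hp => ?_) (h7 r)
      exact three_le_cnt (i := s + 5 * j + 2) (j := s + 5 * j + 3) (l := s + 5 * j + 4) (by omega)
        (by omega) (by omega) (by omega) hp
        (le_trans hp (hsort (s + 5 * j + 2) _ (by omega) (by omega) (by omega)))
        (le_trans hp (hsort (s + 5 * j + 2) _ (by omega) (by omega) (by omega)))
    · omega

/-- `ireg 39 := (ireg 36 - ireg 33) / 2`. -/
def halve : Cmd :=
  .iset 39 (.lit 0) ;; .wh (.ile (.add (.add (.add (.reg 39) (.reg 39)) (.lit 2)) (.reg 33)) (.reg 36))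
    (.iset 39 (.add (.reg 39) (.lit 1)))

theorem run_halve {σ : State} :
    Run halve σ fun t τ => t ≤ 2 * (σ.ireg 36 - σ.ireg 33) + 2 ∧
      τ.ireg 39 = (σ.ireg 36 - σ.ireg 33) / 2 := by
  rw [halve, run_seq, run_iset]
  refine (Run.while (fun τ => τ.ireg 39 ≤ (σ.ireg 36 - σ.ireg 33) / 2)
    (fun τ => 2 * ((σ.ireg 36 - σ.ireg 33) - τ.ireg 39)) (by simp) ?_).mono ?_
  · intro τ hf hI hb
    have h33 : τ.ireg 33 = σ.ireg 33 := by simpa using hf.ir 33 rfl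
    have h36 : τ.ireg 36 = σ.ireg 36 := by simpa using hf.ir 36 rfl
    simp only [BE.eval, IE.eval, h33, h36] at hb
    simp
    omega
  · rintro t τ hf ⟨hI, hb, ht⟩
    have h33 : τ.ireg 33 = σ.ireg 33 := by simpa using hf.ir 33 rfl
    have h36 : τ.ireg 36 = σ.ireg 36 := by simpa using hf.ir 36 rfl
    simp only [BE.eval, IE.eval, h33, h36] at hb
    simp only [ireg_setI, if_true, IE.eval] at ht
    omega

/-- Counts the entries of the segment below and at the pivot `rreg 30`. -/
def countPart : Cmd :=
  .iset 37 (.lit 0) ;; .iset 38 (.lit 0) ;; .iset 35 (.reg 32) ;;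
  forTo 35 (.reg 33) (.ite (.rlt (.ld 18 (.reg 35)) (.reg 30)) (.iset 37 (.add (.reg 37) (.lit 1)))
    (.ite (.rle (.ld 18 (.reg 35)) (.reg 30)) (.iset 38 (.add (.reg 38) (.lit 1))) .skip))

theorem run_countPart {σ : State} {s f : ℕ} (hs : σ.ireg 32 = s) (hf : σ.ireg 33 = f)
    (hsf : s ≤ f) :
    Run countPart σ fun t τ => t ≤ 5 * (f - s) + 4 ∧
      τ.ireg 37 = cnt (· < σ.rreg 30) (σ.rarr 18) s f ∧
      τ.ireg 37 + τ.ireg 38 = cnt (· ≤ σ.rreg 30) (σ.rarr 18) s f := by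
  simp only [countPart, run_seq, run_iset, IE.eval, ireg_setI, Nat.reduceEqDiff, if_false]
  refine (Run.forTo' (a := s) (n := f) (fun k τ =>
      τ.ireg 37 = cnt (· < σ.rreg 30) (σ.rarr 18) s k ∧
      τ.ireg 37 + τ.ireg 38 = cnt (· ≤ σ.rreg 30) (σ.rarr 18) s k) 3 (by simp [hs]) hsf ?_ rfl
      (by simp [cnt_self]) ?_).mono ?_
  · intro τ hτ
    simpa [hf] using hτ.ir 33 rfl
  · rintro k τ hk hkf hτ hτk ⟨h1, h2⟩
    have h30 : τ.rreg 30 = σ.rreg 30 := by simpa using hτ.rr 30 rfl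
    have h18 : τ.rarr 18 = σ.rarr 18 := by simpa using hτ.ra 18 rfl
    rw [cnt_succ _ _ hk, cnt_succ _ _ hk]
    simp only [run_ite, run_iset, run_skip, BE.eval, RE.eval, IE.eval, hτk, h30, h18, ireg_setI,
      Nat.reduceEqDiff, if_true, if_false]
    refine ⟨fun h => ?_, fun h => ⟨fun h' => ?_, fun h' => ?_⟩⟩
    · simp only [h, h.le, if_true]; omega
    · simp only [h, h', if_true, if_false]; omega
    · simp only [h, h', if_false]; omega
  · rintro t τ - ⟨h1, h2, h3⟩
    refine ⟨by omega, h1⟩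

/-- Keeps the entries of the segment that pass the test `b`. -/
def compact (b : BE) : Cmd :=
  .iset 36 (.reg 32) ;; .iset 35 (.reg 32) ;;
  forTo 35 (.reg 33) (.ite b (.rst 18 (.reg 36) (.ld 18 (.reg 35)) ;;
    .iset 36 (.add (.reg 36) (.lit 1))) .skip)

theorem run_compact {b : BE} {σ : State} {s f : ℕ} {φ : ℝ → Prop} (hs : σ.ireg 32 = s)
    (hf : σ.ireg 33 = f) (hsf : s ≤ f)
    (hb : ∀ τ : State, τ.rreg 30 = σ.rreg 30 → (b.eval τ ↔ φ (τ.rarr 18 (τ.ireg 35)))) :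
    Run (compact b) σ fun t τ => t ≤ 5 * (f - s) + 3 ∧ τ.ireg 36 = s + cnt φ (σ.rarr 18) s f ∧
      (∀ i < s, τ.rarr 18 i = σ.rarr 18 i) ∧
      (∀ P, cnt P (τ.rarr 18) s (τ.ireg 36) = cnt (fun x => φ x ∧ P x) (σ.rarr 18) s f) := by
  simp only [compact, run_seq, run_iset, IE.eval, ireg_setI, Nat.reduceEqDiff, if_false]
  refine (Run.forTo' (a := s) (n := f) (fun k τ =>
      τ.ireg 36 = s + cnt φ (σ.rarr 18) s k ∧ s + cnt φ (σ.rarr 18) s k ≤ k ∧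
      (∀ i, i < s ∨ k ≤ i → τ.rarr 18 i = σ.rarr 18 i) ∧
      (∀ P, cnt P (τ.rarr 18) s (τ.ireg 36) = cnt (fun x => φ x ∧ P x) (σ.rarr 18) s k)) 3
      (by simp [hs]) hsf ?_ rfl (by simp [cnt_self, hs]) ?_).mono ?_
  · intro τ hτ
    simpa [hf] using hτ.ir 33 rfl
  · rintro k τ hk hkf hτ hτk ⟨h1, h2, h3, h4⟩
    have h30 : τ.rreg 30 = σ.rreg 30 := by simpa using hτ.rr 30 rfl
    have hb' := hb τ h30
    rw [hτk, h3 k (by omega)] at hb'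
    simp only [run_ite, run_seq, run_iset, run_rst, run_skip, RE.eval, IE.eval, hτk, hb', ireg_setI,
      ireg_setRA, rarr_setRA, rarr_setI, Nat.reduceEqDiff, if_true, if_false, h3 k (Or.inr le_rfl)]
    simp only [h1] at h4 ⊢
    refine ⟨fun h => ⟨by omega, ?_, ?_, ?_, fun P => ?_⟩, fun h => ⟨by omega, ?_, ?_, ?_, fun P => ?_⟩⟩
    · rw [cnt_succ _ _ hk, if_pos h, add_assoc]
    · rw [cnt_succ _ _ hk, if_pos h]; omega
    · intro i hi
      rw [Function.update_of_ne (by omega), h3 i (by omega)]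
    · rw [cnt_succ _ _ hk, cnt_succ _ _ (by omega), ← h4]
      rw [cnt_congr (B := τ.rarr 18) fun i _ _ => Function.update_of_ne (by omega) _ _,
        Function.update_self]
      by_cases hP : P (σ.rarr 18 k) <;> simp [h, hP]
    · rw [cnt_succ _ _ hk, if_neg h, add_zero]
    · rw [cnt_succ _ _ hk, if_neg h]; omega
    · intro i hi
      exact h3 i (by omega)
    · rw [cnt_succ _ _ hk, h4]
      simp [h]
  · rintro t τ - ⟨⟨h1, h2, h3, h4⟩, h5, h6⟩
    exact ⟨by omega, h1, fun i hi => h3 i (Or.inl hi), h4⟩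

/-- One step of the selection: the top frame of the stack (arrays `12`, `13`, `14`, height
`ireg 30`) is a segment of array `18` with a rank.  If `ireg 31 = 0`, it is sorted or its group
medians are pushed; otherwise it is reduced by the pivot `rreg 30`. -/
def selectStep : Cmd :=
  .iset 29 (.sub (.reg 30) (.lit 1)) ;; .iset 32 (.ld 12 (.reg 29)) ;;
  .iset 33 (.ld 13 (.reg 29)) ;; .iset 34 (.ld 14 (.reg 29)) ;;
  .ite (.ilt (.lit 0) (.reg 31))
    (countPart ;; .ite (.ilt (.reg 34) (.reg 37))
      (compact (.rlt (.ld 18 (.reg 35)) (.reg 30)) ;; .ist 13 (.reg 29) (.reg 36) ;;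
        .iset 31 (.lit 0))
      (.ite (.ilt (.reg 34) (.add (.reg 37) (.reg 38))) (.iset 30 (.reg 29))
        (compact (.rlt (.reg 30) (.ld 18 (.reg 35))) ;; .ist 13 (.reg 29) (.reg 36) ;;
          .ist 14 (.reg 29) (.sub (.reg 34) (.add (.reg 37) (.reg 38))) ;; .iset 31 (.lit 0))))
    (.ite (.ile (.reg 33) (.add (.reg 32) (.lit 100)))
      (.iset 20 (.reg 32) ;; .iset 21 (.reg 33) ;; isort 18 15 ;;
        .rset 30 (.ld 18 (.add (.reg 32) (.reg 34))) ;; .iset 30 (.reg 29) ;; .iset 31 (.lit 1))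
      (groupMedians ;; halve ;; .ist 12 (.reg 30) (.reg 33) ;; .ist 13 (.reg 30) (.reg 36) ;;
        .ist 14 (.reg 30) (.reg 39) ;; .iset 30 (.add (.reg 30) (.lit 1))))

/-- The stack holds the frame `(s, f, k)` at position `d`. -/
structure TopFrame (σ : State) (d s f k : ℕ) : Prop where
  height : σ.ireg 30 = d + 1
  lo : σ.iarr 12 d = s
  hi : σ.iarr 13 d = f
  rank : σ.iarr 14 d = k

/-- The parts below the frame at position `d`, and below position `s` of the data, agree. -/
structure SameBelow (σ τ : State) (d s : ℕ) : Prop where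
  data : ∀ i < s, τ.rarr 18 i = σ.rarr 18 i
  lo : ∀ i < d, τ.iarr 12 i = σ.iarr 12 i
  hi : ∀ i < d, τ.iarr 13 i = σ.iarr 13 i
  rank : ∀ i < d, τ.iarr 14 i = σ.iarr 14 i

theorem SameBelow.trans {σ τ υ : State} {d d' s s' : ℕ} (h : SameBelow σ τ d s)
    (h' : SameBelow τ υ d' s') (hd : d ≤ d') (hs : s ≤ s') : SameBelow σ υ d s :=
  ⟨fun i hi => (h'.data i (by omega)).trans (h.data i hi),
    fun i hi => (h'.lo i (by omega)).trans (h.lo i hi),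
    fun i hi => (h'.hi i (by omega)).trans (h.hi i hi),
    fun i hi => (h'.rank i (by omega)).trans (h.rank i hi)⟩

theorem run_selectStep_small {σ : State} {d s f k : ℕ} (h : TopFrame σ d s f k)
    (hret : σ.ireg 31 = 0) (hk : s + k < f) (hf : f ≤ s + 100) :
    Run selectStep σ fun t τ => t ≤ 900 * (f - s) + 50 ∧ τ.ireg 30 = d ∧ τ.ireg 31 = 1 ∧
      IsKth (σ.rarr 18) s f k (τ.rreg 30) ∧ SameBelow σ τ d s := by
  obtain ⟨h1, h2, h3, h4⟩ := h
  simp only [selectStep, run_seq, run_iset, run_ite, IE.eval, BE.eval, ireg_setI, iarr_setI, h1, h2,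
    h3, h4, hret, hf, Nat.reduceEqDiff, if_true, if_false, add_tsub_cancel_right, lt_irrefl,
    not_true, not_false_iff, false_imp_iff, true_imp_iff, and_true, true_and]
  refine (run_isort (X := 18) (Y := 15) (s := s) (f := f) (by simp) (by simp) (by omega)).mono ?_
  rintro t υ hfr ⟨ht, hsort, π, hπ, hB, -⟩
  have e32 : υ.ireg 32 = s := by simpa using hfr.ir 32 rfl
  have e34 : υ.ireg 34 = k := by simpa using hfr.ir 34 rfl
  have e29 : υ.ireg 29 = d := by simpa using hfr.ir 29 rfl
  simp only [rarr_setI] at hB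
  simp only [run_rset, IE.eval, RE.eval, ireg_setR, e32, e34, e29, rreg_setI,
    rreg_setR, if_true, true_and]
  refine ⟨?_, ?_, ?_⟩
  · have : (f - s) * (f - s) ≤ 100 * (f - s) := Nat.mul_le_mul_right _ (by omega)
    nlinarith
  · have := isKth_of_sorted hsort hk
    rw [IsKth, hB, cnt_perm hπ, cnt_perm hπ] at this
    rwa [hB]
  · refine ⟨fun i hi => ?_, fun i hi => ?_, fun i hi => ?_, fun i hi => ?_⟩
    · simp [hB, hπ i (by omega)]
    · simpa using congrFun (hfr.ia 12 rfl) i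
    · simpa using congrFun (hfr.ia 13 rfl) i
    · simpa using congrFun (hfr.ia 14 rfl) i

theorem run_selectStep_push {σ : State} {d s f k : ℕ} (h : TopFrame σ d s f k)
    (hret : σ.ireg 31 = 0) (hf : s + 100 < f) :
    Run selectStep σ fun t τ => t ≤ 48 * (f - s) + 50 ∧ τ.ireg 31 = 0 ∧
      TopFrame τ (d + 1) f (f + (f - s) / 5) ((f - s) / 5 / 2) ∧
      τ.iarr 12 d = s ∧ τ.iarr 13 d = f ∧ τ.iarr 14 d = k ∧ SameBelow σ τ d s ∧
      (∀ P, cnt P (τ.rarr 18) s f = cnt P (σ.rarr 18) s f) ∧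
      (∀ r, 3 * cnt (· ≤ r) (τ.rarr 18) f (f + (f - s) / 5) ≤ cnt (· ≤ r) (τ.rarr 18) s f) ∧
      (∀ r, 3 * cnt (r ≤ ·) (τ.rarr 18) f (f + (f - s) / 5) ≤ cnt (r ≤ ·) (τ.rarr 18) s f) := by
  obtain ⟨h1, h2, h3, h4⟩ := h
  simp only [selectStep, run_seq, run_iset, run_ite, IE.eval, BE.eval, ireg_setI, iarr_setI, h1, h2,
    h3, h4, hret, not_le.2 hf, Nat.reduceEqDiff, if_true, if_false, add_tsub_cancel_right, lt_irrefl,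
    not_false_iff, false_imp_iff, true_imp_iff, true_and]
  refine (run_groupMedians (s := s) (f := f) (by simp) (by simp) (by omega)).mono ?_
  rintro t υ hfr ⟨ht, h5, h6, h7, h8, h9⟩
  refine run_halve.mono ?_
  rintro t' υ' hfr' ⟨ht', h39⟩
  have e33 : υ.ireg 33 = f := by simpa using hfr.ir 33 rfl
  have e33' : υ'.ireg 33 = f := (hfr'.ir 33 rfl).trans e33
  have e36' : υ'.ireg 36 = f + (f - s) / 5 := (hfr'.ir 36 rfl).trans h5
  have e30 : υ'.ireg 30 = d + 1 := (hfr'.ir 30 rfl).trans (by simpa [h1] using hfr.ir 30 rfl)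
  have e31 : υ'.ireg 31 = 0 := (hfr'.ir 31 rfl).trans (by simpa [hret] using hfr.ir 31 rfl)
  have e12 : υ'.iarr 12 = σ.iarr 12 := (hfr'.ia 12 rfl).trans (by simpa using hfr.ia 12 rfl)
  have e13 : υ'.iarr 13 = σ.iarr 13 := (hfr'.ia 13 rfl).trans (by simpa using hfr.ia 13 rfl)
  have e14 : υ'.iarr 14 = σ.iarr 14 := (hfr'.ia 14 rfl).trans (by simpa using hfr.ia 14 rfl)
  have e18 : υ'.rarr 18 = υ.rarr 18 := hfr'.ra 18 rfl
  rw [e33, h5, add_tsub_cancel_left] at h39 ht'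
  rw [h5] at h8 h9
  simp only [run_ist, IE.eval, ireg_setIA, e30, e33', e36', e31, h39,
    iarr_setIA, e12, e13, e14, rarr_setI, rarr_setIA, e18,
    Nat.reduceEqDiff, if_true, if_false, true_and]
  refine ⟨by omega, ⟨by simp, by simp, by simp, by simp⟩, by simp [h2], by simp [h3], by simp [h4],
    ⟨?_, ?_, ?_, ?_⟩, h6, h8, h9⟩
  · simpa [e18] using h7
  · intro i hi
    simp [Function.update_of_ne (show i ≠ d + 1 by omega), e12]
  · intro i hi
    simp [Function.update_of_ne (show i ≠ d + 1 by omega), e13]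
  · intro i hi
    simp [Function.update_of_ne (show i ≠ d + 1 by omega), e14]

theorem IsKth.of_lt {B B' : ℕ → ℝ} {s f g k : ℕ} {p r : ℝ}
    (hB : ∀ P, cnt P B' s g = cnt (fun x => x < p ∧ P x) B s f)
    (hk : k < cnt (· < p) B s f) (h : IsKth B' s g k r) : IsKth B s f k r := by
  rw [IsKth, hB, hB] at h
  have hrp : r < p := by
    by_contra hpr
    have := cnt_congr_prop (B := B) (s := s) (f := f) (P := fun x => x < p ∧ x < r)
      (Q := fun x => x < p) fun x => ⟨fun h => h.1, fun h => ⟨h, h.trans_le (not_lt.1 hpr)⟩⟩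
    omega
  refine ⟨?_, h.2.trans_le (cnt_le_of_imp fun x hx => hx.2)⟩
  rw [cnt_congr_prop (Q := fun x => x < p ∧ x < r) fun x => ⟨fun h => ⟨h.trans hrp, h⟩, fun h => h.2⟩]
  exact h.1

theorem cnt_lt_add (B : ℕ → ℝ) (s f : ℕ) (p : ℝ) :
    cnt (· ≤ p) B s f + cnt (p < ·) B s f = f - s := by
  rw [← cnt_add_not (· ≤ p) B s f, cnt_congr_prop (P := fun x => p < x) fun x => not_le.symm]

theorem cnt_le_add (B : ℕ → ℝ) (s f : ℕ) (p : ℝ) :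
    cnt (· < p) B s f + cnt (p ≤ ·) B s f = f - s := by
  rw [← cnt_add_not (· < p) B s f, cnt_congr_prop (P := fun x => p ≤ x) fun x => not_lt.symm]

theorem cnt_and_add (P Q : ℝ → Prop) (B : ℕ → ℝ) (s f : ℕ) :
    cnt (fun x => P x ∧ Q x) B s f + cnt (fun x => ¬ P x ∧ Q x) B s f = cnt Q B s f := by
  unfold cnt
  rw [← Finset.card_union_of_disjoint]
  · congr 1
    ext i
    simp only [Finset.mem_union, Finset.mem_filter]
    tauto
  · rw [Finset.disjoint_left]
    intro i hi hi'
    simp only [Finset.mem_filter] at hi hi'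
    tauto

theorem IsKth.of_gt {B B' : ℕ → ℝ} {s f g k : ℕ} {p r : ℝ}
    (hB : ∀ P, cnt P B' s g = cnt (fun x => p < x ∧ P x) B s f)
    (hk : cnt (· ≤ p) B s f ≤ k) (h : IsKth B' s g (k - cnt (· ≤ p) B s f) r) :
    IsKth B s f k r := by
  rw [IsKth, hB, hB] at h
  have e1 := cnt_and_add (p < ·) (· < r) B s f
  have e2 := cnt_and_add (p < ·) (· ≤ r) B s f
  have hpr : p < r := by
    by_contra hrp
    have h2 := h.2
    have : cnt (fun x => p < x ∧ x ≤ r) B s f = 0 := by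
      by_contra hne
      obtain ⟨i, hi⟩ := Finset.card_pos.1 (Nat.pos_of_ne_zero hne)
      simp only [Finset.mem_filter] at hi
      exact hrp (hi.2.1.trans_le hi.2.2)
    omega
  have e3 : cnt (fun x => ¬ p < x ∧ x ≤ r) B s f = cnt (· ≤ p) B s f :=
    cnt_congr_prop fun x => ⟨fun h => not_lt.1 h.1, fun h => ⟨not_lt.2 h, h.trans hpr.le⟩⟩
  have e4 : cnt (fun x => ¬ p < x ∧ x < r) B s f = cnt (· ≤ p) B s f :=
    cnt_congr_prop fun x => ⟨fun h => not_lt.1 h.1, fun h => ⟨not_lt.2 h, h.trans_lt hpr⟩⟩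
  constructor <;> omega

theorem run_selectStep_return {σ : State} {d s f k : ℕ} (h : TopFrame σ d s f k)
    (hret : σ.ireg 31 = 1) (hk : s + k < f) :
    Run selectStep σ fun t τ => t ≤ 10 * (f - s) + 30 ∧ SameBelow σ τ d s ∧
      ((τ.ireg 30 = d ∧ τ.ireg 31 = 1 ∧ IsKth (σ.rarr 18) s f k (τ.rreg 30)) ∨
        ∃ g k', τ.ireg 31 = 0 ∧ TopFrame τ d s g k' ∧ s + k' < g ∧
          (g = s + cnt (· < σ.rreg 30) (σ.rarr 18) s f ∨
            g = s + cnt (σ.rreg 30 < ·) (σ.rarr 18) s f) ∧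
          ∀ r, IsKth (τ.rarr 18) s g k' r → IsKth (σ.rarr 18) s f k r) := by
  obtain ⟨h1, h2, h3, h4⟩ := h
  simp only [selectStep, run_seq, run_iset, run_ite, IE.eval, BE.eval, ireg_setI, iarr_setI, h1, h2,
    h3, h4, hret, Nat.reduceEqDiff, if_true, if_false, add_tsub_cancel_right, zero_lt_one,
    not_true, false_imp_iff, true_imp_iff, and_true]
  refine (run_countPart (s := s) (f := f) (by simp) (by simp) (by omega)).mono ?_
  rintro t υ hfr ⟨ht, h5, h6⟩
  simp only [rreg_setI, rarr_setI] at h5 h6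
  have e29 : υ.ireg 29 = d := by simpa using hfr.ir 29 rfl
  have e30 : υ.ireg 30 = d + 1 := by simpa [h1] using hfr.ir 30 rfl
  have e31 : υ.ireg 31 = 1 := by simpa [hret] using hfr.ir 31 rfl
  have e32 : υ.ireg 32 = s := by simpa using hfr.ir 32 rfl
  have e33 : υ.ireg 33 = f := by simpa using hfr.ir 33 rfl
  have e34 : υ.ireg 34 = k := by simpa using hfr.ir 34 rfl
  have er : υ.rreg 30 = σ.rreg 30 := by simpa using hfr.rr 30 rfl
  have e12 : υ.iarr 12 = σ.iarr 12 := by simpa using hfr.ia 12 rfl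
  have e13 : υ.iarr 13 = σ.iarr 13 := by simpa using hfr.ia 13 rfl
  have e14 : υ.iarr 14 = σ.iarr 14 := by simpa using hfr.ia 14 rfl
  have e18 : υ.rarr 18 = σ.rarr 18 := by simpa using hfr.ra 18 rfl
  have hcomp := fun b φ => run_compact (b := b) (σ := υ) (s := s) (f := f) (φ := φ) e32 e33 (by omega)
  rw [er, e18] at hcomp
  rw [e34]
  refine ⟨fun hlt => ?_, fun hlt => ⟨fun heq => ?_, fun heq => ?_⟩⟩
  · refine (hcomp _ (· < σ.rreg 30) (by intro τ hτ; simp [hτ])).mono ?_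
    rintro t' υ' hfr' ⟨ht', h36, h7, h8⟩
    have e29' : υ'.ireg 29 = d := (hfr'.ir 29 rfl).trans e29
    have e30' : υ'.ireg 30 = d + 1 := (hfr'.ir 30 rfl).trans e30
    have e12' := (hfr'.ia 12 rfl).trans e12
    have e13' := (hfr'.ia 13 rfl).trans e13
    have e14' := (hfr'.ia 14 rfl).trans e14
    simp only [run_ist, IE.eval, ireg_setIA, e29']
    refine ⟨by omega, ⟨by simpa using h7, by simp [e12'], ?_, by simp [e14']⟩,
      Or.inr ⟨υ'.ireg 36, k, by simp, ⟨by simp [e30'], by simp [e12', h2], by simp,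
        by simp [e14', h4]⟩, by omega, Or.inl h36, fun r hr => ?_⟩⟩
    · intro i hi
      simp [Function.update_of_ne (show i ≠ d by omega), e13']
    · exact IsKth.of_lt (by simpa using h8) (by omega) (by simpa using hr)
  · refine ⟨by omega, ⟨by simp [e18], by simp [e12], by simp [e13], by simp [e14]⟩,
      Or.inl ⟨by simp [e29], by simp [e31], ?_⟩⟩
    simp only [rreg_setI, er]
    exact ⟨by omega, by omega⟩
  · refine (hcomp _ (σ.rreg 30 < ·) (by intro τ hτ; simp [hτ])).mono ?_
    rintro t' υ' hfr' ⟨ht', h36, h7, h8⟩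
    have e29' : υ'.ireg 29 = d := (hfr'.ir 29 rfl).trans e29
    have e30' : υ'.ireg 30 = d + 1 := (hfr'.ir 30 rfl).trans e30
    have e34' := (hfr'.ir 34 rfl).trans e34
    have e37' := hfr'.ir 37 rfl
    have e38' := hfr'.ir 38 rfl
    have e12' := (hfr'.ia 12 rfl).trans e12
    have e13' := (hfr'.ia 13 rfl).trans e13
    have e14' := (hfr'.ia 14 rfl).trans e14
    have hadd := cnt_lt_add (σ.rarr 18) s f (σ.rreg 30)
    simp only [run_ist, IE.eval, ireg_setIA, e29', e34', e37', e38', h6]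
    refine ⟨by omega, ⟨by simpa using h7, by simp [e12'], ?_, ?_⟩,
      Or.inr ⟨υ'.ireg 36, _, by simp, ⟨by simp [e30'], by simp [e12', h2], by simp, rfl⟩, ?_,
        Or.inr h36, fun r hr => ?_⟩⟩
    · intro i hi
      simp [Function.update_of_ne (show i ≠ d by omega), e13']
    · intro i hi
      simp [Function.update_of_ne (show i ≠ d by omega), e14']
    · simp; omega
    · exact IsKth.of_gt (by simpa using h8) (by omega) (by simpa using hr)

/-- The loop that empties the stack. -/
def selectLoop : Cmd := .wh (.ilt (.lit 0) (.reg 30)) selectStep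

/-- Every run of the selection loop from `τ` extends to one from `σ` with `T` more time units. -/
def SelectReach (σ : State) (T : ℕ) (τ : State) : Prop :=
  ∀ T' υ, HExec selectLoop τ T' υ → HExec selectLoop σ (T + T') υ

theorem SelectReach.trans {σ τ υ : State} {S T : ℕ} (h : SelectReach σ S τ)
    (h' : SelectReach τ T υ) : SelectReach σ (S + T) υ := fun T' υ' hυ => by
  rw [add_assoc]
  exact h _ _ (h' _ _ hυ)

theorem SelectReach.step {σ τ : State} {S : ℕ} (hd : 0 < σ.ireg 30) (h : HExec selectStep σ S τ) :
    SelectReach σ (S + 1) τ := fun T' υ hυ => by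
  rw [show S + 1 + T' = S + T' + 1 by ring]
  exact .wh_true (by simpa using hd) h hυ

theorem selectReach_top (n : ℕ) : ∀ (σ : State) (d s f k : ℕ), f = s + n → TopFrame σ d s f k →
    σ.ireg 31 = 0 → s + k < f → ∃ T τ, SelectReach σ T τ ∧ T ≤ 1000 * n ∧ τ.ireg 30 = d ∧
      τ.ireg 31 = 1 ∧ IsKth (σ.rarr 18) s f k (τ.rreg 30) ∧ SameBelow σ τ d s := by
  induction n using Nat.strong_induction_on with
  | _ n ih =>
    intro σ d s f k hn hσ hret hk
    have hd : 0 < σ.ireg 30 := by rw [hσ.height]; omega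
    by_cases hsmall : f ≤ s + 100
    · obtain ⟨T, τ, h1, h2, h3⟩ := run_selectStep_small hσ hret hk hsmall
      exact ⟨_, τ, .step hd h1, by omega, h3⟩
    push Not at hsmall
    obtain ⟨T₁, σ₁, h1, ht1, hret1, htop1, hlo1, hhi1, hr1, hsame1, hcnt, hle, hge⟩ :=
      run_selectStep_push hσ hret hsmall
    have hn5 : (f - s) / 5 = n / 5 := by congr 1; omega
    rw [hn5] at htop1 hle hge
    obtain ⟨T₂, σ₂, h2, ht2, hd2, hret2, hkth2, hsame2⟩ :=
      ih (n / 5) (by omega) σ₁ (d + 1) f _ _ rfl htop1 hret1 (by omega)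
    have htop2 : TopFrame σ₂ d s f k := ⟨hd2, (hsame2.lo d (by omega)).trans hlo1,
      (hsame2.hi d (by omega)).trans hhi1, (hsame2.rank d (by omega)).trans hr1⟩
    have hseg : ∀ P, cnt P (σ₂.rarr 18) s f = cnt P (σ₁.rarr 18) s f := fun P =>
      cnt_congr fun i _ hi => hsame2.data i hi
    obtain ⟨T₃, σ₃, h3, ht3, hsame3, hcase⟩ := run_selectStep_return htop2 hret2 hk
    have hR2 : SelectReach σ (T₁ + 1 + T₂ + (T₃ + 1)) σ₃ :=
      ((SelectReach.step hd h1).trans h2).trans (.step (by omega) h3)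
    have hsame : SameBelow σ σ₃ d s :=
      (hsame1.trans hsame2 (by omega) (by omega)).trans hsame3 le_rfl le_rfl
    have hkth : ∀ r, IsKth (σ₂.rarr 18) s f k r → IsKth (σ.rarr 18) s f k r := by
      intro r hr
      rwa [IsKth, hseg, hseg, hcnt, hcnt] at hr
    rcases hcase with ⟨hd3, hret3, hk3⟩ | ⟨g, k', hret3, htop3, hk3, hg, himp⟩
    · exact ⟨_, _, hR2, by omega, hd3, hret3, hkth _ hk3, hsame⟩
    · have hbound : 10 * (g - s) ≤ 7 * n + 12 := by
        obtain ⟨hk1, hk2⟩ := hkth2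
        have a1 := hle (σ₂.rreg 30)
        have a2 := hge (σ₂.rreg 30)
        have a3 := cnt_le_add (σ₁.rarr 18) f (f + n / 5) (σ₂.rreg 30)
        have a4 := cnt_le_add (σ₁.rarr 18) s f (σ₂.rreg 30)
        have a5 := cnt_lt_add (σ₁.rarr 18) s f (σ₂.rreg 30)
        rw [hseg, hseg] at hg
        rcases hg with hg | hg <;> omega
      obtain ⟨T₄, σ₄, h4, ht4, hd4, hret4, hkth4, hsame4⟩ :=
        ih (g - s) (by omega) σ₃ d s g k' (by omega) htop3 hret3 hk3
      exact ⟨_, _, hR2.trans h4, by omega, hd4, hret4, hkth _ (himp _ hkth4),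
        hsame.trans hsame4 le_rfl le_rfl⟩

/-- `rreg 30 :=` the entry of rank `ireg 41` among the first `ireg 40` entries of array `18`. -/
def select : Cmd :=
  .ist 12 (.lit 0) (.lit 0) ;; .ist 13 (.lit 0) (.reg 40) ;; .ist 14 (.lit 0) (.reg 41) ;;
  .iset 30 (.lit 1) ;; .iset 31 (.lit 0) ;; selectLoop

theorem run_select {σ : State} {n k : ℕ} (hn : σ.ireg 40 = n) (hk : σ.ireg 41 = k) (hkn : k < n) :
    Run select σ fun t τ => t ≤ 1000 * n + 6 ∧ IsKth (σ.rarr 18) 0 n k (τ.rreg 30) := by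
  simp only [select, run_seq, run_ist, run_iset, IE.eval, ireg_setIA, hn, hk]
  obtain ⟨T, τ, h1, h2, h3, h4, h5, h6⟩ := selectReach_top n
    (((((σ.setIA 12 0 0).setIA 13 0 n).setIA 14 0 k).setI 30 1).setI 31 0) 0 0 n k (by simp)
    ⟨by simp, by simp, by simp, by simp⟩ (by simp) (by omega)
  refine ⟨_, τ, h1 _ _ (.wh_false (by simp [h3])), by omega, by simpa using h5⟩

end RAMLang

namespace RAMLang

open RealRAM Finset

/-! ### Minimising a maximum of convex piecewise linear functions

The functions are indexed by the entries of integer array `9` at positions below `ireg 42`.  The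
function with index `y` is `rarr 12 y * t + rarr 13 y` plus the kinks `rarr 15 j * (t - rarr 14 j)⁺`
with owner `iarr 11 j = y`, for `j < ireg 43`. -/

/-- The value at `t` of the function with index `y`. -/
noncomputable def fnVal (σ : State) (y : ℕ) (t : ℝ) : ℝ :=
  σ.rarr 12 y * t + σ.rarr 13 y +
    ∑ j ∈ range (σ.ireg 43), if σ.iarr 11 j = y then σ.rarr 15 j * max 0 (t - σ.rarr 14 j) else 0

/-- Marks in integer array `10` the functions that have kinks. -/
def markKinked : Cmd :=
  .iset 44 (.lit 0) ;; forTo 44 (.reg 42) (.ist 10 (.ld 9 (.reg 44)) (.lit 0)) ;;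
  .iset 44 (.lit 0) ;; forTo 44 (.reg 43) (.ist 10 (.ld 11 (.reg 44)) (.lit 1))

theorem run_markKinked {σ : State} {F K : ℕ} (hF : σ.ireg 42 = F) (hK : σ.ireg 43 = K) :
    Run markKinked σ fun t τ => t ≤ 3 * F + 3 * K + 4 ∧
      ∀ q < F, 0 < τ.iarr 10 (σ.iarr 9 q) ↔ ∃ j < K, σ.iarr 11 j = σ.iarr 9 q := by
  rw [markKinked, run_seq, run_iset]
  refine (Run.forTo' (a := 0) (n := F) (fun k τ => ∀ q < k, τ.iarr 10 (σ.iarr 9 q) = 0) 1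
    (by simp) (by omega) ?_ rfl (by simp) ?_).seq ?_
  · intro τ hτ; simpa [hF] using hτ.ir 42 rfl
  · intro k τ _ hk hτ hτk hI
    have h9 : τ.iarr 9 = σ.iarr 9 := by simpa using hτ.ia 9 rfl
    simp only [run_ist, IE.eval, hτk, h9, iarr_setI, iarr_setIA, if_true]
    refine ⟨by omega, fun q hq => ?_⟩
    rw [Function.update_apply]
    split_ifs with h
    · rfl
    · refine hI q (lt_of_le_of_ne (by omega) fun hqk => h (by rw [hqk]))
  · rintro t τ hτ ⟨hI, -, ht⟩
    have h9 : τ.iarr 9 = σ.iarr 9 := by simpa using hτ.ia 9 rfl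
    have h11 : τ.iarr 11 = σ.iarr 11 := by simpa using hτ.ia 11 rfl
    have h43 : τ.ireg 43 = K := by simpa [hK] using hτ.ir 43 rfl
    rw [run_seq, run_iset]
    refine (Run.forTo' (a := 0) (n := K) (fun k τ => ∀ q < F, 0 < τ.iarr 10 (σ.iarr 9 q) ↔
      ∃ j < k, σ.iarr 11 j = σ.iarr 9 q) 1 (by simp) (by omega) ?_ rfl ?_ ?_).mono ?_
    · intro υ hυ; simpa [h43] using hυ.ir 43 rfl
    · intro q hq
      simp [hI q hq]
    · intro k υ _ hk hυ hυk hJ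
      have h11' : υ.iarr 11 = σ.iarr 11 := by simpa [h11] using hυ.ia 11 rfl
      simp only [run_ist, IE.eval, hυk, h11', iarr_setI, iarr_setIA, if_true]
      refine ⟨by omega, fun q hq => ?_⟩
      rw [Function.update_apply]
      split_ifs with h
      · simp only [zero_lt_one, true_iff]
        exact ⟨k, by omega, h.symm⟩
      · rw [hJ q hq]
        refine ⟨fun ⟨j, hj, e⟩ => ⟨j, by omega, e⟩, fun ⟨j, hj, e⟩ => ⟨j, ?_, e⟩⟩
        refine lt_of_le_of_ne (by omega) fun hjk => h ?_
        rw [← e, hjk]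
    · rintro t' υ - ⟨h1, -, h2⟩
      exact ⟨by simp at ht h2 ⊢; omega, h1⟩

/-- Replaces the kink-free functions `ireg 48` and `ireg 45` by their maximum, a function with one
kink and index `ireg 48`. -/
def mergeLines : Cmd :=
  .ite (.rle (.ld 12 (.reg 48)) (.ld 12 (.reg 45)))
    (.rset 50 (.ld 12 (.reg 48)) ;; .rset 51 (.ld 13 (.reg 48)) ;;
      .rset 52 (.ld 12 (.reg 45)) ;; .rset 53 (.ld 13 (.reg 45)))
    (.rset 50 (.ld 12 (.reg 45)) ;; .rset 51 (.ld 13 (.reg 45)) ;;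
      .rset 52 (.ld 12 (.reg 48)) ;; .rset 53 (.ld 13 (.reg 48))) ;;
  .rst 14 (.reg 43) (.div (.sub (.reg 51) (.reg 53)) (.sub (.reg 52) (.reg 50))) ;;
  .rst 15 (.reg 43) (.sub (.reg 52) (.reg 50)) ;;
  .ite (.rlt (.reg 50) (.reg 52)) .skip (.rset 51 (.mx (.reg 51) (.reg 53))) ;;
  .rst 12 (.reg 48) (.reg 50) ;; .rst 13 (.reg 48) (.reg 51) ;;
  .ist 11 (.reg 43) (.reg 48) ;; .iset 43 (.add (.reg 43) (.lit 1))

theorem line_add_kink {a₁ b₁ a₂ b₂ : ℝ} (h : a₁ < a₂) (t : ℝ) :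
    a₁ * t + b₁ + (a₂ - a₁) * max 0 (t - (b₁ - b₂) / (a₂ - a₁)) =
      max (a₁ * t + b₁) (a₂ * t + b₂) := by
  have h' : 0 < a₂ - a₁ := by linarith
  rw [mul_max_of_nonneg _ _ h'.le, mul_sub, mul_div_cancel₀ _ h'.ne', ← max_add_add_left]
  congr 1 <;> ring

theorem fnVal_of_pure {σ : State} {y : ℕ} (h : ∀ j < σ.ireg 43, σ.iarr 11 j ≠ y) (t : ℝ) :
    fnVal σ y t = σ.rarr 12 y * t + σ.rarr 13 y := by
  rw [fnVal, Finset.sum_eq_zero, add_zero]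
  intro j hj
  rw [if_neg (h j (Finset.mem_range.1 hj))]

theorem run_mergeLines {σ : State} {u v K : ℕ} (hu : σ.ireg 48 = u) (hv : σ.ireg 45 = v)
    (hK : σ.ireg 43 = K) (hpu : ∀ j < K, σ.iarr 11 j ≠ u) (hpv : ∀ j < K, σ.iarr 11 j ≠ v) :
    Run mergeLines σ fun t τ => t ≤ 15 ∧ τ.ireg 43 = K + 1 ∧
      (∀ j < K, τ.iarr 11 j = σ.iarr 11 j) ∧ τ.iarr 11 K = u ∧
      (∀ j < K, τ.rarr 15 j = σ.rarr 15 j) ∧ 0 ≤ τ.rarr 15 K ∧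
      (∀ y, y ≠ u → ∀ t, fnVal τ y t = fnVal σ y t) ∧
      ∀ t z, fnVal τ u t ≤ z ↔ fnVal σ u t ≤ z ∧ fnVal σ v t ≤ z := by
  suffices H : ∀ a₁ b₁ a₂ b₂ : ℝ, a₁ ≤ a₂ →
      (∀ t z : ℝ, (a₁ * t + b₁ ≤ z ∧ a₂ * t + b₂ ≤ z) ↔ (fnVal σ u t ≤ z ∧ fnVal σ v t ≤ z)) →
      Run (.rst 14 (.reg 43) (.div (.sub (.reg 51) (.reg 53)) (.sub (.reg 52) (.reg 50))) ;;
        .rst 15 (.reg 43) (.sub (.reg 52) (.reg 50)) ;;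
        .ite (.rlt (.reg 50) (.reg 52)) .skip (.rset 51 (.mx (.reg 51) (.reg 53))) ;;
        .rst 12 (.reg 48) (.reg 50) ;; .rst 13 (.reg 48) (.reg 51) ;;
        .ist 11 (.reg 43) (.reg 48) ;; .iset 43 (.add (.reg 43) (.lit 1)))
        ((((σ.setR 50 a₁).setR 51 b₁).setR 52 a₂).setR 53 b₂)
        fun t τ => t ≤ 9 ∧ τ.ireg 43 = K + 1 ∧
      (∀ j < K, τ.iarr 11 j = σ.iarr 11 j) ∧ τ.iarr 11 K = u ∧
      (∀ j < K, τ.rarr 15 j = σ.rarr 15 j) ∧ 0 ≤ τ.rarr 15 K ∧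
      (∀ y, y ≠ u → ∀ t, fnVal τ y t = fnVal σ y t) ∧
      ∀ t z, fnVal τ u t ≤ z ↔ fnVal σ u t ≤ z ∧ fnVal σ v t ≤ z by
    have eu := fun t => fnVal_of_pure (σ := σ) (y := u) (by rwa [hK]) t
    have ev := fun t => fnVal_of_pure (σ := σ) (y := v) (by rwa [hK]) t
    refine Run.seq (Q := fun t τ => t ≤ 5 ∧ ∃ a₁ b₁ a₂ b₂, a₁ ≤ a₂ ∧ (∀ t z : ℝ,
      (a₁ * t + b₁ ≤ z ∧ a₂ * t + b₂ ≤ z) ↔ (fnVal σ u t ≤ z ∧ fnVal σ v t ≤ z)) ∧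
      τ = (((σ.setR 50 a₁).setR 51 b₁).setR 52 a₂).setR 53 b₂) ?_ ?_
    · refine run_ite.2 ⟨fun hle => ?_, fun hle => ?_⟩ <;>
        simp only [BE.eval, RE.eval, IE.eval, hu, hv, not_le] at hle <;>
        simp only [run_seq, run_rset, RE.eval, IE.eval, ireg_setR, rarr_setR, hu, hv]
      · exact ⟨by omega, _, _, _, _, hle, fun t z => by rw [eu, ev], rfl⟩
      · exact ⟨by omega, _, _, _, _, hle.le, fun t z => by rw [eu, ev, and_comm], rfl⟩
    · rintro t τ - ⟨ht, a₁, b₁, a₂, b₂, hle, hz, rfl⟩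
      exact (H _ _ _ _ hle hz).mono fun t' τ' _ ⟨h, h'⟩ => ⟨by omega, h'⟩
  intro a₁ b₁ a₂ b₂ hle hz
  have key : ∀ τ : State, ∀ d b : ℝ, τ.ireg 43 = K + 1 →
      τ.iarr 11 = Function.update (σ.iarr 11) K u →
      τ.rarr 15 = Function.update (σ.rarr 15) K (a₂ - a₁) →
      τ.rarr 14 = Function.update (σ.rarr 14) K d → τ.rarr 12 = Function.update (σ.rarr 12) u a₁ →
      τ.rarr 13 = Function.update (σ.rarr 13) u b →
      (∀ t z : ℝ, a₁ * t + b + (a₂ - a₁) * max 0 (t - d) ≤ z ↔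
        (a₁ * t + b₁ ≤ z ∧ a₂ * t + b₂ ≤ z)) →
      τ.ireg 43 = K + 1 ∧ (∀ j < K, τ.iarr 11 j = σ.iarr 11 j) ∧ τ.iarr 11 K = u ∧
      (∀ j < K, τ.rarr 15 j = σ.rarr 15 j) ∧ 0 ≤ τ.rarr 15 K ∧
      (∀ y, y ≠ u → ∀ t, fnVal τ y t = fnVal σ y t) ∧
      ∀ t z, fnVal τ u t ≤ z ↔ fnVal σ u t ≤ z ∧ fnVal σ v t ≤ z := by
    intro τ d b e43 e11 e15 e14 e12 e13 hmax
    have hsum : ∀ y t, ∑ j ∈ range K, (if Function.update (σ.iarr 11) K u j = y then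
        Function.update (σ.rarr 15) K (a₂ - a₁) j *
          max 0 (t - Function.update (σ.rarr 14) K d j) else 0) =
        ∑ j ∈ range K, if σ.iarr 11 j = y then σ.rarr 15 j * max 0 (t - σ.rarr 14 j) else 0 := by
      intro y t
      refine Finset.sum_congr rfl fun j hj => ?_
      have hj' : j ≠ K := by rw [Finset.mem_range] at hj; omega
      simp only [Function.update_of_ne hj']
    refine ⟨e43, fun j hj => ?_, by simp [e11], fun j hj => ?_, ?_, fun y hy t => ?_, fun t z => ?_⟩
    · rw [e11, Function.update_of_ne (by omega)]
    · rw [e15, Function.update_of_ne (by omega)]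
    · rw [e15, Function.update_self]; linarith
    · rw [fnVal, fnVal, e43, hK, Finset.sum_range_succ, e11, e15, e14, hsum, e12, e13]
      simp [hy, Ne.symm hy]
    · rw [← hz, ← hmax]
      rw [fnVal, e43, Finset.sum_range_succ, e11, e15, e14, hsum, e12, e13]
      rw [Finset.sum_eq_zero fun j hj => by rw [if_neg (hpu j (Finset.mem_range.1 hj))]]
      simp
  simp only [run_seq, run_rst, run_ite, run_skip, run_rset, run_ist, run_iset, IE.eval, RE.eval,
    BE.eval, rreg_setR, rreg_setRA, ireg_setR, ireg_setRA, ireg_setIA, hK, hu,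
    Nat.reduceEqDiff, if_true, if_false]
  refine ⟨fun hlt => ⟨by omega, ?_⟩, fun hlt => ⟨by omega, ?_⟩⟩
  · refine key _ ((b₁ - b₂) / (a₂ - a₁)) b₁ (by simp) (by simp) (by simp) (by simp) (by simp)
      (by simp) fun t z => ?_
    rw [line_add_kink hlt, max_le_iff]
  · have heq : a₁ = a₂ := le_antisymm hle (not_lt.1 hlt)
    subst heq
    refine key _ ((b₁ - b₂) / (a₁ - a₁)) (max b₁ b₂) (by simp) (by simp) (by simp) (by simp)
      (by simp) (by simp) fun t z => ?_
    rw [sub_self, zero_mul, add_zero, ← max_add_add_left, max_le_iff]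

/-- Pairs up the kink-free functions, so that at most one of them remains. -/
def pairStep : Cmd :=
  .iset 45 (.ld 9 (.reg 44)) ;;
  .ite (.ilt (.lit 0) (.ld 10 (.reg 45)))
    (.ist 9 (.reg 46) (.reg 45) ;; .iset 46 (.add (.reg 46) (.lit 1)))
    (.ite (.ilt (.reg 47) (.lit 1)) (.iset 47 (.lit 1) ;; .iset 48 (.reg 45))
      (mergeLines ;; .ist 9 (.reg 46) (.reg 48) ;; .iset 46 (.add (.reg 46) (.lit 1)) ;;
        .iset 47 (.lit 0)))

def pairUp : Cmd :=
  markKinked ;; .iset 44 (.lit 0) ;; .iset 46 (.lit 0) ;; .iset 47 (.lit 0) ;;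
  forTo 44 (.reg 42) pairStep ;;
  .ite (.ilt (.lit 0) (.reg 47))
    (.ist 9 (.reg 46) (.reg 48) ;; .iset 46 (.add (.reg 46) (.lit 1))) .skip ;;
  .iset 42 (.reg 46)

/-- The maximum of the current functions is at most `z` at `t`. -/
def Epi (σ : State) (t z : ℝ) : Prop := ∀ q < σ.ireg 42, fnVal σ (σ.iarr 9 q) t ≤ z

/-- The functions have distinct indices and nonnegative kinks, and there is one. -/
structure WellFormed (σ : State) : Prop where
  pos : 0 < σ.ireg 42
  inj : ∀ q < σ.ireg 42, ∀ q' < σ.ireg 42, σ.iarr 9 q = σ.iarr 9 q' → q = q'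
  nonneg : ∀ j < σ.ireg 43, 0 ≤ σ.rarr 15 j

/-- The invariant of the pairing loop. -/
structure PairInv (σ : State) (i : ℕ) (τ : State) : Prop where
  kinks : σ.ireg 43 ≤ τ.ireg 43
  flag : τ.ireg 47 ≤ 1
  count : τ.ireg 46 + τ.ireg 47 + τ.ireg 43 = i + σ.ireg 43
  rest : ∀ q, i ≤ q → τ.iarr 9 q = σ.iarr 9 q
  mem : ∀ q < τ.ireg 46, ∃ p < i, τ.iarr 9 q = σ.iarr 9 p
  inj : ∀ q < τ.ireg 46, ∀ q' < τ.ireg 46, τ.iarr 9 q = τ.iarr 9 q' → q = q'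
  pend_mem : τ.ireg 47 = 1 → ∃ p < i, τ.ireg 48 = σ.iarr 9 p
  pend_ne : τ.ireg 47 = 1 → ∀ q < τ.ireg 46, τ.iarr 9 q ≠ τ.ireg 48
  pend_pure : τ.ireg 47 = 1 → ∀ j < σ.ireg 43, σ.iarr 11 j ≠ τ.ireg 48
  kinked : ∀ q < τ.ireg 46, ∃ j < τ.ireg 43, τ.iarr 11 j = τ.iarr 9 q
  same : ∀ y, (∀ q < τ.ireg 46, τ.iarr 9 q ≠ y) → ∀ t, fnVal τ y t = fnVal σ y t
  pure : ∀ y, (∀ q < τ.ireg 46, τ.iarr 9 q ≠ y) → (∀ j < σ.ireg 43, σ.iarr 11 j ≠ y) →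
    ∀ j < τ.ireg 43, τ.iarr 11 j ≠ y
  epi : ∀ t z, ((∀ q < τ.ireg 46, fnVal τ (τ.iarr 9 q) t ≤ z) ∧
    (τ.ireg 47 = 1 → fnVal τ (τ.ireg 48) t ≤ z)) ↔ ∀ p < i, fnVal σ (σ.iarr 9 p) t ≤ z
  nonneg : ∀ j < τ.ireg 43, 0 ≤ τ.rarr 15 j

theorem fnVal_congr {σ τ : State} {y : ℕ} (h43 : τ.ireg 43 = σ.ireg 43)
    (h11 : τ.iarr 11 = σ.iarr 11) (h12 : τ.rarr 12 = σ.rarr 12) (h13 : τ.rarr 13 = σ.rarr 13)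
    (h14 : τ.rarr 14 = σ.rarr 14) (h15 : τ.rarr 15 = σ.rarr 15) (t : ℝ) :
    fnVal τ y t = fnVal σ y t := by
  simp only [fnVal, h43, h11, h12, h13, h14, h15]

theorem run_pairStep {σ τ : State} {i : ℕ} (hσ : WellFormed σ) (hi : i < σ.ireg 42)
    (hτi : τ.ireg 44 = i) (h : PairInv σ i τ)
    (hmark : 0 < τ.iarr 10 (σ.iarr 9 i) ↔ ∃ j < σ.ireg 43, σ.iarr 11 j = σ.iarr 9 i)
    (h11 : ∀ j < σ.ireg 43, τ.iarr 11 j = σ.iarr 11 j) :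
    Run pairStep τ fun t υ => t ≤ 21 ∧ PairInv σ (i + 1) υ ∧
      ∀ j < σ.ireg 43, υ.iarr 11 j = σ.iarr 11 j := by
  have hfresh : ∀ p < i, σ.iarr 9 p ≠ σ.iarr 9 i := fun p hp e => by
    have := hσ.inj p (by omega) i hi e
    omega
  have hfresh' : ∀ q < τ.ireg 46, τ.iarr 9 q ≠ σ.iarr 9 i := fun q hq => by
    obtain ⟨p, hp, e⟩ := h.mem q hq
    rw [e]
    exact hfresh p hp
  have hc := h.count
  have hk := h.kinks
  have hfl := h.flag
  have hepi : ∀ t z, (∀ p < i + 1, fnVal σ (σ.iarr 9 p) t ≤ z) ↔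
      ((∀ p < i, fnVal σ (σ.iarr 9 p) t ≤ z) ∧ fnVal σ (σ.iarr 9 i) t ≤ z) := fun t z => by
    refine ⟨fun hh => ⟨fun p hp => hh p (by omega), hh i (by omega)⟩, fun hh p hp => ?_⟩
    rcases Nat.lt_succ_iff_lt_or_eq.1 hp with hp | rfl
    · exact hh.1 p hp
    · exact hh.2
  simp only [pairStep, run_seq, run_iset, run_ite, IE.eval, BE.eval, hτi, h.rest i le_rfl, ireg_setI,
    iarr_setI, Nat.reduceEqDiff, if_true, if_false, hmark]
  refine ⟨fun hkink => ?_, fun hpure => ⟨fun hno => ?_, fun hyes => ?_⟩⟩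
  · simp only [run_ist, IE.eval, ireg_setI, ireg_setIA, Nat.reduceEqDiff, if_true, if_false]
    set υ := (((τ.setI 45 (σ.iarr 9 i)).setIA 9 (τ.ireg 46) (σ.iarr 9 i)).setI 46
      (τ.ireg 46 + 1)) with hυ
    have e9 : υ.iarr 9 = Function.update (τ.iarr 9) (τ.ireg 46) (σ.iarr 9 i) := by simp [hυ]
    have e46 : υ.ireg 46 = τ.ireg 46 + 1 := by simp [hυ]
    have e47 : υ.ireg 47 = τ.ireg 47 := by simp [hυ]
    have e48 : υ.ireg 48 = τ.ireg 48 := by simp [hυ]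
    have e43 : υ.ireg 43 = τ.ireg 43 := by simp [hυ]
    have e11 : υ.iarr 11 = τ.iarr 11 := by simp [hυ]
    have e15 : υ.rarr 15 = τ.rarr 15 := by simp [hυ]
    have ef : ∀ y t, fnVal υ y t = fnVal τ y t := fun y t => fnVal_congr e43 e11 rfl rfl rfl rfl t
    have hne46 : ∀ q < τ.ireg 46, υ.iarr 9 q = τ.iarr 9 q := fun q hq => by
      rw [e9, Function.update_of_ne (by omega)]
    have hat46 : υ.iarr 9 (τ.ireg 46) = σ.iarr 9 i := by rw [e9, Function.update_self]
    have hsub : ∀ y, (∀ q < υ.ireg 46, υ.iarr 9 q ≠ y) → ∀ q < τ.ireg 46, τ.iarr 9 q ≠ y :=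
      fun y hy q hq => by
        rw [← hne46 q hq]
        exact hy q (by omega)
    refine ⟨by omega, ?_, fun j hj => by simpa using h11 j hj⟩
    constructor
    · omega
    · omega
    · omega
    · intro q hq
      rw [e9, Function.update_of_ne (by omega), h.rest q (by omega)]
    · intro q hq
      rcases Nat.lt_succ_iff_lt_or_eq.1 (e46 ▸ hq) with hq | rfl
      · obtain ⟨p, hp, e⟩ := h.mem q hq
        exact ⟨p, by omega, by rw [hne46 q hq, e]⟩
      · exact ⟨i, by omega, hat46⟩
    · intro q hq q' hq' e
      rcases Nat.lt_succ_iff_lt_or_eq.1 (e46 ▸ hq) with hq | hq <;>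
        rcases Nat.lt_succ_iff_lt_or_eq.1 (e46 ▸ hq') with hq' | hq'
      · rw [hne46 q hq, hne46 q' hq'] at e
        exact h.inj q hq q' hq' e
      · rw [hne46 q hq, hq', hat46] at e
        exact absurd e (hfresh' q hq)
      · rw [hne46 q' hq', hq, hat46] at e
        exact absurd e.symm (hfresh' q' hq')
      · omega
    · intro hp
      obtain ⟨p, hp, e⟩ := h.pend_mem (e47 ▸ hp)
      exact ⟨p, by omega, by rw [e48, e]⟩
    · intro hp q hq
      rw [e48]
      rcases Nat.lt_succ_iff_lt_or_eq.1 (e46 ▸ hq) with hq | hq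
      · rw [hne46 q hq]
        exact h.pend_ne (e47 ▸ hp) q hq
      · rw [hq, hat46]
        obtain ⟨p, hp, e⟩ := h.pend_mem (e47 ▸ hp)
        rw [e]
        exact (hfresh p hp).symm
    · intro hp
      rw [e48]
      exact h.pend_pure (e47 ▸ hp)
    · intro q hq
      rw [e43, e11]
      rcases Nat.lt_succ_iff_lt_or_eq.1 (e46 ▸ hq) with hq | hq
      · rw [hne46 q hq]
        exact h.kinked q hq
      · rw [hq, hat46]
        obtain ⟨j, hj, e⟩ := hkink
        exact ⟨j, by omega, by rw [h11 j hj, e]⟩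
    · intro y hy t
      rw [ef]
      exact h.same y (hsub y hy) t
    · intro y hy hy'
      rw [e43, e11]
      exact h.pure y (hsub y hy) hy'
    · intro t z
      rw [hepi, ← h.epi, e46, e47, e48]
      simp only [ef]
      rw [← h.same (σ.iarr 9 i) hfresh' t]
      constructor
      · rintro ⟨h1, h2⟩
        refine ⟨⟨fun q hq => ?_, h2⟩, ?_⟩
        · rw [← hne46 q hq]
          exact h1 q (by omega)
        · rw [← hat46]
          exact h1 _ (by omega)
      · rintro ⟨⟨h1, h2⟩, h3⟩
        refine ⟨fun q hq => ?_, h2⟩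
        rcases Nat.lt_succ_iff_lt_or_eq.1 hq with hq | hq
        · rw [hne46 q hq]
          exact h1 q hq
        · rw [hq, hat46]
          exact h3
    · rw [e43, e15]
      exact h.nonneg
  · have h47 : τ.ireg 47 = 0 := by omega
    refine ⟨by omega, ?_, fun j hj => by simpa using h11 j hj⟩
    have ef : ∀ y t, fnVal (((τ.setI 45 (σ.iarr 9 i)).setI 47 1).setI 48 (σ.iarr 9 i)) y t =
        fnVal τ y t := fun y t => fnVal_congr (by simp) rfl rfl rfl rfl rfl t
    constructor
    · simpa using hk
    · simp
    · simp; omega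
    · intro q hq
      simpa using h.rest q (by omega)
    · intro q hq
      obtain ⟨p, hp, e⟩ := h.mem q (by simpa using hq)
      exact ⟨p, by omega, by simpa using e⟩
    · simpa using h.inj
    · intro _
      exact ⟨i, by omega, by simp⟩
    · intro _ q hq
      simpa using hfresh' q (by simpa using hq)
    · intro _ j hj e
      exact hpure ⟨j, hj, by simpa using e⟩
    · simpa using h.kinked
    · intro y hy t
      rw [ef]
      exact h.same y (by simpa using hy) t
    · intro y hy hy'
      simpa using h.pure y (by simpa using hy) hy'
    · intro t z
      rw [hepi, ← h.epi]
      simp only [ef]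
      simp [h47, h.same (σ.iarr 9 i) hfresh' t]
    · simpa using h.nonneg
  · have h47 : τ.ireg 47 = 1 := by omega
    have hu := h.pend_ne h47
    have hpu := h.pure _ hu (h.pend_pure h47)
    have hpv := h.pure _ hfresh' fun j hj e => hpure ⟨j, hj, e⟩
    have huv : τ.ireg 48 ≠ σ.iarr 9 i := by
      obtain ⟨p, hp, e⟩ := h.pend_mem h47
      rw [e]
      exact hfresh p hp
    have eτ : ∀ y t, fnVal (τ.setI 45 (σ.iarr 9 i)) y t = fnVal τ y t := fun y t =>
      fnVal_congr (by simp) rfl rfl rfl rfl rfl t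
    refine (run_mergeLines (σ := τ.setI 45 (σ.iarr 9 i)) (u := τ.ireg 48) (v := σ.iarr 9 i)
      (K := τ.ireg 43) (by simp) (by simp) (by simp) (by simpa using hpu)
      (by simpa using hpv)).mono ?_
    rintro t υ hfr ⟨ht, g43, g11, g11', g15, g15', gne, gepi⟩
    simp only [iarr_setI, rarr_setI, eτ] at g11 g15 gne gepi
    have u46 : υ.ireg 46 = τ.ireg 46 := by simpa using hfr.ir 46 rfl
    have u47 : υ.ireg 47 = τ.ireg 47 := by simpa using hfr.ir 47 rfl
    have u48 : υ.ireg 48 = τ.ireg 48 := by simpa using hfr.ir 48 rfl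
    have u9 : υ.iarr 9 = τ.iarr 9 := by simpa using hfr.ia 9 rfl
    simp only [run_ist, IE.eval, ireg_setIA,
      u46, u48]
    set ω := (((υ.setIA 9 (τ.ireg 46) (τ.ireg 48)).setI 46 (τ.ireg 46 + 1)).setI 47 0) with hω
    have e9 : ω.iarr 9 = Function.update (τ.iarr 9) (τ.ireg 46) (τ.ireg 48) := by simp [hω, u9]
    have e46 : ω.ireg 46 = τ.ireg 46 + 1 := by simp [hω]
    have e47 : ω.ireg 47 = 0 := by simp [hω]
    have e43 : ω.ireg 43 = τ.ireg 43 + 1 := by simp [hω, g43]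
    have e11 : ω.iarr 11 = υ.iarr 11 := by simp [hω]
    have e15 : ω.rarr 15 = υ.rarr 15 := by simp [hω]
    have ef : ∀ y t, fnVal ω y t = fnVal υ y t := fun y t =>
      fnVal_congr (by simp [hω]) e11 rfl rfl rfl rfl t
    have hne46 : ∀ q < τ.ireg 46, ω.iarr 9 q = τ.iarr 9 q := fun q hq => by
      rw [e9, Function.update_of_ne (by omega)]
    have hat46 : ω.iarr 9 (τ.ireg 46) = τ.ireg 48 := by rw [e9, Function.update_self]
    have hsub : ∀ y, (∀ q < ω.ireg 46, ω.iarr 9 q ≠ y) →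
        (∀ q < τ.ireg 46, τ.iarr 9 q ≠ y) ∧ y ≠ τ.ireg 48 := fun y hy =>
      ⟨fun q hq => by rw [← hne46 q hq]; exact hy q (by omega),
        fun e => hy (τ.ireg 46) (by omega) (by rw [hat46, e])⟩
    have hfl0 : ¬ (ω.ireg 47 = 1) := by omega
    refine ⟨by omega, ?_, fun j hj => by simpa [g11 j (by omega)] using h11 j hj⟩
    constructor
    · omega
    · omega
    · omega
    · intro q hq
      rw [e9, Function.update_of_ne (by omega), h.rest q (by omega)]
    · intro q hq
      rcases Nat.lt_succ_iff_lt_or_eq.1 (e46 ▸ hq) with hq | hq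
      · obtain ⟨p, hp, e⟩ := h.mem q hq
        exact ⟨p, by omega, by rw [hne46 q hq, e]⟩
      · obtain ⟨p, hp, e⟩ := h.pend_mem h47
        exact ⟨p, by omega, by rw [hq, hat46, e]⟩
    · intro q hq q' hq' e
      rcases Nat.lt_succ_iff_lt_or_eq.1 (e46 ▸ hq) with hq | hq <;>
        rcases Nat.lt_succ_iff_lt_or_eq.1 (e46 ▸ hq') with hq' | hq'
      · rw [hne46 q hq, hne46 q' hq'] at e
        exact h.inj q hq q' hq' e
      · rw [hne46 q hq, hq', hat46] at e
        exact absurd e (hu q hq)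
      · rw [hne46 q' hq', hq, hat46] at e
        exact absurd e.symm (hu q' hq')
      · omega
    · exact fun hp => absurd hp hfl0
    · exact fun hp => absurd hp hfl0
    · exact fun hp => absurd hp hfl0
    · intro q hq
      rw [e43, e11]
      rcases Nat.lt_succ_iff_lt_or_eq.1 (e46 ▸ hq) with hq | hq
      · obtain ⟨j, hj, e⟩ := h.kinked q hq
        exact ⟨j, by omega, by rw [hne46 q hq, g11 j hj, e]⟩
      · exact ⟨τ.ireg 43, by omega, by rw [hq, hat46, g11']⟩
    · intro y hy t
      rw [ef, gne y (hsub y hy).2]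
      exact h.same y (hsub y hy).1 t
    · intro y hy hy' j hj
      rw [e11]
      rcases Nat.lt_succ_iff_lt_or_eq.1 (e43 ▸ hj) with hj | hj
      · rw [g11 j hj]
        exact h.pure y (hsub y hy).1 hy' j hj
      · rw [hj, g11']
        exact (hsub y hy).2.symm
    · intro t z
      rw [hepi, ← h.epi, e46]
      simp only [ef, hfl0, h47, true_imp_iff, false_imp_iff, and_true]
      rw [← h.same (σ.iarr 9 i) hfresh' t, and_assoc, ← gepi]
      constructor
      · intro h1
        refine ⟨fun q hq => ?_, ?_⟩
        · rw [← gne _ (hu q hq), ← hne46 q hq]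
          exact h1 q (by omega)
        · rw [← hat46]
          exact h1 _ (by omega)
      · rintro ⟨h1, h2⟩ q hq
        rcases Nat.lt_succ_iff_lt_or_eq.1 hq with hq | hq
        · rw [hne46 q hq, gne _ (hu q hq)]
          exact h1 q hq
        · rw [hq, hat46]
          exact h2
    · intro j hj
      rw [e15]
      rcases Nat.lt_succ_iff_lt_or_eq.1 (e43 ▸ hj) with hj | hj
      · rw [g15 j hj]
        exact h.nonneg j hj
      · rw [hj]
        exact g15'

theorem run_pairUp {σ : State} (hσ : WellFormed σ) :
    Run pairUp σ fun t τ => t ≤ 26 * σ.ireg 42 + 3 * σ.ireg 43 + 20 ∧ WellFormed τ ∧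
      (∀ t z, Epi τ t z ↔ Epi σ t z) ∧ τ.ireg 42 + τ.ireg 43 = σ.ireg 42 + σ.ireg 43 ∧
      τ.ireg 42 ≤ τ.ireg 43 + 1 := by
  refine (run_markKinked rfl rfl).seq ?_
  rintro t υ hfr ⟨ht, hmark⟩
  simp only [run_seq, run_iset, IE.eval]
  have u42 : υ.ireg 42 = σ.ireg 42 := hfr.ir 42 rfl
  have u43 : υ.ireg 43 = σ.ireg 43 := hfr.ir 43 rfl
  have u9 : υ.iarr 9 = σ.iarr 9 := hfr.ia 9 rfl
  have u11 : υ.iarr 11 = σ.iarr 11 := hfr.ia 11 rfl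
  have uf : ∀ y t, fnVal υ y t = fnVal σ y t := fun y t =>
    fnVal_congr u43 u11 (hfr.ra 12 rfl) (hfr.ra 13 rfl) (hfr.ra 14 rfl) (hfr.ra 15 rfl) t
  refine (Run.forTo' (a := 0) (n := σ.ireg 42) (fun k τ => PairInv σ k τ ∧
    ∀ j < σ.ireg 43, τ.iarr 11 j = σ.iarr 11 j) 21 (by simp) (by omega) ?_ rfl ?_ ?_).mono ?_
  · intro τ hτ
    simpa [u42] using hτ.ir 42 rfl
  · refine ⟨?_, by simp [u11]⟩
    have ef : ∀ y t, fnVal (((υ.setI 44 0).setI 46 0).setI 47 0) y t = fnVal σ y t := fun y t => by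
      rw [← uf]
      exact fnVal_congr (by simp) rfl rfl rfl rfl rfl t
    constructor <;> simp [u43, u9, u11, ef, hfr.ra 15 rfl]
    exact hσ.nonneg
  · rintro k τ - hk hτ hτk ⟨hI, h11⟩
    have e10 : τ.iarr 10 = υ.iarr 10 := by simpa using hτ.ia 10 rfl
    refine (run_pairStep hσ hk hτk hI (by rw [e10]; exact hmark k hk) h11).mono ?_
    rintro t' ω - ⟨ht', h1, h2⟩
    refine ⟨ht', ?_, by simpa using h2⟩
    have ef : ∀ y t, fnVal (ω.setI 44 (k + 1)) y t = fnVal ω y t := fun y t =>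
      fnVal_congr (by simp) rfl rfl rfl rfl rfl t
    obtain ⟨a1, a2, a3, a4, a5, a6, a7, a8, a9, a10, a11, a12, a13, a14⟩ := h1
    constructor <;> simp only [ireg_setI, iarr_setI, rarr_setI, ef, Nat.reduceEqDiff, if_false] <;>
      assumption
  · rintro t' τ hτ ⟨⟨hI, -⟩, h44, ht'⟩
    have hcard : τ.ireg 46 ≤ τ.ireg 43 := by
      choose! w hw hw' using hI.kinked
      have := Finset.card_le_card_of_injOn (s := range (τ.ireg 46)) (t := range (τ.ireg 43)) w
        (fun q hq => by simpa using hw q (by simpa using hq)) ?_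
      · simpa using this
      · intro q hq q' hq' e
        simp only [coe_range, Set.mem_Iio] at hq hq'
        exact hI.inj q hq q' hq' (by rw [← hw' q hq, ← hw' q' hq', e])
    have hc := hI.count
    have hfl := hI.flag
    have hpos := hσ.pos
    have hk := hI.kinks
    simp only [run_ite, run_seq, run_ist, run_iset, run_skip, BE.eval, IE.eval, ireg_setI,
      ireg_setIA, Nat.reduceEqDiff, if_true, if_false]
    simp only [Nat.sub_zero] at ht'
    refine ⟨fun h47 => ?_, fun h47 => ?_⟩
    · have hval' : τ.ireg 47 = 1 := by omega
      set ω := ((τ.setIA 9 (τ.ireg 46) (τ.ireg 48)).setI 46 (τ.ireg 46 + 1)).setI 42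
        (τ.ireg 46 + 1) with hω
      have e9 : ω.iarr 9 = Function.update (τ.iarr 9) (τ.ireg 46) (τ.ireg 48) := by simp [hω]
      have e42 : ω.ireg 42 = τ.ireg 46 + 1 := by simp [hω]
      have e43 : ω.ireg 43 = τ.ireg 43 := by simp [hω]
      have ef : ∀ y t, fnVal ω y t = fnVal τ y t := fun y t =>
        fnVal_congr (by simp [hω]) (by simp [hω]) rfl rfl rfl rfl t
      have hne46 : ∀ q < τ.ireg 46, ω.iarr 9 q = τ.iarr 9 q := fun q hq => by
        rw [e9, Function.update_of_ne (by omega)]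
      have hat46 : ω.iarr 9 (τ.ireg 46) = τ.ireg 48 := by rw [e9, Function.update_self]
      refine ⟨by omega, ⟨by omega, ?_, ?_⟩, fun t z => ?_, by omega, by omega⟩
      · intro q hq q' hq' e
        rcases Nat.lt_succ_iff_lt_or_eq.1 (e42 ▸ hq) with hq | hq <;>
          rcases Nat.lt_succ_iff_lt_or_eq.1 (e42 ▸ hq') with hq' | hq'
        · rw [hne46 q hq, hne46 q' hq'] at e
          exact hI.inj q hq q' hq' e
        · rw [hne46 q hq, hq', hat46] at e
          exact absurd e (hI.pend_ne hval' q hq)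
        · rw [hne46 q' hq', hq, hat46] at e
          exact absurd e.symm (hI.pend_ne hval' q' hq')
        · omega
      · rw [e43]
        simpa [hω] using hI.nonneg
      · rw [Epi, Epi, ← hI.epi, e42]
        simp only [ef, hval', true_imp_iff]
        constructor
        · intro h1
          refine ⟨fun q hq => ?_, ?_⟩
          · rw [← hne46 q hq]
            exact h1 q (by omega)
          · rw [← hat46]
            exact h1 _ (by omega)
        · rintro ⟨h1, h2⟩ q hq
          rcases Nat.lt_succ_iff_lt_or_eq.1 hq with hq | hq
          · rw [hne46 q hq]
            exact h1 q hq
          · rw [hq, hat46]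
            exact h2
    · have hval' : τ.ireg 47 = 0 := by omega
      have ef : ∀ y t, fnVal (τ.setI 42 (τ.ireg 46)) y t = fnVal τ y t := fun y t =>
        fnVal_congr (by simp) (by simp) rfl rfl rfl rfl t
      have hpos' : 0 < τ.ireg 46 := by
        by_contra h0
        have := ((hI.epi 0 (fnVal σ (σ.iarr 9 0) 0 - 1)).1
          ⟨fun q hq => by omega, fun h => by omega⟩) 0 hpos
        linarith
      refine ⟨by omega, ⟨by simpa using hpos', by simpa using hI.inj, by simpa using hI.nonneg⟩,
        fun t z => ?_, by omega, by omega⟩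
      rw [Epi, Epi, ← hI.epi]
      simp [ef, hval']

/-- Evaluates all functions at `rreg 43`; `rreg 45` is a slope there of a function that attains the
maximum. -/
def evalAt : Cmd :=
  .iset 44 (.lit 0) ;;
  forTo 44 (.reg 42)
    (.rst 16 (.ld 9 (.reg 44)) (.add (.mul (.ld 12 (.ld 9 (.reg 44))) (.reg 43))
      (.ld 13 (.ld 9 (.reg 44)))) ;;
      .rst 17 (.ld 9 (.reg 44)) (.ld 12 (.ld 9 (.reg 44)))) ;;
  .iset 44 (.lit 0) ;;
  forTo 44 (.reg 43) (.ite (.rle (.ld 14 (.reg 44)) (.reg 43))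
    (.rst 16 (.ld 11 (.reg 44)) (.add (.ld 16 (.ld 11 (.reg 44)))
      (.mul (.ld 15 (.reg 44)) (.sub (.reg 43) (.ld 14 (.reg 44))))) ;;
      .rst 17 (.ld 11 (.reg 44)) (.add (.ld 17 (.ld 11 (.reg 44))) (.ld 15 (.reg 44)))) .skip) ;;
  .rset 44 (.ld 16 (.ld 9 (.lit 0))) ;; .rset 45 (.ld 17 (.ld 9 (.lit 0))) ;;
  .iset 44 (.lit 0) ;;
  forTo 44 (.reg 42) (.ite (.rlt (.reg 44) (.ld 16 (.ld 9 (.reg 44))))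
    (.rset 44 (.ld 16 (.ld 9 (.reg 44))) ;; .rset 45 (.ld 17 (.ld 9 (.reg 44)))) .skip)

/-- The slope to the right of `p` of the function with index `y`. -/
noncomputable def fnSlope (σ : State) (y : ℕ) (p : ℝ) : ℝ :=
  σ.rarr 12 y +
    ∑ j ∈ range (σ.ireg 43), if σ.iarr 11 j = y ∧ σ.rarr 14 j ≤ p then σ.rarr 15 j else 0

theorem fnVal_add_slope_le {σ : State} (h : ∀ j < σ.ireg 43, 0 ≤ σ.rarr 15 j) (y : ℕ) (p t : ℝ) :
    fnVal σ y p + fnSlope σ y p * (t - p) ≤ fnVal σ y t := by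
  have : ∑ j ∈ range (σ.ireg 43), ((if σ.iarr 11 j = y then σ.rarr 15 j * max 0 (p - σ.rarr 14 j)
      else 0) + (if σ.iarr 11 j = y ∧ σ.rarr 14 j ≤ p then σ.rarr 15 j else 0) * (t - p)) ≤
      ∑ j ∈ range (σ.ireg 43), if σ.iarr 11 j = y then σ.rarr 15 j * max 0 (t - σ.rarr 14 j)
        else 0 := by
    refine Finset.sum_le_sum fun j hj => ?_
    have h0 := h j (by simpa using hj)
    by_cases hy : σ.iarr 11 j = y
    · simp only [hy, if_true, true_and]
      split_ifs with hp
      · rw [max_eq_right (by linarith)]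
        nlinarith [mul_le_mul_of_nonneg_left (le_max_right 0 (t - σ.rarr 14 j)) h0]
      · rw [max_eq_left (by linarith)]
        nlinarith [mul_le_mul_of_nonneg_left (le_max_left 0 (t - σ.rarr 14 j)) h0]
    · simp [hy]
  rw [Finset.sum_add_distrib, ← Finset.sum_mul] at this
  rw [fnVal, fnVal, fnSlope]
  nlinarith

theorem run_evalAt {σ : State} (hσ : WellFormed σ) :
    Run evalAt σ fun t τ => t ≤ 9 * σ.ireg 42 + 5 * σ.ireg 43 + 8 ∧
      ∀ t z, Epi σ t z → 0 ≤ τ.rreg 45 * (t - σ.rreg 43) → Epi σ (σ.rreg 43) z := by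
  set p := σ.rreg 43 with hp
  rw [evalAt, run_seq, run_iset]
  refine (Run.forTo' (a := 0) (n := σ.ireg 42) (fun k τ => ∀ q < k,
    τ.rarr 16 (σ.iarr 9 q) = σ.rarr 12 (σ.iarr 9 q) * p + σ.rarr 13 (σ.iarr 9 q) ∧
    τ.rarr 17 (σ.iarr 9 q) = σ.rarr 12 (σ.iarr 9 q)) 2
    (by simp) (by omega) ?_ rfl (by simp) ?_).seq ?_
  · intro τ hτ; simpa using hτ.ir 42 rfl
  · intro k τ _ hk hτ hτk hI
    have e9 : τ.iarr 9 = σ.iarr 9 := by simpa using hτ.ia 9 rfl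
    have e12 : τ.rarr 12 = σ.rarr 12 := by simpa using hτ.ra 12 rfl
    have e13 : τ.rarr 13 = σ.rarr 13 := by simpa using hτ.ra 13 rfl
    have e43 : τ.rreg 43 = p := by simpa using hτ.rr 43 rfl
    simp only [run_seq, run_rst, RE.eval, IE.eval, hτk, e9, e12, e13, e43, rarr_setI, rarr_setRA,
      ireg_setRA, iarr_setRA, Nat.reduceEqDiff, if_true, if_false]
    refine ⟨by omega, fun q hq => ?_⟩
    rw [Function.update_apply, Function.update_apply]
    split_ifs with h
    · rw [h]; simp
    · exact hI q (lt_of_le_of_ne (by omega) fun hqk => h (by rw [hqk]))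
  rintro t₁ σ₁ hf₁ ⟨hI₁, -, ht₁⟩
  rw [run_seq, run_iset]
  refine (Run.forTo' (a := 0) (n := σ.ireg 43) (fun k τ => ∀ q < σ.ireg 42,
    τ.rarr 16 (σ.iarr 9 q) = σ.rarr 12 (σ.iarr 9 q) * p + σ.rarr 13 (σ.iarr 9 q) +
      ∑ j ∈ range k, (if σ.iarr 11 j = σ.iarr 9 q then
        σ.rarr 15 j * max 0 (p - σ.rarr 14 j) else 0) ∧
    τ.rarr 17 (σ.iarr 9 q) = σ.rarr 12 (σ.iarr 9 q) +
      ∑ j ∈ range k, if σ.iarr 11 j = σ.iarr 9 q ∧ σ.rarr 14 j ≤ p then σ.rarr 15 j else 0) 3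
    (by simp) (by omega) ?_ rfl (by simpa using hI₁) ?_).seq ?_
  · intro τ hτ
    have := hf₁.ir 43 rfl
    have := hτ.ir 43 rfl
    simp_all
  · intro k τ _ hk hτ hτk hI
    have e11 : τ.iarr 11 = σ.iarr 11 := by simpa [hf₁.ia 11 rfl] using hτ.ia 11 rfl
    have e14 : τ.rarr 14 = σ.rarr 14 := by simpa [hf₁.ra 14 rfl] using hτ.ra 14 rfl
    have e15 : τ.rarr 15 = σ.rarr 15 := by simpa [hf₁.ra 15 rfl] using hτ.ra 15 rfl
    have e43 : τ.rreg 43 = p := by simpa [hf₁.rr 43 rfl, hp] using hτ.rr 43 rfl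
    simp only [run_ite, run_skip, run_seq, run_rst, RE.eval, BE.eval, IE.eval, hτk, e11, e14, e15,
      e43, rarr_setI, rarr_setRA, ireg_setRA, iarr_setRA, Nat.reduceEqDiff, if_true,
      if_false]
    refine ⟨fun hle => ⟨by omega, fun q hq => ?_⟩, fun hle => ⟨by omega, fun q hq => ?_⟩⟩ <;>
      rw [Finset.sum_range_succ, Finset.sum_range_succ]
    · rw [Function.update_apply, Function.update_apply]
      by_cases h : σ.iarr 9 q = σ.iarr 11 k
      · rw [if_pos h, if_pos h, if_pos h.symm, if_pos ⟨h.symm, hle⟩,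
          max_eq_right (by linarith), ← h, (hI q hq).1, (hI q hq).2]
        constructor <;> ring
      · rw [if_neg h, if_neg h, if_neg (Ne.symm h), if_neg fun h' => h h'.1.symm, add_zero, add_zero]
        exact hI q hq
    · rw [max_eq_left (by linarith), mul_zero, ite_self, if_neg fun h' => hle h'.2, add_zero,
        add_zero]
      exact hI q hq
  rintro t₂ σ₂ hf₂ ⟨hI₂, -, ht₂⟩
  have e9 : σ₂.iarr 9 = σ.iarr 9 := by
    simpa [hf₁.ia 9 rfl] using hf₂.ia 9 rfl
  have e42 : σ₂.ireg 42 = σ.ireg 42 := by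
    simpa [hf₁.ir 42 rfl] using hf₂.ir 42 rfl
  have hval : ∀ q < σ.ireg 42, σ₂.rarr 16 (σ.iarr 9 q) = fnVal σ (σ.iarr 9 q) p :=
    fun q hq => (hI₂ q hq).1
  have hslope : ∀ q < σ.ireg 42, σ₂.rarr 17 (σ.iarr 9 q) = fnSlope σ (σ.iarr 9 q) p :=
    fun q hq => (hI₂ q hq).2
  simp only [run_seq, run_rset, run_iset, RE.eval, IE.eval, rarr_setR, iarr_setR, e9]
  refine (Run.forTo' (a := 0) (n := σ.ireg 42) (fun k τ => ∃ q < σ.ireg 42,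
    τ.rreg 44 = fnVal σ (σ.iarr 9 q) p ∧ τ.rreg 45 = fnSlope σ (σ.iarr 9 q) p ∧
    ∀ q' < k, fnVal σ (σ.iarr 9 q') p ≤ τ.rreg 44) 3 (by simp) (by omega) ?_ rfl ?_ ?_).mono ?_
  · intro τ hτ; simpa [e42] using hτ.ir 42 rfl
  · exact ⟨0, hσ.pos, by simp [hval 0 hσ.pos], by simp [hslope 0 hσ.pos], by simp⟩
  · rintro k τ - hk hτ hτk ⟨q, hq, h1, h2, h3⟩
    have e9' : τ.iarr 9 = σ.iarr 9 := by simpa [e9] using hτ.ia 9 rfl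
    have e16 : τ.rarr 16 = σ₂.rarr 16 := by simpa using hτ.ra 16 rfl
    have e17 : τ.rarr 17 = σ₂.rarr 17 := by simpa using hτ.ra 17 rfl
    simp only [run_ite, run_skip, run_seq, run_rset, RE.eval, BE.eval, IE.eval, hτk, e9', e16, e17,
      rreg_setI, rreg_setR, rarr_setR, ireg_setR, iarr_setR, Nat.reduceEqDiff, if_true, if_false,
      hval k hk, hslope k hk]
    refine ⟨fun hlt => ⟨by omega, k, hk, rfl, rfl, fun q' hq' => ?_⟩,
      fun hlt => ⟨by omega, q, hq, h1, h2, fun q' hq' => ?_⟩⟩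
    · rcases Nat.lt_succ_iff_lt_or_eq.1 hq' with hq' | rfl
      · exact (h3 q' hq').trans hlt.le
      · exact le_rfl
    · rcases Nat.lt_succ_iff_lt_or_eq.1 hq' with hq' | rfl
      · exact h3 q' hq'
      · exact not_lt.1 hlt
  · rintro t₃ τ - ⟨⟨q, hq, h1, h2, h3⟩, -, ht₃⟩
    refine ⟨by simp only [Nat.sub_zero] at ht₁ ht₂ ht₃; omega, fun t z hE hs q' hq' => ?_⟩
    have a1 := h3 q' hq'
    have a2 := hE q hq
    have a3 := fnVal_add_slope_le hσ.nonneg (σ.iarr 9 q) p t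
    rw [h2] at hs
    linarith

/-- Removes the kinks that pass the test `b`, adding `rreg 46` times the line through the kink to
its owner. -/
def prune (b : BE) : Cmd :=
  .iset 46 (.lit 0) ;; .iset 44 (.lit 0) ;;
  forTo 44 (.reg 43) (.ite b
    (.rst 12 (.ld 11 (.reg 44)) (.add (.ld 12 (.ld 11 (.reg 44))) (.mul (.reg 46) (.ld 15 (.reg 44)))) ;;
      .rst 13 (.ld 11 (.reg 44)) (.sub (.ld 13 (.ld 11 (.reg 44)))
        (.mul (.reg 46) (.mul (.ld 15 (.reg 44)) (.ld 14 (.reg 44))))))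
    (.ist 11 (.reg 46) (.ld 11 (.reg 44)) ;; .rst 14 (.reg 46) (.ld 14 (.reg 44)) ;;
      .rst 15 (.reg 46) (.ld 15 (.reg 44)) ;; .iset 46 (.add (.reg 46) (.lit 1)))) ;;
  .iset 43 (.reg 46)

theorem run_prune {b : BE} {σ : State} {φ : ℝ → Prop} {D : Set ℝ}
    (hb : ∀ τ : State, τ.rreg 43 = σ.rreg 43 → (b.eval τ ↔ φ (τ.rarr 14 (τ.ireg 44))))
    (hφ : ∀ x, φ x → ∀ t ∈ D, σ.rreg 46 * (t - x) = max 0 (t - x))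
    (hnonneg : ∀ j < σ.ireg 43, 0 ≤ σ.rarr 15 j) :
    Run (prune b) σ fun t τ => t ≤ 7 * σ.ireg 43 + 5 ∧
      (∀ y, ∀ t ∈ D, fnVal τ y t = fnVal σ y t) ∧
      τ.ireg 43 + cnt φ (σ.rarr 14) 0 (σ.ireg 43) = σ.ireg 43 ∧
      ∀ j < τ.ireg 43, 0 ≤ τ.rarr 15 j := by
  rw [prune, run_seq, run_iset, run_seq, run_iset]
  set K := σ.ireg 43 with hK
  refine (Run.forTo' (a := 0) (n := K) (fun k τ =>
    τ.ireg 46 + cnt φ (σ.rarr 14) 0 k = k ∧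
    (∀ j, k ≤ j → τ.iarr 11 j = σ.iarr 11 j ∧ τ.rarr 14 j = σ.rarr 14 j ∧
      τ.rarr 15 j = σ.rarr 15 j) ∧
    (∀ j < τ.ireg 46, 0 ≤ τ.rarr 15 j) ∧
    ∀ y, ∀ t ∈ D, τ.rarr 12 y * t + τ.rarr 13 y +
      ∑ j ∈ range (τ.ireg 46), (if τ.iarr 11 j = y then τ.rarr 15 j * max 0 (t - τ.rarr 14 j)
        else 0) = σ.rarr 12 y * t + σ.rarr 13 y +
      ∑ j ∈ range k, (if σ.iarr 11 j = y then σ.rarr 15 j * max 0 (t - σ.rarr 14 j) else 0)) 5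
    (by simp) (by omega) ?_ rfl (by simp [cnt_self]) ?_).seq ?_
  · intro τ hτ; simpa using hτ.ir 43 rfl
  · rintro k τ - hk hτ hτk ⟨h1, h2, h3, h4⟩
    obtain ⟨e11, e14, e15⟩ := h2 k le_rfl
    have e43 : τ.rreg 43 = σ.rreg 43 := by simpa using hτ.rr 43 rfl
    have e46 : τ.rreg 46 = σ.rreg 46 := by simpa using hτ.rr 46 rfl
    have hb' := hb τ e43
    rw [hτk, e14] at hb'
    have hcnt := cnt_succ φ (σ.rarr 14) (Nat.zero_le k)
    simp only [run_ite, run_seq, run_rst, run_ist, run_iset, RE.eval, IE.eval, hτk, e11, e14, e15,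
      e46, hb', ireg_setI, iarr_setI, rarr_setI, ireg_setRA, rreg_setRA, iarr_setRA, rarr_setRA,
      ireg_setIA, iarr_setIA, rarr_setIA, Nat.reduceEqDiff, if_true, if_false]
    refine ⟨fun h => ⟨by omega, ?_, ?_, h3, fun y t ht => ?_⟩,
      fun h => ⟨by omega, ?_, ?_, ?_, fun y t ht => ?_⟩⟩
    · rw [if_pos h] at hcnt; omega
    · exact fun j hj => h2 j (by omega)
    · rw [Finset.sum_range_succ, ← add_assoc, ← h4 y t ht, Function.update_apply,
        Function.update_apply]
      by_cases hy : y = σ.iarr 11 k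
      · rw [if_pos hy, if_pos hy, if_pos hy.symm, ← hφ _ h t ht, ← hy]
        ring
      · rw [if_neg hy, if_neg hy, if_neg (Ne.symm hy), add_zero]
    · rw [if_neg h] at hcnt; omega
    · intro j hj
      rw [Function.update_of_ne (by omega), Function.update_of_ne (by omega),
        Function.update_of_ne (by omega)]
      exact h2 j (by omega)
    · intro j hj
      rw [Function.update_apply]
      split_ifs with hj'
      · exact hnonneg k hk
      · exact h3 j (by omega)
    · rw [Finset.sum_range_succ _ k, ← add_assoc, ← h4 y t ht, Finset.sum_range_succ,
        Function.update_self, Function.update_self, Function.update_self, ← add_assoc]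
      congr 2
      refine Finset.sum_congr rfl fun j hj => ?_
      have : j ≠ τ.ireg 46 := by rw [Finset.mem_range] at hj; omega
      simp only [Function.update_of_ne this]
  · rintro t τ hτ ⟨⟨h1, h2, h3, h4⟩, -, ht⟩
    simp only [run_iset, IE.eval, ireg_setI, rarr_setI, if_true]
    refine ⟨by omega, fun y t ht => ?_, h1, h3⟩
    exact h4 y t ht

def pruneRight : Cmd := .rset 46 (.lit 1) ;; prune (.rle (.ld 14 (.reg 44)) (.reg 43))

def pruneLeft : Cmd := .rset 46 (.lit 0) ;; prune (.rle (.reg 43) (.ld 14 (.reg 44)))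

theorem run_pruneRight {σ : State} (hnonneg : ∀ j < σ.ireg 43, 0 ≤ σ.rarr 15 j) :
    Run pruneRight σ fun t τ => t ≤ 7 * σ.ireg 43 + 6 ∧
      (∀ y t, σ.rreg 43 ≤ t → fnVal τ y t = fnVal σ y t) ∧
      τ.ireg 43 + cnt (· ≤ σ.rreg 43) (σ.rarr 14) 0 (σ.ireg 43) = σ.ireg 43 ∧
      ∀ j < τ.ireg 43, 0 ≤ τ.rarr 15 j := by
  rw [pruneRight, run_seq, run_rset]
  refine (run_prune (φ := (· ≤ σ.rreg 43)) (D := Set.Ici (σ.rreg 43)) ?_ ?_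
    (by simpa using hnonneg)).mono ?_
  · intro τ hτ
    simp only [rreg_setR, Nat.reduceEqDiff, if_false] at hτ
    simp [hτ]
  · intro x hx t ht
    rw [Set.mem_Ici] at ht
    rw [max_eq_right (by linarith)]
    simp
  · rintro t τ - ⟨h1, h2, h3⟩
    simp only [ireg_setR, rarr_setR] at h1 h3
    exact ⟨by omega, fun y t ht => h2 y t ht, h3⟩

theorem run_pruneLeft {σ : State} (hnonneg : ∀ j < σ.ireg 43, 0 ≤ σ.rarr 15 j) :
    Run pruneLeft σ fun t τ => t ≤ 7 * σ.ireg 43 + 6 ∧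
      (∀ y t, t ≤ σ.rreg 43 → fnVal τ y t = fnVal σ y t) ∧
      τ.ireg 43 + cnt (σ.rreg 43 ≤ ·) (σ.rarr 14) 0 (σ.ireg 43) = σ.ireg 43 ∧
      ∀ j < τ.ireg 43, 0 ≤ τ.rarr 15 j := by
  rw [pruneLeft, run_seq, run_rset]
  refine (run_prune (φ := (σ.rreg 43 ≤ ·)) (D := Set.Iic (σ.rreg 43)) ?_ ?_
    (by simpa using hnonneg)).mono ?_
  · intro τ hτ
    simp only [rreg_setR, Nat.reduceEqDiff, if_false] at hτ
    simp [hτ]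
  · intro x hx t ht
    rw [Set.mem_Iic] at ht
    rw [max_eq_left (by linarith)]
    simp
  · rintro t τ - ⟨h1, h2, h3⟩
    simp only [ireg_setR, rarr_setR] at h1 h3
    exact ⟨by omega, fun y t ht => h2 y t ht, h3⟩

/-- Decides on which side of the pivot `rreg 43` a minimum lies, shrinks the interval
`[rreg 40, rreg 41]` and removes the kinks on the other side. -/
def narrow : Cmd :=
  .ite (.rle (.reg 43) (.reg 40)) pruneRight
    (.ite (.rle (.reg 41) (.reg 43)) pruneLeft
      (evalAt ;; .ite (.rlt (.reg 45) (.lit 0)) (.rset 40 (.reg 43) ;; pruneRight)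
        (.rset 41 (.reg 43) ;; pruneLeft)))

/-- The problem over `[rreg 40, rreg 41]` in the state `σ` reduces to the one in `τ`. -/
structure Reduces (σ τ : State) : Prop where
  lo : σ.rreg 40 ≤ τ.rreg 40
  hi : τ.rreg 41 ≤ σ.rreg 41
  le : τ.rreg 40 ≤ τ.rreg 41
  epi : ∀ t z, τ.rreg 40 ≤ t → t ≤ τ.rreg 41 → (Epi τ t z ↔ Epi σ t z)
  red : ∀ t z, σ.rreg 40 ≤ t → t ≤ σ.rreg 41 → Epi σ t z →
    ∃ t', τ.rreg 40 ≤ t' ∧ t' ≤ τ.rreg 41 ∧ Epi σ t' z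

theorem Reduces.trans {σ τ υ : State} (h : Reduces σ τ) (h' : Reduces τ υ) : Reduces σ υ where
  lo := h.lo.trans h'.lo
  hi := h'.hi.trans h.hi
  le := h'.le
  epi t z h1 h2 := (h'.epi t z h1 h2).trans (h.epi t z (h'.lo.trans h1) (h2.trans h'.hi))
  red t z h1 h2 hE := by
    obtain ⟨t', a1, a2, a3⟩ := h.red t z h1 h2 hE
    obtain ⟨t'', b1, b2, b3⟩ := h'.red t' z a1 a2 ((h.epi t' z a1 a2).2 a3)
    exact ⟨t'', b1, b2, (h.epi t'' z (h'.lo.trans b1) (b2.trans h'.hi)).1 b3⟩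

theorem epi_congr {σ τ : State} {t : ℝ} (h42 : τ.ireg 42 = σ.ireg 42) (h9 : τ.iarr 9 = σ.iarr 9)
    (h : ∀ y, fnVal τ y t = fnVal σ y t) (z : ℝ) : Epi τ t z ↔ Epi σ t z := by
  simp only [Epi, h42, h9, h]

theorem run_narrow {σ : State} (hσ : WellFormed σ) (hle : σ.rreg 40 ≤ σ.rreg 41) :
    Run narrow σ fun t τ => t ≤ 9 * σ.ireg 42 + 12 * σ.ireg 43 + 20 ∧ WellFormed τ ∧
      Reduces σ τ ∧ τ.ireg 42 = σ.ireg 42 ∧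
      (τ.ireg 43 + cnt (· ≤ σ.rreg 43) (σ.rarr 14) 0 (σ.ireg 43) = σ.ireg 43 ∨
        τ.ireg 43 + cnt (σ.rreg 43 ≤ ·) (σ.rarr 14) 0 (σ.ireg 43) = σ.ireg 43) := by
  refine run_ite.2 ⟨fun h1 => ?_, fun h1 => run_ite.2 ⟨fun h2 => ?_, fun h2 => ?_⟩⟩
  · simp only [BE.eval, RE.eval] at h1
    refine (run_pruneRight hσ.nonneg).mono ?_
    rintro t τ hf ⟨ht, hv, hc, hn⟩
    have e42 : τ.ireg 42 = σ.ireg 42 := hf.ir 42 rfl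
    have e9 : τ.iarr 9 = σ.iarr 9 := hf.ia 9 rfl
    have e40 : τ.rreg 40 = σ.rreg 40 := hf.rr 40 rfl
    have e41 : τ.rreg 41 = σ.rreg 41 := hf.rr 41 rfl
    refine ⟨by omega, ⟨by rw [e42]; exact hσ.pos, by rw [e42, e9]; exact hσ.inj, hn⟩,
      ⟨e40.ge, e41.le, by rw [e40, e41]; exact hle, fun t z h _ => ?_, fun t z h h' hE => ?_⟩,
      e42, Or.inl hc⟩
    · exact epi_congr e42 e9 (fun y => hv y t (h1.trans (e40 ▸ h))) z
    · exact ⟨t, e40 ▸ h, e41 ▸ h', hE⟩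
  · simp only [BE.eval, RE.eval] at h2
    refine (run_pruneLeft hσ.nonneg).mono ?_
    rintro t τ hf ⟨ht, hv, hc, hn⟩
    have e42 : τ.ireg 42 = σ.ireg 42 := hf.ir 42 rfl
    have e9 : τ.iarr 9 = σ.iarr 9 := hf.ia 9 rfl
    have e40 : τ.rreg 40 = σ.rreg 40 := hf.rr 40 rfl
    have e41 : τ.rreg 41 = σ.rreg 41 := hf.rr 41 rfl
    refine ⟨by omega, ⟨by rw [e42]; exact hσ.pos, by rw [e42, e9]; exact hσ.inj, hn⟩,
      ⟨e40.ge, e41.le, by rw [e40, e41]; exact hle, fun t z _ h => ?_, fun t z h h' hE => ?_⟩,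
      e42, Or.inr hc⟩
    · exact epi_congr e42 e9 (fun y => hv y t ((e41 ▸ h).trans h2)) z
    · exact ⟨t, e40 ▸ h, e41 ▸ h', hE⟩
  · simp only [BE.eval, RE.eval, not_le] at h1 h2
    refine (run_evalAt hσ).seq ?_
    rintro t υ hf ⟨ht, hdir⟩
    have u42 : υ.ireg 42 = σ.ireg 42 := hf.ir 42 rfl
    have u43 : υ.ireg 43 = σ.ireg 43 := hf.ir 43 rfl
    have up : υ.rreg 43 = σ.rreg 43 := hf.rr 43 rfl
    have u9 : υ.iarr 9 = σ.iarr 9 := hf.ia 9 rfl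
    have u14 : υ.rarr 14 = σ.rarr 14 := hf.ra 14 rfl
    have u15 : υ.rarr 15 = σ.rarr 15 := hf.ra 15 rfl
    have u40 : υ.rreg 40 = σ.rreg 40 := hf.rr 40 rfl
    have u41 : υ.rreg 41 = σ.rreg 41 := hf.rr 41 rfl
    have uf : ∀ y t, fnVal υ y t = fnVal σ y t := fun y t =>
      fnVal_congr u43 (hf.ia 11 rfl) (hf.ra 12 rfl) (hf.ra 13 rfl) u14 u15 t
    refine run_ite.2 ⟨fun h3 => ?_, fun h3 => ?_⟩ <;>
      simp only [BE.eval, RE.eval, Int.cast_zero, not_lt] at h3 <;>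
      rw [run_seq, run_rset]
    · refine (run_pruneRight (by simpa [u43, u15] using hσ.nonneg)).mono ?_
      rintro t' τ hf' ⟨ht', hv, hc, hn⟩
      simp only [ireg_setR, rreg_setR, rarr_setR, Nat.reduceEqDiff, if_false, up, u14, u43,
        RE.eval] at ht' hv hc
      have e42 : τ.ireg 42 = σ.ireg 42 := by simpa [u42] using hf'.ir 42 rfl
      have e9 : τ.iarr 9 = σ.iarr 9 := by simpa [u9] using hf'.ia 9 rfl
      have e40 : τ.rreg 40 = σ.rreg 43 := by simpa [up] using hf'.rr 40 rfl
      have e41 : τ.rreg 41 = σ.rreg 41 := by simpa [u41] using hf'.rr 41 rfl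
      have ef : ∀ y t, σ.rreg 43 ≤ t → fnVal τ y t = fnVal σ y t := fun y t h => by
        rw [hv y t h, ← uf]
        exact fnVal_congr rfl rfl rfl rfl rfl rfl t
      refine ⟨by omega, ⟨by rw [e42]; exact hσ.pos, by rw [e42, e9]; exact hσ.inj, hn⟩,
        ⟨by rw [e40]; exact h1.le, e41.le, by rw [e40, e41]; exact h2.le, fun t z h _ => ?_,
        fun t z h h' hE => ?_⟩, e42, Or.inl hc⟩
      · exact epi_congr e42 e9 (fun y => ef y t (e40 ▸ h)) z
      · rcases le_total (σ.rreg 43) t with hp | hp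
        · exact ⟨t, e40 ▸ hp, e41 ▸ h', hE⟩
        · exact ⟨σ.rreg 43, e40.le, by rw [e41]; exact h2.le,
            hdir t z hE (mul_nonneg_of_nonpos_of_nonpos h3.le (by linarith))⟩
    · refine (run_pruneLeft (by simpa [u43, u15] using hσ.nonneg)).mono ?_
      rintro t' τ hf' ⟨ht', hv, hc, hn⟩
      simp only [ireg_setR, rreg_setR, rarr_setR, Nat.reduceEqDiff, if_false, up, u14, u43,
        RE.eval] at ht' hv hc
      have e42 : τ.ireg 42 = σ.ireg 42 := by simpa [u42] using hf'.ir 42 rfl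
      have e9 : τ.iarr 9 = σ.iarr 9 := by simpa [u9] using hf'.ia 9 rfl
      have e40 : τ.rreg 40 = σ.rreg 40 := by simpa [u40] using hf'.rr 40 rfl
      have e41 : τ.rreg 41 = σ.rreg 43 := by simpa [up] using hf'.rr 41 rfl
      have ef : ∀ y t, t ≤ σ.rreg 43 → fnVal τ y t = fnVal σ y t := fun y t h => by
        rw [hv y t h, ← uf]
        exact fnVal_congr rfl rfl rfl rfl rfl rfl t
      refine ⟨by omega, ⟨by rw [e42]; exact hσ.pos, by rw [e42, e9]; exact hσ.inj, hn⟩,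
        ⟨e40.ge, by rw [e41]; exact h2.le, by rw [e40, e41]; exact h1.le, fun t z _ h => ?_,
        fun t z h h' hE => ?_⟩, e42, Or.inr hc⟩
      · exact epi_congr e42 e9 (fun y => ef y t (e41 ▸ h)) z
      · rcases le_total t (σ.rreg 43) with hp | hp
        · exact ⟨t, e40 ▸ h, e41 ▸ hp, hE⟩
        · exact ⟨σ.rreg 43, by rw [e40]; exact h1.le, e41.ge,
            hdir t z hE (mul_nonneg h3 (by linarith))⟩

/-- `rreg 43 :=` a median of the kinks. -/
def kinkMedian : Cmd :=
  .iset 44 (.lit 0) ;; forTo 44 (.reg 43) (.rst 18 (.reg 44) (.ld 14 (.reg 44))) ;;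
  .iset 33 (.lit 0) ;; .iset 36 (.reg 43) ;; halve ;; .iset 40 (.reg 43) ;; .iset 41 (.reg 39) ;;
  select ;; .rset 43 (.reg 30)

theorem run_kinkMedian {σ : State} (hK : 0 < σ.ireg 43) :
    Run kinkMedian σ fun t τ => t ≤ 1005 * σ.ireg 43 + 20 ∧
      IsKth (σ.rarr 14) 0 (σ.ireg 43) (σ.ireg 43 / 2) (τ.rreg 43) := by
  rw [kinkMedian, run_seq, run_iset]
  refine (Run.forTo' (a := 0) (n := σ.ireg 43) (fun k τ => ∀ j < k, τ.rarr 18 j = σ.rarr 14 j) 1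
    (by simp) (by omega) ?_ rfl (by simp) ?_).seq ?_
  · intro τ hτ; simpa using hτ.ir 43 rfl
  · intro k τ _ hk hτ hτk hI
    have e14 : τ.rarr 14 = σ.rarr 14 := by simpa using hτ.ra 14 rfl
    simp only [run_rst, RE.eval, IE.eval, hτk, e14, rarr_setI, rarr_setRA, if_true]
    refine ⟨by omega, fun j hj => ?_⟩
    rw [Function.update_apply]
    split_ifs with h
    · rw [h]
    · exact hI j (by omega)
  · rintro t₁ σ₁ hf₁ ⟨hI, -, ht₁⟩
    have e43 : σ₁.ireg 43 = σ.ireg 43 := by simpa using hf₁.ir 43 rfl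
    simp only [run_seq, run_iset, IE.eval, ireg_setI, Nat.reduceEqDiff, if_false, e43]
    refine run_halve.mono ?_
    rintro t₂ σ₂ hf₂ ⟨ht₂, h39⟩
    simp only [ireg_setI, if_true, Nat.reduceEqDiff, if_false, Nat.sub_zero] at ht₂ h39 ht₁
    have e43' : σ₂.ireg 43 = σ.ireg 43 := by simpa [e43] using hf₂.ir 43 rfl
    have e18 : σ₂.rarr 18 = σ₁.rarr 18 := by simpa using hf₂.ra 18 rfl
    refine (run_select (n := σ.ireg 43) (k := σ.ireg 43 / 2) (by simp [e43']) (by simp [h39])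
      (by omega)).mono ?_
    rintro t₃ σ₃ - ⟨ht₃, h30⟩
    simp only [run_rset, RE.eval, rreg_setR, if_true]
    refine ⟨by omega, ?_⟩
    simp only [rarr_setI, e18] at h30
    rw [IsKth, cnt_congr (B := σ.rarr 14) fun i _ hi => hI i hi,
      cnt_congr (B := σ.rarr 14) fun i _ hi => hI i hi] at h30
    exact h30

/-- Minimises the maximum of the functions over `[rreg 40, rreg 41]`: a minimum point `rreg 47` and
the minimum `rreg 48`. -/
def minMax : Cmd :=
  pairUp ;; .wh (.ilt (.lit 0) (.reg 43)) (kinkMedian ;; narrow ;; pairUp) ;;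
  .ite (.rlt (.ld 12 (.ld 9 (.lit 0))) (.lit 0)) (.rset 47 (.reg 41)) (.rset 47 (.reg 40)) ;;
  .rset 48 (.add (.mul (.ld 12 (.ld 9 (.lit 0))) (.reg 47)) (.ld 13 (.ld 9 (.lit 0))))

theorem run_minMax {σ : State} (hσ : WellFormed σ) (hle : σ.rreg 40 ≤ σ.rreg 41) :
    Run minMax σ fun t τ => t ≤ 3030 * (σ.ireg 42 + σ.ireg 43) + 30 ∧
      σ.rreg 40 ≤ τ.rreg 47 ∧ τ.rreg 47 ≤ σ.rreg 41 ∧ Epi σ (τ.rreg 47) (τ.rreg 48) ∧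
      ∀ t z, σ.rreg 40 ≤ t → t ≤ σ.rreg 41 → Epi σ t z → τ.rreg 48 ≤ z := by
  have hpair : ∀ τ υ : State, Frame pairUp τ υ → (∀ t z, Epi υ t z ↔ Epi τ t z) →
      τ.rreg 40 ≤ τ.rreg 41 → Reduces τ υ := fun τ υ hf hE hl => by
    have e40 : υ.rreg 40 = τ.rreg 40 := hf.rr 40 rfl
    have e41 : υ.rreg 41 = τ.rreg 41 := hf.rr 41 rfl
    exact ⟨e40.ge, e41.le, by rw [e40, e41]; exact hl, fun t z _ _ => hE t z,
      fun t z h h' hh => ⟨t, e40 ▸ h, e41 ▸ h', hh⟩⟩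
  refine (run_pairUp hσ).seq ?_
  rintro t₁ σ₁ hf₁ ⟨ht₁, hw₁, hE₁, hs₁, hF₁⟩
  have hr₁ := hpair _ _ hf₁ hE₁ hle
  refine (Run.while (fun τ => WellFormed τ ∧ Reduces σ τ ∧ τ.ireg 42 ≤ τ.ireg 43 + 1)
    (fun τ => 3000 * (τ.ireg 42 + τ.ireg 43)) ⟨hw₁, hr₁, hF₁⟩ ?_).seq ?_
  · rintro τ - ⟨hw, hr, hF⟩ hb
    simp only [BE.eval, IE.eval] at hb
    refine (run_kinkMedian hb).seq ?_
    rintro t₂ σ₂ hf₂ ⟨ht₂, hkth⟩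
    have e42 : σ₂.ireg 42 = τ.ireg 42 := hf₂.ir 42 rfl
    have e43 : σ₂.ireg 43 = τ.ireg 43 := hf₂.ir 43 rfl
    have e40 : σ₂.rreg 40 = τ.rreg 40 := hf₂.rr 40 rfl
    have e41 : σ₂.rreg 41 = τ.rreg 41 := hf₂.rr 41 rfl
    have e9 : σ₂.iarr 9 = τ.iarr 9 := hf₂.ia 9 rfl
    have e14 : σ₂.rarr 14 = τ.rarr 14 := hf₂.ra 14 rfl
    have e15 : σ₂.rarr 15 = τ.rarr 15 := hf₂.ra 15 rfl
    have ef : ∀ y t, fnVal σ₂ y t = fnVal τ y t := fun y t =>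
      fnVal_congr e43 (hf₂.ia 11 rfl) (hf₂.ra 12 rfl) (hf₂.ra 13 rfl) e14 e15 t
    have hr₂ : Reduces τ σ₂ := ⟨e40.ge, e41.le, by rw [e40, e41]; exact hr.le,
      fun t z _ _ => epi_congr e42 e9 (fun y => ef y t) z,
      fun t z h h' hh => ⟨t, e40 ▸ h, e41 ▸ h', hh⟩⟩
    have hw₂ : WellFormed σ₂ := ⟨by rw [e42]; exact hw.pos, by rw [e42, e9]; exact hw.inj,
      by rw [e43, e15]; exact hw.nonneg⟩
    refine (run_narrow hw₂ hr₂.le).seq ?_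
    rintro t₃ σ₃ hf₃ ⟨ht₃, hw₃, hr₃, e42', hcnt⟩
    refine (run_pairUp hw₃).mono ?_
    rintro t₄ σ₄ hf₄ ⟨ht₄, hw₄, hE₄, hs₄, hF₄⟩
    refine ⟨⟨hw₄, ((hr.trans hr₂).trans hr₃).trans (hpair _ _ hf₄ hE₄ hr₃.le), hF₄⟩, ?_⟩
    have hle_cnt := cnt_le_add (τ.rarr 14) 0 (τ.ireg 43) (σ₂.rreg 43)
    obtain ⟨hk1, hk2⟩ := hkth
    rw [e14, e43] at hcnt
    rcases hcnt with hcnt | hcnt <;> omega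
  · rintro t₂ τ hf₂ ⟨⟨hw, hr, hF⟩, hb, ht₂⟩
    simp only [BE.eval, IE.eval, not_lt, nonpos_iff_eq_zero] at hb
    have h42 : τ.ireg 42 = 1 := by have := hw.pos; omega
    set y := τ.iarr 9 0 with hy
    have hval : ∀ t, fnVal τ y t = τ.rarr 12 y * t + τ.rarr 13 y := fun t =>
      fnVal_of_pure (by rw [hb]; intro j hj; omega) t
    have hE : ∀ t z, Epi τ t z ↔ τ.rarr 12 y * t + τ.rarr 13 y ≤ z := fun t z => by
      rw [Epi, h42]
      refine ⟨fun h => by rw [← hval]; exact h 0 (by omega), fun h q hq => ?_⟩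
      obtain rfl : q = 0 := by omega
      rw [← hy, hval]
      exact h
    have hfin : ∀ s, τ.rreg 40 ≤ s → s ≤ τ.rreg 41 →
        (∀ t, τ.rreg 40 ≤ t → t ≤ τ.rreg 41 → τ.rarr 12 y * s ≤ τ.rarr 12 y * t) →
        σ.rreg 40 ≤ s ∧ s ≤ σ.rreg 41 ∧ Epi σ s (τ.rarr 12 y * s + τ.rarr 13 y) ∧
        ∀ t z, σ.rreg 40 ≤ t → t ≤ σ.rreg 41 → Epi σ t z →
          τ.rarr 12 y * s + τ.rarr 13 y ≤ z := by
      intro s h1 h2 h3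
      refine ⟨hr.lo.trans h1, h2.trans hr.hi, (hr.epi s _ h1 h2).1 ((hE _ _).2 le_rfl), ?_⟩
      intro t z h4 h5 h6
      obtain ⟨t', a1, a2, a3⟩ := hr.red t z h4 h5 h6
      have := (hE _ _).1 ((hr.epi t' z a1 a2).2 a3)
      have := h3 t' a1 a2
      linarith
    simp only [run_seq, run_ite, run_rset, RE.eval, BE.eval, IE.eval, rreg_setR, rarr_setR,
      iarr_setR, Int.cast_zero, Nat.reduceEqDiff, if_true, if_false, ← hy]
    refine ⟨fun h => ⟨by omega, hfin _ hr.le le_rfl fun t _ h2 => ?_⟩,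
      fun h => ⟨by omega, hfin _ le_rfl hr.le fun t h1 _ => ?_⟩⟩
    · exact mul_le_mul_of_nonpos_left h2 h.le
    · exact mul_le_mul_of_nonneg_left h1 (not_lt.1 h)

end RAMLang

namespace Network

variable {N : Network}

theorem Walk.nonneg (hN : N.Valid) {i j : Fin N.n} {L : ℝ} (h : N.Walk i j L) : 0 ≤ L := by
  induction h with
  | nil => exact le_rfl
  | fwd e _ ih => exact add_nonneg (hN.len_pos e).le ih
  | bwd e _ ih => exact add_nonneg (hN.len_pos e).le ih

theorem Walk.trans {i j k : Fin N.n} {L M : ℝ} (h : N.Walk i j L) (h' : N.Walk j k M) :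
    N.Walk i k (L + M) := by
  induction h with
  | nil => simpa using h'
  | fwd e _ ih => rw [add_assoc]; exact (ih h').fwd e
  | bwd e _ ih => rw [add_assoc]; exact (ih h').bwd e

theorem Walk.symm {i j : Fin N.n} {L : ℝ} (h : N.Walk i j L) : N.Walk j i L := by
  induction h with
  | nil i => exact .nil i
  | fwd e _ ih =>
    have := ih.trans (.bwd e (.nil _))
    rwa [add_zero, add_comm] at this
  | bwd e _ ih =>
    have := ih.trans (.fwd e (.nil _))
    rwa [add_zero, add_comm] at this

theorem walk_bddBelow (hN : N.Valid) (i j : Fin N.n) : BddBelow {L | N.Walk i j L} :=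
  ⟨0, fun _ h => h.nonneg hN⟩

theorem nodeDist_le (hN : N.Valid) {i j : Fin N.n} {L : ℝ} (h : N.Walk i j L) :
    N.nodeDist i j ≤ L :=
  csInf_le (walk_bddBelow hN i j) h

theorem nodeDist_nonneg (hN : N.Valid) (i j : Fin N.n) : 0 ≤ N.nodeDist i j :=
  Real.sInf_nonneg fun _ h => h.nonneg hN

theorem nodeDist_self (hN : N.Valid) (i : Fin N.n) : N.nodeDist i i = 0 :=
  le_antisymm (nodeDist_le hN (.nil i)) (nodeDist_nonneg hN i i)

theorem nodeDist_comm (i j : Fin N.n) : N.nodeDist i j = N.nodeDist j i :=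
  congrArg sInf (Set.ext fun _ => ⟨Walk.symm, Walk.symm⟩)

theorem nodeDist_src_le (hN : N.Valid) (e : Fin N.m) (j : Fin N.n) :
    N.nodeDist (N.src e) j ≤ N.len e + N.nodeDist (N.dst e) j := by
  rw [← sub_le_iff_le_add']
  exact le_csInf (hN.connected _ _) fun L h => by
    have := nodeDist_le hN (Walk.fwd e h)
    linarith

theorem nodeDist_dst_le (hN : N.Valid) (e : Fin N.m) (j : Fin N.n) :
    N.nodeDist (N.dst e) j ≤ N.len e + N.nodeDist (N.src e) j := by
  rw [← sub_le_iff_le_add']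
  exact le_csInf (hN.connected _ _) fun L h => by
    have := nodeDist_le hN (Walk.bwd e h)
    linarith

/-- A shortest path to another node starts with an edge. -/
theorem exists_first_edge (hN : N.Valid) {i j : Fin N.n} (hij : i ≠ j) :
    ∃ e, (N.src e = i ∧ N.nodeDist i j = N.len e + N.nodeDist (N.dst e) j) ∨
      (N.dst e = i ∧ N.nodeDist i j = N.len e + N.nodeDist (N.src e) j) := by
  classical
  let A : Finset ℝ := (Finset.univ.filter fun e => N.src e = i).image
      (fun e => N.len e + N.nodeDist (N.dst e) j) ∪
    (Finset.univ.filter fun e => N.dst e = i).image (fun e => N.len e + N.nodeDist (N.src e) j)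
  have hmem : ∀ L, N.Walk i j L → ∃ a ∈ A, a ≤ L := by
    intro L h
    cases h with
    | nil => exact absurd rfl hij
    | fwd e h => exact ⟨N.len e + N.nodeDist (N.dst e) j,
        Finset.mem_union_left _ (Finset.mem_image.2 ⟨e, by simp, rfl⟩),
        by simpa using nodeDist_le hN h⟩
    | bwd e h => exact ⟨N.len e + N.nodeDist (N.src e) j,
        Finset.mem_union_right _ (Finset.mem_image.2 ⟨e, by simp, rfl⟩),
        by simpa using nodeDist_le hN h⟩
  obtain ⟨L₀, h₀⟩ := hN.connected i j
  obtain ⟨a₀, ha₀, -⟩ := hmem L₀ h₀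
  obtain ⟨a, ha, hmin⟩ := A.exists_min_image id ⟨a₀, ha₀⟩
  have hle : a ≤ N.nodeDist i j := le_csInf ⟨L₀, h₀⟩ fun L h => by
    obtain ⟨b, hb, hbL⟩ := hmem L h
    exact (hmin b hb).trans hbL
  rw [Finset.mem_union, Finset.mem_image, Finset.mem_image] at ha
  rcases ha with ⟨e, he, rfl⟩ | ⟨e, he, rfl⟩
  · obtain rfl : N.src e = i := by simpa using he
    exact ⟨e, .inl ⟨rfl, le_antisymm (nodeDist_src_le hN e j) hle⟩⟩
  · obtain rfl : N.dst e = i := by simpa using he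
    exact ⟨e, .inr ⟨rfl, le_antisymm (nodeDist_dst_le hN e j) hle⟩⟩

theorem n_le (hN : N.Valid) : N.n ≤ 2 * N.m := by
  have h0 : 0 < N.m := hN.m_pos
  have hs : Function.Surjective (Sum.elim N.src N.dst) := by
    intro i
    by_cases h : i = N.src ⟨0, h0⟩
    · exact ⟨.inl _, h.symm⟩
    · obtain ⟨e, ⟨he, -⟩ | ⟨he, -⟩⟩ := exists_first_edge hN h
      · exact ⟨.inl e, he⟩
      · exact ⟨.inr e, he⟩
  simpa [two_mul] using Fintype.card_le_of_surjective _ hs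

end Network

/-- A network given by functions on `ℕ`, together with its node distances. -/
structure Inst where
  n : ℕ
  m : ℕ
  S : ℕ → ℕ
  T : ℕ → ℕ
  L : ℕ → ℝ
  lb : ℕ → ℝ
  ub : ℕ → ℝ
  R : ℝ
  D : ℕ → ℕ → ℝ

namespace Inst

structure Good (I : Inst) : Prop where
  m_pos : 0 < I.m
  n_le : I.n ≤ 2 * I.m
  S_lt : ∀ {e}, e < I.m → I.S e < I.n
  T_lt : ∀ {e}, e < I.m → I.T e < I.n
  L_pos : ∀ {e}, e < I.m → 0 < I.L e
  R_pos : 0 < I.R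
  lb_le_ub : ∀ {e}, e < I.m → I.lb e ≤ I.ub e
  D_self : ∀ {i}, i < I.n → I.D i i = 0
  D_comm : ∀ {i j}, i < I.n → j < I.n → I.D i j = I.D j i
  D_edge : ∀ {e}, e < I.m → I.D (I.S e) (I.T e) = I.L e
  D_S_le : ∀ {e j}, e < I.m → j < I.n → I.D (I.S e) j ≤ I.L e + I.D (I.T e) j
  D_T_le : ∀ {e j}, e < I.m → j < I.n → I.D (I.T e) j ≤ I.L e + I.D (I.S e) j
  D_step : ∀ {i j}, i < I.n → j < I.n → i ≠ j → ∃ e < I.m,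
    (I.S e = i ∧ I.D i j = I.L e + I.D (I.T e) j) ∨ (I.T e = i ∧ I.D i j = I.L e + I.D (I.S e) j)

variable (I : Inst)

/-- Distance from `(e, t)` to the node `i` through the first endnode of `e`. -/
noncomputable def u (e i : ℕ) (t : ℝ) : ℝ := t * I.L e + I.D (I.S e) i

/-- Distance from `(e, t)` to the node `i` through the second endnode of `e`. -/
noncomputable def v (e i : ℕ) (t : ℝ) : ℝ := (1 - t) * I.L e + I.D (I.T e) i

noncomputable def d (e i : ℕ) (t : ℝ) : ℝ := min (I.u e i t) (I.v e i t)

/-- The covered part of the edge `e` from the point `(x, t)`. -/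
noncomputable def cv (x e : ℕ) (t : ℝ) : ℝ :=
  if x = e then min 1 (t + I.R / I.L e) - max 0 (t - I.R / I.L e)
  else min 1 (max 0 ((I.R - I.d x (I.S e) t) / I.L e) + max 0 ((I.R - I.d x (I.T e) t) / I.L e))

noncomputable def psi (e : ℕ) (z : ℝ) : ℝ := if 0 ≤ z then I.ub e * z else I.lb e * z

noncomputable def reg (x : ℕ) (t : ℝ) (y : ℕ) (s : ℝ) : ℝ :=
  ∑ e ∈ Finset.range I.m, I.psi e (I.cv y e s - I.cv x e t)

/-- Network intersect points and bottleneck points of the node `i`. -/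
def NodeCond (x i : ℕ) (t : ℝ) : Prop :=
  I.d x i t = I.R ∨ (0 < t ∧ t < 1 ∧ I.u x i t = I.v x i t)

/-- Exact coverage points for the edge `e`. -/
def EdgeCond (x e : ℕ) (t : ℝ) : Prop :=
  x ≠ e ∧ 0 < t ∧ t < 1 ∧
  ((I.u x (I.S e) t + I.u x (I.T e) t = 2 * I.R - I.L e ∧ I.u x (I.S e) t < I.v x (I.S e) t ∧
    I.u x (I.T e) t < I.v x (I.T e) t ∧ I.R - I.L e < I.u x (I.S e) t ∧ I.u x (I.S e) t < I.R) ∨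
   (I.v x (I.S e) t + I.v x (I.T e) t = 2 * I.R - I.L e ∧ I.v x (I.S e) t < I.u x (I.S e) t ∧
    I.v x (I.T e) t < I.u x (I.T e) t ∧ I.R - I.L e < I.v x (I.S e) t ∧ I.v x (I.S e) t < I.R))

/-- The partition points on the edge `x`. -/
def PP (x : ℕ) : Set ℝ :=
  {t | 0 ≤ t ∧ t ≤ 1 ∧ (t = 0 ∨ t = 1 ∨ (∃ i < I.n, I.NodeCond x i t) ∨
    ∃ e < I.m, I.EdgeCond x e t)}

noncomputable def tu (x i : ℕ) : ℝ := (I.R - I.D (I.S x) i) / I.L x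
noncomputable def tv (x i : ℕ) : ℝ := 1 - (I.R - I.D (I.T x) i) / I.L x
noncomputable def tb (x i : ℕ) : ℝ := (I.L x + I.D (I.T x) i - I.D (I.S x) i) / (2 * I.L x)
noncomputable def eu (x e : ℕ) : ℝ :=
  (2 * I.R - I.L e - I.D (I.S x) (I.S e) - I.D (I.S x) (I.T e)) / (2 * I.L x)
noncomputable def ev (x e : ℕ) : ℝ :=
  1 - (2 * I.R - I.L e - I.D (I.T x) (I.S e) - I.D (I.T x) (I.T e)) / (2 * I.L x)

variable {I}

theorem u_eq_iff {x i : ℕ} (hL : 0 < I.L x) {t c : ℝ} :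
    I.u x i t = c ↔ t = (c - I.D (I.S x) i) / I.L x := by
  rw [u, eq_div_iff hL.ne']; constructor <;> intro h <;> linarith

theorem v_eq_iff {x i : ℕ} (hL : 0 < I.L x) {t c : ℝ} :
    I.v x i t = c ↔ t = 1 - (c - I.D (I.T x) i) / I.L x := by
  rw [eq_comm (a := t), sub_eq_iff_eq_add, ← sub_eq_iff_eq_add', eq_div_iff hL.ne', v]
  constructor <;> intro h <;> linarith

theorem u_eq_v_iff {x i : ℕ} (hL : 0 < I.L x) {t : ℝ} :
    I.u x i t = I.v x i t ↔ t = I.tb x i := by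
  rw [u, v, tb, eq_div_iff (by positivity)]; constructor <;> intro h <;> linarith

theorem nodeCond_cand {x i : ℕ} (hL : 0 < I.L x) {t : ℝ} (h : I.NodeCond x i t) :
    t = I.tu x i ∨ t = I.tv x i ∨ t = I.tb x i := by
  rcases h with h | ⟨-, -, h⟩
  · rw [d] at h
    rcases min_choice (I.u x i t) (I.v x i t) with h' | h' <;> rw [h'] at h
    · exact .inl ((u_eq_iff hL).1 h)
    · exact .inr (.inl ((v_eq_iff hL).1 h))
  · exact .inr (.inr ((u_eq_v_iff hL).1 h))

theorem edgeCond_cand {x e : ℕ} (hL : 0 < I.L x) {t : ℝ} (h : I.EdgeCond x e t) :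
    t = I.eu x e ∨ t = I.ev x e := by
  rcases h with ⟨-, -, -, ⟨h, -⟩ | ⟨h, -⟩⟩
  · left; rw [eu, eq_div_iff (by positivity)]; simp only [u] at h; linarith
  · right
    rw [ev, eq_comm (a := t), sub_eq_iff_eq_add, ← sub_eq_iff_eq_add', eq_div_iff (by positivity)]
    simp only [v] at h; linarith

def AffOn (f : ℝ → ℝ) (a b : ℝ) : Prop := ∃ p q, ∀ t ∈ Set.Icc a b, f t = p * t + q

theorem affine_sign {p q a b : ℝ} (h : ∀ t, a < t → t < b → p * t + q ≠ 0) :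
    (∀ t ∈ Set.Icc a b, 0 ≤ p * t + q) ∨ (∀ t ∈ Set.Icc a b, p * t + q ≤ 0) := by
  by_contra hcon
  push Not at hcon
  obtain ⟨⟨s, hs, hs'⟩, ⟨r, hr, hr'⟩⟩ := hcon
  have hne : p ≠ 0 := by rintro rfl; linarith
  have key : p * (-q / p) + q = 0 := by field_simp; ring
  refine h (-q / p) ?_ ?_ key
  · by_contra hle
    push Not at hle
    rcases lt_or_gt_of_ne hne with hp | hp
    · nlinarith [hs.1, hr.1]
    · nlinarith [hs.1, hr.1]
  · by_contra hle
    push Not at hle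
    rcases lt_or_gt_of_ne hne with hp | hp
    · nlinarith [hs.2, hr.2]
    · nlinarith [hs.2, hr.2]

theorem affine_pos {p q a b : ℝ} (hp : p ≠ 0) (h : ∀ t ∈ Set.Icc a b, 0 ≤ p * t + q) {t : ℝ}
    (h1 : a < t) (h2 : t < b) : 0 < p * t + q := by
  rcases lt_or_gt_of_ne hp with hp | hp
  · have := h b ⟨(h1.trans h2).le, le_rfl⟩; nlinarith
  · have := h a ⟨le_rfl, (h1.trans h2).le⟩; nlinarith

/-- The points at which the slope of `cv x e` may change. -/
noncomputable def breaks (I : Inst) (x e : ℕ) : Finset ℝ :=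
  {I.tu x (I.S e), I.tv x (I.S e), I.tb x (I.S e), I.tu x (I.T e), I.tv x (I.T e), I.tb x (I.T e),
    I.eu x e, I.ev x e}

theorem card_breaks (x e : ℕ) : (I.breaks x e).card ≤ 8 := by
  rw [breaks]
  refine (Finset.card_insert_le _ _).trans (Nat.succ_le_succ ?_)
  refine (Finset.card_insert_le _ _).trans (Nat.succ_le_succ Finset.card_le_six)

theorem d_S_self (hI : I.Good) {x : ℕ} (hx : x < I.m) {t : ℝ} (ht : t ≤ 1) :
    I.d x (I.S x) t = t * I.L x := by
  have hL := hI.L_pos hx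
  rw [d, u, v, hI.D_self (hI.S_lt hx), hI.D_comm (hI.T_lt hx) (hI.S_lt hx), hI.D_edge hx,
    add_zero, min_eq_left]
  nlinarith

theorem d_T_self (hI : I.Good) {x : ℕ} (hx : x < I.m) {t : ℝ} (ht : 0 ≤ t) :
    I.d x (I.T x) t = (1 - t) * I.L x := by
  have hL := hI.L_pos hx
  rw [d, u, v, hI.D_self (hI.T_lt hx), hI.D_edge hx, add_zero, min_eq_right]
  nlinarith

theorem mem_PP_of_d_eq {x i : ℕ} (hi : i < I.n) {t : ℝ} (h0 : 0 ≤ t) (h1 : t ≤ 1)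
    (h : I.d x i t = I.R) : t ∈ I.PP x :=
  ⟨h0, h1, .inr (.inr (.inl ⟨i, hi, .inl h⟩))⟩

theorem d_S_le (hI : I.Good) {x e : ℕ} (hx : x < I.m) (he : e < I.m) (t : ℝ) :
    I.d x (I.S e) t ≤ I.L e + I.d x (I.T e) t := by
  have h1 := hI.D_S_le he (hI.S_lt hx)
  have h2 := hI.D_S_le he (hI.T_lt hx)
  rw [hI.D_comm (hI.S_lt he) (hI.S_lt hx), hI.D_comm (hI.T_lt he) (hI.S_lt hx)] at h1
  rw [hI.D_comm (hI.S_lt he) (hI.T_lt hx), hI.D_comm (hI.T_lt he) (hI.T_lt hx)] at h2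
  rw [d, d, ← min_add_add_left]
  exact min_le_min (by simp only [u]; linarith) (by simp only [v]; linarith)

theorem d_T_le (hI : I.Good) {x e : ℕ} (hx : x < I.m) (he : e < I.m) (t : ℝ) :
    I.d x (I.T e) t ≤ I.L e + I.d x (I.S e) t := by
  have h1 := hI.D_T_le he (hI.S_lt hx)
  have h2 := hI.D_T_le he (hI.T_lt hx)
  rw [hI.D_comm (hI.S_lt he) (hI.S_lt hx), hI.D_comm (hI.T_lt he) (hI.S_lt hx)] at h1
  rw [hI.D_comm (hI.S_lt he) (hI.T_lt hx), hI.D_comm (hI.T_lt he) (hI.T_lt hx)] at h2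
  rw [d, d, ← min_add_add_left]
  exact min_le_min (by simp only [u]; linarith) (by simp only [v]; linarith)

/-- Away from the break points of a node, its distance is a strict minimum of affine functions. -/
theorem d_shape (hI : I.Good) {x i : ℕ} (hx : x < I.m) {a b : ℝ} (ha : 0 ≤ a)
    (hb : b ≤ 1) (hno : ∀ t, a < t → t < b → ¬ I.NodeCond x i t) :
    ((∀ t ∈ Set.Icc a b, I.d x i t = I.u x i t) ∧
        ∀ t, a < t → t < b → I.u x i t < I.v x i t) ∨
      ((∀ t ∈ Set.Icc a b, I.d x i t = I.v x i t) ∧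
        ∀ t, a < t → t < b → I.v x i t < I.u x i t) := by
  have hL := hI.L_pos hx
  set q := I.L x + I.D (I.T x) i - I.D (I.S x) i with hq
  have e1 : ∀ t, I.v x i t - I.u x i t = (-2 * I.L x) * t + q := fun t => by
    simp only [u, v, hq]; ring
  have e2 : ∀ t, I.u x i t - I.v x i t = (2 * I.L x) * t + -q := fun t => by
    simp only [u, v, hq]; ring
  have hne : ∀ t, a < t → t < b → (-2 * I.L x) * t + q ≠ 0 := fun t h1 h2 h => by
    rw [← e1] at h
    exact hno t h1 h2 (.inr ⟨by linarith, by linarith, by linarith⟩)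
  rcases affine_sign hne with h | h
  · left
    refine ⟨fun t ht => ?_, fun t h1 h2 => ?_⟩
    · have := h t ht; rw [← e1] at this
      exact min_eq_left (by linarith)
    · have := affine_pos (by nlinarith) h h1 h2; rw [← e1] at this; linarith
  · right
    have h' : ∀ t ∈ Set.Icc a b, 0 ≤ (2 * I.L x) * t + -q := fun t ht => by
      have := h t ht; rw [← e2]; rw [← e1] at this; linarith
    refine ⟨fun t ht => ?_, fun t h1 h2 => ?_⟩
    · have := h' t ht; rw [← e2] at this
      exact min_eq_right (by linarith)
    · have := affine_pos (by nlinarith) h' h1 h2; rw [← e2] at this; linarith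

/-- An affine function of nonzero slope, `R - d`, without zeros, cut off at `0`. -/
theorem cut_shape {f : ℝ → ℝ} {p q a b : ℝ} (hp : p ≠ 0)
    (hf : ∀ t ∈ Set.Icc a b, f t = p * t + q) (hno : ∀ t, a < t → t < b → f t ≠ 0) :
    (∀ t ∈ Set.Icc a b, max 0 (f t) = p * t + q ∧ 0 ≤ f t) ∧ (∀ t, a < t → t < b → 0 < f t) ∨
      ∀ t ∈ Set.Icc a b, max 0 (f t) = 0 ∧ f t ≤ 0 := by
  have hne : ∀ t, a < t → t < b → p * t + q ≠ 0 := fun t h1 h2 => by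
    rw [← hf t ⟨h1.le, h2.le⟩]; exact hno t h1 h2
  rcases affine_sign hne with h | h
  · left
    refine ⟨fun t ht => ?_, fun t h1 h2 => ?_⟩
    · have := h t ht
      rw [← hf t ht] at this ⊢
      exact ⟨max_eq_right this, this⟩
    · rw [hf t ⟨h1.le, h2.le⟩]; exact affine_pos hp h h1 h2
  · right
    intro t ht
    have := h t ht
    rw [← hf t ht] at this
    exact ⟨max_eq_left this, this⟩

theorem AffOn.min_one {f : ℝ → ℝ} {p q a b : ℝ} (hf : ∀ t ∈ Set.Icc a b, f t = p * t + q)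
    (hno : p ≠ 0 → ∀ t, a < t → t < b → f t ≠ 1) : AffOn (fun t => min 1 (f t)) a b := by
  by_cases hp : p = 0
  · exact ⟨0, min 1 q, fun t ht => by simp [hf t ht, hp]⟩
  · have hne : ∀ t, a < t → t < b → p * t + (q - 1) ≠ 0 := fun t h1 h2 h => by
      refine hno hp t h1 h2 ?_
      rw [hf t ⟨h1.le, h2.le⟩]; linarith
    rcases affine_sign hne with h | h
    · exact ⟨0, 1, fun t ht => by
        have := h t ht; simp only [hf t ht]; rw [min_eq_left (by linarith)]; ring⟩
    · exact ⟨p, q, fun t ht => by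
        have := h t ht; simp only [hf t ht]; rw [min_eq_right (by linarith)]⟩

/-- The covered part of an edge is affine between partition points. -/
theorem cv_affOn (hI : I.Good) {x e : ℕ} (hx : x < I.m) (he : e < I.m) {a b : ℝ} (ha : 0 ≤ a)
    (hb : b ≤ 1) (hno : ∀ t ∈ I.PP x, t ∈ I.breaks x e → a < t → ¬ t < b) :
    AffOn (I.cv x e) a b := by
  have hL := hI.L_pos hx
  have hl := hI.L_pos he
  have hR := hI.R_pos
  by_cases hxe : x = e
  · subst hxe
    have hρ : 0 < I.R / I.L x := by positivity
    have h1 : ∀ t, a < t → t < b → t - I.R / I.L x ≠ 0 := fun t h1 h2 h => by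
      have ht : t = I.R / I.L x := by linarith
      refine hno t (mem_PP_of_d_eq (hI.S_lt hx) (by linarith) (by linarith) ?_) ?_ h1 h2
      · rw [d_S_self hI hx (by linarith), ht]; field_simp
      · have : t = I.tu x (I.S x) := by rw [tu, hI.D_self (hI.S_lt hx), ht, sub_zero]
        simp [breaks, ← this]
    have h2 : ∀ t, a < t → t < b → t + I.R / I.L x ≠ 1 := fun t h1 h2 h => by
      have ht : t = 1 - I.R / I.L x := by linarith
      refine hno t (mem_PP_of_d_eq (hI.T_lt hx) (by linarith) (by linarith) ?_) ?_ h1 h2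
      · rw [d_T_self hI hx (by linarith), ht]; field_simp; ring
      · have : t = I.tv x (I.T x) := by rw [tv, hI.D_self (hI.T_lt hx), ht, sub_zero]
        simp [breaks, ← this]
    obtain ⟨p, q, hpq⟩ := AffOn.min_one (f := fun t => t + I.R / I.L x) (p := 1)
      (q := I.R / I.L x) (a := a) (b := b) (fun t _ => by ring) (fun _ => h2)
    simp only at hpq
    rcases cut_shape (f := fun t => t - I.R / I.L x) (p := 1) (q := -(I.R / I.L x)) (a := a)
      (b := b) one_ne_zero (fun t _ => by ring) h1 with ⟨h, -⟩ | h
    · exact ⟨p - 1, q + I.R / I.L x, fun t ht => by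
        rw [cv, if_pos rfl, hpq t ht, (h t ht).1]; ring⟩
    · exact ⟨p, q, fun t ht => by rw [cv, if_pos rfl, hpq t ht, (h t ht).1]; ring⟩
  · have hS : ∀ t, a < t → t < b → ¬ I.NodeCond x (I.S e) t := fun t h1 h2 h => by
      refine hno t ⟨by linarith, by linarith, .inr (.inr (.inl ⟨_, hI.S_lt he, h⟩))⟩ ?_ h1 h2
      rcases nodeCond_cand hL h with h | h | h <;> simp [breaks, ← h]
    have hT : ∀ t, a < t → t < b → ¬ I.NodeCond x (I.T e) t := fun t h1 h2 h => by
      refine hno t ⟨by linarith, by linarith, .inr (.inr (.inl ⟨_, hI.T_lt he, h⟩))⟩ ?_ h1 h2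
      rcases nodeCond_cand hL h with h | h | h <;> simp [breaks, ← h]
    have hE : ∀ t, a < t → t < b → ¬ I.EdgeCond x e t := fun t h1 h2 h => by
      refine hno t ⟨by linarith, by linarith, .inr (.inr (.inr ⟨_, he, h⟩))⟩ ?_ h1 h2
      rcases edgeCond_cand hL h with h | h <;> simp [breaks, ← h]
    have hw : 0 < I.L x / I.L e := by positivity
    have shape : ∀ i, (∀ t, a < t → t < b → ¬ I.NodeCond x i t) →
        ∃ p q : ℝ, (p = -(I.L x / I.L e) ∨ p = I.L x / I.L e) ∧
          (∀ t ∈ Set.Icc a b, (I.R - I.d x i t) / I.L e = p * t + q) ∧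
          (p = -(I.L x / I.L e) → ∀ t, a < t → t < b → I.d x i t = I.u x i t ∧
            I.u x i t < I.v x i t) ∧
          (p = I.L x / I.L e → ∀ t, a < t → t < b → I.d x i t = I.v x i t ∧
            I.v x i t < I.u x i t) := by
      intro i hi
      rcases d_shape hI hx ha hb hi with ⟨h1, h2⟩ | ⟨h1, h2⟩
      · refine ⟨-(I.L x / I.L e), (I.R - I.D (I.S x) i) / I.L e, .inl rfl, fun t ht => ?_,
          fun _ t h h' => ⟨h1 t ⟨h.le, h'.le⟩, h2 t h h'⟩, fun h => by linarith⟩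
        rw [h1 t ht, u]; field_simp; ring
      · refine ⟨I.L x / I.L e, (I.R - I.L x - I.D (I.T x) i) / I.L e, .inr rfl, fun t ht => ?_,
          fun h => by linarith, fun _ t h h' => ⟨h1 t ⟨h.le, h'.le⟩, h2 t h h'⟩⟩
        rw [h1 t ht, v]; field_simp; ring
    obtain ⟨p, q, hp, hpq, hpu, hpv⟩ := shape _ hS
    obtain ⟨p', q', hp', hpq', hpu', hpv'⟩ := shape _ hT
    have hp0 : p ≠ 0 := by rcases hp with rfl | rfl <;> [exact neg_ne_zero.2 hw.ne'; exact hw.ne']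
    have hp0' : p' ≠ 0 := by
      rcases hp' with rfl | rfl <;> [exact neg_ne_zero.2 hw.ne'; exact hw.ne']
    have hz : ∀ i, (∀ t, a < t → t < b → ¬ I.NodeCond x i t) → ∀ t, a < t → t < b →
        (I.R - I.d x i t) / I.L e ≠ 0 := fun i hi t h1 h2 h => by
      rw [div_eq_zero_iff] at h
      rcases h with h | h
      · exact hi t h1 h2 (.inl (by linarith))
      · exact hl.ne' h
    have hcv : I.cv x e = fun t => min 1 (max 0 ((I.R - I.d x (I.S e) t) / I.L e) +
      max 0 ((I.R - I.d x (I.T e) t) / I.L e)) := by funext t; rw [cv, if_neg hxe]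
    rw [hcv]
    rcases cut_shape hp0 hpq (hz _ hS) with ⟨hA, hA'⟩ | hA <;>
      rcases cut_shape hp0' hpq' (hz _ hT) with ⟨hB, hB'⟩ | hB
    · refine AffOn.min_one (p := p + p') (q := q + q')
        (fun t ht => by rw [(hA t ht).1, (hB t ht).1]; ring) fun hne t h1 h2 h => ?_
      have ht : t ∈ Set.Icc a b := ⟨h1.le, h2.le⟩
      have hs := hA' t h1 h2
      have hs' := hB' t h1 h2
      rw [max_eq_right hs.le, max_eq_right hs'.le, ← add_div, div_eq_one_iff_eq hl.ne'] at h
      rw [div_pos_iff_of_pos_right hl] at hs hs'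
      rcases hp with hp | hp <;> rcases hp' with hp' | hp'
      · obtain ⟨e1, e2⟩ := hpu hp t h1 h2
        obtain ⟨e3, e4⟩ := hpu' hp' t h1 h2
        exact hE t h1 h2 ⟨hxe, by linarith, by linarith, .inl ⟨by linarith, e2, e4, by linarith,
          by linarith⟩⟩
      · exact hne (by rw [hp, hp']; ring)
      · exact hne (by rw [hp, hp']; ring)
      · obtain ⟨e1, e2⟩ := hpv hp t h1 h2
        obtain ⟨e3, e4⟩ := hpv' hp' t h1 h2
        exact hE t h1 h2 ⟨hxe, by linarith, by linarith, .inr ⟨by linarith, e2, e4, by linarith,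
          by linarith⟩⟩
    · refine AffOn.min_one (p := p) (q := q)
        (fun t ht => by rw [(hA t ht).1, (hB t ht).1]; ring) fun hne t h1 h2 h => ?_
      have ht : t ∈ Set.Icc a b := ⟨h1.le, h2.le⟩
      rw [(hB t ht).1, add_zero, max_eq_right (hA t ht).2, div_eq_one_iff_eq hl.ne'] at h
      have h3 := (hB t ht).2
      rw [div_le_iff₀ hl, zero_mul] at h3
      exact hT t h1 h2 (.inl (by have := d_T_le hI hx he t; linarith))
    · refine AffOn.min_one (p := p') (q := q')
        (fun t ht => by rw [(hA t ht).1, (hB t ht).1]; ring) fun hne t h1 h2 h => ?_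
      have ht : t ∈ Set.Icc a b := ⟨h1.le, h2.le⟩
      rw [(hA t ht).1, zero_add, max_eq_right (hB t ht).2, div_eq_one_iff_eq hl.ne'] at h
      have h3 := (hA t ht).2
      rw [div_le_iff₀ hl, zero_mul] at h3
      exact hS t h1 h2 (.inl (by have := d_S_le hI hx he t; linarith))
    · exact ⟨0, 0, fun t ht => by simp only [(hA t ht).1, (hB t ht).1]; norm_num⟩

end Inst

namespace Inst

variable {I : Inst}

theorem PP_finite (hI : I.Good) {x : ℕ} (hx : x < I.m) : (I.PP x).Finite := by
  refine (((Finset.range I.n).biUnion fun i => {I.tu x i, I.tv x i, I.tb x i}) ∪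
    ((Finset.range I.m).biUnion fun e => {I.eu x e, I.ev x e}) ∪ {0, 1}).finite_toSet.subset ?_
  rintro t ⟨-, -, h⟩
  simp only [Finset.coe_union, Set.mem_union, Finset.mem_coe, Finset.mem_biUnion,
    Finset.mem_range, Finset.mem_insert, Finset.mem_singleton]
  rcases h with h | h | ⟨i, hi, h⟩ | ⟨e, he, h⟩
  · exact .inr (.inl h)
  · exact .inr (.inr h)
  · exact .inl (.inl ⟨i, hi, nodeCond_cand (hI.L_pos hx) h⟩)
  · exact .inl (.inr ⟨e, he, edgeCond_cand (hI.L_pos hx) h⟩)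

theorem zero_mem_PP (x : ℕ) : (0 : ℝ) ∈ I.PP x := ⟨le_rfl, zero_le_one, .inl rfl⟩

theorem one_mem_PP (x : ℕ) : (1 : ℝ) ∈ I.PP x := ⟨zero_le_one, le_rfl, .inr (.inl rfl)⟩

theorem cv_nonneg (hI : I.Good) {x e : ℕ} (he : e < I.m) {t : ℝ} (h0 : 0 ≤ t) (h1 : t ≤ 1) :
    0 ≤ I.cv x e t := by
  have : 0 < I.R / I.L e := div_pos hI.R_pos (hI.L_pos he)
  rw [cv]
  split_ifs
  · rw [sub_nonneg]
    exact max_le (le_min zero_le_one (by linarith)) (le_min (by linarith) (by linarith))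
  · positivity

theorem cv_le_one (x e : ℕ) (t : ℝ) : I.cv x e t ≤ 1 := by
  rw [cv]
  split_ifs
  · have h1 := min_le_left 1 (t + I.R / I.L e)
    have h2 := le_max_left 0 (t - I.R / I.L e)
    linarith
  · exact min_le_left _ _

theorem le_psi {e : ℕ} {w z : ℝ} (h1 : I.lb e ≤ w)
    (h2 : w ≤ I.ub e) : w * z ≤ I.psi e z := by
  rw [psi]
  split_ifs with h
  · exact mul_le_mul_of_nonneg_right h2 h
  · exact mul_le_mul_of_nonpos_right h1 (by linarith)

/-- Between two neighbouring partition points. -/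
theorem exists_cell (hI : I.Good) {x : ℕ} (hx : x < I.m) {t : ℝ} (h0 : 0 ≤ t) (h1 : t ≤ 1) :
    ∃ a ∈ I.PP x, ∃ b ∈ I.PP x, a ≤ t ∧ t ≤ b ∧ ∀ s ∈ I.PP x, a < s → ¬ s < b := by
  have hfin := PP_finite hI hx
  obtain ⟨a, ⟨ha, hat⟩, hamax⟩ := Set.exists_max_image (I.PP x ∩ Set.Iic t) id
    (hfin.inter_of_left _) ⟨0, zero_mem_PP x, h0⟩
  obtain ⟨b, ⟨hb, hbt⟩, hbmin⟩ := Set.exists_min_image (I.PP x ∩ Set.Ici t) id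
    (hfin.inter_of_left _) ⟨1, one_mem_PP x, h1⟩
  refine ⟨a, ha, b, hb, hat, hbt, fun s hs has hsb => ?_⟩
  rcases le_total s t with h | h
  · exact absurd (hamax s ⟨hs, h⟩) (not_le.2 has)
  · exact absurd (hbmin s ⟨hs, h⟩) (not_le.2 hsb)

/-- A weighted cover function has its maximum at partition points. -/
theorem sum_cv_le_of_PP (hI : I.Good) {x : ℕ} (hx : x < I.m) (w : ℕ → ℝ) {z t : ℝ} (h0 : 0 ≤ t)
    (h1 : t ≤ 1) (h : ∀ s ∈ I.PP x, ∑ e ∈ Finset.range I.m, w e * I.cv x e s ≤ z) :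
    ∑ e ∈ Finset.range I.m, w e * I.cv x e t ≤ z := by
  obtain ⟨a, ha, b, hb, hat, htb, hno⟩ := exists_cell hI hx h0 h1
  have haff : ∀ e, ∃ p q, e < I.m → ∀ s ∈ Set.Icc a b, I.cv x e s = p * s + q := by
    intro e
    by_cases he : e < I.m
    · obtain ⟨p, q, hpq⟩ := cv_affOn hI hx he ha.1 hb.2.1 fun s hs _ => hno s hs
      exact ⟨p, q, fun _ => hpq⟩
    · exact ⟨0, 0, fun h => absurd h he⟩
  choose p q hpq using haff
  have key : ∀ s ∈ Set.Icc a b, ∑ e ∈ Finset.range I.m, w e * I.cv x e s =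
      (∑ e ∈ Finset.range I.m, w e * p e) * s + ∑ e ∈ Finset.range I.m, w e * q e := by
    intro s hs
    rw [Finset.sum_mul, ← Finset.sum_add_distrib]
    refine Finset.sum_congr rfl fun e he => ?_
    rw [hpq e (Finset.mem_range.1 he) s hs]; ring
  have e1 := h a ha
  have e2 := h b hb
  rw [key _ ⟨hat, htb⟩]
  rw [key _ ⟨le_rfl, hat.trans htb⟩] at e1
  rw [key _ ⟨hat.trans htb, le_rfl⟩] at e2
  rcases le_total 0 (∑ e ∈ Finset.range I.m, w e * p e) with hp | hp <;> nlinarith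

theorem concaveOn_d (x i : ℕ) : ConcaveOn ℝ Set.univ (I.d x i) := by
  have h1 : ConcaveOn ℝ Set.univ (I.u x i) := ⟨convex_univ, fun s _ t _ a b _ _ hab => by
    obtain rfl : b = 1 - a := by linarith
    simp only [u, smul_eq_mul]; apply le_of_eq; ring⟩
  have h2 : ConcaveOn ℝ Set.univ (I.v x i) := ⟨convex_univ, fun s _ t _ a b _ _ hab => by
    obtain rfl : b = 1 - a := by linarith
    simp only [v, smul_eq_mul]; apply le_of_eq; ring⟩
  exact h1.inf h2

theorem ordConnected_cv_le (hI : I.Good) {x e : ℕ} (he : e < I.m) (hxe : x ≠ e) (z : ℝ) :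
    {t | I.cv x e t ≤ z}.OrdConnected := by
  have hl := hI.L_pos he
  have hc : ∀ i, ConvexOn ℝ Set.univ fun t => max 0 ((I.R - I.d x i t) / I.L e) := fun i => by
    refine (convexOn_const 0 convex_univ).sup ?_
    have := (((convexOn_const I.R convex_univ).sub (concaveOn_d (I := I) x i))).smul
      (inv_nonneg.2 hl.le)
    refine this.congr fun t _ => ?_
    simp [div_eq_inv_mul]
  have h := ((hc (I.S e)).add (hc (I.T e))).convex_le z
  by_cases hz : 1 ≤ z
  · convert Set.ordConnected_univ
    exact Set.eq_univ_of_forall fun t => (cv_le_one x e t).trans hz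
  · have heq : {t | I.cv x e t ≤ z} = {t | t ∈ Set.univ ∧
        ((fun t => max 0 ((I.R - I.d x (I.S e) t) / I.L e)) +
          fun t => max 0 ((I.R - I.d x (I.T e) t) / I.L e)) t ≤ z} :=
      Set.ext fun t => by simp [cv, hxe, hz]
    rw [heq]
    exact h.ordConnected

theorem ordConnected_lt_cv (e : ℕ) (z : ℝ) : {t | z < I.cv e e t}.OrdConnected := by
  have h1 : ConcaveOn ℝ Set.univ fun t : ℝ => min 1 (t + I.R / I.L e) :=
    (concaveOn_const 1 convex_univ).inf ((concaveOn_id convex_univ).add_const _)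
  have h2 : ConvexOn ℝ Set.univ fun t : ℝ => max 0 (t - I.R / I.L e) := by
    refine (convexOn_const 0 convex_univ).sup ?_
    exact ⟨convex_univ, fun s _ t _ a b _ _ hab => by
      obtain rfl : b = 1 - a := by linarith
      simp only [smul_eq_mul]; apply le_of_eq; ring⟩
  have h := ((h1.sub h2).convex_gt z).ordConnected
  have heq : {t | z < I.cv e e t} = {t | t ∈ Set.univ ∧ z <
      ((fun t => min 1 (t + I.R / I.L e)) - fun t => max 0 (t - I.R / I.L e)) t} :=
    Set.ext fun t => by simp [cv]
  rw [heq]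
  exact h

open Classical in
theorem card_flips_le_two {s : ℕ → Prop} (Q : ℕ)
    (h : ∀ i j k, i ≤ j → j ≤ k → k ≤ Q → s i → s k → s j) :
    ((Finset.range Q).filter fun q => ¬ (s q ↔ s (q + 1))).card ≤ 2 := by
  have hsub : ((Finset.range Q).filter fun q => ¬ (s q ↔ s (q + 1))) ⊆
      ((Finset.range Q).filter fun q => s q ∧ ¬ s (q + 1)) ∪
      ((Finset.range Q).filter fun q => ¬ s q ∧ s (q + 1)) := by
    intro q
    simp only [Finset.mem_filter, Finset.mem_union]
    tauto
  refine (Finset.card_le_card hsub).trans ((Finset.card_union_le _ _).trans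
    (add_le_add (b := 1) (d := 1) ?_ ?_))
  · rw [Finset.card_le_one]
    intro i hi j hj
    simp only [Finset.mem_filter, Finset.mem_range] at hi hj
    by_contra hne
    rcases lt_or_gt_of_ne hne with hlt | hlt
    · exact hi.2.2 (h i (i + 1) j (by omega) (by omega) (by omega) hi.2.1 hj.2.1)
    · exact hj.2.2 (h j (j + 1) i (by omega) (by omega) (by omega) hj.2.1 hi.2.1)
  · rw [Finset.card_le_one]
    intro i hi j hj
    simp only [Finset.mem_filter, Finset.mem_range] at hi hj
    by_contra hne
    rcases lt_or_gt_of_ne hne with hlt | hlt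
    · exact hj.2.1 (h (i + 1) j (j + 1) (by omega) (by omega) (by omega) hi.2.2 hj.2.2)
    · exact hi.2.1 (h (j + 1) i (i + 1) (by omega) (by omega) (by omega) hj.2.2 hi.2.2)

open Classical in
/-- Along increasing points of an edge, the comparison of a cover value with a constant changes at
most twice. -/
theorem card_flips_cv_le (hI : I.Good) {x e : ℕ} (he : e < I.m) (z : ℝ) {a : ℕ → ℝ} {Q : ℕ}
    (ha : ∀ i j, i ≤ j → j ≤ Q → a i ≤ a j) :
    ((Finset.range Q).filter fun q =>
      ¬ (I.cv x e (a q) ≤ z ↔ I.cv x e (a (q + 1)) ≤ z)).card ≤ 2 := by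
  by_cases hxe : x = e
  · subst hxe
    have h := card_flips_le_two (s := fun q => z < I.cv x x (a q)) Q fun i j k hij hjk hk h1 h2 =>
      (ordConnected_lt_cv x z).out h1 h2 ⟨ha i j hij (hjk.trans hk), ha j k hjk hk⟩
    convert h using 4
    rw [← not_le, ← not_le, not_iff_not]
  · exact card_flips_le_two (s := fun q => I.cv x e (a q) ≤ z) Q fun i j k hij hjk hk h1 h2 =>
      (ordConnected_cv_le hI he hxe z).out h1 h2 ⟨ha i j hij (hjk.trans hk), ha j k hjk hk⟩

end Inst

namespace Network

open MeasureTheory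

noncomputable def inst (N : Network) : Inst where
  n := N.n
  m := N.m
  S := N.input.iarr 0
  T := N.input.iarr 1
  L := N.input.rarr 0
  lb := N.input.rarr 1
  ub := N.input.rarr 2
  R := N.R
  D := fun i j => if h : i < N.n ∧ j < N.n then N.nodeDist ⟨i, h.1⟩ ⟨j, h.2⟩ else 0

variable {N : Network}

theorem inst_S (e : Fin N.m) : N.inst.S e = N.src e := by simp [inst, input]
theorem inst_T (e : Fin N.m) : N.inst.T e = N.dst e := by simp [inst, input]
theorem inst_L (e : Fin N.m) : N.inst.L e = N.len e := by simp [inst, input]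
theorem inst_lb (e : Fin N.m) : N.inst.lb e = N.lb e := by simp [inst, input]
theorem inst_ub (e : Fin N.m) : N.inst.ub e = N.ub e := by simp [inst, input]
theorem inst_D (i j : Fin N.n) : N.inst.D i j = N.nodeDist i j := by simp [inst]

theorem inst_good (hN : N.Valid) : N.inst.Good where
  m_pos := hN.m_pos
  n_le := n_le hN
  S_lt := fun {e} he => by rw [inst_S ⟨e, he⟩]; exact (N.src _).2
  T_lt := fun {e} he => by rw [inst_T ⟨e, he⟩]; exact (N.dst _).2
  L_pos := fun {e} he => by rw [inst_L ⟨e, he⟩]; exact hN.len_pos _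
  R_pos := hN.R_pos
  lb_le_ub := fun {e} he => by rw [inst_lb ⟨e, he⟩, inst_ub ⟨e, he⟩]; exact hN.lb_le_ub _
  D_self := fun {i} hi => by rw [inst_D ⟨i, hi⟩ ⟨i, hi⟩]; exact nodeDist_self hN _
  D_comm := fun {i j} hi hj => by
    rw [inst_D ⟨i, hi⟩ ⟨j, hj⟩, inst_D ⟨j, hj⟩ ⟨i, hi⟩]; exact nodeDist_comm _ _
  D_edge := fun {e} he => by
    rw [inst_S ⟨e, he⟩, inst_T ⟨e, he⟩, inst_D, inst_L ⟨e, he⟩]; exact hN.geodesic _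
  D_S_le := fun {e j} he hj => by
    rw [inst_S ⟨e, he⟩, inst_T ⟨e, he⟩, inst_D _ ⟨j, hj⟩, inst_D _ ⟨j, hj⟩, inst_L ⟨e, he⟩]
    exact nodeDist_src_le hN _ _
  D_T_le := fun {e j} he hj => by
    rw [inst_S ⟨e, he⟩, inst_T ⟨e, he⟩, inst_D _ ⟨j, hj⟩, inst_D _ ⟨j, hj⟩, inst_L ⟨e, he⟩]
    exact nodeDist_dst_le hN _ _
  D_step := fun {i j} hi hj hij => by
    obtain ⟨e, h⟩ := exists_first_edge hN (i := ⟨i, hi⟩) (j := ⟨j, hj⟩) (fun h => hij (congrArg Fin.val h))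
    refine ⟨e, e.2, ?_⟩
    rw [inst_S, inst_T, inst_L, inst_D ⟨i, hi⟩ ⟨j, hj⟩, inst_D _ ⟨j, hj⟩, inst_D _ ⟨j, hj⟩]
    exact h.imp (fun h => ⟨congrArg Fin.val h.1, h.2⟩) fun h => ⟨congrArg Fin.val h.1, h.2⟩

theorem distNode_eq (x : N.Point) (i : Fin N.n) : distNode x i = N.inst.d x.e i x.t := by
  rw [distNode, Inst.d, Inst.u, Inst.v, inst_S, inst_T, inst_L, inst_D, inst_D]

theorem mem_coverSet_of_ne {x : N.Point} {e : Fin N.m} (h : x.e ≠ e) {t : ℝ} :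
    t ∈ coverSet x e ↔ t ∈ Set.Icc (0 : ℝ) 1 ∧ (t * N.len e + distNode x (N.src e) ≤ N.R ∨
      (1 - t) * N.len e + distNode x (N.dst e) ≤ N.R) := by
  simp only [coverSet, Set.mem_ofPred_eq, dist, if_neg h, min_le_iff, exists_prop]

theorem coverSet_self (hN : N.Valid) (x : N.Point) :
    coverSet x x.e = Set.Icc (max 0 (x.t - N.R / N.len x.e)) (min 1 (x.t + N.R / N.len x.e)) := by
  have hL := hN.len_pos x.e
  have hI := inst_good hN
  have e1 : distNode x (N.src x.e) = x.t * N.len x.e := by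
    rw [distNode_eq, ← inst_S, ← inst_L]; exact Inst.d_S_self hI x.e.2 x.ht.2
  have e2 : distNode x (N.dst x.e) = (1 - x.t) * N.len x.e := by
    rw [distNode_eq, ← inst_T, ← inst_L]; exact Inst.d_T_self hI x.e.2 x.ht.1
  ext t
  simp only [coverSet, Set.mem_ofPred_eq, dist, if_true, e1, e2, Set.mem_Icc, exists_prop,
    max_le_iff, le_min_iff]
  have key : ∀ h : (0 ≤ t ∧ t ≤ 1), min (|x.t - t| * N.len x.e)
      (min (t * N.len x.e + x.t * N.len x.e) ((1 - t) * N.len x.e + (1 - x.t) * N.len x.e)) =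
      |x.t - t| * N.len x.e := by
    intro h
    refine min_eq_left (le_min ?_ ?_)
    · rw [← add_mul]
      exact mul_le_mul_of_nonneg_right (abs_le.2 ⟨by linarith [x.ht.1], by linarith⟩) hL.le
    · rw [← add_mul]
      exact mul_le_mul_of_nonneg_right
        (abs_le.2 ⟨by linarith [x.ht.1, x.ht.2], by linarith [x.ht.2]⟩) hL.le
  constructor
  · rintro ⟨h, h'⟩
    rw [key h, ← le_div_iff₀ hL, abs_le] at h'
    exact ⟨⟨h.1, by linarith⟩, h.2, by linarith⟩
  · rintro ⟨⟨h1, h2⟩, h3, h4⟩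
    refine ⟨⟨h1, h3⟩, ?_⟩
    rw [key ⟨h1, h3⟩, ← le_div_iff₀ hL, abs_le]
    exact ⟨by linarith, by linarith⟩

theorem coverSet_eq_univ_iff (hN : N.Valid) {x : N.Point} {e : Fin N.m} (h : x.e ≠ e) :
    coverSet x e = Set.Icc 0 1 ↔ 1 ≤ max 0 ((N.R - distNode x (N.src e)) / N.len e) +
      max 0 ((N.R - distNode x (N.dst e)) / N.len e) := by
  have hl := hN.len_pos e
  set α := (N.R - distNode x (N.src e)) / N.len e with hα
  set β := (N.R - distNode x (N.dst e)) / N.len e with hβ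
  have hmem : ∀ t, t ∈ coverSet x e ↔ t ∈ Set.Icc (0 : ℝ) 1 ∧ (t ≤ α ∨ 1 - β ≤ t) := by
    intro t
    rw [mem_coverSet_of_ne h, hα, hβ, le_div_iff₀ hl, sub_le_comm, le_div_iff₀ hl]
    refine and_congr_right fun _ => or_congr ?_ ?_ <;> constructor <;> intro h <;> linarith
  constructor
  · intro heq
    have hall : ∀ t ∈ Set.Icc (0 : ℝ) 1, t ≤ α ∨ 1 - β ≤ t := fun t ht => by
      rw [← heq] at ht; exact ((hmem t).1 ht).2
    by_contra hlt
    push Not at hlt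
    have h1 := le_max_left 0 α
    have h2 := le_max_right 0 α
    have h3 := le_max_left 0 β
    have h4 := le_max_right 0 β
    rcases hall ((max 0 α + (1 - max 0 β)) / 2) ⟨by linarith, by linarith⟩ with h | h <;> linarith
  · intro hle
    ext t
    rw [hmem]
    refine ⟨fun h => h.1, fun ht => ⟨ht, ?_⟩⟩
    rcases le_total 0 α with h1 | h1 <;> rcases le_total 0 β with h2 | h2
    · rw [max_eq_right h1, max_eq_right h2] at hle
      rcases le_total t α with h | h
      · exact .inl h
      · exact .inr (by linarith)
    · rw [max_eq_right h1, max_eq_left h2] at hle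
      exact .inl (by linarith [ht.2])
    · rw [max_eq_left h1, max_eq_right h2] at hle
      exact .inr (by linarith [ht.1])
    · rw [max_eq_left h1, max_eq_left h2] at hle
      norm_num at hle

theorem volume_coverSet (hN : N.Valid) (x : N.Point) (e : Fin N.m) :
    volume.real (coverSet x e) = N.inst.cv x.e e x.t := by
  by_cases h : x.e = e
  · subst h
    have h0 := div_pos hN.R_pos (hN.len_pos x.e)
    rw [coverSet_self hN, measureReal_def, Real.volume_Icc, ENNReal.toReal_ofReal, Inst.cv,
      if_pos rfl, inst_L]
    · rfl
    · rw [sub_nonneg]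
      exact max_le (le_min zero_le_one (by linarith [x.ht.1]))
        (le_min (by linarith [x.ht.2]) (by linarith))
  · have hl := hN.len_pos e
    have hne : (x.e : ℕ) ≠ e := fun h' => h (Fin.ext h')
    rw [Inst.cv, if_neg hne, inst_S, inst_T, inst_L, ← distNode_eq, ← distNode_eq]
    change _ = min 1 (max 0 ((N.R - distNode x (N.src e)) / N.len e) +
      max 0 ((N.R - distNode x (N.dst e)) / N.len e))
    rcases le_or_gt 1 (max 0 ((N.R - distNode x (N.src e)) / N.len e) +
      max 0 ((N.R - distNode x (N.dst e)) / N.len e)) with h1 | h1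
    · rw [(coverSet_eq_univ_iff hN h).2 h1, min_eq_left h1]
      simp
    · rw [min_eq_right h1.le]
      set α := (N.R - distNode x (N.src e)) / N.len e with hα
      set β := (N.R - distNode x (N.dst e)) / N.len e with hβ
      have hmem : ∀ t, t ∈ coverSet x e ↔ t ∈ Set.Icc (0 : ℝ) 1 ∧ (t ≤ α ∨ 1 - β ≤ t) := by
        intro t
        rw [mem_coverSet_of_ne h, hα, hβ, le_div_iff₀ hl, sub_le_comm, le_div_iff₀ hl]
        refine and_congr_right fun _ => or_congr ?_ ?_ <;> constructor <;> intro h <;> linarith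
      have hA := le_max_left 0 α
      have hB := le_max_left 0 β
      have hA' := le_max_right 0 α
      have hB' := le_max_right 0 β
      have hup : coverSet x e ⊆ Set.Icc 0 (max 0 α) ∪ Set.Icc (1 - max 0 β) 1 := fun t ht => by
        rw [hmem] at ht
        exact ht.2.imp (fun h => ⟨ht.1.1, h.trans hA'⟩) fun h => ⟨by linarith, ht.1.2⟩
      have hlow : Set.Ico 0 (max 0 α) ∪ Set.Ioc (1 - max 0 β) 1 ⊆ coverSet x e := by
        rintro t (ht | ht)
        · rw [hmem]
          refine ⟨⟨ht.1, by linarith [ht.2]⟩, .inl ?_⟩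
          rcases lt_max_iff.1 ht.2 with h | h
          · linarith [ht.1]
          · exact h.le
        · rw [hmem]
          refine ⟨⟨by linarith [ht.1], ht.2⟩, .inr ?_⟩
          have : 1 - t < max 0 β := by linarith [ht.1]
          rcases lt_max_iff.1 this with h | h <;> linarith [ht.2]
      have hvol : volume (coverSet x e) = ENNReal.ofReal (max 0 α + max 0 β) := by
        refine le_antisymm ((measure_mono hup).trans ((measure_union_le _ _).trans ?_))
          (le_trans ?_ (measure_mono hlow))
        · rw [Real.volume_Icc, Real.volume_Icc, ← ENNReal.ofReal_add (by linarith) (by linarith)]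
          exact ENNReal.ofReal_le_ofReal (by linarith)
        · rw [measure_union _ measurableSet_Ioc, Real.volume_Ico, Real.volume_Ioc,
            ← ENNReal.ofReal_add (by linarith) (by linarith)]
          · exact ENNReal.ofReal_le_ofReal (by linarith)
          · rw [Set.disjoint_left]
            intro t h1 h2
            linarith [h1.2, h2.1]
      rw [measureReal_def, hvol, ENNReal.toReal_ofReal (by linarith)]

theorem cover_eq (hN : N.Valid) (x : N.Point) (w : Fin N.m → ℝ) :
    cover x w = ∑ e, w e * N.inst.cv x.e e x.t := by
  refine Finset.sum_congr rfl fun e _ => ?_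
  rw [coverEdge, setIntegral_const, volume_coverSet hN, smul_eq_mul, mul_comm]

end Network

namespace Network

variable {N : Network}

theorem mem_scenarios {w : Fin N.m → ℝ} :
    w ∈ N.scenarios ↔ ∀ e, N.lb e ≤ w e ∧ w e ≤ N.ub e := by
  rw [scenarios, Set.mem_Icc, Pi.le_def, Pi.le_def]
  exact forall_and.symm

theorem cover_sub_eq (hN : N.Valid) (x y : N.Point) (w : Fin N.m → ℝ) :
    cover y w - cover x w = ∑ e, w e * (N.inst.cv y.e e y.t - N.inst.cv x.e e x.t) := by
  rw [cover_eq hN, cover_eq hN, ← Finset.sum_sub_distrib]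
  exact Finset.sum_congr rfl fun e _ => by ring

theorem reg_eq (x y : N.Point) : N.inst.reg x.e x.t y.e y.t =
    ∑ e : Fin N.m, N.inst.psi e (N.inst.cv y.e e y.t - N.inst.cv x.e e x.t) := by
  rw [Inst.reg]
  exact Finset.sum_range (n := N.m) fun e =>
    N.inst.psi e (N.inst.cv y.e e y.t - N.inst.cv x.e e x.t)

theorem cover_sub_le (hN : N.Valid) (x y : N.Point) {w : Fin N.m → ℝ} (hw : w ∈ N.scenarios) :
    cover y w - cover x w ≤ N.inst.reg x.e x.t y.e y.t := by
  rw [cover_sub_eq hN, reg_eq]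
  refine Finset.sum_le_sum fun e _ => ?_
  have := mem_scenarios.1 hw e
  exact Inst.le_psi (by rw [inst_lb]; exact this.1) (by rw [inst_ub]; exact this.2)

theorem exists_scenario (hN : N.Valid) (x y : N.Point) :
    ∃ w ∈ N.scenarios, cover y w - cover x w = N.inst.reg x.e x.t y.e y.t := by
  refine ⟨fun e => if 0 ≤ N.inst.cv y.e e y.t - N.inst.cv x.e e x.t then N.ub e else N.lb e,
    mem_scenarios.2 fun e => ?_, ?_⟩
  · split_ifs
    · exact ⟨hN.lb_le_ub e, le_rfl⟩
    · exact ⟨le_rfl, hN.lb_le_ub e⟩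
  · rw [cover_sub_eq hN, reg_eq]
    refine Finset.sum_congr rfl fun e _ => ?_
    rw [Inst.psi, inst_lb, inst_ub]
    split_ifs <;> rfl

theorem nonempty_scenarios (hN : N.Valid) : Nonempty N.scenarios :=
  ⟨⟨N.lb, mem_scenarios.2 fun e => ⟨le_rfl, hN.lb_le_ub e⟩⟩⟩

theorem nonempty_point (hN : N.Valid) : Nonempty N.Point :=
  ⟨⟨⟨0, hN.m_pos⟩, 0, ⟨le_rfl, zero_le_one⟩⟩⟩

theorem regret_eq (hN : N.Valid) (x y : N.Point) :
    regret x y = N.inst.reg x.e x.t y.e y.t := by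
  have := nonempty_scenarios hN
  refine le_antisymm (ciSup_le fun w => cover_sub_le hN x y w.2) ?_
  obtain ⟨w, hw, h⟩ := exists_scenario hN x y
  rw [← h]
  exact le_ciSup (f := fun w : N.scenarios => cover y w - cover x w)
    ⟨N.inst.reg x.e x.t y.e y.t, by rintro _ ⟨w, rfl⟩; exact cover_sub_le hN x y w.2⟩ ⟨w, hw⟩

theorem cover_nonneg (hN : N.Valid) (x : N.Point) {w : Fin N.m → ℝ} (hw : w ∈ N.scenarios) :
    0 ≤ cover x w := by
  rw [cover_eq hN]
  refine Finset.sum_nonneg fun e _ => mul_nonneg ?_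
    (Inst.cv_nonneg (inst_good hN) e.2 x.ht.1 x.ht.2)
  exact (hN.lb_nonneg e).trans (mem_scenarios.1 hw e).1

theorem cover_le (hN : N.Valid) (x : N.Point) {w : Fin N.m → ℝ} (hw : w ∈ N.scenarios) :
    cover x w ≤ ∑ e, N.ub e := by
  rw [cover_eq hN]
  refine Finset.sum_le_sum fun e _ => ?_
  have h := mem_scenarios.1 hw e
  have h0 := Inst.cv_nonneg (x := x.e) (inst_good hN) e.2 x.ht.1 x.ht.2
  have h1 := Inst.cv_le_one (I := N.inst) x.e e x.t
  have h2 := hN.lb_nonneg e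
  nlinarith

theorem regret_le_sum (hN : N.Valid) (x y : N.Point) : regret x y ≤ ∑ e, N.ub e := by
  have := nonempty_scenarios hN
  refine ciSup_le fun w => ?_
  have h1 := cover_nonneg hN x w.2
  have h2 := cover_le hN y w.2
  linarith

theorem nonempty_partitionPoints (hN : N.Valid) : Nonempty N.partitionPoints :=
  ⟨⟨⟨⟨0, hN.m_pos⟩, 0, ⟨le_rfl, zero_le_one⟩⟩, .inl rfl⟩⟩

theorem regret_le_envelope (hN : N.Valid) (x : N.Point) {y : N.Point}
    (hy : y ∈ N.partitionPoints) : regret x y ≤ envelope x :=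
  le_ciSup (f := fun y : N.partitionPoints => regret x y)
    ⟨∑ e, N.ub e, by rintro _ ⟨y, rfl⟩; exact regret_le_sum hN x y⟩ ⟨y, hy⟩

theorem envelope_le_iff (hN : N.Valid) (x : N.Point) (z : ℝ) :
    envelope x ≤ z ↔ ∀ y ∈ N.partitionPoints, regret x y ≤ z := by
  have := nonempty_partitionPoints hN
  exact ⟨fun h y hy => (regret_le_envelope hN x hy).trans h, fun h => ciSup_le fun y => h y y.2⟩

theorem maxRegret_le_iff (hN : N.Valid) (x : N.Point) (z : ℝ) :
    maxRegret x ≤ z ↔ ∀ w ∈ N.scenarios, ∀ y : N.Point, cover y w - cover x w ≤ z := by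
  have := nonempty_scenarios hN
  have := nonempty_point hN
  have hbdd : ∀ w : N.scenarios, BddAbove (Set.range fun y : N.Point => cover y w) := fun w =>
    ⟨∑ e, N.ub e, by rintro _ ⟨y, rfl⟩; exact cover_le hN y w.2⟩
  constructor
  · intro h w hw y
    have h1 := le_ciSup (hbdd ⟨w, hw⟩) y
    have h2 := le_ciSup (f := fun w : N.scenarios => (⨆ y : N.Point, cover y w) - cover x w)
      ⟨∑ e, N.ub e, by
        rintro _ ⟨w, rfl⟩
        have h1 : (⨆ y : N.Point, cover y w) ≤ ∑ e, N.ub e := ciSup_le fun y => cover_le hN y w.2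
        have h2 := cover_nonneg hN x w.2
        simp only
        linarith⟩ ⟨w, hw⟩
    change _ ≤ maxRegret x at h2
    simp only at h1 h2
    linarith
  · intro h
    refine ciSup_le fun w => ?_
    rw [sub_le_iff_le_add]
    exact ciSup_le fun y => by linarith [h w w.2 y]

theorem sPlus_eq_sMinus_iff (hN : N.Valid) {x : N.Point} {e : Fin N.m} (h : x.e ≠ e) :
    (0 < sPlus e x ∧ sPlus e x = sMinus e x ∧ sMinus e x < 1) ↔
      distNode x (N.src e) + distNode x (N.dst e) = 2 * N.R - N.len e ∧
        N.R - N.len e < distNode x (N.src e) ∧ distNode x (N.src e) < N.R := by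
  have hl := hN.len_pos e
  rw [sPlus, sMinus, if_neg h.symm, if_neg h.symm]
  set a := distNode x (N.src e)
  set b := distNode x (N.dst e)
  have e1 : ∀ c, (N.R - a) / N.len e = c ↔ a = N.R - c * N.len e := fun c => by
    rw [div_eq_iff hl.ne']; constructor <;> intro h <;> linarith
  constructor
  · rintro ⟨h1, h2, h3⟩
    have h4 : sPlus e x < 1 := by rw [sPlus, if_neg h.symm, h2]; exact h3
    rw [sPlus, if_neg h.symm] at h4
    have f1 : (N.R - a) / N.len e < 1 := by
      by_contra hc
      push Not at hc
      rw [max_eq_right (zero_le_one.trans hc), min_eq_left hc] at h4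
      exact lt_irrefl _ h4
    have f2 : 0 < (N.R - a) / N.len e := by
      by_contra hc
      push Not at hc
      rw [max_eq_left hc, min_eq_right zero_le_one] at h1
      exact lt_irrefl _ h1
    rw [max_eq_right f2.le, min_eq_right f1.le] at h2
    have f3 : (N.R - a) / N.len e = 1 - (N.R - b) / N.len e := by
      rcases le_total 1 (1 - (N.R - b) / N.len e) with h | h
      · rw [min_eq_left h, max_eq_right zero_le_one] at h2; linarith
      · rw [min_eq_right h] at h2
        rcases le_total 0 (1 - (N.R - b) / N.len e) with h' | h'
        · rw [max_eq_right h'] at h2; exact h2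
        · rw [max_eq_left h'] at h2; linarith
    rw [eq_sub_iff_add_eq, ← add_div, div_eq_one_iff_eq hl.ne'] at f3
    rw [div_lt_one hl] at f1
    rw [div_pos_iff_of_pos_right hl] at f2
    exact ⟨by linarith, by linarith, by linarith⟩
  · rintro ⟨h1, h2, h3⟩
    have f2 : 0 < (N.R - a) / N.len e := div_pos (by linarith) hl
    have f1 : (N.R - a) / N.len e < 1 := by rw [div_lt_one hl]; linarith
    have f3 : (N.R - a) / N.len e = 1 - (N.R - b) / N.len e := by
      rw [eq_sub_iff_add_eq, ← add_div, div_eq_one_iff_eq hl.ne']; linarith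
    rw [← f3, max_eq_right f2.le, min_eq_right f1.le, max_eq_right f2.le]
    exact ⟨f2, rfl, f1⟩

theorem isExactCoverage_ne (hN : N.Valid) {x : N.Point} {e : Fin N.m}
    (h : 0 < sPlus e x ∧ sPlus e x = sMinus e x ∧ sMinus e x < 1) : x.e ≠ e := by
  rintro rfl
  have hI := inst_good hN
  have hL := hN.len_pos x.e
  have hR := div_pos hN.R_pos hL
  have e1 : distNode x (N.src x.e) = x.t * N.len x.e := by
    rw [distNode_eq, ← inst_S, ← inst_L]; exact Inst.d_S_self hI x.e.2 x.ht.2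
  have e2 : distNode x (N.dst x.e) = (1 - x.t) * N.len x.e := by
    rw [distNode_eq, ← inst_T, ← inst_L]; exact Inst.d_T_self hI x.e.2 x.ht.1
  obtain ⟨h1, h2, h3⟩ := h
  rw [sPlus, if_pos rfl, e1, sub_div, mul_div_cancel_right₀ _ hL.ne'] at h1 h2
  rw [sMinus, if_pos rfl, e2, sub_div, mul_div_cancel_right₀ _ hL.ne'] at h2 h3
  have h4 : 0 < x.t - N.R / N.len x.e := by
    rcases lt_max_iff.1 h1 with h | h
    · exact absurd h (lt_irrefl _)
    · exact h
  have h5 : 1 - (1 - x.t - N.R / N.len x.e) < 1 := by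
    rcases min_lt_iff.1 h3 with h | h
    · exact absurd h (lt_irrefl _)
    · exact h
  rw [max_eq_right h4.le, min_eq_right h5.le] at h2
  linarith

end Network

namespace Inst

variable {I : Inst}

theorem d_lipschitz {x i : ℕ} (hL : 0 < I.L x) {s t : ℝ} :
    I.d x i s ≤ I.d x i t + |s - t| * I.L x := by
  have h1 := mul_le_mul_of_nonneg_right (le_abs_self (s - t)) hL.le
  have h2 := mul_le_mul_of_nonneg_right (neg_abs_le (s - t)) hL.le
  rw [d, d, ← min_add_add_right]
  exact min_le_min (by simp only [u]; linarith) (by simp only [v]; linarith)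

theorem d_right_le {x i : ℕ} {s t : ℝ} (h : I.v x i t ≤ I.u x i t) :
    I.d x i s ≤ I.d x i t - (s - t) * I.L x := by
  rw [d, d, min_eq_right h]
  exact (min_le_right _ _).trans (le_of_eq (by simp only [v]; ring))

theorem d_left_le {x i : ℕ} {s t : ℝ} (h : I.u x i t ≤ I.v x i t) :
    I.d x i s ≤ I.d x i t + (s - t) * I.L x := by
  rw [d, d, min_eq_left h]
  exact (min_le_left _ _).trans (le_of_eq (by simp only [u]; ring))

theorem cut_add_lt_one {R a b a' b' l : ℝ} (hl : 0 < l) (h : a + b = 2 * R - l) (h1 : R - l < a)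
    (h2 : a < R) (ha : a < a') (hb : b < b') :
    max 0 ((R - a') / l) + max 0 ((R - b') / l) < 1 := by
  have e1 : max 0 ((R - a') / l) < (R - a) / l :=
    max_lt (div_pos (by linarith) hl) (div_lt_div_of_pos_right (by linarith) hl)
  have e2 : max 0 ((R - b') / l) < (R - b) / l :=
    max_lt (div_pos (by linarith) hl) (div_lt_div_of_pos_right (by linarith) hl)
  have e3 : (R - a) / l + (R - b) / l = 1 := by
    rw [← add_div, div_eq_one_iff_eq hl.ne']; linarith
  linarith

theorem one_le_cut_add {R a b l : ℝ} (hl : 0 < l) (h : a + b ≤ 2 * R - l) :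
    1 ≤ max 0 ((R - a) / l) + max 0 ((R - b) / l) := by
  have e3 : 1 ≤ (R - a) / l + (R - b) / l := by
    rw [← add_div, one_le_div hl]; linarith
  exact e3.trans (add_le_add (le_max_right _ _) (le_max_right _ _))

end Inst

namespace Network

variable {N : Network}

theorem isExactCoverage_iff (hN : N.Valid) {x : N.Point} (h0 : 0 < x.t) (h1 : x.t < 1) :
    IsExactCoverage x ↔ ∃ e < N.inst.m, N.inst.EdgeCond x.e e x.t := by
  have hL : 0 < N.inst.L x.e := (inst_good hN).L_pos x.e.2
  constructor
  · rintro ⟨e, hp, he, hm, ε₁, ε₂, hε₁, hε₂, hε, hcov⟩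
    have hne := isExactCoverage_ne hN ⟨hp, he, hm⟩
    obtain ⟨hsum, hlo, hhi⟩ := (sPlus_eq_sMinus_iff hN hne).1 ⟨hp, he, hm⟩
    have hl := hN.len_pos e
    rw [distNode_eq, ← inst_S, ← inst_L] at hlo
    rw [distNode_eq, ← inst_S] at hhi
    rw [distNode_eq, distNode_eq, ← inst_S, ← inst_T, ← inst_L] at hsum
    change _ = 2 * N.inst.R - _ at hsum
    change N.inst.R - _ < _ at hlo
    change _ < N.inst.R at hhi
    have hbad : ∀ s : ℝ, s ∈ Set.Icc (0 : ℝ) 1 →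
        s ∈ Set.Ioo (x.t - ε₁) x.t ∪ Set.Ioo x.t (x.t + ε₂) →
        ¬ (N.inst.d x.e (N.inst.S e) s + N.inst.d x.e (N.inst.T e) s ≤
          2 * N.inst.R - N.inst.L e) := by
      intro s hs hs' hle
      refine hcov ⟨x.e, s, hs⟩ rfl hs' ((coverSet_eq_univ_iff hN (x := ⟨x.e, s, hs⟩) hne).2 ?_)
      refine Inst.one_le_cut_add hl ?_
      rw [distNode_eq, distNode_eq, ← inst_S, ← inst_T, ← inst_L]
      exact hle
    refine ⟨e, e.2, fun h => hne (Fin.ext h), h0, h1, ?_⟩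
    rcases hε₂.eq_or_lt with h2 | h2
    · right
      have hε1 : 0 < ε₁ := by linarith
      set s := x.t - min ε₁ x.t / 2 with hs
      have hm0 : 0 < min ε₁ x.t := lt_min hε1 h0
      have hm1 := min_le_left ε₁ x.t
      have hm2 := min_le_right ε₁ x.t
      have hb := hbad s ⟨by linarith, by linarith⟩ (.inl ⟨by linarith, by linarith⟩)
      have habs : |s - x.t| = x.t - s := by rw [abs_of_neg (by linarith)]; ring
      have key : ∀ i j, N.inst.d x.e i x.t + N.inst.d x.e j x.t ≤ 2 * N.inst.R - N.inst.L e →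
          ¬ (N.inst.d x.e i s + N.inst.d x.e j s ≤ 2 * N.inst.R - N.inst.L e) →
          N.inst.v x.e i x.t < N.inst.u x.e i x.t := by
        intro i j hij hb
        by_contra hc
        push Not at hc
        have e1 := Inst.d_left_le (s := s) hc
        have e2 := Inst.d_lipschitz (i := j) (s := s) (t := x.t) hL
        rw [habs] at e2
        exact hb (by linarith)
      have k1 := key (N.inst.S e) (N.inst.T e) hsum.le hb
      have k2 := key (N.inst.T e) (N.inst.S e) (by linarith) (by rwa [add_comm])
      rw [Inst.d, min_eq_right k1.le] at hsum hlo hhi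
      rw [Inst.d, min_eq_right k2.le] at hsum
      exact ⟨hsum, k1, k2, hlo, hhi⟩
    · left
      set s := x.t + min ε₂ (1 - x.t) / 2 with hs
      have hm0 : 0 < min ε₂ (1 - x.t) := lt_min h2 (by linarith)
      have hm1 := min_le_left ε₂ (1 - x.t)
      have hm2 := min_le_right ε₂ (1 - x.t)
      have hb := hbad s ⟨by linarith, by linarith⟩ (.inr ⟨by linarith, by linarith⟩)
      have habs : |s - x.t| = s - x.t := abs_of_pos (by linarith)
      have key : ∀ i j, N.inst.d x.e i x.t + N.inst.d x.e j x.t ≤ 2 * N.inst.R - N.inst.L e →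
          ¬ (N.inst.d x.e i s + N.inst.d x.e j s ≤ 2 * N.inst.R - N.inst.L e) →
          N.inst.u x.e i x.t < N.inst.v x.e i x.t := by
        intro i j hij hb
        by_contra hc
        push Not at hc
        have e1 := Inst.d_right_le (s := s) hc
        have e2 := Inst.d_lipschitz (i := j) (s := s) (t := x.t) hL
        rw [habs] at e2
        exact hb (by linarith)
      have k1 := key (N.inst.S e) (N.inst.T e) hsum.le hb
      have k2 := key (N.inst.T e) (N.inst.S e) (by linarith) (by rwa [add_comm])
      rw [Inst.d, min_eq_left k1.le] at hsum hlo hhi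
      rw [Inst.d, min_eq_left k2.le] at hsum
      exact ⟨hsum, k1, k2, hlo, hhi⟩
  · rintro ⟨e', he', hne', -, -, hcases⟩
    obtain ⟨e, rfl⟩ : ∃ e : Fin N.m, (e : ℕ) = e' := ⟨⟨e', he'⟩, rfl⟩
    have hne : x.e ≠ e := fun h => hne' (congrArg Fin.val h)
    have hl : 0 < N.inst.L e := (inst_good hN).L_pos e.2
    have hfull : ∀ x' : N.Point, x'.e = x.e →
        N.inst.d x.e (N.inst.S e) x.t + N.inst.d x.e (N.inst.T e) x.t =
          2 * N.inst.R - N.inst.L e →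
        N.inst.R - N.inst.L e < N.inst.d x.e (N.inst.S e) x.t →
        N.inst.d x.e (N.inst.S e) x.t < N.inst.R →
        N.inst.d x.e (N.inst.S e) x.t < N.inst.d x.e (N.inst.S e) x'.t →
        N.inst.d x.e (N.inst.T e) x.t < N.inst.d x.e (N.inst.T e) x'.t →
        coverSet x' e ≠ Set.Icc 0 1 := by
      intro x' hx' k1 k2 k3 k4 k5 hc
      rw [coverSet_eq_univ_iff hN (by rw [hx']; exact hne), distNode_eq, distNode_eq, ← inst_S,
        ← inst_T, ← inst_L, hx'] at hc
      exact absurd (Inst.cut_add_lt_one hl k1 k2 k3 k4 k5) (not_lt.2 hc)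
    rcases hcases with ⟨hsum, k1, k2, hlo, hhi⟩ | ⟨hsum, k1, k2, hlo, hhi⟩
    · have d1 : N.inst.d x.e (N.inst.S e) x.t = N.inst.u x.e (N.inst.S e) x.t := min_eq_left k1.le
      have d2 : N.inst.d x.e (N.inst.T e) x.t = N.inst.u x.e (N.inst.T e) x.t := min_eq_left k2.le
      rw [← d1] at hsum hlo hhi
      rw [← d2] at hsum
      have hpm := (sPlus_eq_sMinus_iff hN hne).2 (by
        rw [distNode_eq, distNode_eq, ← inst_S, ← inst_T, ← inst_L]; exact ⟨hsum, hlo, hhi⟩)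
      set ε := min (N.inst.v x.e (N.inst.S e) x.t - N.inst.u x.e (N.inst.S e) x.t)
        (N.inst.v x.e (N.inst.T e) x.t - N.inst.u x.e (N.inst.T e) x.t) with hε
      have hε0 : 0 < ε := lt_min (by linarith) (by linarith)
      refine ⟨e, hpm.1, hpm.2.1, hpm.2.2, 0, ε / (2 * N.inst.L x.e), le_rfl, by positivity,
        by positivity, fun x' hx' ht' => ?_⟩
      have ht : x.t < x'.t ∧ x'.t < x.t + ε / (2 * N.inst.L x.e) := by
        rcases ht' with h | h
        · exact absurd h.2 (by linarith [h.1])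
        · exact h
      have hlt : (x'.t - x.t) * (2 * N.inst.L x.e) < ε := by
        rw [← lt_div_iff₀ (by positivity)]; linarith
      have hb1 := min_le_left (N.inst.v x.e (N.inst.S e) x.t - N.inst.u x.e (N.inst.S e) x.t)
        (N.inst.v x.e (N.inst.T e) x.t - N.inst.u x.e (N.inst.T e) x.t)
      have hb2 := min_le_right (N.inst.v x.e (N.inst.S e) x.t - N.inst.u x.e (N.inst.S e) x.t)
        (N.inst.v x.e (N.inst.T e) x.t - N.inst.u x.e (N.inst.T e) x.t)
      rw [← hε] at hb1 hb2
      have hpos : 0 < (x'.t - x.t) * N.inst.L x.e := mul_pos (by linarith) hL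
      refine hfull x' hx' hsum hlo hhi (lt_min ?_ ?_) (lt_min ?_ ?_)
      · rw [d1]; simp only [Inst.u]; linarith
      · rw [d1]; simp only [Inst.u, Inst.v] at hb1 ⊢; linarith
      · rw [d2]; simp only [Inst.u]; linarith
      · rw [d2]; simp only [Inst.u, Inst.v] at hb2 ⊢; linarith
    · have d1 : N.inst.d x.e (N.inst.S e) x.t = N.inst.v x.e (N.inst.S e) x.t := min_eq_right k1.le
      have d2 : N.inst.d x.e (N.inst.T e) x.t = N.inst.v x.e (N.inst.T e) x.t := min_eq_right k2.le
      rw [← d1] at hsum hlo hhi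
      rw [← d2] at hsum
      have hpm := (sPlus_eq_sMinus_iff hN hne).2 (by
        rw [distNode_eq, distNode_eq, ← inst_S, ← inst_T, ← inst_L]; exact ⟨hsum, hlo, hhi⟩)
      set ε := min (N.inst.u x.e (N.inst.S e) x.t - N.inst.v x.e (N.inst.S e) x.t)
        (N.inst.u x.e (N.inst.T e) x.t - N.inst.v x.e (N.inst.T e) x.t) with hε
      have hε0 : 0 < ε := lt_min (by linarith) (by linarith)
      refine ⟨e, hpm.1, hpm.2.1, hpm.2.2, ε / (2 * N.inst.L x.e), 0, by positivity, le_rfl,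
        by positivity, fun x' hx' ht' => ?_⟩
      have ht : x'.t < x.t ∧ x.t - ε / (2 * N.inst.L x.e) < x'.t := by
        rcases ht' with h | h
        · exact ⟨h.2, h.1⟩
        · exact absurd h.2 (by linarith [h.1])
      have hlt : (x.t - x'.t) * (2 * N.inst.L x.e) < ε := by
        rw [← lt_div_iff₀ (by positivity)]; linarith
      have hb1 := min_le_left (N.inst.u x.e (N.inst.S e) x.t - N.inst.v x.e (N.inst.S e) x.t)
        (N.inst.u x.e (N.inst.T e) x.t - N.inst.v x.e (N.inst.T e) x.t)
      have hb2 := min_le_right (N.inst.u x.e (N.inst.S e) x.t - N.inst.v x.e (N.inst.S e) x.t)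
        (N.inst.u x.e (N.inst.T e) x.t - N.inst.v x.e (N.inst.T e) x.t)
      rw [← hε] at hb1 hb2
      have hpos : 0 < (x.t - x'.t) * N.inst.L x.e := mul_pos (by linarith) hL
      refine hfull x' hx' hsum hlo hhi (lt_min ?_ ?_) (lt_min ?_ ?_)
      · rw [d1]; simp only [Inst.u, Inst.v] at hb1 ⊢; linarith
      · rw [d1]; simp only [Inst.v]; linarith
      · rw [d2]; simp only [Inst.u, Inst.v] at hb2 ⊢; linarith
      · rw [d2]; simp only [Inst.v]; linarith

theorem isBottleneck_or_iff (x : N.Point) :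
    IsNetworkIntersect x ∨ IsBottleneck x ↔ ∃ i < N.inst.n, N.inst.NodeCond x.e i x.t := by
  constructor
  · rintro (⟨i, hi⟩ | ⟨h0, h1, i, hi⟩)
    · exact ⟨i, i.2, .inl (by rw [← distNode_eq]; exact hi)⟩
    · refine ⟨i, i.2, .inr ⟨h0, h1, ?_⟩⟩
      rw [Inst.u, Inst.v, inst_S, inst_T, inst_L, inst_D, inst_D]; exact hi
  · rintro ⟨i', hi', h⟩
    obtain ⟨i, rfl⟩ : ∃ i : Fin N.n, (i : ℕ) = i' := ⟨⟨i', hi'⟩, rfl⟩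
    refine h.imp (fun h => ⟨i, ?_⟩) fun h => ⟨h.1, h.2.1, i, ?_⟩
    · rw [distNode_eq]; exact h
    · have := h.2.2
      rwa [Inst.u, Inst.v, inst_S, inst_T, inst_L, inst_D, inst_D] at this

theorem mem_partitionPoints_iff (hN : N.Valid) (x : N.Point) :
    x ∈ N.partitionPoints ↔ x.t ∈ N.inst.PP x.e := by
  have h01 := x.ht
  change (x.t = 0 ∨ x.t = 1 ∨ IsNetworkIntersect x ∨ IsBottleneck x ∨ IsExactCoverage x) ↔
    (0 ≤ x.t ∧ x.t ≤ 1 ∧ (x.t = 0 ∨ x.t = 1 ∨ (∃ i < N.inst.n, N.inst.NodeCond x.e i x.t) ∨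
      ∃ e < N.inst.m, N.inst.EdgeCond x.e e x.t))
  by_cases h0 : x.t = 0
  · simp [h0]
  by_cases h1 : x.t = 1
  · simp [h1]
  rw [← isBottleneck_or_iff, ← isExactCoverage_iff hN (lt_of_le_of_ne h01.1 (Ne.symm h0))
    (lt_of_le_of_ne h01.2 h1)]
  simp [h0, h1, h01.1, h01.2, or_assoc]

theorem maxRegret_eq_envelope (hN : N.Valid) (x : N.Point) : maxRegret x = envelope x := by
  have hI := inst_good hN
  refine le_antisymm ((maxRegret_le_iff hN x _).2 fun w hw y => ?_)
    ((envelope_le_iff hN x _).2 fun y _ => ?_)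
  · let W : ℕ → ℝ := fun e => if h : e < N.m then w ⟨e, h⟩ else 0
    have hW : ∀ z : N.Point, cover z w = ∑ e ∈ Finset.range N.inst.m, W e * N.inst.cv z.e e z.t := by
      intro z
      rw [cover_eq hN]
      change _ = ∑ e ∈ Finset.range N.m, W e * N.inst.cv z.e e z.t
      rw [Finset.sum_range]
      exact Finset.sum_congr rfl fun e _ => by simp [W]
    have := Inst.sum_cv_le_of_PP hI (x := y.e) y.e.2 W (z := envelope x + cover x w) y.ht.1 y.ht.2
      fun s hs => by
        have hy : (⟨y.e, s, ⟨hs.1, hs.2.1⟩⟩ : N.Point) ∈ N.partitionPoints :=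
          (mem_partitionPoints_iff hN _).2 hs
        have h1 := regret_le_envelope hN x hy
        rw [regret_eq hN] at h1
        have h2 := cover_sub_le hN x ⟨y.e, s, ⟨hs.1, hs.2.1⟩⟩ hw
        have h3 := hW ⟨y.e, s, ⟨hs.1, hs.2.1⟩⟩
        simp only at h1 h2 h3
        rw [← h3]
        linarith
    rw [← hW] at this
    linarith
  · rw [regret_eq hN]
    obtain ⟨w, hw, h⟩ := exists_scenario hN x y
    rw [← h]
    exact (maxRegret_le_iff hN x _).1 le_rfl w hw y

/-- A state that holds the solution, in terms of the data on `ℕ`. -/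
structure Solves (I : Inst) (τ : RealRAM.State) : Prop where
  partition : ∀ e < I.m, ∀ t, t ∈ I.PP e ↔
    ∃ j, τ.iarr 0 e ≤ j ∧ j < τ.iarr 0 (e + 1) ∧ τ.rarr 0 j = t
  mem : ∀ e < I.m, τ.rarr 1 e ∈ Set.Icc (0 : ℝ) 1
  le : ∀ e < I.m, ∀ b < I.m, ∀ s ∈ I.PP b, I.reg e (τ.rarr 1 e) b s ≤ τ.rarr 2 e
  min : ∀ e < I.m, ∀ t ∈ Set.Icc (0 : ℝ) 1, ∀ z, (∀ b < I.m, ∀ s ∈ I.PP b, I.reg e t b s ≤ z) →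
    τ.rarr 2 e ≤ z
  best_lt : τ.ireg 0 < I.m
  best_pt : τ.rreg 0 = τ.rarr 1 (τ.ireg 0)
  best_val : τ.rreg 1 = τ.rarr 2 (τ.ireg 0)
  best_le : ∀ e < I.m, τ.rreg 1 ≤ τ.rarr 2 e

theorem Solves.isSolution (hN : N.Valid) {τ : RealRAM.State} (h : Solves N.inst τ) :
    N.IsSolution τ := by
  have henv : ∀ (x : N.Point) (z : ℝ), envelope x ≤ z ↔
      ∀ b < N.m, ∀ s ∈ N.inst.PP b, N.inst.reg x.e x.t b s ≤ z := by
    intro x z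
    rw [envelope_le_iff hN]
    constructor
    · intro hz b hb s hs
      have := hz ⟨⟨b, hb⟩, s, ⟨hs.1, hs.2.1⟩⟩ ((mem_partitionPoints_iff hN _).2 hs)
      rwa [regret_eq hN] at this
    · intro hz y hy
      rw [regret_eq hN]
      exact hz y.e y.e.2 y.t ((mem_partitionPoints_iff hN y).1 hy)
  have hedge : ∀ e : Fin N.m, ∃ x : N.Point, x.e = e ∧ x.t = τ.rarr 1 e ∧
      envelope x = τ.rarr 2 e ∧ ∀ x' : N.Point, x'.e = e → envelope x ≤ envelope x' := by
    intro e
    have hmin : ∀ x' : N.Point, x'.e = e → τ.rarr 2 e ≤ envelope x' := by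
      rintro x' rfl
      exact h.min x'.e x'.e.2 x'.t x'.ht _ ((henv x' _).1 le_rfl)
    have heq : envelope (⟨e, τ.rarr 1 e, h.mem e e.2⟩ : N.Point) = τ.rarr 2 e :=
      le_antisymm ((henv _ _).2 (h.le e e.2)) (hmin _ rfl)
    exact ⟨⟨e, τ.rarr 1 e, h.mem e e.2⟩, rfl, rfl, heq, fun x' hx' => heq ▸ hmin x' hx'⟩
  refine ⟨fun x => ?_, fun e j h1 h2 => ?_, hedge, ?_, ?_⟩
  · rw [mem_partitionPoints_iff hN]
    exact h.partition x.e x.e.2 x.t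
  · have := (h.partition e e.2 (τ.rarr 0 j)).2 ⟨j, h1, h2, rfl⟩
    exact ⟨this.1, this.2.1⟩
  · refine ⟨⟨τ.ireg 0, h.best_lt⟩, rfl, h.best_pt, h.best_val, fun e' => ?_⟩
    change τ.rarr 2 (τ.ireg 0) ≤ _
    rw [← h.best_val]
    exact h.best_le e' e'.2
  · obtain ⟨x, hxe, hxt, hx, hxmin⟩ := hedge ⟨τ.ireg 0, h.best_lt⟩
    refine ⟨x, by rw [hxe], by rw [hxt, h.best_pt], by rw [maxRegret_eq_envelope hN, hx, h.best_val],
      fun x' => ?_⟩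
    rw [maxRegret_eq_envelope hN, maxRegret_eq_envelope hN, hx]
    obtain ⟨z, hze, hzt, hz, hzmin⟩ := hedge x'.e
    change τ.rarr 2 (τ.ireg 0) ≤ _
    rw [← h.best_val]
    exact (h.best_le x'.e x'.e.2).trans (hz ▸ hzmin x' rfl)

end Network

namespace Inst

variable {I : Inst}

open Classical in
/-- The number of nodes that are closer to `j` than `i`. -/
noncomputable def rank (I : Inst) (j i : ℕ) : ℕ :=
  ((Finset.range I.n).filter fun i' => I.D i' j < I.D i j).card

theorem rank_lt_rank {i i' j : ℕ} (hi' : i' < I.n) (h : I.D i' j < I.D i j) :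
    I.rank j i' < I.rank j i := by
  refine Finset.card_lt_card (Finset.ssubset_iff_of_subset ?_ |>.2 ⟨i', ?_, ?_⟩)
  · intro k hk
    simp only [Finset.mem_filter] at hk ⊢
    exact ⟨hk.1, hk.2.trans h⟩
  · simpa using ⟨hi', h⟩
  · simp

theorem rank_lt {i : ℕ} (j : ℕ) (hi : i < I.n) : I.rank j i < I.n := by
  have : I.rank j i < (Finset.range I.n).card :=
    Finset.card_lt_card (Finset.ssubset_iff_of_subset (Finset.filter_subset _ _) |>.2
      ⟨i, by simpa using hi, by simp⟩)
  simpa using this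

theorem D_step' (hI : I.Good) {i j : ℕ} (hi : i < I.n) (hj : j < I.n) (hij : i ≠ j) :
    ∃ e < I.m, ∃ i' < I.n, (I.S e = i ∧ I.T e = i' ∨ I.T e = i ∧ I.S e = i') ∧
      I.D i j = I.L e + I.D i' j ∧ I.rank j i' < I.rank j i := by
  obtain ⟨e, he, ⟨h1, h2⟩ | ⟨h1, h2⟩⟩ := hI.D_step hi hj hij
  · exact ⟨e, he, _, hI.T_lt he, .inl ⟨h1, rfl⟩, h2,
      rank_lt_rank (hI.T_lt he) (by linarith [hI.L_pos he])⟩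
  · exact ⟨e, he, _, hI.S_lt he, .inr ⟨h1, rfl⟩, h2,
      rank_lt_rank (hI.S_lt he) (by linarith [hI.L_pos he])⟩

theorem sum_L_nonneg (hI : I.Good) : 0 ≤ ∑ e ∈ Finset.range I.m, I.L e :=
  Finset.sum_nonneg fun _ he => (hI.L_pos (Finset.mem_range.1 he)).le

theorem D_le_rank (hI : I.Good) {j : ℕ} (hj : j < I.n) :
    ∀ r i, i < I.n → I.rank j i = r → I.D i j ≤ r * ∑ e ∈ Finset.range I.m, I.L e := by
  intro r
  induction r using Nat.strong_induction_on with
  | _ r ih =>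
    intro i hi hr
    by_cases hij : i = j
    · rw [hij, hI.D_self hj]
      exact mul_nonneg (Nat.cast_nonneg _) (sum_L_nonneg hI)
    · obtain ⟨e, he, i', hi', -, h1, h2⟩ := D_step' hI hi hj hij
      have h3 := ih _ (hr ▸ h2) i' hi' rfl
      have h4 : I.L e ≤ ∑ e ∈ Finset.range I.m, I.L e :=
        Finset.single_le_sum (f := I.L) (fun e he => (hI.L_pos (Finset.mem_range.1 he)).le)
          (Finset.mem_range.2 he)
      have h5 : (I.rank j i' : ℝ) + 1 ≤ r := by exact_mod_cast hr ▸ h2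
      have h6 := mul_le_mul_of_nonneg_right h5 (sum_L_nonneg hI)
      linarith

theorem D_le (hI : I.Good) {i j : ℕ} (hi : i < I.n) (hj : j < I.n) :
    I.D i j ≤ I.n * ∑ e ∈ Finset.range I.m, I.L e :=
  (D_le_rank hI hj _ i hi rfl).trans (mul_le_mul_of_nonneg_right
    (by exact_mod_cast (rank_lt j hi).le) (sum_L_nonneg hI))

end Inst

namespace RAMLang

open RealRAM Finset

variable {I : Inst}

/-- The instance is stored in the registers `0`, `1` and the arrays `2`, `3`, `4`, `5`. -/
structure Loaded (I : Inst) (σ : State) : Prop where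
  n : σ.ireg 0 = I.n
  m : σ.ireg 1 = I.m
  R : σ.rreg 0 = I.R
  S : σ.iarr 2 = I.S
  T : σ.iarr 3 = I.T
  L : σ.rarr 3 = I.L
  lb : σ.rarr 4 = I.lb
  ub : σ.rarr 5 = I.ub

theorem Loaded.frame {c : Cmd} {σ τ : State} (h : Loaded I σ) (hf : Frame c σ τ)
    (hc : (c.wI 0 || c.wI 1 || c.wR 0 || c.wIA 2 || c.wIA 3 || c.wRA 3 || c.wRA 4 || c.wRA 5) =
      false) : Loaded I τ := by
  simp only [Bool.or_eq_false_iff] at hc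
  obtain ⟨⟨⟨⟨⟨⟨⟨h1, h2⟩, h3⟩, h4⟩, h5⟩, h6⟩, h7⟩, h8⟩ := hc
  exact ⟨(hf.ir 0 h1).trans h.n, (hf.ir 1 h2).trans h.m, (hf.rr 0 h3).trans h.R,
    (hf.ia 2 h4).trans h.S, (hf.ia 3 h5).trans h.T, (hf.ra 3 h6).trans h.L,
    (hf.ra 4 h7).trans h.lb, (hf.ra 5 h8).trans h.ub⟩

def load : Cmd :=
  .iset 2 (.lit 0) ;; forTo 2 (.reg 1) (.ist 2 (.reg 2) (.ld 0 (.reg 2)) ;;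
    .ist 3 (.reg 2) (.ld 1 (.reg 2)) ;; .rst 3 (.reg 2) (.ld 0 (.reg 2)) ;;
    .rst 4 (.reg 2) (.ld 1 (.reg 2)) ;; .rst 5 (.reg 2) (.ld 2 (.reg 2)))

theorem update_prefix {α : Type} [Zero α] {f g : ℕ → α} {k : ℕ}
    (h : ∀ j, f j = if j < k then g j else 0) (j : ℕ) :
    Function.update f k (g k) j = if j < k + 1 then g j else 0 := by
  rcases lt_trichotomy j k with hj | rfl | hj
  · rw [Function.update_of_ne (by omega), h, if_pos hj, if_pos (by omega)]
  · rw [Function.update_self, if_pos (by omega)]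
  · rw [Function.update_of_ne (by omega), h, if_neg (by omega), if_neg (by omega)]

theorem run_load (N : Network) :
    Run load N.input fun t τ => t ≤ 7 * N.m + 2 ∧ Loaded N.inst τ := by
  rw [load, run_seq, run_iset]
  refine (Run.forTo' (a := 0) (n := N.m) (fun k τ =>
    (∀ j, τ.iarr 2 j = if j < k then N.inst.S j else 0) ∧
    (∀ j, τ.iarr 3 j = if j < k then N.inst.T j else 0) ∧
    (∀ j, τ.rarr 3 j = if j < k then N.inst.L j else 0) ∧
    (∀ j, τ.rarr 4 j = if j < k then N.inst.lb j else 0) ∧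
    (∀ j, τ.rarr 5 j = if j < k then N.inst.ub j else 0)) 5 (by simp) (Nat.zero_le _)
    (fun τ hτ => ?_) rfl ?_ ?_).mono ?_
  · have := hτ.ir 1 rfl
    simpa [Network.input] using this
  · simp [Network.input]
  · rintro k τ - hk hτ hτk ⟨h1, h2, h3, h4, h5⟩
    have e1 : τ.iarr 0 = N.inst.S := hτ.ia 0 rfl
    have e2 : τ.iarr 1 = N.inst.T := hτ.ia 1 rfl
    have e3 : τ.rarr 0 = N.inst.L := hτ.ra 0 rfl
    have e4 : τ.rarr 1 = N.inst.lb := hτ.ra 1 rfl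
    have e5 : τ.rarr 2 = N.inst.ub := hτ.ra 2 rfl
    simp [hτk, e1, e2, e3, e4, e5, -Order.lt_add_one_iff]
    exact ⟨update_prefix h1, update_prefix h2, update_prefix h3, update_prefix h4,
      update_prefix h5⟩
  · rintro t τ hτ ⟨⟨h1, h2, h3, h4, h5⟩, -, ht⟩
    refine ⟨by omega, ⟨by simpa [Network.input, Network.inst] using hτ.ir 0 rfl,
      by simpa [Network.input, Network.inst] using hτ.ir 1 rfl,
      by simpa [Network.input, Network.inst] using hτ.rr 0 rfl,
      ?_, ?_, ?_, ?_, ?_⟩⟩ <;> funext j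
    · rw [h1]; split_ifs with h <;> simp [Network.inst, Network.input, h]
    · rw [h2]; split_ifs with h <;> simp [Network.inst, Network.input, h]
    · rw [h3]; split_ifs with h <;> simp [Network.inst, Network.input, h]
    · rw [h4]; split_ifs with h <;> simp [Network.inst, Network.input, h]
    · rw [h5]; split_ifs with h <;> simp [Network.inst, Network.input, h]

/-- Stores the multiples of register `s` below the number in register `h` in the array `A`. -/
def table (A h s : ℕ) : Cmd :=
  .iset 25 (.lit 0) ;; .iset 26 (.lit 0) ;; forTo 25 (.reg h)
    (.ist A (.reg 25) (.reg 26) ;; .iset 26 (.add (.reg 26) (.reg s)))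

theorem run_table {A h s : ℕ} {σ : State} (hh : h ≠ 25) (hh' : h ≠ 26) (hs : s ≠ 25)
    (hs' : s ≠ 26) : Run (table A h s) σ fun t τ => t ≤ 4 * σ.ireg h + 3 ∧
      ∀ i < σ.ireg h, τ.iarr A i = i * σ.ireg s := by
  rw [table, run_seq, run_iset, run_seq, run_iset]
  refine (Run.forTo' (a := 0) (n := σ.ireg h) (fun k τ => τ.ireg 26 = k * σ.ireg s ∧
    ∀ i < k, τ.iarr A i = i * σ.ireg s) 2 (by simp) (Nat.zero_le _)
    (fun τ hτ => ?_) rfl (by simp) ?_).mono ?_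
  · have := hτ.ir h (by simp [forTo, Cmd.wI]; omega)
    simpa [hh, hh'] using this
  · rintro k τ - hk hτ hτk ⟨h1, h2⟩
    have e1 : τ.ireg s = σ.ireg s := by
      simpa [hs, hs'] using hτ.ir s (by simp [forTo, Cmd.wI]; omega)
    simp [hτk, h1, e1, add_mul, -Order.lt_add_one_iff]
    intro i hi
    rcases Nat.lt_succ_iff_lt_or_eq.1 hi with h | rfl
    · rw [Function.update_of_ne (by omega), h2 i h]
    · simp
  · rintro t τ hτ ⟨⟨h1, h2⟩, -, ht⟩
    exact ⟨by omega, h2⟩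


/-! ### Shortest paths -/

/-- Relaxes the edge `ireg 2` in the row at `ireg 4`. -/
def relax : Cmd :=
  .rst 6 (.add (.reg 4) (.ld 2 (.reg 2))) (.mn (.ld 6 (.add (.reg 4) (.ld 2 (.reg 2))))
    (.add (.ld 3 (.reg 2)) (.ld 6 (.add (.reg 4) (.ld 3 (.reg 2)))))) ;;
  .rst 6 (.add (.reg 4) (.ld 3 (.reg 2))) (.mn (.ld 6 (.add (.reg 4) (.ld 3 (.reg 2))))
    (.add (.ld 3 (.reg 2)) (.ld 6 (.add (.reg 4) (.ld 2 (.reg 2))))))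

theorem run_relax {σ : State} {e b : ℕ} (hI : I.Good) (hσ : Loaded I σ) (he : σ.ireg 2 = e)
    (hem : e < I.m) (hb : σ.ireg 4 = b) :
    Run relax σ fun t τ => t = 2 ∧ (∀ q < b, τ.rarr 6 q = σ.rarr 6 q) ∧
      (∀ i, τ.rarr 6 (b + i) ≤ σ.rarr 6 (b + i)) ∧
      τ.rarr 6 (b + I.S e) ≤ I.L e + σ.rarr 6 (b + I.T e) ∧
      τ.rarr 6 (b + I.T e) ≤ I.L e + σ.rarr 6 (b + I.S e) ∧
      ∀ j < I.n, (∀ i < I.n, I.D i j ≤ σ.rarr 6 (b + i)) → ∀ i < I.n, I.D i j ≤ τ.rarr 6 (b + i) := by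
  simp only [relax, run_seq, run_rst, RE.eval, IE.eval, ireg_setRA, iarr_setRA, rarr_setRA,
    Nat.reduceEqDiff, if_false, if_true, he, hb, hσ.S, hσ.T, hσ.L]
  have hne : I.S e ≠ I.T e := fun h => by
    have h1 := hI.D_edge hem
    rw [h, hI.D_self (hI.T_lt hem)] at h1
    exact (hI.L_pos hem).ne h1
  have hne1 : b + I.S e ≠ b + I.T e := by omega
  have hle : ∀ i, Function.update (Function.update (σ.rarr 6) (b + I.S e)
      (min (σ.rarr 6 (b + I.S e)) (I.L e + σ.rarr 6 (b + I.T e)))) (b + I.T e)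
      (min (Function.update (σ.rarr 6) (b + I.S e)
        (min (σ.rarr 6 (b + I.S e)) (I.L e + σ.rarr 6 (b + I.T e))) (b + I.T e))
        (I.L e + Function.update (σ.rarr 6) (b + I.S e)
          (min (σ.rarr 6 (b + I.S e)) (I.L e + σ.rarr 6 (b + I.T e))) (b + I.S e))) (b + i) =
      if i = I.T e then min (σ.rarr 6 (b + I.T e)) (I.L e +
        min (σ.rarr 6 (b + I.S e)) (I.L e + σ.rarr 6 (b + I.T e))) else
      if i = I.S e then min (σ.rarr 6 (b + I.S e)) (I.L e + σ.rarr 6 (b + I.T e)) else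
      σ.rarr 6 (b + i) := by
    intro i
    rw [Function.update_self, Function.update_of_ne hne1.symm]
    by_cases h1 : i = I.T e
    · rw [if_pos h1, h1, Function.update_self]
    · rw [if_neg h1, Function.update_of_ne (by omega)]
      by_cases h2 : i = I.S e
      · rw [if_pos h2, h2, Function.update_self]
      · rw [if_neg h2, Function.update_of_ne (by omega)]
  refine ⟨by simp, fun q hq => ?_, fun i => ?_, ?_, ?_, fun j hj hlow i hi => ?_⟩
  · rw [Function.update_of_ne (by omega), Function.update_of_ne (by omega)]
  · rw [hle]
    split_ifs with h1 h2
    · rw [h1]; exact min_le_left _ _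
    · rw [h2]; exact min_le_left _ _
    · exact le_rfl
  · rw [hle, if_neg hne, if_pos rfl]; exact min_le_right _ _
  · rw [hle, if_pos rfl]
    exact (min_le_right _ _).trans (add_le_add le_rfl (min_le_left _ _))
  · have k1 := hI.D_S_le hem hj
    have k2 := hI.D_T_le hem hj
    have k3 := hlow _ (hI.S_lt hem)
    have k4 := hlow _ (hI.T_lt hem)
    have k5 := hI.L_pos hem
    rw [hle]
    split_ifs with h1 h2
    · rw [h1]
      refine le_min k4 ?_
      rw [← sub_le_iff_le_add']
      exact le_min (by linarith) (by linarith)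
    · rw [h2]; exact le_min k3 (by linarith)
    · exact hlow i hi

/-- One round of Bellman–Ford. -/
def relaxAll : Cmd := .iset 2 (.lit 0) ;; forTo 2 (.reg 1) relax

theorem run_relaxAll {σ : State} {j b r : ℕ} (hI : I.Good) (hσ : Loaded I σ) (hb : σ.ireg 4 = b)
    (hj : j < I.n) (hlow : ∀ i < I.n, I.D i j ≤ σ.rarr 6 (b + i))
    (hup : ∀ i < I.n, I.rank j i < r → σ.rarr 6 (b + i) ≤ I.D i j)
    (h0 : σ.rarr 6 (b + j) ≤ 0) :
    Run relaxAll σ fun t τ => t ≤ 4 * I.m + 2 ∧ (∀ q < b, τ.rarr 6 q = σ.rarr 6 q) ∧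
      (∀ i < I.n, I.D i j ≤ τ.rarr 6 (b + i)) ∧
      (∀ i < I.n, I.rank j i < r + 1 → τ.rarr 6 (b + i) ≤ I.D i j) ∧ τ.rarr 6 (b + j) ≤ 0 := by
  rw [relaxAll, run_seq, run_iset]
  refine (Run.forTo' (a := 0) (n := I.m) (fun k τ => (∀ q < b, τ.rarr 6 q = σ.rarr 6 q) ∧
      (∀ i < I.n, I.D i j ≤ τ.rarr 6 (b + i)) ∧
      (∀ i, τ.rarr 6 (b + i) ≤ σ.rarr 6 (b + i)) ∧
      ∀ e < k, τ.rarr 6 (b + I.S e) ≤ I.L e + σ.rarr 6 (b + I.T e) ∧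
        τ.rarr 6 (b + I.T e) ≤ I.L e + σ.rarr 6 (b + I.S e)) 2 (by simp) (Nat.zero_le _)
    (fun τ hτ => ?_) rfl (by simpa using hlow) ?_).mono ?_
  · have := hτ.ir 1 rfl
    simpa [hσ.m] using this
  · rintro k τ - hk hτ hτk ⟨h1, h2, h3, h4⟩
    have hLo : Loaded I τ := Loaded.frame (σ := σ.setI 2 0) ⟨hσ.n, hσ.m, hσ.R, hσ.S, hσ.T, hσ.L,
      hσ.lb, hσ.ub⟩ hτ rfl
    refine (run_relax hI hLo hτk hk (b := b) ?_).mono ?_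
    · simpa [hb] using hτ.ir 4 rfl
    · rintro t υ - ⟨ht, k1, k2, k3, k4, k5⟩
      refine ⟨ht.le, fun q hq => (k1 q hq).trans (h1 q hq), k5 j hj h2,
        fun i => (k2 i).trans (h3 i), fun e he => ?_⟩
      rcases Nat.lt_succ_iff_lt_or_eq.1 he with he | rfl
      · exact ⟨(k2 _).trans (h4 e he).1, (k2 _).trans (h4 e he).2⟩
      · exact ⟨k3.trans (add_le_add le_rfl (h3 _)), k4.trans (add_le_add le_rfl (h3 _))⟩
  · rintro t τ hτ ⟨⟨h1, h2, h3, h4⟩, -, ht⟩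
    refine ⟨by omega, h1, h2, fun i hi hr => ?_, (h3 j).trans h0⟩
    by_cases hij : i = j
    · rw [hij, hI.D_self hj]; exact (h3 j).trans h0
    · obtain ⟨e, he, i', hi', hor, hD, hrank⟩ := Inst.D_step' hI hi hj hij
      have h5 := hup i' hi' (by omega)
      rcases hor with ⟨rfl, rfl⟩ | ⟨rfl, rfl⟩
      · linarith [(h4 e he).1]
      · linarith [(h4 e he).2]

/-- Fills the row of distances to the node `ireg 3`. -/
def distRow : Cmd :=
  .iset 4 (.ld 4 (.reg 3)) ;;
  .iset 6 (.lit 0) ;; forTo 6 (.reg 0) (.rst 6 (.add (.reg 4) (.reg 6)) (.reg 2)) ;;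
  .rst 6 (.add (.reg 4) (.reg 3)) (.lit 0) ;;
  .iset 5 (.lit 0) ;; forTo 5 (.reg 0) relaxAll

theorem run_distRow {σ : State} {j : ℕ} (hI : I.Good) (hσ : Loaded I σ) (h3 : σ.ireg 3 = j)
    (hj : j < I.n) (h4 : σ.iarr 4 j = j * I.n) (hM : σ.rreg 2 = I.n * ∑ e ∈ range I.m, I.L e) :
    Run distRow σ fun t τ => t ≤ 10 * I.n * I.m + 10 * I.n + 10 ∧
      (∀ q < j * I.n, τ.rarr 6 q = σ.rarr 6 q) ∧ ∀ i < I.n, τ.rarr 6 (j * I.n + i) = I.D i j := by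
  set b := j * I.n with hb
  rw [distRow, run_seq, run_iset, run_seq, run_iset, run_seq]
  refine (Run.forTo' (a := 0) (n := I.n) (fun k τ => (∀ q < b, τ.rarr 6 q = σ.rarr 6 q) ∧
    ∀ i < k, τ.rarr 6 (b + i) = σ.rreg 2) 1 (by simp) (Nat.zero_le _) (fun τ hτ => ?_) rfl
    (by simp) ?_).mono ?_
  · simpa [hσ.n] using hτ.ir 0 rfl
  · rintro k τ - hk hτ hτk ⟨h1, h2⟩
    have e1 : τ.ireg 4 = b := by simpa [h3, h4] using hτ.ir 4 rfl
    have e2 : τ.rreg 2 = σ.rreg 2 := by simpa using hτ.rr 2 rfl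
    simp [hτk, e1, e2, -Order.lt_add_one_iff]
    refine ⟨fun q hq => by rw [Function.update_of_ne (by omega), h1 q hq], fun i hi => ?_⟩
    rcases Nat.lt_succ_iff_lt_or_eq.1 hi with hi | rfl
    · rw [Function.update_of_ne (by omega), h2 i hi]
    · simp
  · rintro t τ hτ ⟨⟨h1, h2⟩, -, ht⟩
    have e1 : τ.ireg 4 = b := by simpa [h3, h4] using hτ.ir 4 rfl
    have e2 : τ.ireg 3 = j := by simpa [h3] using hτ.ir 3 rfl
    have hLo : Loaded I τ := Loaded.frame (σ := (σ.setI 4 b).setI 6 0) ⟨hσ.n, hσ.m, hσ.R, hσ.S,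
      hσ.T, hσ.L, hσ.lb, hσ.ub⟩ (by simpa [h3, h4] using hτ) rfl
    rw [run_seq, run_rst, run_seq, run_iset]
    refine (Run.forTo' (a := 0) (n := I.n) (fun r τ => (∀ q < b, τ.rarr 6 q = σ.rarr 6 q) ∧
      (∀ i < I.n, I.D i j ≤ τ.rarr 6 (b + i)) ∧
      (∀ i < I.n, I.rank j i < r → τ.rarr 6 (b + i) ≤ I.D i j) ∧ τ.rarr 6 (b + j) ≤ 0)
      (4 * I.m + 2) (by simp) (Nat.zero_le _) (fun τ' hτ' => ?_) rfl ?_ ?_).mono ?_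
    · simpa [hLo.n] using hτ'.ir 0 rfl
    · simp [e1, e2]
      refine ⟨fun q hq => by rw [Function.update_of_ne (by omega), h1 q hq], fun i hi => ?_⟩
      by_cases hij : i = j
      · rw [hij, Function.update_self, hI.D_self hj]
      · rw [Function.update_of_ne (by omega), h2 i hi, hM]
        exact Inst.D_le hI hi hj
    · rintro k υ - hk hυ hυk ⟨k1, k2, k3, k4⟩
      have hLo' : Loaded I υ := Loaded.frame (σ := (τ.setRA 6 (b + j) 0).setI 5 0) ⟨hLo.n, hLo.m,
        hLo.R, hLo.S, hLo.T, by simpa using hLo.L, by simpa using hLo.lb, by simpa using hLo.ub⟩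
        (by simpa [e1, e2] using hυ) rfl
      have e4 : υ.ireg 4 = b := by simpa [e1] using hυ.ir 4 rfl
      refine (run_relaxAll hI hLo' e4 hj k2 k3 k4).mono ?_
      rintro t' ω - ⟨ht', l1, l2, l3, l4⟩
      exact ⟨ht', fun q hq => (l1 q hq).trans (k1 q hq), l2, l3, l4⟩
    · rintro t' υ - ⟨⟨k1, k2, k3, k4⟩, -, ht'⟩
      refine ⟨?_, k1, fun i hi => le_antisymm (k3 i hi (Inst.rank_lt j hi)) (k2 i hi)⟩
      simp only [Nat.sub_zero] at ht ht'
      nlinarith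

/-- All distances, in array `6`, with row offsets in array `4`. -/
def distances : Cmd :=
  table 4 0 0 ;;
  .rset 1 (.lit 0) ;; .iset 2 (.lit 0) ;; forTo 2 (.reg 1) (.rset 1 (.add (.reg 1) (.ld 3 (.reg 2)))) ;;
  .rset 2 (.lit 0) ;; .iset 2 (.lit 0) ;; forTo 2 (.reg 0) (.rset 2 (.add (.reg 2) (.reg 1))) ;;
  .iset 3 (.lit 0) ;; forTo 3 (.reg 0) distRow

/-- The node distances are stored in array `6`, with row offsets in array `4`. -/
structure HasDist (I : Inst) (σ : State) : Prop extends Loaded I σ where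
  off : ∀ j < I.n, σ.iarr 4 j = j * I.n
  dist : ∀ i < I.n, ∀ j < I.n, σ.rarr 6 (j * I.n + i) = I.D i j

theorem run_distances {σ : State} (hI : I.Good) (hσ : Loaded I σ) :
    Run distances σ fun t τ => t ≤ 200 * I.m ^ 3 ∧ HasDist I τ := by
  rw [distances]
  refine (run_table (A := 4) (by decide) (by decide) (by decide) (by decide)).seq
    fun t τ hτ ⟨ht, hoff⟩ => ?_
  rw [hσ.n] at ht hoff
  have hLo : Loaded I τ := hσ.frame hτ rfl
  rw [run_seq, run_rset, run_seq, run_iset]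
  refine (Run.forTo' (a := 0) (n := I.m) (fun k υ => υ.rreg 1 = ∑ e ∈ range k, I.L e) 1 (by simp)
    (Nat.zero_le _) (fun υ hυ => ?_) rfl (by simp) ?_).seq ?_
  · simpa [hLo.m] using hυ.ir 1 rfl
  · rintro k υ - hk hυ hυk h1
    have e1 : υ.rarr 3 = I.L := (hυ.ra 3 rfl).trans hLo.L
    simp [hυk, e1, h1, sum_range_succ]
  rintro t1 υ hυ ⟨h1, -, ht1⟩
  rw [run_seq, run_rset, run_seq, run_iset]
  have e0 : υ.ireg 0 = I.n := (hυ.ir 0 rfl).trans hLo.n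
  refine (Run.forTo' (a := 0) (n := I.n) (fun k ω => ω.rreg 2 = k * ∑ e ∈ range I.m, I.L e) 1
    (by simp) (Nat.zero_le _) (fun ω hω => ?_) rfl (by simp) ?_).seq ?_
  · simpa [e0] using hω.ir 0 rfl
  · rintro k ω - hk hω hωk h2
    have e1 : ω.rreg 1 = ∑ e ∈ range I.m, I.L e := by simpa [h1] using hω.rr 1 rfl
    simp [e1, h2]
    ring
  rintro t2 ω hω ⟨h2, -, ht2⟩
  rw [run_seq, run_iset]
  have hLo' : Loaded I ω := ⟨by simpa [e0] using hω.ir 0 rfl,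
    by simpa [(hυ.ir 1 rfl).trans hLo.m] using hω.ir 1 rfl,
    by simpa [(hυ.rr 0 rfl).trans hLo.R] using hω.rr 0 rfl,
    (hω.ia 2 rfl).trans ((hυ.ia 2 rfl).trans hLo.S),
    (hω.ia 3 rfl).trans ((hυ.ia 3 rfl).trans hLo.T),
    (hω.ra 3 rfl).trans ((hυ.ra 3 rfl).trans hLo.L),
    (hω.ra 4 rfl).trans ((hυ.ra 4 rfl).trans hLo.lb),
    (hω.ra 5 rfl).trans ((hυ.ra 5 rfl).trans hLo.ub)⟩
  have e4 : ω.iarr 4 = τ.iarr 4 := (hω.ia 4 rfl).trans (hυ.ia 4 rfl)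
  refine (Run.forTo' (a := 0) (n := I.n) (fun k χ => ∀ j < k, ∀ i < I.n,
    χ.rarr 6 (j * I.n + i) = I.D i j) (10 * I.n * I.m + 10 * I.n + 10)
    (by simp) (Nat.zero_le _) (fun χ hχ => ?_) rfl (by simp) ?_).mono ?_
  · simpa [hLo'.n] using hχ.ir 0 rfl
  · rintro k χ - hk hχ hχk h3
    have hLo2 : Loaded I χ := Loaded.frame (σ := ω.setI 3 0) ⟨hLo'.n, hLo'.m, hLo'.R, hLo'.S,
      hLo'.T, hLo'.L, hLo'.lb, hLo'.ub⟩ (by simpa using hχ) rfl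
    have e5 : χ.iarr 4 = τ.iarr 4 := (hχ.ia 4 rfl).trans e4
    refine (run_distRow hI hLo2 hχk hk (by rw [e5]; exact hoff k hk)
      (by rw [← h2]; exact hχ.rr 2 rfl)).mono ?_
    rintro t3 ψ - ⟨ht3, k1, k2⟩
    refine ⟨ht3, fun j hj i hi => ?_⟩
    rcases Nat.lt_succ_iff_lt_or_eq.1 hj with hj | rfl
    · rw [← h3 j hj i hi]
      exact k1 _ (by nlinarith)
    · exact k2 i hi
  · rintro t3 χ hχ ⟨h3, -, ht3⟩
    have hLo2 : Loaded I χ := Loaded.frame (σ := ω.setI 3 0) ⟨hLo'.n, hLo'.m, hLo'.R, hLo'.S,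
      hLo'.T, hLo'.L, hLo'.lb, hLo'.ub⟩ (by simpa using hχ) rfl
    have e5 : χ.iarr 4 = τ.iarr 4 := (hχ.ia 4 rfl).trans e4
    refine ⟨?_, hLo2, fun j hj => by rw [e5]; exact hoff j hj, fun i hi j hj => h3 j hj i hi⟩
    have hn := hI.n_le
    have hm := hI.m_pos
    simp only [Nat.sub_zero] at ht1 ht2 ht3
    have b1 : I.n * (10 * I.n * I.m + 10 * I.n + 10 + 2) ≤
        (2 * I.m) * (10 * (2 * I.m) * I.m + 10 * (2 * I.m) + 10 + 2) := by gcongr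
    have b2 : I.m ≤ I.m ^ 3 := Nat.le_self_pow (by norm_num) _
    have b3 : I.m ^ 2 ≤ I.m ^ 3 := Nat.pow_le_pow_right hm (by norm_num)
    have b4 : 1 ≤ I.m ^ 3 := Nat.one_le_pow _ _ hm
    nlinarith

end RAMLang

namespace RAMLang

open RealRAM Finset

variable {I : Inst}

/-! ### Partition points -/

theorem perm_mem_of_fix {π : Equiv.Perm ℕ} {P : ℕ → Prop} (h : ∀ k, ¬ P k → π k = k) {k : ℕ} :
    P (π k) ↔ P k := by
  constructor
  · intro hk
    by_contra hn
    exact hn (h k hn ▸ hk)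
  · intro hk
    by_contra hn
    exact hn (by rwa [π.injective (h _ hn)])

/-- The positions `[s, f)` hold the set `A` in increasing order. -/
def Lists (g : ℕ → ℝ) (s f : ℕ) (A : Set ℝ) : Prop :=
  (∀ p q, s ≤ p → p < q → q < f → g p < g q) ∧ ∀ t, t ∈ A ↔ ∃ j, s ≤ j ∧ j < f ∧ g j = t

def BE.req (a b : RE) : BE := .and (.rle a b) (.rle b a)

@[simp] theorem BE.eval_req (a b : RE) (σ : State) : (BE.req a b).eval σ ↔ a.eval σ = b.eval σ :=
  ⟨fun h => le_antisymm h.1 h.2, fun h => ⟨h.le, h.ge⟩⟩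

/-- Adds `rreg 3` to the increasing list at the positions `[ireg 9, ireg 8)` of array `0`. -/
def insertPoint : Cmd :=
  .iset 10 (.lit 0) ;; .iset 11 (.reg 9) ;;
  forTo 11 (.reg 8) (.ite (.req (.ld 0 (.reg 11)) (.reg 3)) (.iset 10 (.lit 1)) .skip) ;;
  .ite (.ilt (.reg 10) (.lit 1))
    (.rst 0 (.reg 8) (.reg 3) ;; .iset 20 (.reg 9) ;; .iset 23 (.reg 8) ;; sink 0 15 ;;
      .iset 8 (.add (.reg 8) (.lit 1)))
    .skip

theorem run_insertPoint {σ : State} {s f : ℕ} {A : Set ℝ} (h9 : σ.ireg 9 = s) (h8 : σ.ireg 8 = f)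
    (hsf : s ≤ f) (hA : Lists (σ.rarr 0) s f A) :
    Run insertPoint σ fun t τ => t ≤ 12 * (f - s) + 20 ∧ f ≤ τ.ireg 8 ∧ τ.ireg 8 ≤ f + 1 ∧
      Lists (τ.rarr 0) s (τ.ireg 8) (insert (σ.rreg 3) A) ∧
      ∀ q < s, τ.rarr 0 q = σ.rarr 0 q := by
  rw [insertPoint, run_seq, run_iset, run_seq, run_iset]
  refine (Run.forTo' (a := s) (n := f) (fun k τ => τ.ireg 10 < 1 ↔
    ∀ j, s ≤ j → j < k → σ.rarr 0 j ≠ σ.rreg 3) 2 (by simp [h9]) hsf (fun τ hτ => ?_) rfl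
    ?_ ?_).seq ?_
  · simpa [h8] using hτ.ir 8 rfl
  · simp only [ireg_setI]
    simp
    intro j h1 h2
    omega
  · rintro k τ hk1 hk hτ hτk h1
    have e1 : τ.rarr 0 = σ.rarr 0 := hτ.ra 0 rfl
    have e2 : τ.rreg 3 = σ.rreg 3 := hτ.rr 3 rfl
    rw [run_ite]
    simp only [BE.eval_req, RE.eval, IE.eval, e1, e2, hτk, run_iset, run_skip, ireg_setI,
      Nat.reduceEqDiff, if_false, if_true, ireg_setI]
    constructor
    · intro h
      refine ⟨by omega, ?_⟩
      simp
      exact ⟨k, hk1, le_rfl, h⟩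
    · intro h
      refine ⟨by omega, ?_⟩
      rw [h1]
      constructor
      · intro h2 j hj1 hj2
        rcases Nat.lt_succ_iff_lt_or_eq.1 hj2 with hj | rfl
        · exact h2 j hj1 hj
        · exact h
      · exact fun h2 j hj1 hj2 => h2 j hj1 (by omega)
  · rintro t τ hτ ⟨h1, -, ht⟩
    have e1 : τ.rarr 0 = σ.rarr 0 := hτ.ra 0 rfl
    have e2 : τ.rreg 3 = σ.rreg 3 := hτ.rr 3 rfl
    have e8 : τ.ireg 8 = f := by simpa [h8] using hτ.ir 8 rfl
    have e9 : τ.ireg 9 = s := by simpa [h9] using hτ.ir 9 rfl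
    rw [run_ite]
    simp only [BE.eval, IE.eval, h1]
    constructor
    · intro hnew
      rw [run_seq, run_rst, run_seq, run_iset, run_seq, run_iset]
      have hupd : ∀ j, j < f → Function.update (σ.rarr 0) f (σ.rreg 3) j = σ.rarr 0 j :=
        fun j hj => Function.update_of_ne (by omega) _ _
      refine (run_sink (s := s) (i := f) (by simp [e9]) (by simp [e8]) hsf ?_).seq ?_
      · intro p q hp hpq hq
        simp [e8, e1, e2, hupd p (by omega), hupd q hq]
        rcases eq_or_lt_of_le hpq with rfl | h
        · exact le_rfl
        · exact (hA.1 p q hp h hq).le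
      · rintro t' υ hυ ⟨ht', hs, π, hπ, hX, -⟩
        have e8' : υ.ireg 8 = f := by simpa [e8] using hυ.ir 8 rfl
        rw [run_iset]
        simp [e8']
        simp [e8, e1, e2] at hX
        have hmem : ∀ k, (s ≤ π k ∧ π k ≤ f) ↔ (s ≤ k ∧ k ≤ f) := fun k =>
          perm_mem_of_fix (P := fun k => s ≤ k ∧ k ≤ f) hπ
        have hinj : ∀ p q, s ≤ p → p ≤ f → s ≤ q → q ≤ f →
            Function.update (σ.rarr 0) f (σ.rreg 3) p = Function.update (σ.rarr 0) f (σ.rreg 3) q →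
            p = q := by
          intro p q hp hpf hq hqf heq
          by_contra hne
          wlog hpq : p < q generalizing p q
          · exact this q p hq hqf hp hpf heq.symm (Ne.symm hne) (by omega)
          rw [hupd p (by omega)] at heq
          by_cases hqf' : q = f
          · rw [hqf', Function.update_self] at heq
            exact hnew p hp (by omega) heq
          · rw [hupd q (by omega)] at heq
            exact (hA.1 p q hp hpq (by omega)).ne heq
        refine ⟨by omega, ⟨fun p q hp hpq hq => ?_, fun x => ?_⟩, fun q hq => ?_⟩
        · refine lt_of_le_of_ne (hs p q hp hpq.le hq) fun heq => ?_
          rw [hX] at heq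
          have h3 := (hmem p).2 ⟨hp, by omega⟩
          have h4 := (hmem q).2 ⟨by omega, by omega⟩
          have := π.injective (hinj _ _ h3.1 h3.2 h4.1 h4.2 heq)
          omega
        · rw [Set.mem_insert_iff, hA.2]
          constructor
          · intro hx
            obtain ⟨j, hj1, hj2, hj3⟩ : ∃ j, s ≤ j ∧ j ≤ f ∧
                Function.update (σ.rarr 0) f (σ.rreg 3) j = x := by
              rcases hx with rfl | ⟨j, hj1, hj2, hj3⟩
              · exact ⟨f, hsf, le_rfl, by simp⟩
              · exact ⟨j, hj1, hj2.le, by rw [hupd j hj2, hj3]⟩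
            have h5 := (hmem (π.symm j)).1 (by simpa using ⟨hj1, hj2⟩)
            exact ⟨π.symm j, h5.1, by omega, by rw [hX]; simpa using hj3⟩
          · rintro ⟨j, hj1, hj2, rfl⟩
            have h5 := (hmem j).2 ⟨hj1, by omega⟩
            rw [hX, Function.comp]
            by_cases h6 : π j = f
            · left; rw [h6, Function.update_self]
            · right
              exact ⟨π j, h5.1, by omega, by rw [hupd _ (by omega)]⟩
        · rw [hX, Function.comp, hπ q (by omega), Function.update_of_ne (by omega)]
    · intro hold
      push Not at hold
      obtain ⟨j, hj1, hj2, hj3⟩ := hold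
      rw [run_skip, e8, e1]
      have : insert (σ.rreg 3) A = A := Set.insert_eq_of_mem ((hA.2 _).2 ⟨j, hj1, hj2, hj3⟩)
      rw [this]
      exact ⟨by omega, le_rfl, by omega, hA, fun _ _ => rfl⟩

/-- Adds the candidate `e` if it passes the test `b`, evaluated with the candidate in `rreg 3`. -/
def tryPoint (e : RE) (b : BE) : Cmd := .rset 3 e ;; .ite b insertPoint .skip

theorem run_tryPoint {e : RE} {b : BE} {σ : State} {s f : ℕ} {A : Set ℝ} (h9 : σ.ireg 9 = s)
    (h8 : σ.ireg 8 = f) (hsf : s ≤ f) (hA : Lists (σ.rarr 0) s f A) (P : ℝ → Prop)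
    (hP : ∀ x, b.eval (σ.setR 3 x) ↔ P x) :
    Run (tryPoint e b) σ fun t τ => t ≤ 12 * (f - s) + 22 ∧ f ≤ τ.ireg 8 ∧ τ.ireg 8 ≤ f + 1 ∧
      Lists (τ.rarr 0) s (τ.ireg 8) (A ∪ {x | x = e.eval σ ∧ P x}) ∧
      ∀ q < s, τ.rarr 0 q = σ.rarr 0 q := by
  rw [tryPoint, run_seq, run_rset, run_ite]
  rw [hP]
  constructor
  · intro h
    refine (run_insertPoint (s := s) (f := f) (A := A) (by simpa using h9) (by simpa using h8) hsf
      (by simpa using hA)).mono ?_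
    rintro t τ - ⟨h1, h2, h3, h4, h5⟩
    refine ⟨by omega, h2, h3, ?_, by simpa using h5⟩
    convert h4 using 1
    ext x
    simp only [rreg_setR, if_true, Set.mem_union, Set.mem_insert_iff, or_comm (b := x ∈ A)]
    refine or_congr Iff.rfl ⟨fun h => h.1, fun hx => ⟨hx, hx ▸ h⟩⟩
  · intro h
    rw [run_skip]
    simp only [ireg_setR, h8, rarr_setR]
    refine ⟨by omega, le_rfl, by omega, ?_, by simp⟩
    convert hA using 1
    ext x
    simp only [Set.mem_union, or_iff_left_iff_imp]
    rintro ⟨rfl, hx⟩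
    exact absurd hx h


/-- Distances from the candidate `rreg 3` on an edge of length `rreg 4` through its endnodes. -/
def uExp (k : ℕ) : RE := .add (.mul (.reg 3) (.reg 4)) (.reg k)
def vExp (k : ℕ) : RE := .add (.mul (.sub (.lit 1) (.reg 3)) (.reg 4)) (.reg k)

def nodeTest : BE :=
  .and (.rle (.lit 0) (.reg 3)) (.and (.rle (.reg 3) (.lit 1))
    (.or (.req (.mn (uExp 5) (vExp 6)) (.reg 0))
      (.and (.rlt (.lit 0) (.reg 3)) (.and (.rlt (.reg 3) (.lit 1)) (.req (uExp 5) (vExp 6))))))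

/-- Adds the candidates of the node `ireg 12` on the edge `ireg 7`. -/
def nodePoints : Cmd :=
  .rset 4 (.ld 3 (.reg 7)) ;; .rset 5 (.ld 6 (.add (.ld 4 (.reg 12)) (.ld 2 (.reg 7)))) ;;
  .rset 6 (.ld 6 (.add (.ld 4 (.reg 12)) (.ld 3 (.reg 7)))) ;;
  tryPoint (.div (.sub (.reg 0) (.reg 5)) (.reg 4)) nodeTest ;;
  tryPoint (.sub (.lit 1) (.div (.sub (.reg 0) (.reg 6)) (.reg 4))) nodeTest ;;
  tryPoint (.div (.sub (.add (.reg 4) (.reg 6)) (.reg 5)) (.mul (.lit 2) (.reg 4))) nodeTest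

theorem HasDist.frame {c : Cmd} {σ τ : State} (h : HasDist I σ) (hf : Frame c σ τ)
    (hc : (c.wI 0 || c.wI 1 || c.wR 0 || c.wIA 2 || c.wIA 3 || c.wRA 3 || c.wRA 4 || c.wRA 5 ||
      c.wIA 4 || c.wRA 6) = false) : HasDist I τ := by
  rw [Bool.or_eq_false_iff, Bool.or_eq_false_iff] at hc
  exact ⟨h.toLoaded.frame hf hc.1.1, by rw [hf.ia 4 hc.1.2]; exact h.off,
    by rw [hf.ra 6 hc.2]; exact h.dist⟩

theorem Lists.congr_set {g : ℕ → ℝ} {s f : ℕ} {A B : Set ℝ} (h : Lists g s f A)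
    (hAB : ∀ t, t ∈ B ↔ t ∈ A) : Lists g s f B :=
  ⟨h.1, fun t => (hAB t).trans (h.2 t)⟩

theorem run_nodePoints {σ : State} {x i s f : ℕ} {A : Set ℝ} (hI : I.Good) (hσ : HasDist I σ)
    (h7 : σ.ireg 7 = x) (hx : x < I.m) (h12 : σ.ireg 12 = i) (hi : i < I.n)
    (h9 : σ.ireg 9 = s) (h8 : σ.ireg 8 = f) (hsf : s ≤ f) (hA : Lists (σ.rarr 0) s f A) :
    Run nodePoints σ fun t τ => t ≤ 36 * (f - s) + 120 ∧ f ≤ τ.ireg 8 ∧ τ.ireg 8 ≤ f + 3 ∧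
      Lists (τ.rarr 0) s (τ.ireg 8) (A ∪ {t | 0 ≤ t ∧ t ≤ 1 ∧ I.NodeCond x i t}) ∧
      ∀ q < s, τ.rarr 0 q = σ.rarr 0 q := by
  have hL := hI.L_pos hx
  have key : ∀ τ : State, τ.rreg 0 = I.R → τ.rreg 4 = I.L x → τ.rreg 5 = I.D (I.S x) i →
      τ.rreg 6 = I.D (I.T x) i → ∀ t, nodeTest.eval (τ.setR 3 t) ↔
        (0 ≤ t ∧ t ≤ 1 ∧ I.NodeCond x i t) := by
    intro τ r0 r4 r5 r6 t
    simp only [nodeTest, BE.eval, BE.eval_req, RE.eval, uExp, vExp, rreg_setR, Nat.reduceEqDiff,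
      if_false, if_true, r0, r4, r5, r6, Inst.NodeCond, Inst.d, Inst.u, Inst.v, OfNat.zero_ne_ofNat]
    push_cast
    rfl
  simp only [nodePoints, run_seq (c := .rset 4 _), run_seq (c := .rset 5 _),
    run_seq (c := .rset 6 _), run_rset, IE.eval, RE.eval, ireg_setR, iarr_setR, rarr_setR, h7, h12,
    hσ.S, hσ.T, hσ.L, hσ.off i hi, hσ.dist _ (hI.S_lt hx) i hi, hσ.dist _ (hI.T_lt hx) i hi]
  refine (run_tryPoint (s := s) (f := f) (A := A) (by simpa using h9) (by simpa using h8) hsf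
    (by simpa using hA) _ (key _ (by simpa using hσ.R) (by simp) (by simp) (by simp))).seq ?_
  rintro t1 τ1 hτ1 ⟨ht1, a1, b1, c1, d1⟩
  refine (run_tryPoint (s := s) (A := _) ?_ rfl (hsf.trans a1) c1 _ (key _
    ((hτ1.rr 0 rfl).trans (by simpa using hσ.R)) ((hτ1.rr 4 rfl).trans (by simp))
    ((hτ1.rr 5 rfl).trans (by simp)) ((hτ1.rr 6 rfl).trans (by simp)))).seq ?_
  · simpa [h9] using hτ1.ir 9 rfl
  rintro t2 τ2 hτ2 ⟨ht2, a2, b2, c2, d2⟩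
  have e0 : τ1.rreg 0 = I.R := (hτ1.rr 0 rfl).trans (by simpa using hσ.R)
  have e4 : τ1.rreg 4 = I.L x := (hτ1.rr 4 rfl).trans (by simp)
  have e5 : τ1.rreg 5 = I.D (I.S x) i := (hτ1.rr 5 rfl).trans (by simp)
  have e6 : τ1.rreg 6 = I.D (I.T x) i := (hτ1.rr 6 rfl).trans (by simp)
  have e4' : τ2.rreg 4 = I.L x := (hτ2.rr 4 rfl).trans e4
  have e5' : τ2.rreg 5 = I.D (I.S x) i := (hτ2.rr 5 rfl).trans e5
  have e6' : τ2.rreg 6 = I.D (I.T x) i := (hτ2.rr 6 rfl).trans e6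
  refine (run_tryPoint (s := s) (A := _) ?_ rfl ((hsf.trans a1).trans a2) c2 _ (key _
    ((hτ2.rr 0 rfl).trans e0) e4' e5' e6')).mono ?_
  · simpa [h9] using (hτ2.ir 9 rfl).trans (hτ1.ir 9 rfl)
  rintro t3 τ3 - ⟨ht3, a3, b3, c3, d3⟩
  refine ⟨by omega, by omega, by omega, c3.congr_set fun t => ?_, fun q hq => ?_⟩
  · simp only [RE.eval, e0, e4, e6, e4', e5', e6', rreg_setR, Nat.reduceEqDiff, if_true, if_false,
      hσ.R, Set.mem_union, Set.mem_ofPred_eq, or_assoc, OfNat.zero_ne_ofNat]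
    refine or_congr Iff.rfl ⟨fun h => ?_, ?_⟩
    · have h' := Inst.nodeCond_cand hL h.2.2
      simp only [Inst.tu, Inst.tv, Inst.tb] at h'
      push_cast
      tauto
    · rintro (h | h | h) <;> exact h.2
  · rw [d3 q hq, d2 q hq, d1 q hq]; simp

def edgeTest : BE :=
  .and (.or (.ilt (.reg 7) (.reg 2)) (.ilt (.reg 2) (.reg 7)))
    (.and (.rlt (.lit 0) (.reg 3)) (.and (.rlt (.reg 3) (.lit 1)) (.or
      (.and (.req (.add (uExp 5) (uExp 7)) (.sub (.mul (.lit 2) (.reg 0)) (.reg 9)))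
        (.and (.rlt (uExp 5) (vExp 6)) (.and (.rlt (uExp 7) (vExp 8))
          (.and (.rlt (.sub (.reg 0) (.reg 9)) (uExp 5)) (.rlt (uExp 5) (.reg 0))))))
      (.and (.req (.add (vExp 6) (vExp 8)) (.sub (.mul (.lit 2) (.reg 0)) (.reg 9)))
        (.and (.rlt (vExp 6) (uExp 5)) (.and (.rlt (vExp 8) (uExp 7))
          (.and (.rlt (.sub (.reg 0) (.reg 9)) (vExp 6)) (.rlt (vExp 6) (.reg 0)))))))))

/-- Loads the distances between the endnodes of the edges `ireg 7` and `ireg 2`. -/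
def loadDist : Cmd :=
  .rset 4 (.ld 3 (.reg 7)) ;;
  .rset 5 (.ld 6 (.add (.ld 4 (.ld 2 (.reg 2))) (.ld 2 (.reg 7)))) ;;
  .rset 6 (.ld 6 (.add (.ld 4 (.ld 2 (.reg 2))) (.ld 3 (.reg 7)))) ;;
  .rset 7 (.ld 6 (.add (.ld 4 (.ld 3 (.reg 2))) (.ld 2 (.reg 7)))) ;;
  .rset 8 (.ld 6 (.add (.ld 4 (.ld 3 (.reg 2))) (.ld 3 (.reg 7)))) ;;
  .rset 9 (.ld 3 (.reg 2))

structure DistRegs (I : Inst) (x e : ℕ) (τ : State) : Prop where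
  r0 : τ.rreg 0 = I.R
  r4 : τ.rreg 4 = I.L x
  r5 : τ.rreg 5 = I.D (I.S x) (I.S e)
  r6 : τ.rreg 6 = I.D (I.T x) (I.S e)
  r7 : τ.rreg 7 = I.D (I.S x) (I.T e)
  r8 : τ.rreg 8 = I.D (I.T x) (I.T e)
  r9 : τ.rreg 9 = I.L e

theorem DistRegs.frame {c : Cmd} {x e : ℕ} {σ τ : State} (h : DistRegs I x e σ) (hf : Frame c σ τ)
    (hc : (c.wR 0 || c.wR 4 || c.wR 5 || c.wR 6 || c.wR 7 || c.wR 8 || c.wR 9) = false) :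
    DistRegs I x e τ := by
  simp only [Bool.or_eq_false_iff] at hc
  obtain ⟨⟨⟨⟨⟨⟨h1, h2⟩, h3⟩, h4⟩, h5⟩, h6⟩, h7⟩ := hc
  exact ⟨(hf.rr 0 h1).trans h.r0, (hf.rr 4 h2).trans h.r4, (hf.rr 5 h3).trans h.r5,
    (hf.rr 6 h4).trans h.r6, (hf.rr 7 h5).trans h.r7, (hf.rr 8 h6).trans h.r8,
    (hf.rr 9 h7).trans h.r9⟩

theorem run_loadDist {σ : State} {x e : ℕ} (hI : I.Good) (hσ : HasDist I σ)
    (h7 : σ.ireg 7 = x) (hx : x < I.m) (h2 : σ.ireg 2 = e) (he : e < I.m) :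
    Run loadDist σ fun t τ => t = 6 ∧ DistRegs I x e τ := by
  simp only [loadDist, run_seq, run_rset, IE.eval, RE.eval, ireg_setR, iarr_setR, rarr_setR, h7, h2,
    hσ.S, hσ.T, hσ.L, hσ.off _ (hI.S_lt he), hσ.off _ (hI.T_lt he),
    hσ.dist _ (hI.S_lt hx) _ (hI.S_lt he), hσ.dist _ (hI.T_lt hx) _ (hI.S_lt he),
    hσ.dist _ (hI.S_lt hx) _ (hI.T_lt he), hσ.dist _ (hI.T_lt hx) _ (hI.T_lt he)]
  exact ⟨trivial, by simpa using hσ.R, by simp, by simp, by simp, by simp, by simp, by simp⟩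

/-- Adds the candidates of the edge `ireg 2` on the edge `ireg 7`. -/
def edgePoints : Cmd :=
  loadDist ;;
  tryPoint (.div (.sub (.sub (.sub (.mul (.lit 2) (.reg 0)) (.reg 9)) (.reg 5)) (.reg 7))
    (.mul (.lit 2) (.reg 4))) edgeTest ;;
  tryPoint (.sub (.lit 1) (.div (.sub (.sub (.sub (.mul (.lit 2) (.reg 0)) (.reg 9)) (.reg 6))
    (.reg 8)) (.mul (.lit 2) (.reg 4)))) edgeTest

theorem run_edgePoints {σ : State} {x e s f : ℕ} {A : Set ℝ} (hI : I.Good) (hσ : HasDist I σ)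
    (h7 : σ.ireg 7 = x) (hx : x < I.m) (h2 : σ.ireg 2 = e) (he : e < I.m)
    (h9 : σ.ireg 9 = s) (h8 : σ.ireg 8 = f) (hsf : s ≤ f) (hA : Lists (σ.rarr 0) s f A) :
    Run edgePoints σ fun t τ => t ≤ 24 * (f - s) + 70 ∧ f ≤ τ.ireg 8 ∧ τ.ireg 8 ≤ f + 2 ∧
      Lists (τ.rarr 0) s (τ.ireg 8) (A ∪ {t | I.EdgeCond x e t}) ∧
      ∀ q < s, τ.rarr 0 q = σ.rarr 0 q := by
  have hL := hI.L_pos hx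
  have key : ∀ τ : State, DistRegs I x e τ → τ.ireg 7 = x → τ.ireg 2 = e → ∀ t,
      edgeTest.eval (τ.setR 3 t) ↔ I.EdgeCond x e t := by
    intro τ h i7 i2 t
    simp only [edgeTest, BE.eval, BE.eval_req, RE.eval, IE.eval, uExp, vExp, rreg_setR,
      Nat.reduceEqDiff, if_false, if_true, h.r0, h.r4, h.r5, h.r6, h.r7, h.r8, h.r9, i7, i2,
      ireg_setR, Inst.EdgeCond, Inst.u, Inst.v, OfNat.zero_ne_ofNat, lt_or_lt_iff_ne]
    push_cast
    rfl
  rw [edgePoints]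
  refine (run_loadDist hI hσ h7 hx h2 he).seq ?_
  rintro t0 τ0 hτ0 ⟨ht0, hd⟩
  refine (run_tryPoint (s := s) (f := f) (A := A) ((hτ0.ir 9 rfl).trans h9)
    ((hτ0.ir 8 rfl).trans h8) hsf (by rw [hτ0.ra 0 rfl]; exact hA) _
    (key _ hd ((hτ0.ir 7 rfl).trans h7) ((hτ0.ir 2 rfl).trans h2))).seq ?_
  rintro t1 τ1 hτ1 ⟨ht1, a1, b1, c1, d1⟩
  have hd1 : DistRegs I x e τ1 := hd.frame hτ1 rfl
  refine (run_tryPoint (s := s) (A := _) ((hτ1.ir 9 rfl).trans ((hτ0.ir 9 rfl).trans h9)) rfl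
    (hsf.trans a1) c1 _ (key _ hd1 ((hτ1.ir 7 rfl).trans ((hτ0.ir 7 rfl).trans h7))
    ((hτ1.ir 2 rfl).trans ((hτ0.ir 2 rfl).trans h2)))).mono ?_
  rintro t2 τ2 - ⟨ht2, a2, b2, c2, d2⟩
  refine ⟨by omega, by omega, by omega, c2.congr_set fun t => ?_, fun q hq => ?_⟩
  · simp only [RE.eval, hd.r0, hd.r4, hd.r5, hd.r7, hd.r9, hd1.r0, hd1.r4, hd1.r6, hd1.r8, hd1.r9,
      Set.mem_union, Set.mem_ofPred_eq, or_assoc]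
    refine or_congr Iff.rfl ⟨fun h => ?_, ?_⟩
    · have h' := Inst.edgeCond_cand hL h
      simp only [Inst.eu, Inst.ev] at h'
      push_cast
      tauto
    · rintro (h | h) <;> exact h.2
  · rw [d2 q hq, d1 q hq, hτ0.ra 0 rfl]

/-- Lists the partition points of the edge `ireg 7` from position `ireg 8` on. -/
def edgePartition : Cmd :=
  .iset 9 (.reg 8) ;; tryPoint (.lit 0) (.ile (.lit 0) (.lit 0)) ;;
  tryPoint (.lit 1) (.ile (.lit 0) (.lit 0)) ;;
  .iset 12 (.lit 0) ;; forTo 12 (.reg 0) nodePoints ;;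
  .iset 2 (.lit 0) ;; forTo 2 (.reg 1) edgePoints

theorem run_edgePartition {σ : State} {x s : ℕ} (hI : I.Good) (hσ : HasDist I σ)
    (h7 : σ.ireg 7 = x) (hx : x < I.m) (h8 : σ.ireg 8 = s) :
    Run edgePartition σ fun t τ => t ≤ 2000 * I.m ^ 2 ∧ s + 2 ≤ τ.ireg 8 ∧
      τ.ireg 8 ≤ s + 10 * I.m ∧ Lists (τ.rarr 0) s (τ.ireg 8) (I.PP x) ∧
      ∀ q < s, τ.rarr 0 q = σ.rarr 0 q := by
  have hn := hI.n_le
  have hm := hI.m_pos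
  rw [edgePartition, run_seq, run_iset]
  refine (run_tryPoint (s := s) (f := s) (A := ∅) (by simp [h8]) (by simp [h8]) le_rfl
    ⟨fun p q _ _ _ => by omega, fun t => by simp; omega⟩ (fun _ => True) (by simp)).seq ?_
  rintro t1 τ1 hτ1 ⟨ht1, a1, b1, c1, d1⟩
  have e9 : τ1.ireg 9 = s := by simpa [h8] using hτ1.ir 9 rfl
  refine (run_tryPoint (s := s) (A := _) e9 rfl a1 c1 (fun _ => True) (by simp)).seq ?_
  rintro t2 τ2 hτ2 ⟨ht2, a2, b2, c2, d2⟩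
  have e9' : τ2.ireg 9 = s := (hτ2.ir 9 rfl).trans e9
  have hD2 : HasDist I τ2 := (HasDist.frame (σ := σ.setI 9 s) ⟨⟨hσ.n, hσ.m, hσ.R, hσ.S, hσ.T, hσ.L,
    hσ.lb, hσ.ub⟩, hσ.off, hσ.dist⟩ (by simpa [h8] using hτ1) rfl).frame hτ2 rfl
  have e7 : τ2.ireg 7 = x := (hτ2.ir 7 rfl).trans (by simpa [h7] using hτ1.ir 7 rfl)
  have hlen : s + 2 ≤ τ2.ireg 8 := by
    obtain ⟨i, hi1, hi2, hi3⟩ := (c2.2 0).1 (by simp)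
    obtain ⟨j, hj1, hj2, hj3⟩ := (c2.2 1).1 (by simp)
    have : i ≠ j := by rintro rfl; linarith
    omega
  rw [run_seq, run_iset]
  refine (Run.forTo' (a := 0) (n := I.n) (fun k υ => s + 2 ≤ υ.ireg 8 ∧ υ.ireg 8 ≤ s + 2 + 3 * k ∧
    Lists (υ.rarr 0) s (υ.ireg 8)
      {t | t = 0 ∨ t = 1 ∨ ∃ i < k, 0 ≤ t ∧ t ≤ 1 ∧ I.NodeCond x i t} ∧
    ∀ q < s, υ.rarr 0 q = σ.rarr 0 q) (36 * (2 + 3 * I.n) + 120) (by simp) (Nat.zero_le _)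
    (fun υ hυ => ?_) rfl ?_ ?_).seq ?_
  · simpa [hD2.n] using hυ.ir 0 rfl
  · refine ⟨by simpa using hlen, ?_, ?_, ?_⟩
    · simp; omega
    · simpa using c2.congr_set fun t => by simp [or_comm]
    · intro q hq
      simp [d2 q hq, d1 q hq]
  · rintro k υ - hk hυ hυk ⟨h1, h2, h3, h4⟩
    have hDυ : HasDist I υ := (HasDist.frame (σ := τ2.setI 12 0) ⟨⟨hD2.n, hD2.m, hD2.R, hD2.S,
      hD2.T, hD2.L, hD2.lb, hD2.ub⟩, hD2.off, hD2.dist⟩ (by simpa using hυ) rfl)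
    refine (run_nodePoints hI hDυ (x := x) (by simpa [e7] using hυ.ir 7 rfl) hx hυk hk (s := s)
      (by simpa [e9'] using hυ.ir 9 rfl) rfl (by omega) h3).mono ?_
    rintro t3 ω - ⟨ht3, a3, b3, c3, d3⟩
    simp only [ireg_setI, rarr_setI, Nat.reduceEqDiff, if_false]
    refine ⟨by omega, by omega, by omega, c3.congr_set fun t => ?_, fun q hq =>
      (d3 q hq).trans (h4 q hq)⟩
    simp only [Set.mem_union, Set.mem_ofPred_eq, Nat.lt_succ_iff_lt_or_eq, or_and_right, exists_or,
      exists_eq_left, or_assoc]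
  rintro t3 τ3 hτ3 ⟨⟨h1, h2, h3, h4⟩, -, ht3⟩
  have hD3 : HasDist I τ3 := (HasDist.frame (σ := τ2.setI 12 0) ⟨⟨hD2.n, hD2.m, hD2.R, hD2.S,
    hD2.T, hD2.L, hD2.lb, hD2.ub⟩, hD2.off, hD2.dist⟩ (by simpa using hτ3) rfl)
  have e93 : τ3.ireg 9 = s := by simpa [e9'] using hτ3.ir 9 rfl
  have e73 : τ3.ireg 7 = x := by simpa [e7] using hτ3.ir 7 rfl
  rw [run_seq, run_iset]
  refine (Run.forTo' (a := 0) (n := I.m) (fun k υ => s + 2 ≤ υ.ireg 8 ∧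
    υ.ireg 8 ≤ s + 2 + 3 * I.n + 2 * k ∧
    Lists (υ.rarr 0) s (υ.ireg 8)
      {t | t = 0 ∨ t = 1 ∨ (∃ i < I.n, 0 ≤ t ∧ t ≤ 1 ∧ I.NodeCond x i t) ∨
        ∃ e < k, I.EdgeCond x e t} ∧
    ∀ q < s, υ.rarr 0 q = σ.rarr 0 q) (24 * (2 + 3 * I.n + 2 * I.m) + 70) (by simp) (Nat.zero_le _)
    (fun υ hυ => ?_) rfl ?_ ?_).mono ?_
  · simpa [hD3.m] using hυ.ir 1 rfl
  · exact ⟨by simpa using h1, by simpa using h2, by simpa using h3, by simpa using h4⟩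
  · rintro k υ - hk hυ hυk ⟨h1, h2, h3, h4⟩
    have hDυ : HasDist I υ := (HasDist.frame (σ := τ3.setI 2 0) ⟨⟨hD3.n, hD3.m, hD3.R, hD3.S,
      hD3.T, hD3.L, hD3.lb, hD3.ub⟩, hD3.off, hD3.dist⟩ (by simpa using hυ) rfl)
    refine (run_edgePoints hI hDυ (x := x) (by simpa [e73] using hυ.ir 7 rfl) hx hυk hk (s := s)
      (by simpa [e93] using hυ.ir 9 rfl) rfl (by omega) h3).mono ?_
    rintro t4 ω - ⟨ht4, a4, b4, c4, d4⟩
    simp only [ireg_setI, rarr_setI, Nat.reduceEqDiff, if_false]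
    refine ⟨by omega, by omega, by omega, c4.congr_set fun t => ?_, fun q hq =>
      (d4 q hq).trans (h4 q hq)⟩
    simp only [Set.mem_union, Set.mem_ofPred_eq, Nat.lt_succ_iff_lt_or_eq, or_and_right, exists_or,
      exists_eq_left, or_assoc]
  · rintro t4 τ4 - ⟨⟨h1, h2, h3, h4⟩, -, ht4⟩
    refine ⟨?_, h1, by omega, h3.congr_set fun t => ?_, h4⟩
    · simp only [Nat.sub_zero] at ht3 ht4
      have b1 : I.n * (36 * (2 + 3 * I.n) + 120 + 2) ≤ 432 * I.m ^ 2 + 388 * I.m :=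
        (Nat.mul_le_mul hn (by gcongr)).trans (le_of_eq
          (show (2 * I.m) * (36 * (2 + 3 * (2 * I.m)) + 120 + 2) = _ by ring))
      have b2 : I.m * (24 * (2 + 3 * I.n + 2 * I.m) + 70 + 2) ≤ 192 * I.m ^ 2 + 120 * I.m :=
        (Nat.mul_le_mul le_rfl (by gcongr)).trans (le_of_eq
          (show I.m * (24 * (2 + 3 * (2 * I.m) + 2 * I.m) + 70 + 2) = _ by ring))
      have b3 : I.m ≤ I.m ^ 2 := Nat.le_self_pow (by norm_num) _
      have b4 : 1 ≤ I.m ^ 2 := Nat.one_le_pow _ _ hm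
      omega
    · simp only [Inst.PP, Set.mem_ofPred_eq]
      constructor
      · rintro ⟨h0, h1, h | h | ⟨i, hi, h⟩ | h⟩
        · exact .inl h
        · exact .inr (.inl h)
        · exact .inr (.inr (.inl ⟨i, hi, h0, h1, h⟩))
        · exact .inr (.inr (.inr h))
      · rintro (h | h | ⟨i, hi, h0, h1, h⟩ | ⟨e, he, h⟩)
        · exact ⟨by linarith, by linarith, .inl h⟩
        · exact ⟨by linarith, by linarith, .inr (.inl h)⟩
        · exact ⟨h0, h1, .inr (.inr (.inl ⟨i, hi, h⟩))⟩
        · exact ⟨h.2.1.le, h.2.2.1.le, .inr (.inr (.inr ⟨e, he, h⟩))⟩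

/-- Lists all partition points in array `0`, with the starting positions of the edges in array `0`. -/
def partition : Cmd :=
  .iset 8 (.lit 0) ;; .ist 0 (.lit 0) (.lit 0) ;; .iset 7 (.lit 0) ;;
  forTo 7 (.reg 1) (edgePartition ;; .ist 0 (.add (.reg 7) (.lit 1)) (.reg 8))

/-- The positions `[st e, st (e + 1))` of `pt` list the partition points of the edge `e`. -/
structure Pts (I : Inst) (st : ℕ → ℕ) (pt : ℕ → ℝ) : Prop where
  zero : st 0 = 0
  lt : ∀ e < I.m, st e + 2 ≤ st (e + 1)
  le : ∀ e < I.m, st (e + 1) ≤ st e + 10 * I.m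
  lists : ∀ e < I.m, Lists pt (st e) (st (e + 1)) (I.PP e)

theorem run_partition {σ : State} (hI : I.Good) (hσ : HasDist I σ) :
    Run partition σ fun t τ => t ≤ 2010 * I.m ^ 3 ∧ HasDist I τ ∧ Pts I (τ.iarr 0) (τ.rarr 0) ∧
      τ.ireg 8 = τ.iarr 0 I.m := by
  have hm := hI.m_pos
  rw [partition, run_seq, run_iset, run_seq, run_ist, run_seq, run_iset]
  refine (Run.forTo' (a := 0) (n := I.m) (fun k υ => υ.iarr 0 0 = 0 ∧ υ.ireg 8 = υ.iarr 0 k ∧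
    (∀ e < k, υ.iarr 0 e + 2 ≤ υ.iarr 0 (e + 1)) ∧
    (∀ e < k, υ.iarr 0 (e + 1) ≤ υ.iarr 0 e + 10 * I.m) ∧
    (∀ e < k, υ.iarr 0 (e + 1) ≤ υ.iarr 0 k) ∧
    (∀ e < k, Lists (υ.rarr 0) (υ.iarr 0 e) (υ.iarr 0 (e + 1)) (I.PP e)))
    (2000 * I.m ^ 2 + 1) (by simp) (Nat.zero_le _)
    (fun υ hυ => ?_) rfl ?_ ?_).mono ?_
  · simpa [hσ.m] using hυ.ir 1 rfl
  · simp
  · rintro k υ - hk hυ hυk ⟨h1, h2, h3, h4, h4', h5⟩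
    have hDυ : HasDist I υ := (HasDist.frame (σ := ((σ.setI 8 0).setIA 0 0 0).setI 7 0)
      ⟨⟨hσ.n, hσ.m, hσ.R, by simpa using hσ.S, by simpa using hσ.T, hσ.L, hσ.lb, hσ.ub⟩,
        by simpa using hσ.off, hσ.dist⟩ (by simpa using hυ) rfl)
    refine (run_edgePartition hI hDυ hυk hk h2).seq ?_
    rintro t1 ω hω ⟨ht1, a1, b1, c1, d1⟩
    have e0 : ω.iarr 0 = υ.iarr 0 := hω.ia 0 rfl
    have e7 : ω.ireg 7 = k := (hω.ir 7 rfl).trans hυk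
    rw [run_ist]
    simp only [IE.eval, e7, e0, ireg_setI, iarr_setI, rarr_setI, iarr_setIA, rarr_setIA, ireg_setIA,
      Nat.reduceEqDiff, if_false, if_true]
    have hu : ∀ j, j ≤ k → Function.update (υ.iarr 0) (k + 1) (ω.ireg 8) j = υ.iarr 0 j :=
      fun j hj => Function.update_of_ne (by omega) _ _
    refine ⟨by omega, by rw [hu 0 (by omega), h1], by rw [Function.update_self], ?_, ?_, ?_, ?_⟩
    · intro e he
      rcases Nat.lt_succ_iff_lt_or_eq.1 he with he | rfl
      · rw [hu _ (by omega), hu _ (by omega)]; exact h3 e he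
      · rw [hu _ le_rfl, Function.update_self]; exact a1
    · intro e he
      rcases Nat.lt_succ_iff_lt_or_eq.1 he with he | rfl
      · rw [hu _ (by omega), hu _ (by omega)]; exact h4 e he
      · rw [hu _ le_rfl, Function.update_self]; exact b1
    · intro e he
      rw [Function.update_self]
      rcases Nat.lt_succ_iff_lt_or_eq.1 he with he | rfl
      · rw [hu _ (by omega)]
        have := h4' e he
        omega
      · rw [Function.update_self]
    · intro e he
      rcases Nat.lt_succ_iff_lt_or_eq.1 he with he | rfl
      · rw [hu _ (by omega), hu _ (by omega)]
        have hle := h4' e he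
        obtain ⟨g1, g2⟩ := h5 e he
        refine ⟨fun p q hp hpq hq => ?_, fun t => (g2 t).trans ?_⟩
        · rw [d1 p (by omega), d1 q (by omega)]; exact g1 p q hp hpq hq
        · refine exists_congr fun j => and_congr_right fun _ => and_congr_right fun hj => ?_
          rw [d1 j (by omega)]
      · rw [hu _ le_rfl, Function.update_self]; exact c1
  · rintro t υ hυ ⟨⟨h1, h2, h3, h4, h4', h5⟩, -, ht⟩
    refine ⟨?_, (HasDist.frame (σ := ((σ.setI 8 0).setIA 0 0 0).setI 7 0)
      ⟨⟨hσ.n, hσ.m, hσ.R, by simpa using hσ.S, by simpa using hσ.T, hσ.L, hσ.lb, hσ.ub⟩,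
        by simpa using hσ.off, hσ.dist⟩ (by simpa using hυ) rfl), ⟨h1, h3, h4, h5⟩, h2⟩
    have b4 : 1 ≤ I.m ^ 3 := Nat.one_le_pow _ _ hm
    have b5 : I.m ≤ I.m ^ 3 := Nat.le_self_pow (by norm_num) _
    simp only [Nat.sub_zero] at ht
    nlinarith [pow_succ I.m 2]

/-! ### Cover values and sorted keys -/

theorem mul_add_lt {a b c m : ℕ} (hab : a < b) (hc : c < m) : a * m + c < b * m := by nlinarith

namespace Pts

variable {st : ℕ → ℕ} {pt : ℕ → ℝ}

theorem mono (h : Pts I st pt) {a b : ℕ} (hab : a ≤ b) (hb : b ≤ I.m) : st a ≤ st b := by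
  induction b, hab using Nat.le_induction with
  | base => exact le_rfl
  | succ b _ ih => exact (ih (by omega)).trans (by have := h.lt b (by omega); omega)

theorem unique (h : Pts I st pt) {a b y : ℕ} (ha : a < I.m) (hb : b < I.m) (h1 : st a ≤ y)
    (h2 : y < st (a + 1)) (h3 : st b ≤ y) (h4 : y < st (b + 1)) : a = b := by
  rcases lt_trichotomy a b with hab | hab | hab
  · have := h.mono (show a + 1 ≤ b by omega) (by omega); omega
  · exact hab
  · have := h.mono (show b + 1 ≤ a by omega) (by omega); omega

theorem exists_block (h : Pts I st pt) {y k : ℕ} (hk : k ≤ I.m) (hy : y < st k) :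
    ∃ b < k, st b ≤ y ∧ y < st (b + 1) := by
  induction k with
  | zero => rw [h.zero] at hy; omega
  | succ k ih =>
    by_cases hyk : y < st k
    · obtain ⟨b, hb, h1⟩ := ih (by omega) hyk
      exact ⟨b, by omega, h1⟩
    · exact ⟨k, by omega, by omega, hy⟩

theorem lt_total (h : Pts I st pt) {b y : ℕ} (hb : b < I.m) (hy : y < st (b + 1)) :
    y < st I.m := lt_of_lt_of_le hy (h.mono (by omega) le_rfl)

theorem le_mul (h : Pts I st pt) {k : ℕ} (hk : k ≤ I.m) : st k ≤ k * (10 * I.m) := by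
  induction k with
  | zero => rw [h.zero]; omega
  | succ k ih =>
    have h1 := ih (by omega)
    have h2 := h.le k (by omega)
    nlinarith

theorem total_le (h : Pts I st pt) : st I.m ≤ 10 * I.m ^ 2 :=
  (h.le_mul le_rfl).trans (le_of_eq (by ring))

theorem le_total (h : Pts I st pt) {k : ℕ} (hk : k ≤ I.m) : 2 * k ≤ st k := by
  induction k with
  | zero => omega
  | succ k ih =>
    have h1 := ih (by omega)
    have h2 := h.lt k (by omega)
    omega

end Pts

structure HasPts (I : Inst) (st : ℕ → ℕ) (pt : ℕ → ℝ) (σ : State) : Prop extends HasDist I σ where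
  ia0 : σ.iarr 0 = st
  ra0 : σ.rarr 0 = pt
  i8 : σ.ireg 8 = st I.m
  offY : ∀ y < st I.m, σ.iarr 5 y = y * I.m
  offE : ∀ e < I.m, σ.iarr 6 e = e * st I.m

theorem HasPts.frame {c : Cmd} {st : ℕ → ℕ} {pt : ℕ → ℝ} {σ τ : State} (h : HasPts I st pt σ)
    (hf : Frame c σ τ)
    (hc : (c.wI 0 || c.wI 1 || c.wR 0 || c.wIA 2 || c.wIA 3 || c.wRA 3 || c.wRA 4 || c.wRA 5 ||
      c.wIA 4 || c.wRA 6) = false)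
    (hc' : (c.wIA 0 || c.wRA 0 || c.wI 8 || c.wIA 5 || c.wIA 6) = false) : HasPts I st pt τ := by
  simp only [Bool.or_eq_false_iff] at hc'
  obtain ⟨⟨⟨⟨h1, h2⟩, h3⟩, h4⟩, h5⟩ := hc'
  exact ⟨h.toHasDist.frame hf hc, (hf.ia 0 h1).trans h.ia0, (hf.ra 0 h2).trans h.ra0,
    (hf.ir 8 h3).trans h.i8, by rw [hf.ia 5 h4]; exact h.offY, by rw [hf.ia 6 h5]; exact h.offE⟩

/-- Changing registers that hold no data keeps the data. -/
theorem HasPts.setI {st : ℕ → ℕ} {pt : ℕ → ℝ} {σ : State} (h : HasPts I st pt σ) {d v : ℕ}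
    (h0 : d ≠ 0) (h1 : d ≠ 1) (h8 : d ≠ 8) : HasPts I st pt (σ.setI d v) :=
  ⟨⟨⟨by simpa [Ne.symm h0] using h.n, by simpa [Ne.symm h1] using h.m, h.R, h.S, h.T, h.L, h.lb,
    h.ub⟩, h.off, h.dist⟩, h.ia0, h.ra0, by simpa [Ne.symm h8] using h.i8, h.offY, h.offE⟩

def tables : Cmd := table 5 8 1 ;; table 6 1 8

theorem run_tables {st : ℕ → ℕ} {pt : ℕ → ℝ} {σ : State} (hσ : HasDist I σ) (h0 : σ.iarr 0 = st)
    (h0' : σ.rarr 0 = pt) (h8 : σ.ireg 8 = st I.m) :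
    Run tables σ fun t τ => t ≤ 4 * st I.m + 4 * I.m + 6 ∧ HasPts I st pt τ := by
  rw [tables]
  refine (run_table (A := 5) (by decide) (by decide) (by decide) (by decide)).seq ?_
  rintro t τ hτ ⟨ht, h1⟩
  refine (run_table (A := 6) (by decide) (by decide) (by decide) (by decide)).mono ?_
  rintro t' υ hυ ⟨ht', h2⟩
  rw [h8, hσ.m] at h1
  rw [h8] at ht
  have e8 : τ.ireg 8 = st I.m := (hτ.ir 8 rfl).trans h8
  have e1 : τ.ireg 1 = I.m := (hτ.ir 1 rfl).trans hσ.m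
  rw [e1, e8] at h2
  rw [e1] at ht'
  refine ⟨by omega, (hσ.frame hτ rfl).frame hυ rfl, (hυ.ia 0 rfl).trans ((hτ.ia 0 rfl).trans h0),
    (hυ.ra 0 rfl).trans ((hτ.ra 0 rfl).trans h0'), (hυ.ir 8 rfl).trans e8, fun y hy => ?_, h2⟩
  rw [hυ.ia 5 rfl]
  exact h1 y hy

/-- Stores the covered part of the edge `ireg 2` from the point `ireg 12` on the edge `ireg 7`. -/
def coverEntry : Cmd :=
  loadDist ;; .rset 3 (.ld 0 (.reg 12)) ;;
  .ite (.and (.ile (.reg 7) (.reg 2)) (.ile (.reg 2) (.reg 7)))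
    (.rst 8 (.add (.ld 5 (.reg 12)) (.reg 2))
      (.sub (.mn (.lit 1) (.add (.reg 3) (.div (.reg 0) (.reg 9))))
        (.mx (.lit 0) (.sub (.reg 3) (.div (.reg 0) (.reg 9))))))
    (.rst 8 (.add (.ld 5 (.reg 12)) (.reg 2)) (.mn (.lit 1)
      (.add (.mx (.lit 0) (.div (.sub (.reg 0) (.mn (uExp 5) (vExp 6))) (.reg 9)))
        (.mx (.lit 0) (.div (.sub (.reg 0) (.mn (uExp 7) (vExp 8))) (.reg 9))))))

theorem run_coverEntry {st : ℕ → ℕ} {pt : ℕ → ℝ} {σ : State} {x e y : ℕ} (hI : I.Good)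
    (hσ : HasPts I st pt σ) (h7 : σ.ireg 7 = x) (hx : x < I.m) (h2 : σ.ireg 2 = e) (he : e < I.m)
    (h12 : σ.ireg 12 = y) (hy : y < st I.m) :
    Run coverEntry σ fun t τ => t ≤ 9 ∧
      τ.rarr 8 = Function.update (σ.rarr 8) (y * I.m + e) (I.cv x e (pt y)) := by
  rw [coverEntry]
  refine (run_loadDist hI hσ.toHasDist h7 hx h2 he).seq ?_
  rintro t τ hτ ⟨rfl, hd⟩
  have e7 : τ.ireg 7 = x := (hτ.ir 7 rfl).trans h7
  have e2 : τ.ireg 2 = e := (hτ.ir 2 rfl).trans h2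
  have e12 : τ.ireg 12 = y := (hτ.ir 12 rfl).trans h12
  have e0 : τ.rarr 0 = pt := (hτ.ra 0 rfl).trans hσ.ra0
  have e5 : τ.iarr 5 y = y * I.m := by rw [hτ.ia 5 rfl]; exact hσ.offY y hy
  have e8 : τ.rarr 8 = σ.rarr 8 := hτ.ra 8 rfl
  simp only [run_seq, run_rset, run_ite, run_rst, BE.eval, IE.eval, RE.eval, uExp, vExp, e7, e2,
    ireg_setR, rreg_setR, rarr_setR, iarr_setR, e12, e0, e5, e8, Nat.reduceEqDiff, if_true,
    if_false, rarr_setRA, hd.r0, hd.r4, hd.r5, hd.r6, hd.r7, hd.r8, hd.r9, OfNat.zero_ne_ofNat,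
    Int.cast_one, Int.cast_zero]
  constructor
  · intro h
    refine ⟨by omega, ?_⟩
    rw [Inst.cv, if_pos (by omega)]
  · intro h
    refine ⟨by omega, ?_⟩
    rw [Inst.cv, if_neg (by omega)]
    rfl

def coverTable : Cmd :=
  .iset 7 (.lit 0) ;; forTo 7 (.reg 1) (.iset 12 (.ld 0 (.reg 7)) ;;
    forTo 12 (.ld 0 (.add (.reg 7) (.lit 1))) (.iset 2 (.lit 0) ;; forTo 2 (.reg 1) coverEntry))

structure HasCov (I : Inst) (st : ℕ → ℕ) (pt : ℕ → ℝ) (σ : State) : Prop extends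
    HasPts I st pt σ where
  cov : ∀ b < I.m, ∀ y, st b ≤ y → y < st (b + 1) → ∀ e < I.m,
    σ.rarr 8 (y * I.m + e) = I.cv b e (pt y)

theorem HasCov.frame {c : Cmd} {st : ℕ → ℕ} {pt : ℕ → ℝ} {σ τ : State} (h : HasCov I st pt σ)
    (hf : Frame c σ τ)
    (hc : (c.wI 0 || c.wI 1 || c.wR 0 || c.wIA 2 || c.wIA 3 || c.wRA 3 || c.wRA 4 || c.wRA 5 ||
      c.wIA 4 || c.wRA 6) = false)
    (hc' : (c.wIA 0 || c.wRA 0 || c.wI 8 || c.wIA 5 || c.wIA 6) = false)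
    (h8 : c.wRA 8 = false) : HasCov I st pt τ :=
  ⟨h.toHasPts.frame hf hc hc', by rw [hf.ra 8 h8]; exact h.cov⟩

theorem HasCov.setI {st : ℕ → ℕ} {pt : ℕ → ℝ} {σ : State} (h : HasCov I st pt σ) {d v : ℕ}
    (h0 : d ≠ 0) (h1 : d ≠ 1) (h8 : d ≠ 8) : HasCov I st pt (σ.setI d v) :=
  ⟨h.toHasPts.setI h0 h1 h8, h.cov⟩

theorem run_coverTable {st : ℕ → ℕ} {pt : ℕ → ℝ} {σ : State} (hI : I.Good) (hp : Pts I st pt)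
    (hσ : HasPts I st pt σ) :
    Run coverTable σ fun t τ => t ≤ 200 * I.m ^ 3 ∧ HasCov I st pt τ := by
  have hm := hI.m_pos
  rw [coverTable, run_seq, run_iset]
  have hσ0 := hσ.setI (d := 7) (v := 0) (by decide) (by decide) (by decide)
  refine (Run.forTo' (a := 0) (n := I.m) (fun k τ => ∀ b < I.m, ∀ y, st b ≤ y → y < st (b + 1) →
    y < st k → ∀ e < I.m, τ.rarr 8 (y * I.m + e) = I.cv b e (pt y))
    (10 * I.m * (11 * I.m + 2 + 2) + 2) (by simp) (Nat.zero_le _) (fun τ hτ => ?_) rfl ?_ ?_).mono ?_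
  · simpa [hσ.m] using hτ.ir 1 rfl
  · intro b hb y _ _ h
    rw [hp.zero] at h; omega
  · rintro k τ - hk hτ hτk h1
    have hτp : HasPts I st pt τ := hσ0.frame hτ rfl rfl
    rw [run_seq, run_iset]
    have hτp1 := hτp.setI (d := 12) (v := st k) (by decide) (by decide) (by decide)
    simp only [IE.eval, hτp.ia0, hτk]
    refine (Run.forTo' (a := st k) (n := st (k + 1)) (fun z υ => ∀ b < I.m, ∀ y, st b ≤ y →
      y < st (b + 1) → y < z → ∀ e < I.m, υ.rarr 8 (y * I.m + e) = I.cv b e (pt y))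
      (11 * I.m + 2) (by simp) (by have := hp.lt k hk; omega) (fun υ hυ => ?_) rfl
      (by simpa using h1) ?_).mono ?_
    · have hυp : HasPts I st pt υ := hτp1.frame hυ rfl rfl
      have e7 : υ.ireg 7 = k := by simpa [hτk] using hυ.ir 7 rfl
      simp [hυp.ia0, e7]
    · rintro z υ hz1 hz2 hυ hυz h2
      have hυp : HasPts I st pt υ := hτp1.frame hυ rfl rfl
      have e7 : υ.ireg 7 = k := by simpa [hτk] using hυ.ir 7 rfl
      rw [run_seq, run_iset]
      have hυp1 := hυp.setI (d := 2) (v := 0) (by decide) (by decide) (by decide)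
      refine (Run.forTo' (a := 0) (n := I.m) (fun e ω => (∀ q < z * I.m, ω.rarr 8 q = υ.rarr 8 q) ∧
        ∀ e' < e, ω.rarr 8 (z * I.m + e') = I.cv k e' (pt z)) 9 (by simp) (Nat.zero_le _)
        (fun ω hω => ?_) rfl (by simp) ?_).mono ?_
      · simpa [hυp.m] using hω.ir 1 rfl
      · rintro e ω - he hω hωe ⟨h3, h4⟩
        have hωp : HasPts I st pt ω := hυp1.frame hω rfl rfl
        refine (run_coverEntry hI hωp (x := k) (by simpa [e7] using hω.ir 7 rfl) hk hωe he (y := z)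
          (by simpa [hυz] using hω.ir 12 rfl) (hp.lt_total hk hz2)).mono ?_
        rintro t χ - ⟨ht, h5⟩
        refine ⟨ht, fun q hq => ?_, fun e' he' => ?_⟩
        · simp only [rarr_setI, h5]
          rw [Function.update_of_ne (by omega), h3 q hq]
        · simp only [rarr_setI, h5]
          rcases Nat.lt_succ_iff_lt_or_eq.1 he' with he' | rfl
          · rw [Function.update_of_ne (by omega), h4 e' he']
          · rw [Function.update_self]
      · rintro t ω - ⟨⟨h3, h4⟩, -, ht⟩
        refine ⟨by omega, fun b hb y hy1 hy2 hy3 e he => ?_⟩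
        simp only [rarr_setI]
        rcases Nat.lt_succ_iff_lt_or_eq.1 hy3 with hy | rfl
        · rw [h3 _ (mul_add_lt hy he)]
          exact h2 b hb y hy1 hy2 hy e he
        · rw [hp.unique hb hk hy1 hy2 hz1 hz2]
          exact h4 e he
    · rintro t υ - ⟨h2, -, ht⟩
      refine ⟨?_, h2⟩
      have := Nat.mul_le_mul_right (11 * I.m + 2 + 2)
        (show st (k + 1) - st k ≤ 10 * I.m by have := hp.le k hk; omega)
      omega
  · rintro t τ hτ ⟨h1, -, ht⟩
    refine ⟨?_, hσ0.frame hτ rfl rfl, fun b hb y hy1 hy2 e he =>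
      h1 b hb y hy1 hy2 (hp.lt_total hb hy2) e he⟩
    have b4 : 1 ≤ I.m ^ 3 := Nat.one_le_pow _ _ hm
    have b5 : I.m ≤ I.m ^ 3 := Nat.le_self_pow (by norm_num) _
    have b6 : I.m ^ 2 ≤ I.m ^ 3 := Nat.pow_le_pow_right hm (by norm_num)
    have : I.m * (10 * I.m * (11 * I.m + 2 + 2) + 2 + 2) = 110 * I.m ^ 3 + 40 * I.m ^ 2 + 4 * I.m := by
      ring
    simp only [Nat.sub_zero] at ht
    omega

/-- In array `9`, from `e * st m` on, the cover values of `e`, sorted in each block, with the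
numbers of the points in array `7`. -/
def keyRow : Cmd :=
  .iset 13 (.ld 6 (.reg 2)) ;; .iset 12 (.lit 0) ;;
  forTo 12 (.reg 8) (.rst 9 (.add (.reg 13) (.reg 12)) (.ld 8 (.add (.ld 5 (.reg 12)) (.reg 2))) ;;
    .ist 7 (.add (.reg 13) (.reg 12)) (.reg 12)) ;;
  .iset 7 (.lit 0) ;; forTo 7 (.reg 1) (.iset 20 (.add (.reg 13) (.ld 0 (.reg 7))) ;;
    .iset 21 (.add (.reg 13) (.ld 0 (.add (.reg 7) (.lit 1)))) ;; isort 9 7)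

/-- The row of sorted keys of an edge `e`, at offset `o`. -/
structure KeyRow (I : Inst) (st : ℕ → ℕ) (c : ℕ → ℝ) (o : ℕ) (k : ℕ) (id : ℕ → ℕ) (key : ℕ → ℝ)
    (e : ℕ) : Prop where
  maps : ∀ b < I.m, ∀ p, st b ≤ p → p < st (b + 1) → st b ≤ id (o + p) ∧ id (o + p) < st (b + 1)
  inj : ∀ p < st I.m, ∀ q < st I.m, id (o + p) = id (o + q) → p = q
  key_eq : ∀ p < st I.m, key (o + p) = c (id (o + p) * I.m + e)
  sorted : ∀ b < k, SortedOn key (o + st b) (o + st (b + 1))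

theorem run_keyRow {st : ℕ → ℕ} {pt : ℕ → ℝ} {σ : State} {e : ℕ} (hp : Pts I st pt)
    (hσ : HasCov I st pt σ) (h2 : σ.ireg 2 = e) (he : e < I.m) :
    Run keyRow σ fun t τ => t ≤ 1000 * I.m ^ 3 ∧
      KeyRow I st (σ.rarr 8) (e * st I.m) I.m (τ.iarr 7) (τ.rarr 9) e ∧
      ∀ q < e * st I.m, τ.iarr 7 q = σ.iarr 7 q ∧ τ.rarr 9 q = σ.rarr 9 q := by
  have hm : 0 < I.m := by omega
  set P := st I.m with hP
  set o := e * P with ho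
  have hσ0 := (hσ.setI (d := 13) (v := o) (by decide) (by decide) (by decide)).setI (d := 12)
    (v := 0) (by decide) (by decide) (by decide)
  rw [keyRow, run_seq, run_iset, run_seq, run_iset]
  simp only [IE.eval, h2, hσ.offE e he]
  refine (Run.forTo' (a := 0) (n := P) (fun k τ =>
    (∀ p < k, τ.iarr 7 (o + p) = p ∧ τ.rarr 9 (o + p) = σ.rarr 8 (p * I.m + e)) ∧
    ∀ q < o, τ.iarr 7 q = σ.iarr 7 q ∧ τ.rarr 9 q = σ.rarr 9 q) 2 (by simp) (Nat.zero_le _)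
    (fun τ hτ => ?_) rfl (by simp) ?_).seq ?_
  · simpa [hσ.i8] using hτ.ir 8 rfl
  · rintro k τ - hk hτ hτk ⟨h3, h4⟩
    have hτ0 := hσ0.frame hτ rfl rfl rfl
    have e13 : τ.ireg 13 = o := by simpa using hτ.ir 13 rfl
    have e2 : τ.ireg 2 = e := by simpa [h2] using hτ.ir 2 rfl
    have e8 : τ.rarr 8 = σ.rarr 8 := hτ.ra 8 rfl
    simp [hτk, e13, hτ0.offY k hk, e2, e8, -Order.lt_add_one_iff]
    refine ⟨fun p hp => ?_, fun q hq => ?_⟩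
    · rcases Nat.lt_succ_iff_lt_or_eq.1 hp with hp | rfl
      · rw [Function.update_of_ne (by omega), Function.update_of_ne (by omega)]; exact h3 p hp
      · simp
    · rw [Function.update_of_ne (by omega), Function.update_of_ne (by omega)]; exact h4 q hq
  rintro t1 τ hτ ⟨⟨h3, h4⟩, -, ht1⟩
  have hτ0 := hσ0.frame hτ rfl rfl rfl
  have e13 : τ.ireg 13 = o := by simpa using hτ.ir 13 rfl
  have hτ1 := hτ0.setI (d := 7) (v := 0) (by decide) (by decide) (by decide)
  rw [run_seq, run_iset]
  refine (Run.forTo' (a := 0) (n := I.m) (fun k υ =>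
    KeyRow I st (σ.rarr 8) o k (υ.iarr 7) (υ.rarr 9) e ∧
    ∀ q < o, υ.iarr 7 q = σ.iarr 7 q ∧ υ.rarr 9 q = σ.rarr 9 q)
    (8 * (10 * I.m) * (10 * I.m) + 4 * (10 * I.m) + 4) (by simp) (Nat.zero_le _)
    (fun υ hυ => ?_) rfl ?_ ?_).mono ?_
  · simpa [hτ0.m] using hυ.ir 1 rfl
  · refine ⟨⟨fun b hb p h5 h6 => ?_, fun p hp' q hq h => ?_, fun p hp' => ?_, by simp⟩,
      by simpa using h4⟩
    · have := (h3 p (hp.lt_total hb h6)).1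
      simp only [iarr_setI]
      omega
    · simp only [iarr_setI, (h3 p hp').1, (h3 q hq).1] at h
      exact h
    · simp only [iarr_setI, rarr_setI, (h3 p hp').1, (h3 p hp').2]
  · rintro k υ - hk hυ hυk ⟨h5, h6⟩
    have hυ0 := hτ1.frame hυ rfl rfl rfl
    have e13' : υ.ireg 13 = o := by simpa [e13] using hυ.ir 13 rfl
    rw [run_seq, run_iset, run_seq, run_iset]
    have hle := hp.lt k hk
    have hle' := hp.le k hk
    refine (run_isort (s := o + st k) (f := o + st (k + 1)) (by simp [e13', hυk, hυ0.ia0])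
      (by simp [e13', hυk, hυ0.ia0]) (by omega)).mono ?_
    rintro t ω - ⟨ht, hs, π, hπ, hX, hY⟩
    simp only [rarr_setI] at hX
    simp only [iarr_setI] at hY
    have hmem : ∀ q, (o + st k ≤ π q ∧ π q < o + st (k + 1)) ↔
        (o + st k ≤ q ∧ q < o + st (k + 1)) := fun q =>
      perm_mem_of_fix (P := fun q => o + st k ≤ q ∧ q < o + st (k + 1)) hπ
    have hrel : ∀ p, ∃ p', π (o + p) = o + p' ∧ (p < P → p' < P) ∧ (∀ b < I.m, st b ≤ p →
        p < st (b + 1) → st b ≤ p' ∧ p' < st (b + 1)) := by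
      intro p
      by_cases hpk : st k ≤ p ∧ p < st (k + 1)
      · have h7 := (hmem (o + p)).2 ⟨by omega, by omega⟩
        refine ⟨π (o + p) - o, by omega, fun _ => hp.lt_total hk (by omega), fun b hb h8 h9 => ?_⟩
        rw [hp.unique hb hk h8 h9 hpk.1 hpk.2]
        omega
      · exact ⟨p, hπ _ (by omega), fun h => h, fun _ _ h8 h9 => ⟨h8, h9⟩⟩
    refine ⟨?_, ⟨fun b hb p h7 h8 => ?_, fun p hp' q hq h => ?_, fun p hp' => ?_, fun b hb => ?_⟩,
      fun q hq => ?_⟩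
    · have a1 : (o + st (k + 1)) - (o + st k) ≤ 10 * I.m := by omega
      have := Nat.mul_le_mul (Nat.mul_le_mul_left 8 a1) a1
      omega
    · simp only [iarr_setI, hY, Function.comp]
      obtain ⟨p', h9, -, h10⟩ := hrel p
      rw [h9]
      have := h10 b hb h7 h8
      exact h5.maps b hb p' this.1 this.2
    · simp only [iarr_setI, hY, Function.comp] at h
      obtain ⟨p', h9, h10, -⟩ := hrel p
      obtain ⟨q', h11, h12, -⟩ := hrel q
      rw [h9, h11] at h
      have := h5.inj p' (h10 hp') q' (h12 hq) h
      have h13 : π (o + p) = π (o + q) := by rw [h9, h11, this]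
      have := π.injective h13
      omega
    · simp only [iarr_setI, rarr_setI, hX, hY, Function.comp]
      obtain ⟨p', h9, h10, -⟩ := hrel p
      rw [h9]
      exact h5.key_eq p' (h10 hp')
    · simp only [rarr_setI]
      rcases Nat.lt_succ_iff_lt_or_eq.1 hb with hb | rfl
      · intro p q h7 h8 h9
        have := hp.mono (show b + 1 ≤ k by omega) hk.le
        rw [hX, Function.comp, Function.comp, hπ p (by omega), hπ q (by omega)]
        exact h5.sorted b hb p q h7 h8 h9
      · exact hs
    · simp only [iarr_setI, rarr_setI, hX, hY, Function.comp, hπ q (by omega)]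
      exact h6 q hq
  · rintro t2 υ - ⟨⟨h5, h6⟩, -, ht2⟩
    refine ⟨?_, h5, h6⟩
    have b0 : P ≤ 10 * I.m ^ 2 := hp.total_le
    have b4 : 1 ≤ I.m ^ 3 := Nat.one_le_pow _ _ hm
    have b5 : I.m ≤ I.m ^ 3 := Nat.le_self_pow (by norm_num) _
    have b6 : I.m ^ 2 ≤ I.m ^ 3 := Nat.pow_le_pow_right hm (by norm_num)
    have : I.m * (8 * (10 * I.m) * (10 * I.m) + 4 * (10 * I.m) + 4 + 2) =
        800 * I.m ^ 3 + 40 * I.m ^ 2 + 6 * I.m := by ring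
    simp only [Nat.sub_zero] at ht1 ht2
    omega

def keyTable : Cmd := .iset 2 (.lit 0) ;; forTo 2 (.reg 1) keyRow

structure HasKeys (I : Inst) (st : ℕ → ℕ) (pt : ℕ → ℝ) (σ : State) : Prop extends
    HasCov I st pt σ where
  row : ∀ e < I.m, KeyRow I st (σ.rarr 8) (e * st I.m) I.m (σ.iarr 7) (σ.rarr 9) e

theorem KeyRow.congr {st : ℕ → ℕ} {pt : ℕ → ℝ} (hp : Pts I st pt) {c : ℕ → ℝ} {o k : ℕ}
    {id id' : ℕ → ℕ} {key key' : ℕ → ℝ} {e : ℕ} (hk : k ≤ I.m) (h : KeyRow I st c o k id key e)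
    (heq : ∀ q < o + st I.m, id' q = id q ∧ key' q = key q) : KeyRow I st c o k id' key' e := by
  refine ⟨fun b hb p h1 h2 => ?_, fun p hp' q hq h' => ?_, fun p hp' => ?_, fun b hb p q h1 h2 h3 => ?_⟩
  · have := hp.lt_total hb h2
    rw [(heq (o + p) (by omega)).1]; exact h.maps b hb p h1 h2
  · rw [(heq (o + p) (by omega)).1, (heq (o + q) (by omega)).1] at h'
    exact h.inj p hp' q hq h'
  · rw [(heq (o + p) (by omega)).1, (heq (o + p) (by omega)).2]; exact h.key_eq p hp'
  · have := hp.mono (show b + 1 ≤ I.m by omega) le_rfl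
    rw [(heq p (by omega)).2, (heq q (by omega)).2]
    exact h.sorted b hb p q h1 h2 h3

theorem run_keyTable {st : ℕ → ℕ} {pt : ℕ → ℝ} {σ : State} (hI : I.Good) (hp : Pts I st pt)
    (hσ : HasCov I st pt σ) :
    Run keyTable σ fun t τ => t ≤ 1010 * I.m ^ 4 ∧ HasKeys I st pt τ := by
  have hm := hI.m_pos
  have hσ0 := hσ.setI (d := 2) (v := 0) (by decide) (by decide) (by decide)
  rw [keyTable, run_seq, run_iset]
  refine (Run.forTo' (a := 0) (n := I.m) (fun k τ => ∀ e < k,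
    KeyRow I st (σ.rarr 8) (e * st I.m) I.m (τ.iarr 7) (τ.rarr 9) e) (1000 * I.m ^ 3) (by simp)
    (Nat.zero_le _) (fun τ hτ => ?_) rfl (by simp) ?_).mono ?_
  · simpa [hσ.m] using hτ.ir 1 rfl
  · rintro k τ - hk hτ hτk h1
    have hτ0 := hσ0.frame hτ rfl rfl rfl
    have e8 : τ.rarr 8 = σ.rarr 8 := hτ.ra 8 rfl
    refine (run_keyRow hp hτ0 hτk hk).mono ?_
    rintro t υ - ⟨ht, h2, h3⟩
    refine ⟨ht, fun e he => ?_⟩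
    rcases Nat.lt_succ_iff_lt_or_eq.1 he with he | rfl
    · refine (h1 e he).congr hp le_rfl fun q hq => ?_
      have : (e + 1) * st I.m ≤ k * st I.m := Nat.mul_le_mul_right _ he
      exact h3 q (by rw [add_mul] at this; omega)
    · rw [← e8]; exact h2
  · rintro t τ hτ ⟨h1, -, ht⟩
    have e8 : τ.rarr 8 = σ.rarr 8 := hτ.ra 8 rfl
    refine ⟨?_, hσ0.frame hτ rfl rfl rfl, by rw [e8]; exact h1⟩
    have b4 : 1 ≤ I.m ^ 4 := Nat.one_le_pow _ _ hm
    have b5 : I.m ≤ I.m ^ 4 := Nat.le_self_pow (by norm_num) _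
    have : I.m * (1000 * I.m ^ 3 + 2) = 1000 * I.m ^ 4 + 2 * I.m := by ring
    simp only [Nat.sub_zero] at ht
    omega

end RAMLang

namespace RAMLang

open RealRAM Finset

/-! ### The regret functions between neighbouring partition points -/

/-- Partition points `pt`, listed in the blocks given by `st`, and their cover values `C`. -/
structure Table (I : Inst) (st : ℕ → ℕ) (pt : ℕ → ℝ) (C : ℕ → ℝ) : Prop extends Pts I st pt where
  good : I.Good
  cov : ∀ b < I.m, ∀ y, st b ≤ y → y < st (b + 1) → ∀ e < I.m, C (y * I.m + e) = I.cv b e (pt y)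

section

variable (I : Inst) (pt C : ℕ → ℝ)

noncomputable def slope (r e : ℕ) : ℝ :=
  (C ((r + 1) * I.m + e) - C (r * I.m + e)) / (pt (r + 1) - pt r)

/-- The slope on the interval before the point `r`, or `0` at the first point `s`. -/
noncomputable def prevSlope (s r e : ℕ) : ℝ := if r = s then 0 else slope I pt C (r - 1) e

/-- The demand on `e` that is worst for the point `r` compared with `y`. -/
noncomputable def wt (r e y : ℕ) : ℝ :=
  if C (r * I.m + e) ≤ C (y * I.m + e) then I.ub e else I.lb e

/-- The worst demand on `e` changes between the points `r` and `r + 1`. -/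
def Flip (r e y : ℕ) : Prop :=
  ¬ (C (r * I.m + e) ≤ C (y * I.m + e) ↔ C ((r + 1) * I.m + e) ≤ C (y * I.m + e))

/-- Position and size of the kink that comes from a flip. -/
noncomputable def kinkPos (r e : ℕ) (z : ℝ) : ℝ := pt r + (z - C (r * I.m + e)) / slope I pt C r e

noncomputable def kinkSize (r e : ℕ) : ℝ :=
  (I.ub e - I.lb e) * max (slope I pt C r e) (0 - slope I pt C r e)

/-- The regret at `(x, t)` with respect to the partition point number `y`. -/
noncomputable def regAt (x : ℕ) (t : ℝ) (y : ℕ) : ℝ :=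
  ∑ e ∈ range I.m, I.psi e (C (y * I.m + e) - I.cv x e t)

end

variable {I : Inst} {st : ℕ → ℕ} {pt C : ℕ → ℝ}

namespace Table

theorem lt_iff (h : Table I st pt C) {x p q : ℕ} (hx : x < I.m) (hp : st x ≤ p)
    (hp' : p < st (x + 1)) (hq : st x ≤ q) (hq' : q < st (x + 1)) : pt p < pt q ↔ p < q := by
  constructor
  · intro hlt
    by_contra hn
    rcases eq_or_lt_of_le (not_lt.1 hn) with rfl | hqp
    · exact lt_irrefl _ hlt
    · exact lt_asymm hlt ((h.lists x hx).1 q p hq hqp hp')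
  · exact fun hlt => (h.lists x hx).1 p q hp hlt hq'

theorem mem_PP (h : Table I st pt C) {x p : ℕ} (hx : x < I.m) (hp : st x ≤ p)
    (hp' : p < st (x + 1)) : pt p ∈ I.PP x := ((h.lists x hx).2 _).2 ⟨p, hp, hp', rfl⟩

theorem affOn (h : Table I st pt C) {x e p q : ℕ} (hx : x < I.m) (he : e < I.m) (hp : st x ≤ p)
    (hpq : p ≤ q) (hq : q < st (x + 1))
    (hno : ∀ r, p < r → r < q → pt r ∉ I.breaks x e) : Inst.AffOn (I.cv x e) (pt p) (pt q) := by
  refine Inst.cv_affOn h.good hx he (h.mem_PP hx hp (by omega)).1 (h.mem_PP hx (by omega) hq).2.1 ?_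
  intro t ht hb h1 h2
  obtain ⟨j, hj1, hj2, rfl⟩ := ((h.lists x hx).2 t).1 ht
  rw [h.lt_iff hx hp (by omega) hj1 hj2] at h1
  rw [h.lt_iff hx hj1 hj2 (by omega) hq] at h2
  exact hno j h1 h2 hb

theorem cv_eq_of_aff (h : Table I st pt C) {x e p q a b : ℕ} (hx : x < I.m) (he : e < I.m)
    (hp : st x ≤ p) (hq : q < st (x + 1)) (hpa : p ≤ a) (hab : a < b) (hbq : b ≤ q)
    (haff : Inst.AffOn (I.cv x e) (pt p) (pt q)) {t : ℝ} (ht : t ∈ Set.Icc (pt p) (pt q)) :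
    I.cv x e t = C (a * I.m + e) +
      (C (b * I.m + e) - C (a * I.m + e)) / (pt b - pt a) * (t - pt a) := by
  obtain ⟨u, v, huv⟩ := haff
  have hle : ∀ i j, st x ≤ i → i ≤ j → j < st (x + 1) → pt i ≤ pt j := fun i j h1 h2 h3 => by
    rcases eq_or_lt_of_le h2 with rfl | h2
    · exact le_rfl
    · exact ((h.lists x hx).1 i j h1 h2 h3).le
  have hlt := (h.lists x hx).1 a b (by omega) hab (by omega)
  rw [h.cov x hx a (by omega) (by omega) e he, h.cov x hx b (by omega) (by omega) e he, huv t ht,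
    huv (pt a) ⟨hle _ _ hp hpa (by omega), hle _ _ (by omega) (by omega) hq⟩,
    huv (pt b) ⟨hle _ _ hp (by omega) (by omega), hle _ _ (by omega) hbq hq⟩]
  have : pt b - pt a ≠ 0 := by linarith
  field_simp
  ring

theorem cv_eq (h : Table I st pt C) {x r e : ℕ} (hx : x < I.m) (he : e < I.m) (hr : st x ≤ r)
    (hr' : r + 1 < st (x + 1)) {t : ℝ} (ht : t ∈ Set.Icc (pt r) (pt (r + 1))) :
    I.cv x e t = C (r * I.m + e) + slope I pt C r e * (t - pt r) :=
  h.cv_eq_of_aff hx he hr hr' le_rfl (by omega) le_rfl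
    (h.affOn hx he hr (by omega) hr' fun j h1 h2 => by omega) ht

theorem succ_eq (h : Table I st pt C) {x r e : ℕ} (hx : x < I.m) (hr : st x ≤ r)
    (hr' : r + 1 < st (x + 1)) :
    C ((r + 1) * I.m + e) = C (r * I.m + e) + slope I pt C r e * (pt (r + 1) - pt r) := by
  have := (h.lists x hx).1 r (r + 1) hr (by omega) hr'
  rw [slope, div_mul_cancel₀ _ (by linarith)]
  ring

/-- A flip occurs at a nonzero slope, upwards or downwards. -/
theorem flip_cases (h : Table I st pt C) {x r e y : ℕ} (hx : x < I.m) (hr : st x ≤ r)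
    (hr' : r + 1 < st (x + 1)) (hf : Flip I C r e y) :
    (0 < slope I pt C r e ∧ C (r * I.m + e) ≤ C (y * I.m + e) ∧
        C (y * I.m + e) < C ((r + 1) * I.m + e)) ∨
      (slope I pt C r e < 0 ∧ C (y * I.m + e) < C (r * I.m + e) ∧
        C ((r + 1) * I.m + e) ≤ C (y * I.m + e)) := by
  have hlt := (h.lists x hx).1 r (r + 1) hr (by omega) hr'
  by_cases h1 : C (r * I.m + e) ≤ C (y * I.m + e)
  · have h2 : C (y * I.m + e) < C ((r + 1) * I.m + e) := by
      by_contra hn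
      exact hf ⟨fun _ => not_lt.1 hn, fun _ => h1⟩
    exact .inl ⟨div_pos (by linarith) (by linarith), h1, h2⟩
  · have h2 : C ((r + 1) * I.m + e) ≤ C (y * I.m + e) := by
      by_contra hn
      exact hf ⟨fun h => absurd h h1, fun h => absurd h hn⟩
    exact .inr ⟨div_neg_of_neg_of_pos (by linarith) (by linarith), not_le.1 h1, h2⟩

open Classical in
/-- On the interval after `r`, a regret term is a line plus a kink. -/
theorem psi_eq (h : Table I st pt C) {x r e y : ℕ} (hx : x < I.m) (he : e < I.m) (hr : st x ≤ r)
    (hr' : r + 1 < st (x + 1)) {t : ℝ} (ht : t ∈ Set.Icc (pt r) (pt (r + 1))) :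
    I.psi e (C (y * I.m + e) - I.cv x e t) =
      -(wt I C r e y * slope I pt C r e) * t +
      wt I C r e y * (C (y * I.m + e) - C (r * I.m + e) + slope I pt C r e * pt r) +
      if Flip I C r e y then
        kinkSize I pt C r e * max 0 (t - kinkPos I pt C r e (C (y * I.m + e))) else 0 := by
  have hsucc := h.succ_eq (e := e) hx hr hr'
  rw [h.cv_eq hx he hr hr' ht]
  obtain ⟨ht1, ht2⟩ := ht
  set a := C (r * I.m + e)
  set z := C (y * I.m + e)
  set p := slope I pt C r e with hp
  by_cases hf : Flip I C r e y
  · rw [if_pos hf]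
    rcases h.flip_cases hx hr hr' hf with ⟨h1, h2, h3⟩ | ⟨h1, h2, h3⟩
    · rw [wt, if_pos h2, kinkSize, ← hp, max_eq_left (by linarith), kinkPos, ← hp, Inst.psi]
      have hp0 : p ≠ 0 := h1.ne'
      have e1 : t - (pt r + (z - a) / p) = -(z - (a + p * (t - pt r))) / p := by
        field_simp; ring
      rw [e1]
      split_ifs with h4
      · rw [max_eq_left (div_nonpos_of_nonpos_of_nonneg (by linarith) h1.le)]; ring
      · rw [max_eq_right (div_nonneg (by linarith) h1.le)]; field_simp; ring
    · rw [wt, if_neg (not_le.2 h2), kinkSize, ← hp, max_eq_right (by linarith), kinkPos, ← hp,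
        Inst.psi]
      have hp0 : p ≠ 0 := h1.ne
      have e1 : t - (pt r + (z - a) / p) = (z - (a + p * (t - pt r))) / (-p) := by
        field_simp; ring
      rw [e1]
      split_ifs with h4
      · rw [max_eq_right (div_nonneg h4 (by linarith))]; field_simp; ring
      · rw [max_eq_left (div_nonpos_of_nonpos_of_nonneg (by linarith) (by linarith))]; ring
  · rw [if_neg hf]
    have hiff := not_not.1 hf
    by_cases h1 : a ≤ z
    · have h2 := hiff.1 h1
      rw [wt, if_pos h1, Inst.psi, if_pos]
      · ring
      · rcases le_total 0 p with hp0 | hp0 <;> nlinarith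
    · have h2 : ¬ C ((r + 1) * I.m + e) ≤ z := fun h' => h1 (hiff.2 h')
      rw [wt, if_neg h1, Inst.psi, if_neg]
      · ring
      · push Not at h1 h2 ⊢
        rcases le_total 0 p with hp0 | hp0 <;> nlinarith

open Classical in
theorem wt_succ_mul (h : Table I st pt C) {x r e y : ℕ} (hx : x < I.m) (hr : st x ≤ r)
    (hr' : r + 1 < st (x + 1)) :
    wt I C (r + 1) e y * slope I pt C r e = wt I C r e y * slope I pt C r e -
        (if Flip I C r e y then kinkSize I pt C r e else 0) ∧
    wt I C (r + 1) e y *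
        (C (y * I.m + e) - C ((r + 1) * I.m + e) + slope I pt C r e * pt (r + 1)) =
      wt I C r e y * (C (y * I.m + e) - C (r * I.m + e) + slope I pt C r e * pt r) -
        if Flip I C r e y then kinkSize I pt C r e * kinkPos I pt C r e (C (y * I.m + e)) else 0 := by
  have hsucc := h.succ_eq (e := e) hx hr hr'
  by_cases hf : Flip I C r e y
  · rw [if_pos hf, if_pos hf]
    rcases h.flip_cases hx hr hr' hf with ⟨h1, h2, h3⟩ | ⟨h1, h2, h3⟩
    · rw [wt, if_neg (not_le.2 h3), wt, if_pos h2, kinkSize, max_eq_left (by linarith), kinkPos]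
      refine ⟨by ring, ?_⟩
      rw [hsucc]
      field_simp
      ring
    · rw [wt, if_pos h3, wt, if_neg (not_le.2 h2), kinkSize, max_eq_right (by linarith), kinkPos]
      have hp0 := h1.ne
      refine ⟨by ring, ?_⟩
      rw [hsucc]
      field_simp
      ring
  · rw [if_neg hf, if_neg hf]
    have hw : wt I C (r + 1) e y = wt I C r e y := by
      have hiff := not_not.1 hf
      rw [wt, wt]
      by_cases h1 : C (r * I.m + e) ≤ C (y * I.m + e)
      · rw [if_pos h1, if_pos (hiff.1 h1)]
      · rw [if_neg h1, if_neg fun h' => h1 (hiff.2 h')]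
    rw [hw]
    refine ⟨by ring, ?_⟩
    rw [hsucc]
    ring

theorem kinkSize_nonneg (h : Table I st pt C) {r e : ℕ} (he : e < I.m) :
    0 ≤ kinkSize I pt C r e := by
  refine mul_nonneg (by linarith [h.good.lb_le_ub he]) ?_
  rcases _root_.le_total 0 (slope I pt C r e) with h' | h'
  · exact h'.trans (le_max_left _ _)
  · exact le_trans (by linarith) (le_max_right _ _)

open Classical in
theorem sum_flips_le (h : Table I st pt C) {x e : ℕ} (hx : x < I.m) (he : e < I.m) (y : ℕ) :
    ∑ r ∈ Ico (st x) (st (x + 1) - 1), (if Flip I C r e y then 1 else 0) ≤ 2 := by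
  have hlt := h.lt x hx
  have := Inst.card_flips_cv_le (x := x) h.good he (C (y * I.m + e)) (a := fun q => pt (st x + q))
    (Q := st (x + 1) - 1 - st x) fun i j hij hj => by
      rcases eq_or_lt_of_le hij with rfl | hij
      · exact le_rfl
      · exact ((h.lists x hx).1 _ _ (by omega) (by omega) (by omega)).le
  rw [card_filter] at this
  rw [sum_Ico_eq_sum_range]
  refine le_trans (le_of_eq (sum_congr rfl fun q hq => ?_)) this
  rw [mem_range] at hq
  refine if_congr (not_congr ?_) rfl rfl
  rw [h.cov x hx (st x + q) (by omega) (by omega) e he,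
    h.cov x hx (st x + q + 1) (by omega) (by omega) e he]
  rfl

open Classical in
theorem sum_changes_le (h : Table I st pt C) {x e : ℕ} (hx : x < I.m) (he : e < I.m) :
    ∑ r ∈ Ico (st x) (st (x + 1) - 1),
      (if slope I pt C r e = prevSlope I pt C (st x) r e then 0 else 1) ≤ 9 := by
  have hlt := h.lt x hx
  rw [sum_eq_sum_Ico_succ_bot (by omega)]
  refine add_le_add (b := 1) (d := 8) (by split_ifs <;> omega) (le_trans ?_ (Inst.card_breaks (I := I) x e))
  have hswap : ∀ r, (if slope I pt C r e = prevSlope I pt C (st x) r e then 0 else 1) =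
      if ¬ slope I pt C r e = prevSlope I pt C (st x) r e then 1 else 0 := fun r => by
    split_ifs <;> rfl
  simp only [hswap]
  rw [← card_filter]
  refine card_le_card_of_injOn pt (fun r hr => ?_) fun r hr r' hr' heq => ?_
  · simp only [coe_filter, mem_Ico, Set.mem_ofPred_eq] at hr
    obtain ⟨⟨hr1, hr2⟩, hne⟩ := hr
    by_contra hb
    refine hne ?_
    rw [prevSlope, if_neg (by omega)]
    have haff := h.affOn hx he (p := r - 1) (q := r + 1) (by omega) (by omega) (by omega)
      fun j h1 h2 => by rwa [show j = r by omega]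
    have hlt1 := (h.lists x hx).1 (r - 1) r (by omega) (by omega) (by omega)
    have hlt2 := (h.lists x hx).1 r (r + 1) (by omega) (by omega) (by omega)
    have e1 := h.cv_eq_of_aff hx he (a := r - 1) (b := r) (by omega) (by omega) le_rfl (by omega)
      (by omega) haff (t := pt (r + 1)) ⟨by linarith, le_rfl⟩
    rw [← h.cov x hx (r + 1) (by omega) (by omega) e he] at e1
    have e2 := h.succ_eq (e := e) (r := r - 1) hx (by omega) (by omega)
    have e3 : slope I pt C (r - 1) e = (C (r * I.m + e) - C ((r - 1) * I.m + e)) / (pt r - pt (r - 1)) := by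
      rw [slope, show r - 1 + 1 = r by omega]
    rw [← e3] at e1
    rw [show r - 1 + 1 = r by omega] at e2
    rw [slope, e1, e2, div_eq_iff (by linarith)]
    ring
  · simp only [coe_filter, mem_Ico, Set.mem_ofPred_eq] at hr hr'
    by_contra hne
    rcases lt_or_gt_of_ne hne with hlt | hlt
    · exact ((h.lists x hx).1 r r' (by omega) hlt (by omega)).ne heq
    · exact ((h.lists x hx).1 r' r (by omega) hlt (by omega)).ne heq.symm

theorem regAt_eq (h : Table I st pt C) {x b y : ℕ} (hb : b < I.m) (h1 : st b ≤ y)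
    (h2 : y < st (b + 1)) (t : ℝ) : regAt I C x t y = I.reg x t b (pt y) :=
  sum_congr rfl fun e he => by rw [h.cov b hb y h1 h2 e (mem_range.1 he)]

end Table

end RAMLang

namespace RAMLang

open RealRAM Finset

variable {I : Inst} {st : ℕ → ℕ} {pt : ℕ → ℝ}

/-! ### Finding the kinks of the regret functions -/

theorem HasKeys.frame {c : Cmd} {σ τ : State} (h : HasKeys I st pt σ) (hf : Frame c σ τ)
    (hc : (c.wI 0 || c.wI 1 || c.wR 0 || c.wIA 2 || c.wIA 3 || c.wRA 3 || c.wRA 4 || c.wRA 5 ||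
      c.wIA 4 || c.wRA 6) = false)
    (hc' : (c.wIA 0 || c.wRA 0 || c.wI 8 || c.wIA 5 || c.wIA 6) = false)
    (h8 : c.wRA 8 = false) (h7 : c.wIA 7 = false) (h9 : c.wRA 9 = false) : HasKeys I st pt τ :=
  ⟨h.toHasCov.frame hf hc hc' h8, by rw [hf.ra 8 h8, hf.ia 7 h7, hf.ra 9 h9]; exact h.row⟩

theorem HasKeys.setI {σ : State} (h : HasKeys I st pt σ) {d v : ℕ}
    (h0 : d ≠ 0) (h1 : d ≠ 1) (h8 : d ≠ 8) : HasKeys I st pt (σ.setI d v) :=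
  ⟨h.toHasCov.setI h0 h1 h8, h.row⟩

theorem HasKeys.table {σ : State} (hI : I.Good) (hp : Pts I st pt) (h : HasKeys I st pt σ) :
    Table I st pt (σ.rarr 8) := ⟨hp, hI, h.cov⟩

/-- The position `p` separates the keys below `c` from the others. -/
structure Cut (key : ℕ → ℝ) (lo hi p : ℕ) (c : ℝ) : Prop where
  lo_le : lo ≤ p
  le_hi : p ≤ hi
  lt : ∀ q, lo ≤ q → q < p → key q < c
  le : ∀ q, p ≤ q → q < hi → c ≤ key q

/-- Moves the pointer `ireg 17` to the first key of at least `rreg 11` in the sorted block from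
`ireg 18` to `ireg 19`. -/
def movePtr : Cmd :=
  .wh (.and (.ilt (.reg 17) (.reg 19)) (.rlt (.ld 9 (.reg 17)) (.reg 11)))
    (.iset 17 (.add (.reg 17) (.lit 1))) ;;
  .wh (.and (.ilt (.reg 18) (.reg 17)) (.rle (.reg 11) (.ld 9 (.sub (.reg 17) (.lit 1)))))
    (.iset 17 (.sub (.reg 17) (.lit 1)))

theorem run_movePtr {σ : State} {lo hi p : ℕ} {c : ℝ} {key : ℕ → ℝ} (h17 : σ.ireg 17 = p)
    (h18 : σ.ireg 18 = lo) (h19 : σ.ireg 19 = hi) (h11 : σ.rreg 11 = c) (h9 : σ.rarr 9 = key)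
    (hs : SortedOn key lo hi) (hlo : lo ≤ p) (hhi : p ≤ hi) :
    Run movePtr σ fun t τ => t ≤ 2 * (max p (τ.ireg 17) - min p (τ.ireg 17)) + 2 ∧
      Cut key lo hi (τ.ireg 17) c := by
  rw [movePtr]
  refine (Run.while (fun τ => p ≤ τ.ireg 17 ∧ τ.ireg 17 ≤ hi ∧
    (p < τ.ireg 17 → key (τ.ireg 17 - 1) < c)) (fun τ => 2 * (hi - τ.ireg 17))
    ⟨h17.ge, by omega, by omega⟩ ?_).seq ?_
  · rintro τ hτ ⟨h1, h2, h3⟩ hb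
    have e11 : τ.rreg 11 = c := (hτ.rr 11 rfl).trans h11
    have e19 : τ.ireg 19 = hi := (hτ.ir 19 rfl).trans h19
    have e9 : τ.rarr 9 = key := (hτ.ra 9 rfl).trans h9
    simp only [BE.eval, IE.eval, RE.eval, e19, e11, e9] at hb
    simp only [run_iset, IE.eval, ireg_setI, if_true]
    exact ⟨⟨by omega, by omega, fun _ => by simpa using hb.2⟩, by omega⟩
  rintro t τ hτ ⟨⟨h1, h2, h3⟩, hb, ht⟩
  have e11 : τ.rreg 11 = c := (hτ.rr 11 rfl).trans h11
  have e19 : τ.ireg 19 = hi := (hτ.ir 19 rfl).trans h19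
  have e18 : τ.ireg 18 = lo := (hτ.ir 18 rfl).trans h18
  have e9 : τ.rarr 9 = key := (hτ.ra 9 rfl).trans h9
  simp only [BE.eval, IE.eval, RE.eval, e19, e11, e9, not_and, not_lt] at hb
  have hsuf : ∀ q, τ.ireg 17 ≤ q → q < hi → c ≤ key q := fun q hq1 hq2 =>
    (hb (by omega)).trans (hs _ _ (by omega) hq1 hq2)
  refine (Run.while (fun υ => lo ≤ υ.ireg 17 ∧ υ.ireg 17 ≤ τ.ireg 17 ∧
    ∀ q, υ.ireg 17 ≤ q → q < hi → c ≤ key q) (fun υ => 2 * (υ.ireg 17 - lo))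
    ⟨by omega, le_rfl, hsuf⟩ ?_).mono ?_
  · rintro υ hυ ⟨h4, h5, h6⟩ hb
    have e11' : υ.rreg 11 = c := (hυ.rr 11 rfl).trans e11
    have e18' : υ.ireg 18 = lo := (hυ.ir 18 rfl).trans e18
    have e9' : υ.rarr 9 = key := (hυ.ra 9 rfl).trans e9
    simp only [BE.eval, IE.eval, RE.eval, e18', e11', e9'] at hb
    simp only [run_iset, IE.eval, ireg_setI, if_true]
    refine ⟨⟨by omega, by omega, fun q hq1 hq2 => ?_⟩, by omega⟩
    by_cases hq : υ.ireg 17 ≤ q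
    · exact h6 q hq hq2
    · rw [show q = υ.ireg 17 - 1 by omega]; exact hb.2
  rintro t' υ hυ ⟨⟨h4, h5, h6⟩, hb', ht'⟩
  have e11' : υ.rreg 11 = c := (hυ.rr 11 rfl).trans e11
  have e18' : υ.ireg 18 = lo := (hυ.ir 18 rfl).trans e18
  have e9' : υ.rarr 9 = key := (hυ.ra 9 rfl).trans e9
  simp only [BE.eval, IE.eval, RE.eval, e18', e11', e9', not_and, not_le] at hb'
  have heq : p < τ.ireg 17 → υ.ireg 17 = τ.ireg 17 := fun hlt => by
    by_contra hne
    exact absurd (h3 hlt) (not_lt.2 (h6 _ (by omega) (by omega)))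
  refine ⟨by omega, h4, by omega, fun q hq1 hq2 => ?_, h6⟩
  exact (hs q (υ.ireg 17 - 1) hq1 (by omega) (by omega)).trans_lt (hb' (by omega))

/-- The sum of `φ (position) (size)` over the kinks of the function `y`. -/
noncomputable def kinkSum (σ : State) (φ : ℝ → ℝ → ℝ) (y : ℕ) : ℝ :=
  ∑ j ∈ range (σ.ireg 43), if σ.iarr 11 j = y then φ (σ.rarr 14 j) (σ.rarr 15 j) else 0

/-- The first `N` lines in the arrays `10`, `11` are those in `12`, `13` after all their kinks. -/
structure Balanced (N : ℕ) (σ : State) : Prop where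
  nonneg : ∀ j < σ.ireg 43, 0 ≤ σ.rarr 15 j
  slope : ∀ y < N, σ.rarr 10 y = σ.rarr 12 y + kinkSum σ (fun _ d => d) y
  icpt : ∀ y < N, σ.rarr 11 y = σ.rarr 13 y - kinkSum σ (fun a d => d * a) y

theorem kinkSum_push {σ τ : State} {v : ℕ} {a d : ℝ} (h43 : τ.ireg 43 = σ.ireg 43 + 1)
    (h11 : τ.iarr 11 = Function.update (σ.iarr 11) (σ.ireg 43) v)
    (h14 : τ.rarr 14 = Function.update (σ.rarr 14) (σ.ireg 43) a)
    (h15 : τ.rarr 15 = Function.update (σ.rarr 15) (σ.ireg 43) d) (φ : ℝ → ℝ → ℝ) (y : ℕ) :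
    kinkSum τ φ y = kinkSum σ φ y + if v = y then φ a d else 0 := by
  rw [kinkSum, h43, sum_range_succ, h11, h14, h15]
  simp only [Function.update_self]
  congr 1
  refine sum_congr rfl fun j hj => ?_
  rw [mem_range] at hj
  simp only [Function.update_of_ne hj.ne]

theorem kinkSum_congr {σ τ : State} (h43 : τ.ireg 43 = σ.ireg 43) (h11 : τ.iarr 11 = σ.iarr 11)
    (h14 : τ.rarr 14 = σ.rarr 14) (h15 : τ.rarr 15 = σ.rarr 15) (φ : ℝ → ℝ → ℝ) (y : ℕ) :
    kinkSum τ φ y = kinkSum σ φ y := by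
  rw [kinkSum, h43, h11, h14, h15]; rfl

theorem Balanced.congr {N : ℕ} {σ τ : State} (h : Balanced N σ) (h43 : τ.ireg 43 = σ.ireg 43)
    (h11 : τ.iarr 11 = σ.iarr 11) (hr : τ.rarr = σ.rarr) : Balanced N τ := by
  refine ⟨by rw [h43, hr]; exact h.nonneg, fun y hy => ?_, fun y hy => ?_⟩
  · rw [kinkSum_congr h43 h11 (by rw [hr]) (by rw [hr]), hr]; exact h.slope y hy
  · rw [kinkSum_congr h43 h11 (by rw [hr]) (by rw [hr]), hr]; exact h.icpt y hy

/-- Records the kink of size `rreg 14` where the cover value reaches the key number `ireg 18`. -/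
def emit : Cmd :=
  .ist 11 (.reg 43) (.ld 7 (.reg 18)) ;;
  .rst 14 (.reg 43) (.add (.reg 13) (.div (.sub (.ld 9 (.reg 18)) (.reg 10)) (.reg 12))) ;;
  .rst 15 (.reg 43) (.reg 14) ;;
  .rst 10 (.ld 7 (.reg 18)) (.add (.ld 10 (.ld 7 (.reg 18))) (.reg 14)) ;;
  .rst 11 (.ld 7 (.reg 18)) (.sub (.ld 11 (.ld 7 (.reg 18))) (.mul (.reg 14) (.ld 14 (.reg 43)))) ;;
  .iset 43 (.add (.reg 43) (.lit 1))

theorem run_emit {N : ℕ} {σ : State} (hb : Balanced N σ) (h14 : 0 ≤ σ.rreg 14) :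
    Run emit σ fun t τ => t = 6 ∧ Balanced N τ ∧ τ.ireg 43 = σ.ireg 43 + 1 ∧
      ∀ φ y, kinkSum τ φ y = kinkSum σ φ y + if σ.iarr 7 (σ.ireg 18) = y then
        φ (σ.rreg 13 + (σ.rarr 9 (σ.ireg 18) - σ.rreg 10) / σ.rreg 12) (σ.rreg 14) else 0 := by
  set a := σ.rreg 13 + (σ.rarr 9 (σ.ireg 18) - σ.rreg 10) / σ.rreg 12 with ha
  set v := σ.iarr 7 (σ.ireg 18)
  have hrun : Run emit σ fun t τ => t = 6 ∧ τ.ireg 43 = σ.ireg 43 + 1 ∧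
      τ.iarr 11 = Function.update (σ.iarr 11) (σ.ireg 43) v ∧
      τ.rarr 14 = Function.update (σ.rarr 14) (σ.ireg 43) a ∧
      τ.rarr 15 = Function.update (σ.rarr 15) (σ.ireg 43) (σ.rreg 14) ∧
      τ.rarr 10 = Function.update (σ.rarr 10) v (σ.rarr 10 v + σ.rreg 14) ∧
      τ.rarr 11 = Function.update (σ.rarr 11) v (σ.rarr 11 v - σ.rreg 14 * a) := by
    simp [emit, IE.eval, RE.eval, v, ha]
  refine hrun.mono ?_
  rintro t τ hτ ⟨rfl, h1, h2, h3, h4, h5, h6⟩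
  have hpush := kinkSum_push h1 h2 h3 h4
  have e12 : τ.rarr 12 = σ.rarr 12 := hτ.ra 12 rfl
  have e13 : τ.rarr 13 = σ.rarr 13 := hτ.ra 13 rfl
  refine ⟨rfl, ⟨fun j hj => ?_, fun y hy => ?_, fun y hy => ?_⟩, h1, hpush⟩
  · rw [h4]
    rw [h1] at hj
    rcases Nat.lt_succ_iff_lt_or_eq.1 hj with hj | rfl
    · rw [Function.update_of_ne hj.ne]; exact hb.nonneg j hj
    · rw [Function.update_self]; exact h14
  · rw [hpush, h5, e12, Function.update_apply]
    by_cases h : v = y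
    · rw [if_pos h.symm, if_pos h, h, hb.slope y hy]; ring
    · rw [if_neg (Ne.symm h), if_neg h, hb.slope y hy]; ring
  · rw [hpush, h6, e13, Function.update_apply]
    by_cases h : v = y
    · rw [if_pos h.symm, if_pos h, h, hb.icpt y hy]; ring
    · rw [if_neg (Ne.symm h), if_neg h, hb.icpt y hy]; ring

open Classical in
/-- The points of a block whose worst demand flips are those between the two cuts. -/
theorem KeyRow.sum_flips {c : ℕ → ℝ} {o : ℕ} {id : ℕ → ℕ} {key : ℕ → ℝ} {e r b p p' : ℕ}
    {M : Type} [AddCommMonoid M] (hp : Pts I st pt) (hk : KeyRow I st c o I.m id key e) (hb : b < I.m)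
    (h : Cut key (o + st b) (o + st (b + 1)) p (c (r * I.m + e)))
    (h' : Cut key (o + st b) (o + st (b + 1)) p' (c ((r + 1) * I.m + e))) (F : ℕ → M) :
    ∑ q ∈ Ico (min p p') (max p p'), F (id q) =
      ∑ y ∈ Ico (st b) (st (b + 1)), if Flip I c r e y then F y else 0 := by
  have hinj : Set.InjOn (fun q => id (o + q)) (Ico (st b) (st (b + 1)) : Finset ℕ) :=
    fun q hq q' hq' heq => by
      simp only [coe_Ico, Set.mem_Ico] at hq hq'
      exact hk.inj q (hp.lt_total hb hq.2) q' (hp.lt_total hb hq'.2) heq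
  have himg : (Ico (st b) (st (b + 1))).image (fun q => id (o + q)) = Ico (st b) (st (b + 1)) := by
    refine eq_of_subset_of_card_le (fun y hy => ?_) (card_image_of_injOn hinj).ge
    obtain ⟨q, hq, rfl⟩ := mem_image.1 hy
    rw [mem_Ico] at hq ⊢
    exact hk.maps b hb q hq.1 hq.2
  have hsum : (∑ y ∈ Ico (st b) (st (b + 1)), if Flip I c r e y then F y else 0) =
      ∑ q ∈ Ico (o + st b) (o + st (b + 1)), if Flip I c r e (id q) then F (id q) else 0 := by
    rw [add_comm o, add_comm o, ← sum_Ico_add (fun q => if Flip I c r e (id q) then F (id q) else 0)]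
    conv_lhs => rw [← himg]
    exact sum_image hinj
  rw [hsum, ← sum_filter]
  refine sum_congr (Finset.ext fun q => ?_) fun _ _ => rfl
  have l1 := h.lo_le
  have l2 := h.le_hi
  have l3 := h'.lo_le
  have l4 := h'.le_hi
  rw [mem_filter, mem_Ico, mem_Ico]
  by_cases hq : o + st b ≤ q ∧ q < o + st (b + 1)
  · have hkey : key q = c (id q * I.m + e) := by
      have := hk.key_eq (q - o) (hp.lt_total hb (by omega))
      rwa [show o + (q - o) = q by omega] at this
    rw [Flip, ← hkey]
    have i1 : c (r * I.m + e) ≤ key q ↔ p ≤ q :=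
      ⟨fun hle => by by_contra hn; exact absurd (h.lt q hq.1 (by omega)) (not_lt.2 hle),
        fun hle => h.le q hle hq.2⟩
    have i2 : c ((r + 1) * I.m + e) ≤ key q ↔ p' ≤ q :=
      ⟨fun hle => by by_contra hn; exact absurd (h'.lt q hq.1 (by omega)) (not_lt.2 hle),
        fun hle => h'.le q hle hq.2⟩
    rw [i1, i2]
    omega
  · exact ⟨fun h1 => absurd (by omega) hq, fun h1 => absurd h1.1 hq⟩

end RAMLang

namespace RAMLang

open RealRAM Finset

variable {I : Inst} {st : ℕ → ℕ} {pt C : ℕ → ℝ} {N : ℕ}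

open Classical in
noncomputable def flipCount (I : Inst) (C : ℕ → ℝ) (r e a b : ℕ) : ℕ :=
  ∑ y ∈ Ico a b, if Flip I C r e y then 1 else 0

open Classical in
/-- What the kink of `y` that comes from `e` contributes to `kinkSum`. -/
noncomputable def flipGain (I : Inst) (pt C : ℕ → ℝ) (r e : ℕ) (φ : ℝ → ℝ → ℝ) (y : ℕ) : ℝ :=
  if Flip I C r e y then φ (kinkPos I pt C r e (C (y * I.m + e))) (kinkSize I pt C r e) else 0

/-- The registers while the edge `e` is treated on the interval after `r`. -/
structure EdgeRegs (I : Inst) (st : ℕ → ℕ) (pt C : ℕ → ℝ) (r e : ℕ) (σ : State) : Prop where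
  i2 : σ.ireg 2 = e
  i13 : σ.ireg 13 = e * st I.m
  r10 : σ.rreg 10 = C (r * I.m + e)
  r11 : σ.rreg 11 = C ((r + 1) * I.m + e)
  r12 : σ.rreg 12 = slope I pt C r e
  r13 : σ.rreg 13 = pt r
  r14 : σ.rreg 14 = kinkSize I pt C r e
  a8 : σ.rarr 8 = C

theorem EdgeRegs.frame {r e : ℕ} {c : Cmd} {σ τ : State} (h : EdgeRegs I st pt C r e σ)
    (hf : Frame c σ τ) (hc : (c.wI 2 || c.wI 13 || c.wR 10 || c.wR 11 || c.wR 12 || c.wR 13 ||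
      c.wR 14 || c.wRA 8) = false) : EdgeRegs I st pt C r e τ := by
  simp only [Bool.or_eq_false_iff] at hc
  obtain ⟨⟨⟨⟨⟨⟨⟨h1, h2⟩, h3⟩, h4⟩, h5⟩, h6⟩, h7⟩, h8⟩ := hc
  exact ⟨(hf.ir _ h1).trans h.i2, (hf.ir _ h2).trans h.i13, (hf.rr _ h3).trans h.r10,
    (hf.rr _ h4).trans h.r11, (hf.rr _ h5).trans h.r12, (hf.rr _ h6).trans h.r13,
    (hf.rr _ h7).trans h.r14, (hf.ra _ h8).trans h.a8⟩

theorem run_emits {σ : State} {r e lo hi : ℕ} (hr : EdgeRegs I st pt C r e σ) (hb : Balanced N σ)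
    (h18 : σ.ireg 18 = lo) (h19 : σ.ireg 19 = hi) (hle : lo ≤ hi)
    (hpos : 0 ≤ kinkSize I pt C r e)
    (hkey : ∀ q, lo ≤ q → q < hi → σ.rarr 9 q = C (σ.iarr 7 q * I.m + e)) :
    Run (forTo 18 (.reg 19) emit) σ fun t τ => t ≤ 1 + (hi - lo) * 8 ∧ Balanced N τ ∧
      τ.ireg 43 = σ.ireg 43 + (hi - lo) ∧ ∀ φ y, kinkSum τ φ y = kinkSum σ φ y +
        ∑ q ∈ Ico lo hi, if σ.iarr 7 q = y then
          φ (kinkPos I pt C r e (C (σ.iarr 7 q * I.m + e))) (kinkSize I pt C r e) else 0 := by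
  refine (Run.forTo' (a := lo) (n := hi) (fun k τ => Balanced N τ ∧
    τ.ireg 43 = σ.ireg 43 + (k - lo) ∧ ∀ φ y, kinkSum τ φ y = kinkSum σ φ y +
        ∑ q ∈ Ico lo k, if σ.iarr 7 q = y then
          φ (kinkPos I pt C r e (C (σ.iarr 7 q * I.m + e))) (kinkSize I pt C r e) else 0) 6 h18 hle
    (fun τ hτ => by simpa using (hτ.ir 19 rfl).trans h19) rfl ⟨hb, by omega, by simp⟩ ?_).mono ?_
  · rintro k τ hk1 hk2 hτ hτk ⟨h1, h2, h3⟩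
    have hr' := hr.frame hτ rfl
    have e7 : τ.iarr 7 = σ.iarr 7 := hτ.ia 7 rfl
    have e9 : τ.rarr 9 = σ.rarr 9 := hτ.ra 9 rfl
    refine (run_emit h1 (by rw [hr'.r14]; exact hpos)).mono ?_
    rintro t υ hυ ⟨rfl, h4, h5, h6⟩
    refine ⟨le_rfl, h4.congr (by simp) rfl rfl, by simp; omega, fun φ y => ?_⟩
    rw [kinkSum_congr (τ := υ.setI 18 (k + 1)) (σ := υ) (by simp) rfl rfl rfl, h6, h3,
      sum_Ico_succ_top hk1, hr'.r10, hr'.r12, hr'.r13, hr'.r14, e7, e9, hτk, hkey k hk1 hk2, kinkPos]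
    ring
  · rintro t τ - ⟨⟨h1, h2, h3⟩, -, ht⟩
    exact ⟨ht, h1, h2, h3⟩

/-- Loads the bounds of the block `ireg 15` and its pointer. -/
def blockRegs : Cmd :=
  .iset 49 (.add (.ld 5 (.reg 2)) (.reg 15)) ;; .iset 17 (.ld 8 (.reg 49)) ;; .iset 16 (.reg 17) ;;
  .iset 18 (.add (.reg 13) (.ld 0 (.reg 15))) ;;
  .iset 19 (.add (.reg 13) (.ld 0 (.add (.reg 15) (.lit 1))))

def orderPtrs : Cmd :=
  .ite (.ile (.reg 16) (.reg 17)) (.iset 18 (.reg 16) ;; .iset 19 (.reg 17))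
    (.iset 18 (.reg 17) ;; .iset 19 (.reg 16))

/-- Moves the pointer of the block `ireg 15` and records the kinks that this yields. -/
def flipBlock : Cmd :=
  blockRegs ;; movePtr ;; .ist 8 (.reg 49) (.reg 17) ;; orderPtrs ;; forTo 18 (.reg 19) emit

theorem run_orderPtrs (σ : State) : Run orderPtrs σ fun t τ => t = 3 ∧
    τ.ireg 18 = min (σ.ireg 16) (σ.ireg 17) ∧ τ.ireg 19 = max (σ.ireg 16) (σ.ireg 17) := by
  simp [orderPtrs]
  omega

open Classical in
theorem run_flipBlock {σ : State} {r e b : ℕ} (hI : I.Good) (hp : Pts I st pt)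
    (hσ : HasKeys I st pt σ) (he : e < I.m) (hb : b < I.m) (hr : EdgeRegs I st pt C r e σ)
    (hbal : Balanced N σ) (h15 : σ.ireg 15 = b) (hcut : Cut (σ.rarr 9) (e * st I.m + st b)
      (e * st I.m + st (b + 1)) (σ.iarr 8 (e * I.m + b)) (C (r * I.m + e))) :
    Run flipBlock σ fun t τ => t ≤ 20 + 10 * flipCount I C r e (st b) (st (b + 1)) ∧ Balanced N τ ∧
      τ.ireg 43 = σ.ireg 43 + flipCount I C r e (st b) (st (b + 1)) ∧
      (∀ φ y, kinkSum τ φ y = kinkSum σ φ y +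
        if st b ≤ y ∧ y < st (b + 1) then flipGain I pt C r e φ y else 0) ∧
      ∃ p, τ.iarr 8 = Function.update (σ.iarr 8) (e * I.m + b) p ∧ Cut (σ.rarr 9)
        (e * st I.m + st b) (e * st I.m + st (b + 1)) p (C ((r + 1) * I.m + e)) := by
  have hrow := hσ.row e he
  rw [hr.a8] at hrow
  set o := e * st I.m with ho
  set p := σ.iarr 8 (e * I.m + b) with hpdef
  have e5 : σ.iarr 5 e = e * I.m := hσ.offY e (by have := hp.le_total le_rfl; omega)
  have hregs : Run blockRegs σ fun t τ => t = 5 ∧ τ.ireg 49 = e * I.m + b ∧ τ.ireg 17 = p ∧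
      τ.ireg 16 = p ∧ τ.ireg 18 = o + st b ∧ τ.ireg 19 = o + st (b + 1) := by
    simp [blockRegs, hr.i2, hr.i13, h15, e5, hσ.ia0, ← hpdef, ← ho]
  rw [flipBlock]
  refine hregs.seq ?_
  rintro t τ hτ ⟨rfl, h49, h17, h16, h18, h19⟩
  have e9 : τ.rarr 9 = σ.rarr 9 := hτ.ra 9 rfl
  refine (run_movePtr h17 h18 h19 ((hτ.rr 11 rfl).trans hr.r11) e9 (hrow.sorted b hb) hcut.lo_le
    hcut.le_hi).seq ?_
  rintro t' υ hυ ⟨ht', hcut'⟩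
  set p' := υ.ireg 17 with hp'
  rw [run_seq, run_ist]
  refine (run_orderPtrs _).seq ?_
  rintro _ χ hχ ⟨rfl, h18', h19'⟩
  have e16 : υ.ireg 16 = p := (hυ.ir 16 rfl).trans h16
  have e49 : υ.ireg 49 = e * I.m + b := (hυ.ir 49 rfl).trans h49
  simp only [ireg_setIA, e16, ← hp'] at h18' h19'
  have hrχ : EdgeRegs I st pt C r e χ := by
    have := (hr.frame hτ rfl).frame hυ rfl
    exact EdgeRegs.frame (σ := υ.setIA 8 _ _) ⟨this.i2, this.i13, this.r10, this.r11, this.r12,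
      this.r13, this.r14, this.a8⟩ hχ rfl
  have ra : χ.rarr = σ.rarr := by
    have a1 : ∀ k, χ.rarr k = σ.rarr k := fun k =>
      (hχ.ra k rfl).trans ((hυ.ra k rfl).trans (hτ.ra k rfl))
    exact funext a1
  have ia : ∀ k, k ≠ 8 → χ.iarr k = σ.iarr k := fun k hk => by
    rw [hχ.ia k rfl, iarr_setIA, if_neg hk, hυ.ia k rfl, hτ.ia k rfl]
  have i43 : χ.ireg 43 = σ.ireg 43 :=
    (hχ.ir 43 rfl).trans ((hυ.ir 43 rfl).trans (hτ.ir 43 rfl))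
  have hcnt : max p p' - min p p' = flipCount I C r e (st b) (st (b + 1)) := by
    have := hrow.sum_flips hp hb hcut hcut' (fun _ => 1)
    simpa [flipCount] using this
  have hl1 := hcut.lo_le
  have hl2 := hcut.le_hi
  have hl3 := hcut'.lo_le
  have hl4 := hcut'.le_hi
  refine (run_emits hrχ (hbal.congr i43 (ia 11 (by decide)) ra) h18' h19' (by omega)
    ((hr.a8 ▸ hσ.table hI hp : Table I st pt C).kinkSize_nonneg he) fun q hq1 hq2 => ?_).mono ?_
  · rw [ra, ia 7 (by decide)]
    have := hrow.key_eq (q - o) (hp.lt_total hb (by omega))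
    rwa [show o + (q - o) = q by omega] at this
  rintro t'' ω hω ⟨ht'', h1, h2, h3⟩
  rw [hcnt] at ht' ht'' h2
  refine ⟨by omega, h1, by omega, fun φ y => ?_, p', ?_, hcut'⟩
  · rw [h3, ia 7 (by decide), kinkSum_congr i43 (ia 11 (by decide)) (by rw [ra]) (by rw [ra]),
      hrow.sum_flips hp hb hcut hcut' (fun v => if v = y then
        φ (kinkPos I pt C r e (C (v * I.m + e))) (kinkSize I pt C r e) else 0)]
    congr 1
    have : ∀ v ∈ Ico (st b) (st (b + 1)), (if Flip I C r e v then (if v = y then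
        φ (kinkPos I pt C r e (C (v * I.m + e))) (kinkSize I pt C r e) else 0) else 0) =
        if v = y then flipGain I pt C r e φ y else 0 := by
      intro v _
      by_cases hv : v = y
      · subst hv; rw [if_pos rfl, if_pos rfl, flipGain]
      · rw [if_neg hv, if_neg hv, ite_self]
    rw [sum_congr rfl this, sum_ite_eq']
    simp only [mem_Ico]
  · rw [hω.ia 8 rfl, hχ.ia 8 rfl]
    simp [IE.eval, e49, ← hp']
    rw [hυ.ia 8 rfl, hτ.ia 8 rfl]

/-- The pointers of the edge `e` separate the keys at the cover value from the point `r`. -/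
def PtrAt (I : Inst) (st : ℕ → ℕ) (σ : State) (r e : ℕ) : Prop :=
  ∀ b < I.m, Cut (σ.rarr 9) (e * st I.m + st b) (e * st I.m + st (b + 1)) (σ.iarr 8 (e * I.m + b))
    (σ.rarr 8 (r * I.m + e))

/-- Loads the data of the edge `ireg 2` on the interval after the point `ireg 14`. -/
def edgeRegs : Cmd :=
  .rset 10 (.ld 8 (.add (.ld 5 (.reg 14)) (.reg 2))) ;;
  .rset 11 (.ld 8 (.add (.ld 5 (.add (.reg 14) (.lit 1))) (.reg 2))) ;;
  .rset 12 (.ld 19 (.reg 2)) ;; .rset 13 (.ld 0 (.reg 14)) ;;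
  .rset 14 (.mul (.sub (.ld 5 (.reg 2)) (.ld 4 (.reg 2))) (.mx (.reg 12) (.sub (.lit 0) (.reg 12)))) ;;
  .iset 13 (.ld 6 (.reg 2)) ;; .iset 15 (.lit 0)

def flipEdge : Cmd := edgeRegs ;; forTo 15 (.reg 1) flipBlock

theorem run_edgeRegs {σ : State} {r e : ℕ} (hσ : HasKeys I st pt σ) (he : e < I.m)
    (hr : r + 1 < st I.m) (h8 : σ.rarr 8 = C) (h2 : σ.ireg 2 = e) (h14 : σ.ireg 14 = r)
    (h19 : σ.rarr 19 e = slope I pt C r e) :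
    Run edgeRegs σ fun t τ => t = 7 ∧ EdgeRegs I st pt C r e τ ∧ τ.ireg 15 = 0 := by
  have e5 : σ.iarr 5 r = r * I.m := hσ.offY r (by omega)
  have e5' : σ.iarr 5 (r + 1) = (r + 1) * I.m := hσ.offY (r + 1) hr
  simp only [edgeRegs, run_seq, run_rset, run_iset]
  refine ⟨trivial, ⟨?_, ?_, ?_, ?_, ?_, ?_, ?_, ?_⟩, ?_⟩ <;>
    simp [h2, h14, hσ.ra0, e5, e5', h8, h19, hσ.offE e he, hσ.ub, hσ.lb, kinkSize]

theorem run_flipEdge {σ : State} {r e : ℕ} (hI : I.Good) (hp : Pts I st pt)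
    (hσ : HasKeys I st pt σ) (he : e < I.m) (hr : r + 1 < st I.m) (h8 : σ.rarr 8 = C)
    (h2 : σ.ireg 2 = e) (h14 : σ.ireg 14 = r) (h19 : σ.rarr 19 e = slope I pt C r e)
    (hbal : Balanced N σ) (hptr : PtrAt I st σ r e) :
    Run flipEdge σ fun t τ => t ≤ 22 * I.m + 8 + 10 * flipCount I C r e 0 (st I.m) ∧ Balanced N τ ∧
      τ.ireg 43 = σ.ireg 43 + flipCount I C r e 0 (st I.m) ∧
      (∀ φ, ∀ y < st I.m, kinkSum τ φ y = kinkSum σ φ y + flipGain I pt C r e φ y) ∧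
      PtrAt I st τ (r + 1) e ∧ ∀ q, q < e * I.m ∨ (e + 1) * I.m ≤ q → τ.iarr 8 q = σ.iarr 8 q := by
  rw [flipEdge]
  refine (run_edgeRegs hσ he hr h8 h2 h14 h19).seq ?_
  rintro _ τ hτ ⟨rfl, hregs, h15⟩
  have hτk := hσ.frame hτ rfl rfl rfl rfl rfl
  have ra : τ.rarr = σ.rarr := funext fun k => hτ.ra k rfl
  have ia : τ.iarr = σ.iarr := funext fun k => hτ.ia k rfl
  have i43 : τ.ireg 43 = σ.ireg 43 := hτ.ir 43 rfl
  refine (Run.forTo (a := 0) (n := I.m) (fun k υ => Balanced N υ ∧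
    υ.ireg 43 = σ.ireg 43 + flipCount I C r e 0 (st k) ∧
    (∀ φ y, kinkSum υ φ y = kinkSum σ φ y + if y < st k then flipGain I pt C r e φ y else 0) ∧
    (∀ b < k, Cut (σ.rarr 9) (e * st I.m + st b) (e * st I.m + st (b + 1)) (υ.iarr 8 (e * I.m + b))
      (C ((r + 1) * I.m + e))) ∧
    ∀ q, q < e * I.m ∨ e * I.m + k ≤ q → υ.iarr 8 q = σ.iarr 8 q)
    (fun b => 20 + 10 * flipCount I C r e (st b) (st (b + 1))) h15 (Nat.zero_le _)
    (fun υ hυ => by simpa using (hυ.ir 1 rfl).trans hτk.m) rfl ?_ ?_).mono ?_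
  · refine ⟨hbal.congr i43 (by rw [ia]) ra, by simp [hp.zero, i43, flipCount], fun φ y => ?_,
      by simp, by simp [ia]⟩
    rw [kinkSum_congr i43 (by rw [ia]) (by rw [ra]) (by rw [ra]), hp.zero]
    simp
  · rintro b υ - hb hυ hυb ⟨h3, h4, h5, h6, h7⟩
    have e9 : υ.rarr 9 = σ.rarr 9 := (hυ.ra 9 rfl).trans (by rw [ra])
    refine (run_flipBlock hI hp (hτk.frame hυ rfl rfl rfl rfl rfl) he hb (hregs.frame hυ rfl) h3 hυb
      ?_).mono ?_
    · rw [e9, h7 _ (by omega)]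
      have := hptr b hb
      rwa [h8] at this
    rintro t ω hω ⟨ht, k1, k2, k3, p, k4, k5⟩
    have hlt := hp.lt b hb
    refine ⟨ht, k1.congr (by simp) rfl rfl, ?_, fun φ y => ?_, fun b' hb' => ?_, fun q hq => ?_⟩
    · simp only [ireg_setI, Nat.reduceEqDiff, if_false, k2, h4]
      rw [flipCount, flipCount, flipCount, add_assoc,
        sum_Ico_consecutive _ (Nat.zero_le _) (by omega)]
    · rw [kinkSum_congr (τ := ω.setI 15 (b + 1)) (σ := ω) (by simp) rfl rfl rfl, k3, h5, add_assoc]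
      congr 1
      by_cases hy : y < st b
      · rw [if_pos hy, if_neg (by omega), if_pos (by omega), add_zero]
      · rw [if_neg hy, zero_add]
        exact if_congr (by omega) rfl rfl
    · simp only [iarr_setI, k4]
      rcases Nat.lt_succ_iff_lt_or_eq.1 hb' with hb' | rfl
      · rw [Function.update_of_ne (by omega)]
        exact h6 b' hb'
      · rw [Function.update_self, ← e9]
        exact k5
    · simp only [iarr_setI, k4]
      rw [Function.update_of_ne (by omega)]
      exact h7 q (by omega)
  · rintro t υ hυ ⟨⟨h3, h4, h5, h6, h7⟩, -, ht⟩
    refine ⟨?_, h3, h4, fun φ y hy => ?_, fun b hb => ?_, fun q hq => h7 q ?_⟩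
    · have hsum : ∀ k ≤ I.m, ∑ b ∈ Ico 0 k, (20 + 10 * flipCount I C r e (st b) (st (b + 1)) + 2) =
          22 * k + 10 * flipCount I C r e 0 (st k) := by
        intro k hk
        induction k with
        | zero => simp [hp.zero, flipCount]
        | succ k ih =>
          have hlt := hp.lt k (by omega)
          rw [sum_Ico_succ_top (Nat.zero_le _), ih (by omega)]
          have : flipCount I C r e 0 (st k) + flipCount I C r e (st k) (st (k + 1)) =
              flipCount I C r e 0 (st (k + 1)) :=
            sum_Ico_consecutive _ (Nat.zero_le _) (by omega)
          omega
      rw [hsum I.m le_rfl] at ht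
      omega
    · rw [h5, if_pos hy]
    · have := h6 b hb
      rw [hυ.ra 9 rfl, hυ.ra 8 rfl, ra, h8]
      exact this
    · rw [add_mul] at hq; omega

/-- Records the kinks of all regret functions on the interval after the point `ireg 14`. -/
def flips : Cmd := .iset 2 (.lit 0) ;; forTo 2 (.reg 1) flipEdge

noncomputable def flipTotal (I : Inst) (st : ℕ → ℕ) (C : ℕ → ℝ) (r : ℕ) : ℕ :=
  ∑ e ∈ range I.m, flipCount I C r e 0 (st I.m)

theorem run_flips {σ : State} {r : ℕ} (hI : I.Good) (hp : Pts I st pt)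
    (hσ : HasKeys I st pt σ) (hr : r + 1 < st I.m) (h8 : σ.rarr 8 = C) (h14 : σ.ireg 14 = r)
    (h19 : ∀ e < I.m, σ.rarr 19 e = slope I pt C r e) (hbal : Balanced N σ)
    (hptr : ∀ e < I.m, PtrAt I st σ r e) :
    Run flips σ fun t τ => t ≤ 32 * I.m ^ 2 + 2 + 10 * flipTotal I st C r ∧ Balanced N τ ∧
      τ.ireg 43 = σ.ireg 43 + flipTotal I st C r ∧
      (∀ φ, ∀ y < st I.m, kinkSum τ φ y = kinkSum σ φ y +
        ∑ e ∈ range I.m, flipGain I pt C r e φ y) ∧ ∀ e < I.m, PtrAt I st τ (r + 1) e := by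
  rw [flips, run_seq, run_iset]
  have hσ0 := hσ.setI (d := 2) (v := 0) (by decide) (by decide) (by decide)
  refine (Run.forTo (a := 0) (n := I.m) (fun k υ => Balanced N υ ∧
    υ.ireg 43 = σ.ireg 43 + ∑ e ∈ range k, flipCount I C r e 0 (st I.m) ∧
    (∀ φ, ∀ y < st I.m, kinkSum υ φ y = kinkSum σ φ y +
      ∑ e ∈ range k, flipGain I pt C r e φ y) ∧ (∀ e < k, PtrAt I st υ (r + 1) e) ∧
      ∀ e < I.m, k ≤ e → PtrAt I st υ r e)
    (fun e => 22 * I.m + 8 + 10 * flipCount I C r e 0 (st I.m)) (by simp) (Nat.zero_le _)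
    (fun υ hυ => by simpa [hσ.m] using hυ.ir 1 rfl) rfl ?_ ?_).mono ?_
  · exact ⟨hbal.congr (by simp) rfl rfl, by simp, fun φ y _ => by
      simpa using kinkSum_congr (τ := σ.setI 2 0) (σ := σ) (by simp) rfl rfl rfl φ y, by simp,
      fun e he _ => hptr e he⟩
  · rintro e υ - he hυ hυe ⟨h1, h2, h3, h4, h5⟩
    refine (run_flipEdge hI hp (hσ0.frame hυ rfl rfl rfl rfl rfl) he hr ((hυ.ra 8 rfl).trans h8) hυe
      (by simpa [h14] using hυ.ir 14 rfl) (by rw [hυ.ra 19 rfl]; exact h19 e he) h1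
      (h5 e he le_rfl)).mono ?_
    rintro t ω hω ⟨ht, k1, k2, k3, k4, k5⟩
    have keep : ∀ e' s, e' ≠ e → PtrAt I st υ s e' → PtrAt I st (ω.setI 2 (e + 1)) s e' := by
      intro e' s hne h b hb
      have := h b hb
      simp only [rarr_setI, iarr_setI]
      rw [hω.ra 9 rfl, hω.ra 8 rfl, k5]
      · exact this
      · rcases lt_or_gt_of_ne hne with hlt | hlt
        · exact .inl (mul_add_lt hlt hb)
        · have : (e + 1) * I.m ≤ e' * I.m := Nat.mul_le_mul_right _ hlt
          exact .inr (by omega)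
    refine ⟨ht, k1.congr (by simp) rfl rfl, ?_, fun φ y hy => ?_, fun e' he' => ?_,
      fun e' he' hle => ?_⟩
    · simp only [ireg_setI, Nat.reduceEqDiff, if_false, k2, h2, sum_range_succ, add_assoc]
    · rw [kinkSum_congr (τ := ω.setI 2 (e + 1)) (σ := ω) (by simp) rfl rfl rfl, k3 φ y hy, h3 φ y hy,
        sum_range_succ, add_assoc]
    · rcases Nat.lt_succ_iff_lt_or_eq.1 he' with he' | rfl
      · exact keep e' _ he'.ne (h4 e' he')
      · exact k4
    · exact keep e' _ (by omega) (h5 e' he' (by omega))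
  · rintro t υ hυ ⟨⟨h1, h2, h3, h4, -⟩, -, ht⟩
    refine ⟨?_, h1, h2, h3, h4⟩
    have hsum : ∑ e ∈ Ico 0 I.m, (22 * I.m + 8 + 10 * flipCount I C r e 0 (st I.m) + 2) =
        22 * I.m ^ 2 + 10 * I.m + 10 * flipTotal I st C r := by
      rw [Nat.Ico_zero_eq_range, flipTotal, mul_sum, sum_add_distrib, sum_add_distrib]
      simp
      ring
    have : I.m ≤ I.m ^ 2 := Nat.le_self_pow (by norm_num) _
    omega

end RAMLang

namespace RAMLang

open RealRAM Finset

variable {I : Inst} {st : ℕ → ℕ} {pt C : ℕ → ℝ}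

/-! ### The minimum over one edge -/

/-- The lines in the arrays `10`, `11` are the regret functions just after the point `r`, for the
slopes in array `19`. -/
structure Lines (I : Inst) (st : ℕ → ℕ) (pt C : ℕ → ℝ) (r : ℕ) (σ : State) : Prop where
  slope : ∀ y < st I.m, σ.rarr 10 y = -∑ e ∈ range I.m, wt I C r e y * σ.rarr 19 e
  icpt : ∀ y < st I.m, σ.rarr 11 y = ∑ e ∈ range I.m,
    wt I C r e y * (C (y * I.m + e) - C (r * I.m + e) + σ.rarr 19 e * pt r)

/-- Puts into `rreg 14` the change of the slope of the cover value of the edge `ireg 2` at the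
point `ireg 14`. -/
def slopeRegs : Cmd :=
  .rset 10 (.ld 8 (.add (.ld 5 (.reg 14)) (.reg 2))) ;;
  .rset 12 (.div (.sub (.ld 8 (.add (.ld 5 (.add (.reg 14) (.lit 1))) (.reg 2))) (.reg 10))
    (.sub (.ld 0 (.add (.reg 14) (.lit 1))) (.ld 0 (.reg 14)))) ;;
  .rset 13 (.ld 0 (.reg 14)) ;; .rset 14 (.sub (.reg 12) (.ld 19 (.reg 2))) ;;
  .rst 19 (.reg 2) (.reg 12)

/-- Turns the line number `ireg 12` at the point `ireg 14`. -/
def turnLine : Cmd :=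
  .ite (.rle (.reg 10) (.ld 8 (.add (.ld 5 (.reg 12)) (.reg 2)))) (.rset 15 (.ld 5 (.reg 2)))
    (.rset 15 (.ld 4 (.reg 2))) ;;
  .rst 10 (.reg 12) (.sub (.ld 10 (.reg 12)) (.mul (.reg 15) (.reg 14))) ;;
  .rst 11 (.reg 12) (.add (.ld 11 (.reg 12)) (.mul (.mul (.reg 15) (.reg 14)) (.reg 13)))

def turnEdge : Cmd :=
  slopeRegs ;; .ite (.and (.rle (.reg 14) (.lit 0)) (.rle (.lit 0) (.reg 14))) .skip
    (.iset 12 (.lit 0) ;; forTo 12 (.reg 8) turnLine)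

theorem run_slopeRegs {σ : State} {r e : ℕ} (hσ : HasKeys I st pt σ) (hr : r + 1 < st I.m)
    (h8 : σ.rarr 8 = C) (h2 : σ.ireg 2 = e) (h14 : σ.ireg 14 = r) :
    Run slopeRegs σ fun t τ => t = 5 ∧ τ.rreg 10 = C (r * I.m + e) ∧ τ.rreg 13 = pt r ∧
      τ.rreg 14 = slope I pt C r e - σ.rarr 19 e ∧
      τ.rarr 19 = Function.update (σ.rarr 19) e (slope I pt C r e) := by
  have e5 : σ.iarr 5 r = r * I.m := hσ.offY r (by omega)
  have e5' : σ.iarr 5 (r + 1) = (r + 1) * I.m := hσ.offY (r + 1) hr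
  simp [slopeRegs, h2, h14, hσ.ra0, e5, e5', h8, slope]

theorem run_turnEdge {σ : State} {r e : ℕ} (hσ : HasKeys I st pt σ) (hr : r + 1 < st I.m)
    (he : e < I.m) (h8 : σ.rarr 8 = C) (h2 : σ.ireg 2 = e) (h14 : σ.ireg 14 = r)
    (hl : Lines I st pt C r σ) :
    Run turnEdge σ fun t τ => t ≤ 6 + (6 * st I.m + 2) * (open Classical in
        if slope I pt C r e = σ.rarr 19 e then 0 else 1) ∧ Lines I st pt C r τ ∧
      τ.rarr 19 = Function.update (σ.rarr 19) e (slope I pt C r e) := by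
  classical
  rw [turnEdge]
  refine (run_slopeRegs hσ hr h8 h2 h14).seq ?_
  rintro _ τ hτ ⟨rfl, h10, h13, h14', h19⟩
  set p := slope I pt C r e with hp
  set d := p - σ.rarr 19 e with hd
  have hτk := hσ.frame hτ rfl rfl rfl rfl rfl
  have a10 : τ.rarr 10 = σ.rarr 10 := hτ.ra 10 rfl
  have a11 : τ.rarr 11 = σ.rarr 11 := hτ.ra 11 rfl
  have a8 : τ.rarr 8 = C := (hτ.ra 8 rfl).trans h8
  have e2 : τ.ireg 2 = e := (hτ.ir 2 rfl).trans h2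
  have hmain : ∀ υ : State, υ.rarr 19 = τ.rarr 19 →
      (∀ y < st I.m, υ.rarr 10 y = σ.rarr 10 y - wt I C r e y * d) →
      (∀ y < st I.m, υ.rarr 11 y = σ.rarr 11 y + wt I C r e y * d * pt r) →
      Lines I st pt C r υ := by
    intro υ u1 u2 u3
    have hupd : ∀ e', υ.rarr 19 e' = σ.rarr 19 e' + if e' = e then d else 0 := fun e' => by
      rw [u1, h19, Function.update_apply]
      split_ifs with h
      · rw [h, hd]; ring
      · ring
    have hs : ∀ f : ℕ → ℝ, ∑ e' ∈ range I.m, f e' * (if e' = e then d else 0) = f e * d := fun f => by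
      simp [he]
    refine ⟨fun y hy => ?_, fun y hy => ?_⟩
    · rw [u2 y hy, hl.slope y hy, ← hs fun e' => wt I C r e' y]
      simp only [hupd, mul_add, sum_add_distrib]
      ring
    · rw [u3 y hy, hl.icpt y hy, ← hs fun e' => wt I C r e' y, sum_mul, ← sum_add_distrib]
      refine sum_congr rfl fun e' _ => ?_
      rw [hupd]
      ring
  rw [run_ite]
  constructor
  · intro hz
    simp only [BE.eval, RE.eval, h14', Int.cast_zero] at hz
    have hd0 : d = 0 := le_antisymm hz.1 hz.2
    rw [run_skip]
    refine ⟨by omega, hmain τ rfl (fun y _ => ?_) fun y _ => ?_, h19⟩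
    · rw [a10, hd0]; ring
    · rw [a11, hd0]; ring
  · intro hz
    simp only [BE.eval, RE.eval, h14', Int.cast_zero] at hz
    have hne : ¬ p = σ.rarr 19 e := fun h => hz (by rw [hd, h, sub_self]; exact ⟨le_rfl, le_rfl⟩)
    have hτ0 := hτk.setI (d := 12) (v := 0) (by decide) (by decide) (by decide)
    rw [run_seq, run_iset]
    refine (Run.forTo' (a := 0) (n := st I.m) (fun k υ =>
      (∀ y < k, υ.rarr 10 y = σ.rarr 10 y - wt I C r e y * d) ∧
      (∀ y < k, υ.rarr 11 y = σ.rarr 11 y + wt I C r e y * d * pt r) ∧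
      ∀ y, k ≤ y → υ.rarr 10 y = σ.rarr 10 y ∧ υ.rarr 11 y = σ.rarr 11 y) 4 (by simp)
      (Nat.zero_le _) (fun υ hυ => by simpa [hτk.i8] using hυ.ir 8 rfl) rfl (by simp [a10, a11])
      ?_).mono ?_
    · rintro y υ - hy hυ hυy ⟨h3, h4, h5⟩
      have hυk := hτ0.frame hυ rfl rfl rfl rfl rfl
      have f8 : υ.rarr 8 = C := (hυ.ra 8 rfl).trans a8
      have f2 : υ.ireg 2 = e := by simpa [e2] using hυ.ir 2 rfl
      have g10 : υ.rreg 10 = C (r * I.m + e) := (hυ.rr 10 rfl).trans h10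
      have g13 : υ.rreg 13 = pt r := (hυ.rr 13 rfl).trans h13
      have g14 : υ.rreg 14 = d := (hυ.rr 14 rfl).trans h14'
      have hrun : Run turnLine υ fun t ω => t = 4 ∧
          ω.rarr 10 = Function.update (υ.rarr 10) y (σ.rarr 10 y - wt I C r e y * d) ∧
          ω.rarr 11 = Function.update (υ.rarr 11) y (σ.rarr 11 y + wt I C r e y * d * pt r) := by
        simp only [turnLine, run_seq, run_ite, run_rset, run_rst, wt]
        constructor <;> intro hc <;>
          simp [BE.eval, IE.eval, RE.eval, g10, f8, f2, hυy, hυk.offY y hy] at hc <;>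
          simp [hυy, f2, hυk.ub, hυk.lb, g14, g13, h5 y le_rfl, hc]
        simp [not_le.2 hc]
      refine hrun.mono ?_
      rintro t ω hω ⟨rfl, k1, k2⟩
      refine ⟨le_rfl, fun z hz => ?_, fun z hz => ?_, fun z hz => ?_⟩
      · simp only [rarr_setI, k1]
        rcases Nat.lt_succ_iff_lt_or_eq.1 hz with hz | rfl
        · rw [Function.update_of_ne hz.ne, h3 z hz]
        · rw [Function.update_self]
      · simp only [rarr_setI, k2]
        rcases Nat.lt_succ_iff_lt_or_eq.1 hz with hz | rfl
        · rw [Function.update_of_ne hz.ne, h4 z hz]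
        · rw [Function.update_self]
      · simp only [rarr_setI, k1, k2]
        rw [Function.update_of_ne (by omega), Function.update_of_ne (by omega)]
        exact h5 z (by omega)
    · rintro t υ hυ ⟨⟨h3, h4, -⟩, -, ht⟩
      have u19 : υ.rarr 19 = τ.rarr 19 := hυ.ra 19 rfl
      refine ⟨?_, hmain υ u19 h3 h4, u19.trans h19⟩
      rw [if_neg hne]
      omega

/-- Brings the lines and slopes up to date for the interval after the point `ireg 14`. -/
def turn : Cmd := .iset 2 (.lit 0) ;; forTo 2 (.reg 1) turnEdge

open Classical in
noncomputable def changeCount (I : Inst) (pt C : ℕ → ℝ) (s r : ℕ) : ℕ :=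
  ∑ e ∈ range I.m, if slope I pt C r e = prevSlope I pt C s r e then 0 else 1

theorem run_turn {σ : State} {s r : ℕ} (hσ : HasKeys I st pt σ) (hr : r + 1 < st I.m)
    (h8 : σ.rarr 8 = C) (h14 : σ.ireg 14 = r) (hl : Lines I st pt C r σ)
    (h19 : ∀ e < I.m, σ.rarr 19 e = prevSlope I pt C s r e) :
    Run turn σ fun t τ => t ≤ 8 * I.m + 2 + (6 * st I.m + 2) * changeCount I pt C s r ∧
      Lines I st pt C r τ ∧ ∀ e < I.m, τ.rarr 19 e = slope I pt C r e := by
  classical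
  rw [turn, run_seq, run_iset]
  have hσ0 := hσ.setI (d := 2) (v := 0) (by decide) (by decide) (by decide)
  refine (Run.forTo (a := 0) (n := I.m) (fun k υ => Lines I st pt C r υ ∧
    (∀ e < k, υ.rarr 19 e = slope I pt C r e) ∧
    ∀ e < I.m, k ≤ e → υ.rarr 19 e = prevSlope I pt C s r e)
    (fun e => 6 + (6 * st I.m + 2) * if slope I pt C r e = prevSlope I pt C s r e then 0 else 1)
    (by simp) (Nat.zero_le _) (fun υ hυ => by simpa [hσ.m] using hυ.ir 1 rfl) rfl
    ?_ ?_).mono ?_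
  · exact ⟨⟨hl.slope, hl.icpt⟩, by simp, fun e he _ => h19 e he⟩
  · rintro e υ - he hυ hυe ⟨h1, h2, h3⟩
    refine (run_turnEdge (hσ0.frame hυ rfl rfl rfl rfl rfl) hr he ((hυ.ra 8 rfl).trans h8) hυe
      (by simpa [h14] using hυ.ir 14 rfl) h1).mono ?_
    rintro t ω hω ⟨ht, k1, k2⟩
    rw [h3 e he le_rfl] at ht
    refine ⟨?_, ⟨k1.slope, k1.icpt⟩, fun e' he' => ?_, fun e' he' hle => ?_⟩
    · convert ht
    · simp only [rarr_setI, k2]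
      rcases Nat.lt_succ_iff_lt_or_eq.1 he' with he' | rfl
      · rw [Function.update_of_ne he'.ne]; exact h2 e' he'
      · rw [Function.update_self]
    · simp only [rarr_setI, k2]
      rw [Function.update_of_ne (by omega)]
      exact h3 e' he' (by omega)
  · rintro t υ - ⟨⟨h1, h2, -⟩, -, ht⟩
    refine ⟨?_, h1, h2⟩
    simp only [sum_add_distrib, ← mul_sum, Nat.Ico_zero_eq_range] at ht
    simp only [sum_const, card_range, smul_eq_mul] at ht
    rw [changeCount]
    omega

/-- Hands the lines over to `minMax`. -/
def copyLines : Cmd :=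
  .iset 12 (.lit 0) ;; forTo 12 (.reg 8) (.rst 12 (.reg 12) (.ld 10 (.reg 12)) ;;
    .rst 13 (.reg 12) (.ld 11 (.reg 12)) ;; .ist 9 (.reg 12) (.reg 12)) ;;
  .iset 42 (.reg 8) ;; .iset 43 (.lit 0)

theorem run_copyLines {σ : State} {N : ℕ} (h8 : σ.ireg 8 = N) :
    Run copyLines σ fun t τ => t ≤ 5 * N + 4 ∧ Balanced N τ ∧ τ.ireg 42 = N ∧ τ.ireg 43 = 0 ∧
      ∀ y < N, τ.rarr 12 y = σ.rarr 10 y ∧ τ.rarr 13 y = σ.rarr 11 y ∧ τ.iarr 9 y = y := by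
  rw [copyLines, run_seq, run_iset]
  refine (Run.forTo' (a := 0) (n := N) (fun k υ => ∀ y < k, υ.rarr 12 y = σ.rarr 10 y ∧
    υ.rarr 13 y = σ.rarr 11 y ∧ υ.iarr 9 y = y) 3 (by simp) (Nat.zero_le _)
    (fun υ hυ => by simpa [h8] using hυ.ir 8 rfl) rfl (by simp) ?_).seq ?_
  · rintro k υ - hk hυ hυk h1
    have a10 : υ.rarr 10 = σ.rarr 10 := hυ.ra 10 rfl
    have a11 : υ.rarr 11 = σ.rarr 11 := hυ.ra 11 rfl
    simp [hυk, a10, a11, -Order.lt_add_one_iff]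
    intro y hy
    rcases Nat.lt_succ_iff_lt_or_eq.1 hy with hy | rfl
    · simp only [Function.update_of_ne hy.ne]; exact h1 y hy
    · simp
  · rintro t υ hυ ⟨h1, -, ht⟩
    have a10 : υ.rarr 10 = σ.rarr 10 := hυ.ra 10 rfl
    have a11 : υ.rarr 11 = σ.rarr 11 := hυ.ra 11 rfl
    have i8 : υ.ireg 8 = N := by simpa [h8] using hυ.ir 8 rfl
    simp only [run_seq, run_iset, IE.eval, ireg_setI, rarr_setI, iarr_setI, Nat.reduceEqDiff,
      if_true, if_false, i8]
    refine ⟨by omega, ⟨by simp, fun y hy => ?_, fun y hy => ?_⟩, trivial, trivial, h1⟩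
    · simp [kinkSum, a10, (h1 y hy).1]
    · simp [kinkSum, a11, (h1 y hy).2.1]

theorem Table.regAt_eq_line (h : Table I st pt C) {x r y : ℕ} (hx : x < I.m) (hr : st x ≤ r)
    (hr' : r + 1 < st (x + 1)) {t : ℝ} (ht : t ∈ Set.Icc (pt r) (pt (r + 1))) :
    regAt I C x t y = (-∑ e ∈ range I.m, wt I C r e y * slope I pt C r e) * t +
      (∑ e ∈ range I.m, wt I C r e y *
        (C (y * I.m + e) - C (r * I.m + e) + slope I pt C r e * pt r)) +
      ∑ e ∈ range I.m, flipGain I pt C r e (fun a d => d * max 0 (t - a)) y := by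
  rw [regAt, ← sum_neg_distrib, sum_mul, ← sum_add_distrib, ← sum_add_distrib]
  exact sum_congr rfl fun e he => h.psi_eq hx (mem_range.1 he) hr hr' ht

theorem Table.lines_succ (h : Table I st pt C) {x r y : ℕ} (hx : x < I.m) (hr : st x ≤ r)
    (hr' : r + 1 < st (x + 1)) :
    -∑ e ∈ range I.m, wt I C (r + 1) e y * slope I pt C r e =
      -(∑ e ∈ range I.m, wt I C r e y * slope I pt C r e) +
        ∑ e ∈ range I.m, flipGain I pt C r e (fun _ d => d) y ∧
    ∑ e ∈ range I.m, wt I C (r + 1) e y *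
        (C (y * I.m + e) - C ((r + 1) * I.m + e) + slope I pt C r e * pt (r + 1)) =
      ∑ e ∈ range I.m, wt I C r e y *
        (C (y * I.m + e) - C (r * I.m + e) + slope I pt C r e * pt r) -
        ∑ e ∈ range I.m, flipGain I pt C r e (fun a d => d * a) y := by
  constructor
  · rw [← sum_neg_distrib, ← sum_neg_distrib, ← sum_add_distrib]
    refine sum_congr rfl fun e he => ?_
    rw [(h.wt_succ_mul hx hr hr').1, flipGain]
    ring
  · rw [← sum_sub_distrib]
    exact sum_congr rfl fun e he => (h.wt_succ_mul hx hr hr').2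

/-- `s` minimizes the maximal regret `v` on the part of the edge `x` between `a` and `b`. -/
structure BestOn (I : Inst) (N : ℕ) (C : ℕ → ℝ) (x : ℕ) (a b s v : ℝ) : Prop where
  mem : s ∈ Set.Icc a b
  le : ∀ y < N, regAt I C x s y ≤ v
  min : ∀ t ∈ Set.Icc a b, ∀ z, (∀ y < N, regAt I C x t y ≤ z) → v ≤ z

/-- The state of the sweep along the edge `x`, at the point `r`. -/
structure Sweep (I : Inst) (st : ℕ → ℕ) (pt C : ℕ → ℝ) (x r : ℕ) (σ : State) : Prop where
  lines : Lines I st pt C r σ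
  slopes : ∀ e < I.m, σ.rarr 19 e = prevSlope I pt C (st x) r e
  ptr : ∀ e < I.m, PtrAt I st σ r e

/-- Keeps the better one of two minima on the edge `ireg 7`. -/
def keepBest : Cmd :=
  .ite (.or (.ile (.reg 14) (.ld 0 (.reg 7))) (.rlt (.reg 48) (.ld 2 (.reg 7))))
    (.rst 1 (.reg 7) (.reg 47) ;; .rst 2 (.reg 7) (.reg 48)) .skip

/-- Treats the interval after the point `ireg 14` of the edge `ireg 7`. -/
def interval : Cmd :=
  turn ;; copyLines ;; flips ;; .rset 40 (.ld 0 (.reg 14)) ;;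
  .rset 41 (.ld 0 (.add (.reg 14) (.lit 1))) ;; minMax ;; keepBest

theorem run_keepBest {σ : State} {x r N : ℕ} {a b c : ℝ} (h0 : σ.iarr 0 = st) (h7 : σ.ireg 7 = x)
    (h14 : σ.ireg 14 = r) (hr : st x ≤ r) (hab : a ≤ b) (hbc : b ≤ c)
    (hold : st x < r → BestOn I N C x a b (σ.rarr 1 x) (σ.rarr 2 x)) (hra : r = st x → a = b)
    (hnew : BestOn I N C x b c (σ.rreg 47) (σ.rreg 48)) :
    Run keepBest σ fun t τ => t ≤ 3 ∧ BestOn I N C x a c (τ.rarr 1 x) (τ.rarr 2 x) ∧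
      ∀ x', x' ≠ x → τ.rarr 1 x' = σ.rarr 1 x' ∧ τ.rarr 2 x' = σ.rarr 2 x' := by
  simp only [keepBest, run_ite, run_seq, run_rst, run_skip, BE.eval, IE.eval, RE.eval, h0, h7, h14]
  constructor
  · intro hc
    refine ⟨by omega, ?_, fun x' hx' => by simp [hx', h7]⟩
    simp only [rarr_setRA, rreg_setRA, ireg_setRA, h7, Nat.reduceEqDiff, if_true, if_false,
      Function.update_self, OfNat.one_ne_ofNat]
    refine ⟨⟨hab.trans hnew.mem.1, hnew.mem.2⟩, hnew.le, fun t ht z hz => ?_⟩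
    by_cases htb : b ≤ t
    · exact hnew.min t ⟨htb, ht.2⟩ z hz
    · rcases hc with hc | hc
      · have := hra (by omega)
        exact absurd (this ▸ ht.1) htb
      · by_cases hrx : r = st x
        · exact absurd (hra hrx ▸ ht.1) htb
        · exact hc.le.trans ((hold (by omega)).min t ⟨ht.1, (not_le.1 htb).le⟩ z hz)
  · intro hc
    push Not at hc
    have ho := hold hc.1
    refine ⟨by omega, ⟨⟨ho.mem.1, ho.mem.2.trans hbc⟩, ho.le, fun t ht z hz => ?_⟩, by simp⟩
    by_cases htb : t ≤ b
    · exact ho.min t ⟨ht.1, htb⟩ z hz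
    · exact hc.2.trans (hnew.min t ⟨(not_le.1 htb).le, ht.2⟩ z hz)

theorem run_interval {σ : State} {x r : ℕ} (hI : I.Good) (hp : Pts I st pt)
    (hσ : HasKeys I st pt σ) (hx : x < I.m) (hr : st x ≤ r) (hr' : r + 1 < st (x + 1))
    (h8 : σ.rarr 8 = C) (h7 : σ.ireg 7 = x) (h14 : σ.ireg 14 = r) (hs : Sweep I st pt C x r σ)
    (hold : st x < r → BestOn I (st I.m) C x (pt (st x)) (pt r) (σ.rarr 1 x) (σ.rarr 2 x)) :
    Run interval σ fun t τ => t ≤ 30500 * I.m ^ 2 + 3040 * flipTotal I st C r +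
        10 * st I.m * changeCount I pt C (st x) r ∧ Sweep I st pt C x (r + 1) τ ∧
      BestOn I (st I.m) C x (pt (st x)) (pt (r + 1)) (τ.rarr 1 x) (τ.rarr 2 x) ∧
      ∀ x', x' ≠ x → τ.rarr 1 x' = σ.rarr 1 x' ∧ τ.rarr 2 x' = σ.rarr 2 x' := by
  have hT : Table I st pt C := h8 ▸ hσ.table hI hp
  have hrP : r + 1 < st I.m := hp.lt_total hx hr'
  rw [interval]
  refine (run_turn hσ hrP h8 h14 hs.lines hs.slopes).seq ?_
  rintro t₁ σ₁ hf₁ ⟨ht₁, hl₁, hsl₁⟩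
  have hk₁ := hσ.frame hf₁ rfl rfl rfl rfl rfl
  refine (run_copyLines hk₁.i8).seq ?_
  rintro t₂ σ₂ hf₂ ⟨ht₂, hb₂, h42₂, h43₂, hc₂⟩
  have hk₂ := hk₁.frame hf₂ rfl rfl rfl rfl rfl
  have h19₂ : ∀ e < I.m, σ₂.rarr 19 e = slope I pt C r e := by rw [hf₂.ra 19 rfl]; exact hsl₁
  have h8₂ : σ₂.rarr 8 = C := (hf₂.ra 8 rfl).trans ((hf₁.ra 8 rfl).trans h8)
  have h14₂ : σ₂.ireg 14 = r := (hf₂.ir 14 rfl).trans ((hf₁.ir 14 rfl).trans h14)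
  have hptr₂ : ∀ e < I.m, PtrAt I st σ₂ r e := fun e he => by
    have := hs.ptr e he
    rw [PtrAt] at this ⊢
    rwa [hf₂.ra 9 rfl, hf₂.ra 8 rfl, hf₂.ia 8 rfl, hf₁.ra 9 rfl, hf₁.ra 8 rfl, hf₁.ia 8 rfl]
  refine (run_flips hI hp hk₂ hrP h8₂ h14₂ h19₂ hb₂ hptr₂).seq ?_
  rintro t₃ σ₃ hf₃ ⟨ht₃, hb₃, h43₃, hks₃, hptr₃⟩
  have hk₃ := hk₂.frame hf₃ rfl rfl rfl rfl rfl
  have h14₃ : σ₃.ireg 14 = r := (hf₃.ir 14 rfl).trans h14₂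
  have h42₃ : σ₃.ireg 42 = st I.m := (hf₃.ir 42 rfl).trans h42₂
  have h19₃ : ∀ e < I.m, σ₃.rarr 19 e = slope I pt C r e := by rw [hf₃.ra 19 rfl]; exact h19₂
  have h9₃ : ∀ y < st I.m, σ₃.iarr 9 y = y := by
    rw [hf₃.ia 9 rfl]; exact fun y hy => (hc₂ y hy).2.2
  have hks0 : ∀ φ y, kinkSum σ₂ φ y = 0 := fun φ y => by simp [kinkSum, h43₂]
  have h12₃ : ∀ y < st I.m, σ₃.rarr 12 y =
      -∑ e ∈ range I.m, wt I C r e y * slope I pt C r e := fun y hy => by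
    rw [hf₃.ra 12 rfl, (hc₂ y hy).1, hl₁.slope y hy]
    exact congrArg _ (sum_congr rfl fun e he => by rw [hsl₁ e (mem_range.1 he)])
  have h13₃ : ∀ y < st I.m, σ₃.rarr 13 y = ∑ e ∈ range I.m, wt I C r e y *
      (C (y * I.m + e) - C (r * I.m + e) + slope I pt C r e * pt r) := fun y hy => by
    rw [hf₃.ra 13 rfl, (hc₂ y hy).2.1, hl₁.icpt y hy]
    exact sum_congr rfl fun e he => by rw [hsl₁ e (mem_range.1 he)]
  have hfn : ∀ y < st I.m, ∀ t ∈ Set.Icc (pt r) (pt (r + 1)), fnVal σ₃ y t = regAt I C x t y := by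
    intro y hy t ht
    have := hks₃ (fun a d => d * max 0 (t - a)) y hy
    rw [hks0, zero_add] at this
    rw [hT.regAt_eq_line hx hr hr' ht, ← this, ← h12₃ y hy, ← h13₃ y hy]
    rfl
  have hlt : pt r < pt (r + 1) := (hp.lists x hx).1 r (r + 1) hr (by omega) hr'
  have hepi : ∀ t ∈ Set.Icc (pt r) (pt (r + 1)), ∀ z,
      Epi σ₃ t z ↔ ∀ y < st I.m, regAt I C x t y ≤ z := by
    intro t ht z
    rw [Epi, h42₃]
    refine forall₂_congr fun y hy => ?_
    rw [h9₃ y hy, hfn y hy t ht]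
  rw [run_seq, run_rset, run_seq, run_rset]
  set σ₄ := (σ₃.setR 40 ((RE.ld 0 (.reg 14)).eval σ₃)).setR 41
    ((RE.ld 0 (.add (.reg 14) (.lit 1))).eval (σ₃.setR 40 ((RE.ld 0 (.reg 14)).eval σ₃))) with hσ₄
  have r40 : σ₄.rreg 40 = pt r := by simp [hσ₄, hk₃.ra0, h14₃]
  have r41 : σ₄.rreg 41 = pt (r + 1) := by simp [hσ₄, hk₃.ra0, h14₃]
  have hw₄ : WellFormed σ₄ := by
    refine ⟨?_, fun q hq q' hq' heq => ?_, hb₃.nonneg⟩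
    · simp only [hσ₄, ireg_setR, h42₃]; omega
    · simp only [hσ₄, ireg_setR, h42₃, iarr_setR] at hq hq' heq
      rwa [h9₃ q hq, h9₃ q' hq'] at heq
  refine (run_minMax hw₄ (by rw [r40, r41]; exact hlt.le)).seq ?_
  rintro t₅ σ₅ hf₅ ⟨ht₅, hlo, hhi, hE, hmin⟩
  rw [r40] at hlo hmin
  rw [r41] at hhi hmin
  have hnew : BestOn I (st I.m) C x (pt r) (pt (r + 1)) (σ₅.rreg 47) (σ₅.rreg 48) :=
    ⟨⟨hlo, hhi⟩, (hepi _ ⟨hlo, hhi⟩ _).1 hE, fun t ht z hz => hmin t z ht.1 ht.2 ((hepi t ht z).2 hz)⟩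
  have ra : ∀ k, (turn.wRA k || copyLines.wRA k || flips.wRA k || minMax.wRA k) = false →
      σ₅.rarr k = σ.rarr k := fun k hk => by
    simp only [Bool.or_eq_false_iff] at hk
    obtain ⟨⟨⟨k1, k2⟩, k3⟩, k4⟩ := hk
    exact (hf₅.ra k k4).trans ((hf₃.ra k k3).trans ((hf₂.ra k k2).trans (hf₁.ra k k1)))
  have h7₅ : σ₅.ireg 7 = x := (hf₅.ir 7 rfl).trans ((hf₃.ir 7 rfl).trans
    ((hf₂.ir 7 rfl).trans ((hf₁.ir 7 rfl).trans h7)))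
  have hmono : pt (st x) ≤ pt r := by
    rcases eq_or_lt_of_le hr with rfl | h
    · exact le_rfl
    · exact ((hp.lists x hx).1 _ _ le_rfl h (by omega)).le
  refine (run_keepBest (st := st) ((hf₅.ia 0 rfl).trans hk₃.ia0) h7₅ ((hf₅.ir 14 rfl).trans h14₃) hr
    hmono hlt.le (fun h => by rw [ra 1 rfl, ra 2 rfl]; exact hold h) (fun h => by rw [h]) hnew).mono ?_
  rintro t₆ σ₆ hf₆ ⟨ht₆, hbest, hother⟩
  refine ⟨?_, ⟨⟨fun y hy => ?_, fun y hy => ?_⟩, fun e he => ?_, fun e he => ?_⟩, hbest,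
    fun x' hx' => ?_⟩
  · have e43 : σ₄.ireg 43 = flipTotal I st C r := by
      simp only [hσ₄, ireg_setR, h43₃, h43₂, zero_add]
    have e42 : σ₄.ireg 42 = st I.m := h42₃
    rw [e42, e43] at ht₅
    have b1 := hp.total_le
    have b2 : I.m ≤ I.m ^ 2 := Nat.le_self_pow (by norm_num) _
    have b3 : 1 ≤ I.m ^ 2 := Nat.one_le_pow _ _ hI.m_pos
    have b4 : (6 * st I.m + 2) * changeCount I pt C (st x) r ≤
        10 * st I.m * changeCount I pt C (st x) r := Nat.mul_le_mul_right _ (by omega)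
    omega
  · rw [hf₆.ra 10 rfl, hf₆.ra 19 rfl, hf₅.ra 10 rfl, hf₅.ra 19 rfl]
    have := hb₃.slope y hy
    rw [hks₃ _ y hy, hks0, zero_add, h12₃ y hy, ← (hT.lines_succ hx hr hr').1] at this
    refine Eq.trans this (congrArg _ (sum_congr rfl fun e he => ?_))
    rw [← h19₃ e (mem_range.1 he)]; rfl
  · rw [hf₆.ra 11 rfl, hf₆.ra 19 rfl, hf₅.ra 11 rfl, hf₅.ra 19 rfl]
    have := hb₃.icpt y hy
    rw [hks₃ _ y hy, hks0, zero_add, h13₃ y hy, ← (hT.lines_succ hx hr hr').2] at this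
    refine Eq.trans this (sum_congr rfl fun e he => ?_)
    rw [← h19₃ e (mem_range.1 he)]; rfl
  · rw [hf₆.ra 19 rfl, hf₅.ra 19 rfl, prevSlope, if_neg (by omega), Nat.add_sub_cancel]
    exact h19₃ e he
  · have := hptr₃ e he
    rw [PtrAt] at this ⊢
    rw [hf₆.ra 9 rfl, hf₆.ra 8 rfl, hf₆.ia 8 rfl, hf₅.ra 9 rfl, hf₅.ra 8 rfl, hf₅.ia 8 rfl]
    exact this
  · rw [(hother x' hx').1, (hother x' hx').2, ra 1 rfl, ra 2 rfl]
    exact ⟨rfl, rfl⟩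

/-- Sets the pointer of the block `ireg 15`. -/
def initBlock : Cmd :=
  (.iset 49 (.add (.ld 5 (.reg 2)) (.reg 15)) ;; .iset 18 (.add (.reg 13) (.ld 0 (.reg 15))) ;;
  .iset 17 (.reg 18) ;; .iset 19 (.add (.reg 13) (.ld 0 (.add (.reg 15) (.lit 1))))) ;; movePtr ;;
  .ist 8 (.reg 49) (.reg 17)

theorem run_initBlock {σ : State} {r e b : ℕ} (hp : Pts I st pt) (hσ : HasKeys I st pt σ)
    (he : e < I.m) (hb : b < I.m) (h2 : σ.ireg 2 = e) (h13 : σ.ireg 13 = e * st I.m)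
    (h15 : σ.ireg 15 = b) (h11 : σ.rreg 11 = σ.rarr 8 (r * I.m + e)) :
    Run initBlock σ fun t τ => t ≤ 20 * I.m + 7 ∧
      ∃ p, τ.iarr 8 = Function.update (σ.iarr 8) (e * I.m + b) p ∧ Cut (σ.rarr 9)
        (e * st I.m + st b) (e * st I.m + st (b + 1)) p (σ.rarr 8 (r * I.m + e)) := by
  have e5 : σ.iarr 5 e = e * I.m := hσ.offY e (by have := hp.le_total le_rfl; omega)
  rw [initBlock]
  refine Run.seq (Q := fun t τ => t = 4 ∧ τ.ireg 49 = e * I.m + b ∧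
    τ.ireg 17 = e * st I.m + st b ∧ τ.ireg 18 = e * st I.m + st b ∧
    τ.ireg 19 = e * st I.m + st (b + 1)) (by simp [h2, h13, h15, e5, hσ.ia0]) ?_
  rintro _ τ hτ ⟨rfl, h49, h17, h18, h19⟩
  have hlt := hp.lt b hb
  have hle := hp.le b hb
  refine (run_movePtr h17 h18 h19 ((hτ.rr 11 rfl).trans h11) (hτ.ra 9 rfl)
    ((hσ.row e he).sorted b hb) le_rfl (by omega)).seq ?_
  rintro t υ hυ ⟨ht, hcut⟩
  have e49 : υ.ireg 49 = e * I.m + b := (hυ.ir 49 rfl).trans h49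
  have l1 := hcut.lo_le
  have l2 := hcut.le_hi
  rw [run_ist]
  refine ⟨by omega, υ.ireg 17, ?_, hcut⟩
  simp [e49]
  rw [hυ.ia 8 rfl, hτ.ia 8 rfl]

/-- Sets the slope and the pointers of the edge `ireg 2` at the point `ireg 14`. -/
def initEdge : Cmd :=
  (.rst 19 (.reg 2) (.lit 0) ;; .rset 11 (.ld 8 (.add (.ld 5 (.reg 14)) (.reg 2))) ;;
  .iset 13 (.ld 6 (.reg 2)) ;; .iset 15 (.lit 0)) ;; forTo 15 (.reg 1) initBlock

theorem run_initEdge {σ : State} {r e : ℕ} (hp : Pts I st pt) (hσ : HasKeys I st pt σ)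
    (he : e < I.m) (hr : r < st I.m) (h2 : σ.ireg 2 = e) (h14 : σ.ireg 14 = r) :
    Run initEdge σ fun t τ => t ≤ 34 * I.m ^ 2 ∧ τ.rarr 19 = Function.update (σ.rarr 19) e 0 ∧
      PtrAt I st τ r e ∧ ∀ q, q < e * I.m ∨ (e + 1) * I.m ≤ q → τ.iarr 8 q = σ.iarr 8 q := by
  have e5 : σ.iarr 5 r = r * I.m := hσ.offY r hr
  rw [initEdge]
  refine Run.seq (Q := fun t τ => t = 4 ∧ τ.rarr 19 = Function.update (σ.rarr 19) e 0 ∧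
    τ.rreg 11 = σ.rarr 8 (r * I.m + e) ∧ τ.ireg 13 = e * st I.m ∧ τ.ireg 15 = 0)
    (by simp [h2, h14, e5, hσ.offE e he]) ?_
  rintro _ τ hτ ⟨rfl, h19, h11, h13, h15⟩
  have hτk := hσ.frame hτ rfl rfl rfl rfl rfl
  have e2 : τ.ireg 2 = e := (hτ.ir 2 rfl).trans h2
  refine (Run.forTo' (a := 0) (n := I.m) (fun k υ =>
    (∀ b < k, Cut (σ.rarr 9) (e * st I.m + st b) (e * st I.m + st (b + 1)) (υ.iarr 8 (e * I.m + b))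
      (σ.rarr 8 (r * I.m + e))) ∧
    ∀ q, q < e * I.m ∨ e * I.m + k ≤ q → υ.iarr 8 q = σ.iarr 8 q) (20 * I.m + 7) h15 (Nat.zero_le _)
    (fun υ hυ => by simpa using (hυ.ir 1 rfl).trans hτk.m) rfl ?_ ?_).mono ?_
  · exact ⟨by simp, fun q _ => by rw [hτ.ia 8 rfl]⟩
  · rintro b υ - hb hυ hυb ⟨h3, h4⟩
    have a8 : υ.rarr 8 = σ.rarr 8 := (hυ.ra 8 rfl).trans (hτ.ra 8 rfl)
    have a9 : υ.rarr 9 = σ.rarr 9 := (hυ.ra 9 rfl).trans (hτ.ra 9 rfl)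
    refine (run_initBlock (r := r) hp (hτk.frame hυ rfl rfl rfl rfl rfl) he hb
      ((hυ.ir 2 rfl).trans e2) ((hυ.ir 13 rfl).trans h13) hυb
      (by rw [a8]; exact (hυ.rr 11 rfl).trans h11)).mono ?_
    rintro t ω - ⟨ht, p, k1, k2⟩
    rw [a8, a9] at k2
    refine ⟨ht, fun b' hb' => ?_, fun q hq => ?_⟩
    · simp only [iarr_setI, k1]
      rcases Nat.lt_succ_iff_lt_or_eq.1 hb' with hb' | rfl
      · rw [Function.update_of_ne (by omega)]; exact h3 b' hb'
      · rw [Function.update_self]; exact k2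
    · simp only [iarr_setI, k1]
      rw [Function.update_of_ne (by omega)]
      exact h4 q (by omega)
  · rintro t υ hυ ⟨⟨h3, h4⟩, -, ht⟩
    refine ⟨?_, (hυ.ra 19 rfl).trans h19, fun b hb => ?_, fun q hq => h4 q ?_⟩
    · have b2 : I.m ≤ I.m ^ 2 := Nat.le_self_pow (by norm_num) _
      have b3 : 1 ≤ I.m ^ 2 := Nat.one_le_pow _ _ (by omega)
      have : I.m * (20 * I.m + 7 + 2) = 20 * I.m ^ 2 + 9 * I.m := by ring
      simp only [Nat.sub_zero] at ht
      omega
    · rw [hυ.ra 9 rfl, hυ.ra 8 rfl, hτ.ra 9 rfl, hτ.ra 8 rfl]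
      exact h3 b hb
    · rw [add_mul] at hq; omega

def initEdges : Cmd := .iset 2 (.lit 0) ;; forTo 2 (.reg 1) initEdge

theorem run_initEdges {σ : State} {r : ℕ} (hI : I.Good) (hp : Pts I st pt) (hσ : HasKeys I st pt σ)
    (hr : r < st I.m) (h14 : σ.ireg 14 = r) :
    Run initEdges σ fun t τ => t ≤ 38 * I.m ^ 3 ∧ (∀ e < I.m, τ.rarr 19 e = 0) ∧
      ∀ e < I.m, PtrAt I st τ r e := by
  rw [initEdges, run_seq, run_iset]
  have hσ0 := hσ.setI (d := 2) (v := 0) (by decide) (by decide) (by decide)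
  refine (Run.forTo' (a := 0) (n := I.m) (fun k υ => (∀ e < k, υ.rarr 19 e = 0) ∧
    ∀ e < k, PtrAt I st υ r e) (34 * I.m ^ 2) (by simp) (Nat.zero_le _)
    (fun υ hυ => by simpa [hσ.m] using hυ.ir 1 rfl) rfl (by simp) ?_).mono ?_
  · rintro e υ - he hυ hυe ⟨h1, h2⟩
    refine (run_initEdge hp (hσ0.frame hυ rfl rfl rfl rfl rfl) he hr hυe
      (by simpa [h14] using hυ.ir 14 rfl)).mono ?_
    rintro t ω hω ⟨ht, k1, k2, k3⟩
    refine ⟨ht, fun e' he' => ?_, fun e' he' => ?_⟩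
    · simp only [rarr_setI, k1]
      rcases Nat.lt_succ_iff_lt_or_eq.1 he' with he' | rfl
      · rw [Function.update_of_ne he'.ne]; exact h1 e' he'
      · rw [Function.update_self]
    · rcases Nat.lt_succ_iff_lt_or_eq.1 he' with he' | rfl
      · intro b hb
        have := h2 e' he' b hb
        simp only [rarr_setI, iarr_setI]
        rw [hω.ra 9 rfl, hω.ra 8 rfl, k3 _ (.inl (mul_add_lt he' hb))]
        exact this
      · exact k2
  · rintro t υ - ⟨⟨h1, h2⟩, -, ht⟩
    refine ⟨?_, h1, h2⟩
    have b4 : 1 ≤ I.m ^ 3 := Nat.one_le_pow _ _ hI.m_pos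
    have b5 : I.m ≤ I.m ^ 3 := Nat.le_self_pow (by norm_num) _
    have : I.m * (34 * I.m ^ 2 + 2) = 34 * I.m ^ 3 + 2 * I.m := by ring
    simp only [Nat.sub_zero] at ht
    omega

/-- Adds the regret on the edge `ireg 2` at the point `ireg 14` to the line number `ireg 12`. -/
def addTerm : Cmd :=
  (.rset 10 (.ld 8 (.add (.ld 5 (.reg 14)) (.reg 2))) ;;
  .rset 11 (.ld 8 (.add (.ld 5 (.reg 12)) (.reg 2)))) ;;
  .ite (.rle (.reg 10) (.reg 11))
    (.rst 11 (.reg 12) (.add (.ld 11 (.reg 12)) (.mul (.ld 5 (.reg 2)) (.sub (.reg 11) (.reg 10)))))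
    (.rst 11 (.reg 12) (.add (.ld 11 (.reg 12)) (.mul (.ld 4 (.reg 2)) (.sub (.reg 11) (.reg 10)))))

theorem run_addTerm {σ : State} {r e y : ℕ} (hσ : HasKeys I st pt σ) (hr : r < st I.m)
    (hy : y < st I.m) (h8 : σ.rarr 8 = C) (h2 : σ.ireg 2 = e) (h14 : σ.ireg 14 = r)
    (h12 : σ.ireg 12 = y) :
    Run addTerm σ fun t τ => t ≤ 4 ∧ τ.rarr 11 = Function.update (σ.rarr 11) y
      (σ.rarr 11 y + wt I C r e y * (C (y * I.m + e) - C (r * I.m + e))) := by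
  rw [addTerm]
  refine Run.seq (Q := fun t τ => t = 2 ∧ τ.rreg 10 = C (r * I.m + e) ∧
    τ.rreg 11 = C (y * I.m + e)) (by simp [h2, h14, h12, hσ.offY r hr, hσ.offY y hy, h8]) ?_
  rintro _ τ hτ ⟨rfl, h10, h11⟩
  have hτk := hσ.frame hτ rfl rfl rfl rfl rfl
  have e12 : τ.ireg 12 = y := (hτ.ir 12 rfl).trans h12
  have e2 : τ.ireg 2 = e := (hτ.ir 2 rfl).trans h2
  have a11 : τ.rarr 11 = σ.rarr 11 := hτ.ra 11 rfl
  simp only [run_ite, run_rst, BE.eval, RE.eval, IE.eval, h10, h11, e12, e2, hτk.ub, hτk.lb, a11,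
    rarr_setRA, if_true, wt]
  exact ⟨fun h => ⟨by omega, by rw [if_pos h]⟩, fun h => ⟨by omega, by rw [if_neg h]⟩⟩

/-- Sets the lines to the constant regrets at the point `ireg 14`. -/
def initLines : Cmd :=
  .iset 12 (.lit 0) ;; forTo 12 (.reg 8) (.rst 10 (.reg 12) (.lit 0) ;; .rst 11 (.reg 12) (.lit 0) ;;
    .iset 2 (.lit 0) ;; forTo 2 (.reg 1) addTerm)

theorem run_initLines {σ : State} {r : ℕ} (hI : I.Good) (hp : Pts I st pt) (hσ : HasKeys I st pt σ)
    (hr : r < st I.m) (h8 : σ.rarr 8 = C) (h14 : σ.ireg 14 = r)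
    (h19 : ∀ e < I.m, σ.rarr 19 e = 0) :
    Run initLines σ fun t τ => t ≤ 130 * I.m ^ 3 ∧ Lines I st pt C r τ := by
  rw [initLines, run_seq, run_iset]
  have hσ0 := hσ.setI (d := 12) (v := 0) (by decide) (by decide) (by decide)
  refine (Run.forTo' (a := 0) (n := st I.m) (fun k υ => ∀ y < k, υ.rarr 10 y = 0 ∧
    υ.rarr 11 y = ∑ e ∈ range I.m, wt I C r e y * (C (y * I.m + e) - C (r * I.m + e)))
    (6 * I.m + 4) (by simp) (Nat.zero_le _) (fun υ hυ => by simpa [hσ.i8] using hυ.ir 8 rfl) rfl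
    (by simp) ?_).mono ?_
  · rintro y υ - hy hυ hυy h1
    have hυk := hσ0.frame hυ rfl rfl rfl rfl rfl
    rw [run_seq, run_rst, run_seq, run_rst, run_seq, run_iset]
    set υ' := ((υ.setRA 10 _ _).setRA 11 _ _).setI 2 _ with hυ'
    have hk' : HasKeys I st pt υ' :=
      hυk.frame (c := .rst 10 (.reg 12) (.lit 0) ;; .rst 11 (.reg 12) (.lit 0) ;; .iset 2 (.lit 0))
        ((HExec.seq (.rst ..) (.seq (.rst ..) (.iset ..))).frame) rfl rfl rfl rfl rfl
    have a10 : υ'.rarr 10 = Function.update (υ.rarr 10) y 0 := by simp [hυ', hυy]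
    have a11 : υ'.rarr 11 = Function.update (υ.rarr 11) y 0 := by simp [hυ', hυy]
    refine (Run.forTo' (a := 0) (n := I.m) (fun k ω => ω.rarr 11 = Function.update (υ.rarr 11) y
      (∑ e ∈ range k, wt I C r e y * (C (y * I.m + e) - C (r * I.m + e)))) 4
      (by simp [hυ']) (Nat.zero_le _)
      (fun ω hω => by simpa using (hω.ir 1 rfl).trans hk'.m) rfl (by simpa using a11) ?_).mono ?_
    · rintro e ω - he hω hωe h2
      refine (run_addTerm (hk'.frame hω rfl rfl rfl rfl rfl) hr hy (C := C) ?_ hωe ?_ ?_).mono ?_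
      · rw [hω.ra 8 rfl]; simpa [hυ', h8] using hυ.ra 8 rfl
      · rw [hω.ir 14 rfl]; simpa [hυ', h14] using hυ.ir 14 rfl
      · rw [hω.ir 12 rfl]; simp [hυ', hυy]
      rintro t χ - ⟨ht, k1⟩
      refine ⟨ht, ?_⟩
      simp only [rarr_setI, k1, h2, Function.update_self, Function.update_idem, sum_range_succ]
    · rintro t ω hω ⟨h2, -, ht⟩
      refine ⟨by omega, fun z hz => ?_⟩
      simp only [rarr_setI, h2]
      rw [hω.ra 10 rfl, a10]
      rcases Nat.lt_succ_iff_lt_or_eq.1 hz with hz | rfl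
      · rw [Function.update_of_ne hz.ne, Function.update_of_ne hz.ne]; exact h1 z hz
      · rw [Function.update_self, Function.update_self]; exact ⟨rfl, rfl⟩
  · rintro t υ hυ ⟨h1, -, ht⟩
    have a19 : υ.rarr 19 = σ.rarr 19 := hυ.ra 19 rfl
    refine ⟨?_, fun y hy => ?_, fun y hy => ?_⟩
    · have b1 := Nat.mul_le_mul_right (6 * I.m + 4 + 2) hp.total_le
      have b4 : 1 ≤ I.m ^ 3 := Nat.one_le_pow _ _ hI.m_pos
      have b6 : I.m ^ 2 ≤ I.m ^ 3 := Nat.pow_le_pow_right hI.m_pos (by norm_num)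
      have : 10 * I.m ^ 2 * (6 * I.m + 4 + 2) = 60 * I.m ^ 3 + 60 * I.m ^ 2 := by ring
      simp only [Nat.sub_zero] at ht
      omega
    · rw [(h1 y hy).1, a19, sum_eq_zero fun e he => by rw [h19 e (mem_range.1 he), mul_zero], neg_zero]
    · rw [(h1 y hy).2, a19]
      exact sum_congr rfl fun e he => by rw [h19 e (mem_range.1 he), zero_mul, add_zero]

theorem Table.sum_flipTotal_le (h : Table I st pt C) {x : ℕ} (hx : x < I.m) :
    ∑ r ∈ Ico (st x) (st (x + 1) - 1), flipTotal I st C r ≤ I.m * (st I.m * 2) := by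
  simp only [flipTotal, flipCount]
  rw [sum_comm]
  have hle : ∀ e ∈ range I.m, (∑ r ∈ Ico (st x) (st (x + 1) - 1), ∑ y ∈ Ico 0 (st I.m),
      (open Classical in if Flip I C r e y then 1 else 0)) ≤ st I.m * 2 := by
    intro e he
    rw [sum_comm]
    refine (sum_le_card_nsmul _ _ 2 fun y _ => h.sum_flips_le hx (mem_range.1 he) y).trans ?_
    simp
  refine (sum_le_card_nsmul _ _ _ hle).trans ?_
  simp

theorem Table.sum_changeCount_le (h : Table I st pt C) {x : ℕ} (hx : x < I.m) :
    ∑ r ∈ Ico (st x) (st (x + 1) - 1), changeCount I pt C (st x) r ≤ I.m * 9 := by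
  simp only [changeCount]
  rw [sum_comm]
  refine (sum_le_card_nsmul _ _ 9 fun e he => h.sum_changes_le hx (mem_range.1 he)).trans ?_
  simp

theorem Pts.first_eq (h : Pts I st pt) {x : ℕ} (hx : x < I.m) : pt (st x) = 0 := by
  have hlt := h.lt x hx
  have h1 := (((h.lists x hx).2 (pt (st x))).2 ⟨st x, le_rfl, by omega, rfl⟩).1
  obtain ⟨j, hj1, hj2, hj3⟩ := ((h.lists x hx).2 0).1 (Inst.zero_mem_PP x)
  rcases eq_or_lt_of_le hj1 with rfl | hj
  · exact hj3
  · have := (h.lists x hx).1 _ _ le_rfl hj hj2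
    linarith

theorem Pts.last_eq (h : Pts I st pt) {x : ℕ} (hx : x < I.m) : pt (st (x + 1) - 1) = 1 := by
  have hlt := h.lt x hx
  have h1 := (((h.lists x hx).2 (pt (st (x + 1) - 1))).2 ⟨_, by omega, by omega, rfl⟩).2.1
  obtain ⟨j, hj1, hj2, hj3⟩ := ((h.lists x hx).2 1).1 (Inst.one_mem_PP x)
  rcases eq_or_lt_of_le (show j ≤ st (x + 1) - 1 by omega) with rfl | hj
  · exact hj3
  · have := (h.lists x hx).1 _ _ hj1 hj (by omega)
    linarith

/-- Minimizes the upper envelope over the edge `ireg 7`. -/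
def minEdge : Cmd :=
  .iset 14 (.ld 0 (.reg 7)) ;; initEdges ;; initLines ;;
  forTo 14 (.sub (.ld 0 (.add (.reg 7) (.lit 1))) (.lit 1)) interval

theorem run_minEdge {σ : State} {x : ℕ} (hI : I.Good) (hp : Pts I st pt) (hσ : HasKeys I st pt σ)
    (hx : x < I.m) (h8 : σ.rarr 8 = C) (h7 : σ.ireg 7 = x) :
    Run minEdge σ fun t τ => t ≤ 370000 * I.m ^ 3 ∧
      BestOn I (st I.m) C x 0 1 (τ.rarr 1 x) (τ.rarr 2 x) ∧
      ∀ x', x' ≠ x → τ.rarr 1 x' = σ.rarr 1 x' ∧ τ.rarr 2 x' = σ.rarr 2 x' := by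
  have hlt := hp.lt x hx
  have hlast := hp.lt_total hx (show st (x + 1) - 1 < st (x + 1) by omega)
  have hT : Table I st pt C := h8 ▸ hσ.table hI hp
  rw [minEdge, run_seq, run_iset]
  have hσ0 := hσ.setI (d := 14) (v := (IE.ld 0 (.reg 7)).eval σ) (by decide) (by decide) (by decide)
  refine (run_initEdges (r := st x) hI hp hσ0 (by omega) (by simp [hσ.ia0, h7])).seq ?_
  rintro t₁ σ₁ hf₁ ⟨ht₁, hz₁, hptr₁⟩
  have hk₁ := hσ0.frame hf₁ rfl rfl rfl rfl rfl
  have h14₁ : σ₁.ireg 14 = st x := by rw [hf₁.ir 14 rfl]; simp [hσ.ia0, h7]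
  refine (run_initLines hI hp hk₁ (by omega) ((hf₁.ra 8 rfl).trans h8) h14₁ hz₁).seq ?_
  rintro t₂ σ₂ hf₂ ⟨ht₂, hl₂⟩
  have hk₂ := hk₁.frame hf₂ rfl rfl rfl rfl rfl
  have h7₂ : σ₂.ireg 7 = x := by
    rw [hf₂.ir 7 rfl, hf₁.ir 7 rfl]; simpa using h7
  have ra₂ : σ₂.rarr 1 = σ.rarr 1 ∧ σ₂.rarr 2 = σ.rarr 2 :=
    ⟨(hf₂.ra 1 rfl).trans (hf₁.ra 1 rfl), (hf₂.ra 2 rfl).trans (hf₁.ra 2 rfl)⟩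
  refine (Run.forTo (a := st x) (n := st (x + 1) - 1) (fun r υ => Sweep I st pt C x r υ ∧
    (st x < r → BestOn I (st I.m) C x (pt (st x)) (pt r) (υ.rarr 1 x) (υ.rarr 2 x)) ∧
    ∀ x', x' ≠ x → υ.rarr 1 x' = σ.rarr 1 x' ∧ υ.rarr 2 x' = σ.rarr 2 x')
    (fun r => 30500 * I.m ^ 2 + 3040 * flipTotal I st C r +
      10 * st I.m * changeCount I pt C (st x) r) ((hf₂.ir 14 rfl).trans h14₁) (by omega)
    (fun υ hυ => ?_) rfl ?_ ?_).mono ?_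
  · have e7 : υ.ireg 7 = x := (hυ.ir 7 rfl).trans h7₂
    have e0 : υ.iarr 0 = st := (hυ.ia 0 rfl).trans hk₂.ia0
    simp [e7, e0]
  · refine ⟨⟨hl₂, fun e he => ?_, fun e he b hb => ?_⟩, fun h => absurd h (lt_irrefl _), fun x' _ => ?_⟩
    · rw [hf₂.ra 19 rfl, hz₁ e he, prevSlope, if_pos rfl]
    · rw [hf₂.ra 9 rfl, hf₂.ra 8 rfl, hf₂.ia 8 rfl]; exact hptr₁ e he b hb
    · rw [ra₂.1, ra₂.2]; exact ⟨rfl, rfl⟩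
  · rintro r υ hr1 hr2 hυ hυr ⟨h1, h2, h3⟩
    refine (run_interval hI hp (hk₂.frame hυ rfl rfl rfl rfl rfl) hx hr1 (by omega) ?_
      ((hυ.ir 7 rfl).trans h7₂) hυr h1 h2).mono ?_
    · rw [hυ.ra 8 rfl, hf₂.ra 8 rfl, hf₁.ra 8 rfl]; exact h8
    rintro t ω - ⟨ht, k1, k2, k3⟩
    refine ⟨ht, ⟨⟨k1.lines.slope, k1.lines.icpt⟩, k1.slopes, k1.ptr⟩, fun _ => k2, fun x' hx' => ?_⟩
    simp only [rarr_setI]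
    rw [(k3 x' hx').1, (k3 x' hx').2]
    exact h3 x' hx'
  · rintro t υ - ⟨⟨-, h2, h3⟩, -, ht⟩
    refine ⟨?_, ?_, h3⟩
    · simp only [sum_add_distrib, ← mul_sum] at ht
      simp only [sum_const, Nat.card_Ico, smul_eq_mul] at ht
      have s1 := hT.sum_flipTotal_le hx
      have s2 := Nat.mul_le_mul_left (10 * st I.m) (hT.sum_changeCount_le hx)
      have s3 : (st (x + 1) - 1 - st x) * I.m ^ 2 ≤ 10 * I.m * I.m ^ 2 :=
        Nat.mul_le_mul_right _ (by have := hp.le x hx; omega)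
      have s4 : st (x + 1) - 1 - st x ≤ 10 * I.m := by have := hp.le x hx; omega
      have s5 : I.m * (st I.m * 2) ≤ I.m * (10 * I.m ^ 2 * 2) :=
        Nat.mul_le_mul_left _ (Nat.mul_le_mul_right _ hp.total_le)
      have s6 : 10 * st I.m * (I.m * 9) ≤ 10 * (10 * I.m ^ 2) * (I.m * 9) :=
        Nat.mul_le_mul_right _ (Nat.mul_le_mul_left _ hp.total_le)
      have e1 : 10 * I.m * I.m ^ 2 = 10 * I.m ^ 3 := by ring
      have e2 : I.m * (10 * I.m ^ 2 * 2) = 20 * I.m ^ 3 := by ring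
      have e3 : 10 * (10 * I.m ^ 2) * (I.m * 9) = 900 * I.m ^ 3 := by ring
      have b4 : 1 ≤ I.m ^ 3 := Nat.one_le_pow _ _ hI.m_pos
      have b5 : I.m ≤ I.m ^ 3 := Nat.le_self_pow (by norm_num) _
      omega
    · have := h2 (by omega)
      rwa [hp.first_eq hx, hp.last_eq hx] at this

def minEdges : Cmd := .iset 7 (.lit 0) ;; forTo 7 (.reg 1) minEdge

theorem run_minEdges {σ : State} (hI : I.Good) (hp : Pts I st pt) (hσ : HasKeys I st pt σ)
    (h8 : σ.rarr 8 = C) :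
    Run minEdges σ fun t τ => t ≤ 370010 * I.m ^ 4 ∧
      ∀ x < I.m, BestOn I (st I.m) C x 0 1 (τ.rarr 1 x) (τ.rarr 2 x) := by
  rw [minEdges, run_seq, run_iset]
  have hσ0 := hσ.setI (d := 7) (v := 0) (by decide) (by decide) (by decide)
  refine (Run.forTo' (a := 0) (n := I.m) (fun k υ => ∀ x < k,
    BestOn I (st I.m) C x 0 1 (υ.rarr 1 x) (υ.rarr 2 x)) (370000 * I.m ^ 3) (by simp)
    (Nat.zero_le _) (fun υ hυ => by simpa [hσ.m] using hυ.ir 1 rfl) rfl (by simp) ?_).mono ?_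
  · rintro x υ - hx hυ hυx h1
    refine (run_minEdge hI hp (hσ0.frame hυ rfl rfl rfl rfl rfl) hx ((hυ.ra 8 rfl).trans h8)
      hυx).mono ?_
    rintro t ω - ⟨ht, k1, k2⟩
    refine ⟨ht, fun x' hx' => ?_⟩
    simp only [rarr_setI]
    rcases Nat.lt_succ_iff_lt_or_eq.1 hx' with hx' | rfl
    · rw [(k2 x' hx'.ne).1, (k2 x' hx'.ne).2]; exact h1 x' hx'
    · exact k1
  · rintro t υ - ⟨h1, -, ht⟩
    refine ⟨?_, h1⟩
    have b4 : 1 ≤ I.m ^ 4 := Nat.one_le_pow _ _ hI.m_pos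
    have b5 : I.m ≤ I.m ^ 4 := Nat.le_self_pow (by norm_num) _
    have : I.m * (370000 * I.m ^ 3 + 2) = 370000 * I.m ^ 4 + 2 * I.m := by ring
    simp only [Nat.sub_zero] at ht
    omega

/-- Selects the best edge. -/
def bestEdge : Cmd :=
  .iset 0 (.lit 0) ;; .rset 1 (.ld 2 (.lit 0)) ;; .iset 2 (.lit 0) ;;
  forTo 2 (.reg 1) (.ite (.rlt (.ld 2 (.reg 2)) (.reg 1))
    (.iset 0 (.reg 2) ;; .rset 1 (.ld 2 (.reg 2))) .skip) ;; .rset 0 (.ld 1 (.reg 0))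

theorem run_bestEdge {σ : State} (hm : 0 < I.m) (h1 : σ.ireg 1 = I.m) :
    Run bestEdge σ fun t τ => t ≤ 5 * I.m + 5 ∧ τ.ireg 0 < I.m ∧ τ.rreg 0 = τ.rarr 1 (τ.ireg 0) ∧
      τ.rreg 1 = τ.rarr 2 (τ.ireg 0) ∧ ∀ e < I.m, τ.rreg 1 ≤ τ.rarr 2 e := by
  simp only [bestEdge]
  rw [run_seq, run_iset, run_seq, run_rset, run_seq, run_iset]
  refine (Run.forTo' (a := 0) (n := I.m) (fun k υ => υ.ireg 0 < I.m ∧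
    υ.rreg 1 = υ.rarr 2 (υ.ireg 0) ∧ ∀ e < k, υ.rreg 1 ≤ υ.rarr 2 e) 3 (by simp) (Nat.zero_le _)
    (fun υ hυ => by simpa [h1] using hυ.ir 1 rfl) rfl (by simp [hm]) ?_).seq ?_
  · rintro e υ - he hυ hυe ⟨h2, h3, h4⟩
    simp only [run_ite, run_seq, run_iset, run_rset, run_skip, BE.eval, IE.eval, RE.eval, hυe]
    constructor
    · intro hlt
      refine ⟨by omega, by simpa using he, by simp [hυe], fun e' he' => ?_⟩
      simp only [rreg_setI, rreg_setR, rarr_setI, rarr_setR, if_true, ireg_setI, hυe,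
        if_false, OfNat.ofNat_ne_zero]
      rcases Nat.lt_succ_iff_lt_or_eq.1 he' with he' | rfl
      · exact hlt.le.trans (h4 e' he')
      · exact le_rfl
    · intro hlt
      refine ⟨by omega, by simpa using h2, by simpa using h3, fun e' he' => ?_⟩
      simp only [rreg_setI, rarr_setI]
      rcases Nat.lt_succ_iff_lt_or_eq.1 he' with he' | rfl
      · exact h4 e' he'
      · exact not_lt.1 hlt
  · rintro t υ - ⟨⟨h2, h3, h4⟩, -, ht⟩
    rw [run_rset]
    exact ⟨by omega, h2, by simp, by simpa using h3, by simpa using h4⟩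

/-- The algorithm. -/
def solve : Cmd :=
  load ;; distances ;; partition ;; tables ;; coverTable ;; keyTable ;; minEdges ;; bestEdge

theorem run_solve {N : Network} (hN : N.Valid) :
    Run solve N.input fun t τ => t ≤ 400000 * N.m ^ 4 ∧ Network.Solves N.inst τ := by
  have hI : N.inst.Good := Network.inst_good hN
  set I := N.inst with hIdef
  have hNm : N.m = I.m := rfl
  rw [solve]
  refine (run_load N).seq ?_
  rintro t₁ σ₁ hf₁ ⟨ht₁, hl₁⟩
  refine (run_distances hI hl₁).seq ?_
  rintro t₂ σ₂ hf₂ ⟨ht₂, hd₂⟩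
  refine (run_partition hI hd₂).seq ?_
  rintro t₃ σ₃ hf₃ ⟨ht₃, hd₃, hp, h8₃⟩
  set st := σ₃.iarr 0
  set pt := σ₃.rarr 0
  refine (run_tables hd₃ (st := st) (pt := pt) rfl rfl h8₃).seq ?_
  rintro t₄ σ₄ hf₄ ⟨ht₄, hh₄⟩
  refine (run_coverTable hI hp hh₄).seq ?_
  rintro t₅ σ₅ hf₅ ⟨ht₅, hh₅⟩
  refine (run_keyTable hI hp hh₅).seq ?_
  rintro t₆ σ₆ hf₆ ⟨ht₆, hh₆⟩
  refine (run_minEdges hI hp hh₆ rfl).seq ?_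
  rintro t₇ σ₇ hf₇ ⟨ht₇, hb₇⟩
  refine (run_bestEdge hI.m_pos ((hf₇.ir 1 rfl).trans hh₆.m)).mono ?_
  rintro t₈ τ hf₈ ⟨ht₈, hb1, hb2, hb3, hb4⟩
  have hT := hh₆.table hI hp
  have a0 : τ.iarr 0 = st := (hf₈.ia 0 rfl).trans ((hf₇.ia 0 rfl).trans hh₆.ia0)
  have b0 : τ.rarr 0 = pt := (hf₈.ra 0 rfl).trans ((hf₇.ra 0 rfl).trans hh₆.ra0)
  have hbest : ∀ x < I.m, BestOn I (st I.m) (σ₆.rarr 8) x 0 1 (τ.rarr 1 x) (τ.rarr 2 x) := by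
    rw [hf₈.ra 1 rfl, hf₈.ra 2 rfl]; exact hb₇
  have hreg : ∀ (x : ℕ) (t z : ℝ), (∀ y < st I.m, regAt I (σ₆.rarr 8) x t y ≤ z) ↔
      ∀ b < I.m, ∀ s ∈ I.PP b, I.reg x t b s ≤ z := by
    intro x t z
    constructor
    · intro h b hb s hs
      obtain ⟨y, hy1, hy2, rfl⟩ := ((hp.lists b hb).2 s).1 hs
      rw [← hT.regAt_eq hb hy1 hy2]
      exact h y (hp.lt_total hb hy2)
    · intro h y hy
      obtain ⟨b, hb, hy1, hy2⟩ := hp.exists_block le_rfl hy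
      rw [hT.regAt_eq hb hy1 hy2]
      exact h b hb _ (hT.mem_PP hb hy1 hy2)
  refine ⟨?_, ⟨fun e he t => by rw [a0, b0]; exact (hp.lists e he).2 t, fun e he => (hbest e he).mem,
    fun e he => (hreg _ _ _).1 (hbest e he).le,
    fun e he t ht z hz => (hbest e he).min t ht z ((hreg _ _ _).2 hz), hb1, hb2, hb3, hb4⟩⟩
  rw [hNm] at ht₁ ⊢
  have b0 := hp.total_le
  have b1 : 1 ≤ I.m ^ 4 := Nat.one_le_pow _ _ hI.m_pos
  have b2 : I.m ≤ I.m ^ 4 := Nat.le_self_pow (by norm_num) _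
  have b3 : I.m ^ 2 ≤ I.m ^ 4 := Nat.pow_le_pow_right hI.m_pos (by norm_num)
  have b4 : I.m ^ 3 ≤ I.m ^ 4 := Nat.pow_le_pow_right hI.m_pos (by norm_num)
  omega

end RAMLang

theorem mainTheorem1 :
    ∃ (p : RealRAM.Prog) (C : ℕ), ∀ N : Network, N.Valid →
      ∃ (T : ℕ) (τ : RealRAM.State), RealRAM.Exec p N.input T τ ∧
        T ≤ C * (N.m * DavenportSchinzel.lam 3 (N.m ^ 3)) ∧ N.IsSolution τ := by
  refine ⟨RAMLang.solve.comp, RAMLang.solve.factor * 400000, fun N hN => ?_⟩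
  obtain ⟨t, σ, hexec, ht, hs⟩ := RAMLang.run_solve hN
  obtain ⟨T, τ, hE, hT, hag⟩ := hexec.compile rfl N.input (RAMLang.Agree.refl 0 _)
  refine ⟨T, τ, hE, ?_, Network.Solves.isSolution hN ?_⟩
  · have h4 : N.m ^ 4 ≤ N.m * DavenportSchinzel.lam 3 (N.m ^ 3) := by
      have := Nat.mul_le_mul_left N.m (DavenportSchinzel.le_lam_three (N.m ^ 3))
      calc N.m ^ 4 = N.m * N.m ^ 3 := by ring
        _ ≤ _ := this
    calc T ≤ RAMLang.solve.factor * t := hT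
      _ ≤ RAMLang.solve.factor * (400000 * (N.m * DavenportSchinzel.lam 3 (N.m ^ 3))) :=
        Nat.mul_le_mul_left _ (ht.trans (Nat.mul_le_mul_left _ h4))
      _ = _ := by rw [mul_assoc]
  · have i0 : τ.ireg 0 = σ.ireg 0 := hag.ireg 0 (by norm_num)
    have r0 : τ.rreg 0 = σ.rreg 0 := hag.rreg 0 (by norm_num)
    have r1 : τ.rreg 1 = σ.rreg 1 := hag.rreg 1 (by norm_num)
    refine ⟨?_, ?_, ?_, ?_, ?_, ?_, ?_, ?_⟩
    · rw [hag.iarr, hag.rarr]; exact hs.partition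
    · rw [hag.rarr]; exact hs.mem
    · rw [hag.rarr]; exact hs.le
    · rw [hag.rarr]; exact hs.min
    · rw [i0]; exact hs.best_lt
    · rw [i0, r0, hag.rarr]; exact hs.best_pt
    · rw [i0, r1, hag.rarr]; exact hs.best_val
    · rw [r1, hag.rarr]; exact hs.best_le
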